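/- Let $q=2^e$ with $e>1$, let $\mathbb F_{q^2}/\mathbb F_q$ be the quadratic extension of finite fields, and let $\mathrm{Sp}_4(q)$ be the symplectic group of the standard alternating form $b$ on $\mathbb F_q^4$. Let $\mathrm{Sp}_2(q^2){:}2\le \mathrm{Sp}_4(q)$ be the subgroup of all maps $x\mapsto A\,\sigma(x)$ with $A\in \mathrm{Sp}_2(q^2)$ and $\sigma\in\mathrm{Gal}(\mathbb F_{q^2}/\mathbb F_q)$ acting on coordinates, where $\mathbb F_q^4$ is identified $\mathbb F_q$-linearly with $\mathbb F_{q^2}^2$ in such a way that $b$ becomes the trace $\mathrm{Tr}_{\mathbb F_{q^2}/\mathbb F_q}$ of the standard alternating form on $\mathbb F_{q^2}^2$ (such identifications exist; the statement holds for each of them). Let $\mathrm{SO}_4^-(q)\le \mathrm{Sp}_4(q)$ be the isometry group of a quadratic form of minus type (Witt index $1$) on $\mathbb F_q^4$ whose polar form is $b$ (such forms exist; the statement holds for each of them). A subgroup $H$ of a finite group $G$ is called a strong Gelfand subgroup if, for every irreducible complex character $\psi$ of $H$, the induced character $\psi\uparrow G$ is multiplicity-free. Then: 1. $\mathrm{Sp}_2(q^2){:}2$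 is not a strong Gelfand subgroup of $\mathrm{Sp}_4(q)$. 2. The sum of the degrees of the irreducible complex characters of $\mathrm{Sp}_2(q^2){:}2$ is $q^4+q^3+q$. 3. $\mathrm{Sp}_2(q^2){:}2\cong \mathrm{SO}_4^-(q)$, and $\mathrm{SO}_4^-(q)$ is not a strong Gelfand subgroup of $\mathrm{Sp}_4(q)$. 4. The number $q^4+q^3+q$ is smaller than the largest degree of an irreducible complex character of $\mathrm{Sp}_4(q)$; and if $e>2$, this largest degree is $(q+1)^2(q^2+1)$. -/

import Mathlib

open Matrix

noncomputable section

/-! ### Characters of finite groups -/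

/-- The set `Ĝ` of irreducible complex characters of `G`. -/
def irrCharacters (G : Type*) [Group G] : Set (G → ℂ) :=
  {χ | ∃ (n : ℕ) (ρ : Representation ℂ G (Fin n → ℂ)), ρ.IsIrreducible ∧ χ = ρ.character}

/-- The degrees of the irreducible complex characters of `G`. -/
def irrDegrees (G : Type*) [Group G] : Set ℕ :=
  {d | ∃ χ ∈ irrCharacters G, χ 1 = (d : ℂ)}

/-- The total character `τ_G`: the sum of all irreducible complex characters of `G`. -/
def totalCharacter (G : Type*) [Group G] : G → ℂ :=
  ∑ᶠ χ ∈ irrCharacters G, χ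

open Classical in
/-- The character `ψ ↑ G` of the finite group `G` induced from the character `ψ` of `H ≤ G`. -/
def inducedCharacter {G : Type*} [Group G] [Finite G] (H : Subgroup G) (ψ : H → ℂ) : G → ℂ :=
  fun g => (Nat.card H : ℂ)⁻¹ *
    ∑ᶠ x : G, if h : x⁻¹ * g * x ∈ H then ψ ⟨x⁻¹ * g * x, h⟩ else 0

/-- A character is multiplicity-free if it is a sum of pairwise distinct irreducible characters. -/
def IsMultiplicityFree {G : Type*} [Group G] (θ : G → ℂ) : Prop :=
  ∃ S : Finset (G → ℂ), (∀ χ ∈ S, χ ∈ irrCharacters G) ∧ θ = ∑ χ ∈ S, χ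

/-- `(G, H)` is a strong Gelfand pair: every irreducible character of `H` induces to a
multiplicity-free character of `G`. -/
def IsStrongGelfandSubgroup {G : Type*} [Group G] [Finite G] (H : Subgroup G) : Prop :=
  ∀ ψ ∈ irrCharacters H, IsMultiplicityFree (inducedCharacter H ψ)

/-! ### The groups -/

/-- The group `Sp_{2n}(R)` of symplectic matrices. -/
abbrev Sp (n : ℕ) (R : Type*) [CommRing R] := symplecticGroup (Fin n) R

/-- The standard alternating form on `R^{2n}`, preserved by `Sp n R`. -/
def sympForm {n : ℕ} {R : Type*} [CommRing R] (v w : Fin n ⊕ Fin n → R) : R :=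
  v ⬝ᵥ (J (Fin n) R *ᵥ w)

/-- An `F`-linear identification `F⁴ = K²` (for a quadratic extension `K/F`) under which the
standard alternating form of `F⁴` is the trace of the standard alternating form of `K²`. -/
def IsTraceIsometry {F K : Type*} [Field F] [Field K] [Algebra F K]
    (φ : (Fin 2 ⊕ Fin 2 → F) ≃ₗ[F] (Fin 1 ⊕ Fin 1 → K)) : Prop :=
  ∀ v w, Algebra.trace F K (sympForm (φ v) (φ w)) = sympForm v w

/-- The subgroup `Sp_2(K):Gal(K/F)` of `Sp_4(F)`: the symplectic matrices over `F` which act on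
`F⁴ = K²` as `x ↦ A (σ x)` with `A ∈ Sp_2(K)` and `σ ∈ Gal(K/F)` acting on coordinates.
For `|F| = q` and `|K| = q²` this is `Sp_2(q²):2`. -/
def semilinearSp {F K : Type*} [Field F] [Field K] [Algebra F K]
    (φ : (Fin 2 ⊕ Fin 2 → F) ≃ₗ[F] (Fin 1 ⊕ Fin 1 → K)) : Subgroup (Sp 2 F) where
  carrier := {g | ∃ (A : Sp 1 K) (σ : K ≃ₐ[F] K),
    ∀ v, φ (g.1 *ᵥ v) = A.1 *ᵥ (fun i => σ (φ v i))}
  one_mem' := ⟨1, 1, fun v => by simp⟩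
  mul_mem' := by
    rintro g h ⟨A, σ, hg⟩ ⟨B, τ, hh⟩
    refine ⟨A * ⟨B.1.map σ, SymplecticGroup.map_mem B.2 σ⟩, σ * τ, fun v => ?_⟩
    have key : (fun i => σ ((B.1 *ᵥ fun i => τ (φ v i)) i))
        = B.1.map σ *ᵥ (fun i => σ (τ (φ v i))) := by
      ext i
      simp [mulVec, dotProduct]
    have e1 : (g * h).1 *ᵥ v = g.1 *ᵥ (h.1 *ᵥ v) := by simp [mulVec_mulVec]
    rw [e1, hg, hh, key]
    simp [mulVec_mulVec]
  inv_mem' := by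
    rintro g ⟨A, σ, hg⟩
    refine ⟨⟨A⁻¹.1.map σ.symm, SymplecticGroup.map_mem A⁻¹.2 σ.symm⟩, σ⁻¹, fun v => ?_⟩
    have h1 := hg (g⁻¹.1 *ᵥ v)
    have e1 : g.1 *ᵥ (g⁻¹.1 *ᵥ v) = v := by
      rw [mulVec_mulVec, ← Submonoid.coe_mul, mul_inv_cancel]; simp
    rw [e1] at h1
    have h2 : A⁻¹.1 *ᵥ φ v = fun i => σ (φ (g⁻¹.1 *ᵥ v) i) := by
      rw [h1, mulVec_mulVec, ← Submonoid.coe_mul, inv_mul_cancel]; simp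
    ext i
    have h3 := congrArg σ.symm (congrFun h2 i)
    simp only [AlgEquiv.symm_apply_apply] at h3
    rw [← h3]
    simp [mulVec, dotProduct, AlgEquiv.aut_inv]

/-- `Q` is a quadratic form of minus type on `F⁴` (`F` a finite field) whose polar form is the
standard alternating form: its Witt index, the largest dimension of a totally singular subspace,
is `1`. -/
def IsMinusForm {F : Type*} [Field F] (Q : QuadraticForm F (Fin 2 ⊕ Fin 2 → F)) : Prop :=
  (∀ v w, QuadraticMap.polar Q v w = sympForm v w) ∧
  IsGreatest {d : ℕ | ∃ W : Submodule F (Fin 2 ⊕ Fin 2 → F),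
    Module.finrank F W = d ∧ ∀ w ∈ W, Q w = 0} 1

/-- The subgroup of `Sp_4(F)` of all isometries of `Q`. In characteristic `2`, for `Q` of minus
type over the field of order `q`, this is the full isometry group of `Q`, that is,
`SO_4^-(q) = GO_4^-(q)`. -/
def isometrySubgroup {F : Type*} [Field F] (Q : QuadraticForm F (Fin 2 ⊕ Fin 2 → F)) :
    Subgroup (Sp 2 F) where
  carrier := {g | ∀ v, Q (g.1 *ᵥ v) = Q v}
  one_mem' := fun v => by simp
  mul_mem' := by
    intro g h hg hh v
    have e1 : (g * h).1 *ᵥ v = g.1 *ᵥ (h.1 *ᵥ v) := by simp [mulVec_mulVec]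
    rw [e1, hg, hh]
  inv_mem' := by
    intro g hg v
    have e1 : g.1 *ᵥ (g⁻¹.1 *ᵥ v) = v := by
      rw [mulVec_mulVec, ← Submonoid.coe_mul, mul_inv_cancel]; simp
    rw [← hg (g⁻¹.1 *ᵥ v), e1]

end

/-! Write q = |F|, G = Sp₄(q), and let T(H) be the sum of the degrees of the irreducible characters
of H. If H is a strong Gelfand subgroup, Frobenius reciprocity bounds every multiplicity in the
restriction to H of an irreducible χ of G by 1, so χ(1) ≤ T(H)
(`IsStrongGelfandSubgroup.degree_le`). Everything therefore reduces to computing T(H) and the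
largest degree of G.

Computation of T(H). Both subgroups are isomorphic to SL₂(K):Gal(K/F): one by its semilinear action
on K² (`nonempty_semilinearSp_mulEquiv`), the other by its action on Hermitian 2 × 2 matrices, on
which the determinant is a quadratic form of minus type (`nonempty_isometrySubgroup_mulEquiv`). All
irreducible representations of this group are of orthogonal type (`SL2Gal.sum_character_sq`), so by
Frobenius and Schur T(H) is the number of solutions of g² = 1. There are q⁴ in SL₂(K) and q³ + q in
the outer coset.

Upper bound for degrees (`Sp4.finrank_le`). Let V be irreducible for G. If the unipotent radical of
one of the two maximal parabolics fixes a nonzero vector, V is generated by an irreducible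
representation of the Levi subgroup F× × SL₂(F), of dimension at most q + 1, over (q + 1)(q² + 1)
cosets. Otherwise V is decomposed under the abelian radical of order q³ of the stabiliser of a
Lagrangian. Its characters are binary quadratic forms; the zero form does not occur, and each other
weight space has dimension at most q + 1. For anisotropic forms this is uniqueness of Bessel models
(`Sp4.finrank_bessel`), for the others it follows from uniqueness of Whittaker models
(`Sp4.finrank_gelfandGraev`). Then dim V ≤ (q³ − 1)(q + 1), which is below (q + 1)²(q² + 1).

Lower bound. For q ≥ 8 the torus has a character in general position and the principal series gives
degree (q + 1)²(q² + 1) (`Sp4.exists_le_finrank`). For q = 4 there is no such character, and a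
representation induced from a linear character times a Steinberg representation on the stabiliser of
a line gives degree at least q(q + 1)(q² + 1) = 340 > 324 (`Sp4.exists_le_finrank'`). In both cases
linear independence of sufficiently many translates of one vector is read off from a Gram matrix.

The common tool is `Representation.sandwich`, the operator e g e with e the idempotent of a linear
character of a subgroup S. If an anti-automorphism preserving S and its character leaves all e g e
unchanged, these operators commute and the character occurs at most once (Gelfand's trick); if it is
inversion and the character occurs, the representation is of orthogonal type. The condition need
only be checked on double coset representatives g, and it is automatic when e g e = 0, that is, when
g carries an element of S to one on which the character differs. -/

set_option linter.unusedSectionVars false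

noncomputable section

/-! ### Stable subspaces and complete reducibility, at the level of characters. -/

namespace Representation

section Basic

variable {G V W : Type*} [Group G] [AddCommGroup V] [Module ℂ V] [AddCommGroup W] [Module ℂ W]

/-- A subspace is stable under a representation. -/
def Stable (ρ : Representation ℂ G V) (W : Submodule ℂ V) : Prop :=
  ∀ g, ∀ v ∈ W, ρ g v ∈ W

theorem IsIrreducible.eq_bot_or_eq_top {ρ : Representation ℂ G V} (h : ρ.IsIrreducible)
    {W : Submodule ℂ V} (hW : ρ.Stable W) : W = ⊥ ∨ W = ⊤ := by
  have := h
  rcases IsSimpleOrder.eq_bot_or_eq_top (⟨W, fun g v hv => hW g v hv⟩ : Subrepresentation ρ) with h | h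
  · left; exact congrArg Subrepresentation.toSubmodule h
  · right; exact congrArg Subrepresentation.toSubmodule h

theorem IsIrreducible.nontrivial {ρ : Representation ℂ G V} (h : ρ.IsIrreducible) :
    Nontrivial V := by
  by_contra hV
  rw [not_nontrivial_iff_subsingleton] at hV
  have := h
  obtain ⟨a, b, hab⟩ := exists_pair_ne (Subrepresentation ρ)
  apply hab
  apply Subrepresentation.toSubmodule_injective
  exact Subsingleton.elim _ _

theorem isIrreducible_of_forall {ρ : Representation ℂ G V} [Nontrivial V]
    (h : ∀ W : Submodule ℂ V, ρ.Stable W → W = ⊥ ∨ W = ⊤) : ρ.IsIrreducible := by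
  have hn : Nontrivial (Subrepresentation ρ) := by
    refine ⟨⊥, ⊤, fun hh => ?_⟩
    exact bot_ne_top (α := Submodule ℂ V) (congrArg Subrepresentation.toSubmodule hh)
  refine { hn with eq_bot_or_eq_top := fun a => ?_ }
  rcases h a.toSubmodule (fun g v hv => a.apply_mem_toSubmodule g hv) with h | h
  · left; exact Subrepresentation.toSubmodule_injective h
  · right; exact Subrepresentation.toSubmodule_injective h

/-- Transport of a representation along a linear equivalence. -/
def transport (ρ : Representation ℂ G V) (e : V ≃ₗ[ℂ] W) : Representation ℂ G W where
  toFun g := e.conj (ρ g)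
  map_one' := by ext; simp [LinearEquiv.conj_apply]
  map_mul' g h := by ext; simp [LinearEquiv.conj_apply]

theorem transport_apply (ρ : Representation ℂ G V) (e : V ≃ₗ[ℂ] W) (g : G) (w : W) :
    ρ.transport e g w = e (ρ g (e.symm w)) := by
  simp [transport, LinearEquiv.conj_apply]

theorem character_transport (ρ : Representation ℂ G V) (e : V ≃ₗ[ℂ] W) :
    (ρ.transport e).character = ρ.character := by
  ext g
  simp [character, transport, LinearMap.trace_conj']

theorem isIrreducible_transport {ρ : Representation ℂ G V} (h : ρ.IsIrreducible)
    (e : V ≃ₗ[ℂ] W) : (ρ.transport e).IsIrreducible := by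
  have := h.nontrivial
  have : Nontrivial W := e.symm.toEquiv.nontrivial
  refine isIrreducible_of_forall fun U hU => ?_
  have h1 : ρ.Stable (U.comap e.toLinearMap) := fun g v hv => by
    have := hU g _ hv
    simpa [transport_apply] using this
  have hU' : U = (U.comap e.toLinearMap).map e.toLinearMap := by
    rw [Submodule.map_comap_eq_of_surjective]; exact e.surjective
  rcases h.eq_bot_or_eq_top h1 with h2 | h2
  · left; rw [hU', h2, Submodule.map_bot]
  · right; rw [hU', h2, Submodule.map_top, LinearMap.range_eq_top]; exact e.surjective

theorem IsIrreducible.character_mem [FiniteDimensional ℂ V] {ρ : Representation ℂ G V}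
    (h : ρ.IsIrreducible) : ρ.character ∈ irrCharacters G :=
  ⟨_, ρ.transport (Module.finBasis ℂ V).equivFun, isIrreducible_transport h _,
    (character_transport _ _).symm⟩

/-- The representation on a stable subspace. -/
def restrictTo (ρ : Representation ℂ G V) (W : Submodule ℂ V) (hW : ρ.Stable W) :
    Representation ℂ G W where
  toFun g := (ρ g).restrict (hW g)
  map_one' := by ext; simp
  map_mul' g h := by ext; simp

@[simp] theorem restrictTo_apply (ρ : Representation ℂ G V) (W : Submodule ℂ V)
    (hW : ρ.Stable W) (g : G) (w : W) : (ρ.restrictTo W hW g w : V) = ρ g w := rfl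

theorem exists_minimal_stable [FiniteDimensional ℂ V] (ρ : Representation ℂ G V)
    {W : Submodule ℂ V} (hW : ρ.Stable W) (hne : W ≠ ⊥) :
    ∃ (W₀ : Submodule ℂ V) (h₀ : ρ.Stable W₀), W₀ ≤ W ∧ W₀ ≠ ⊥ ∧
      (ρ.restrictTo W₀ h₀).IsIrreducible := by
  classical
  have hex : ∃ n, ∃ U : Submodule ℂ V, ρ.Stable U ∧ U ≤ W ∧ U ≠ ⊥ ∧ Module.finrank ℂ U = n :=
    ⟨_, W, hW, le_rfl, hne, rfl⟩
  obtain ⟨U, hU, hUW, hU0, hUn⟩ := Nat.find_spec hex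
  refine ⟨U, hU, hUW, hU0, ?_⟩
  have : Nontrivial U := (Submodule.nontrivial_iff_ne_bot).2 hU0
  refine isIrreducible_of_forall fun X hX => ?_
  by_cases hX0 : X = ⊥
  · exact Or.inl hX0
  right
  have hmap : ρ.Stable (X.map U.subtype) := by
    rintro g _ ⟨x, hx, rfl⟩
    exact ⟨_, hX g x hx, rfl⟩
  have hmin := Nat.find_min' hex ⟨X.map U.subtype, hmap,
    (Submodule.map_subtype_le U X).trans hUW, fun h0 => hX0
      (Submodule.map_injective_of_injective U.injective_subtype (by rw [h0, Submodule.map_bot])), rfl⟩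
  rw [← hUn, (Submodule.equivMapOfInjective U.subtype U.injective_subtype X).symm.finrank_eq]
    at hmin
  exact Submodule.eq_top_of_finrank_eq (le_antisymm (Submodule.finrank_le X) hmin)

theorem character_of_isCompl [FiniteDimensional ℂ V] (ρ : Representation ℂ G V)
    {W W' : Submodule ℂ V} (hW : ρ.Stable W) (hW' : ρ.Stable W') (h : IsCompl W W') :
    ρ.character = (ρ.restrictTo W hW).character + (ρ.restrictTo W' hW').character := by
  ext g
  have : ρ g = (Submodule.prodEquivOfIsCompl W W' h).conj
      ((ρ.restrictTo W hW g).prodMap (ρ.restrictTo W' hW' g)) := by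
    ext v
    obtain ⟨p, rfl⟩ := (Submodule.prodEquivOfIsCompl W W' h).surjective v
    rw [LinearEquiv.conj_apply]
    simp
  simp only [character, Pi.add_apply]
  conv_lhs => rw [this]
  rw [LinearMap.trace_conj', LinearMap.trace_prodMap']

/-- Maschke's theorem and induction on the dimension. Only the additive decomposition of the
character is kept, which is all that the orthogonality relations need. -/
theorem character_mem_closure [Finite G] (n : ℕ) :
    ∀ {V : Type*} [AddCommGroup V] [Module ℂ V] [FiniteDimensional ℂ V]
      (ρ : Representation ℂ G V), Module.finrank ℂ V = n →
      ρ.character ∈ AddSubmonoid.closure (irrCharacters G) := by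
  induction n using Nat.strong_induction_on with
  | _ n ih =>
  intro V _ _ _ ρ hn
  by_cases hirr : ρ.IsIrreducible
  · exact AddSubmonoid.subset_closure hirr.character_mem
  by_cases hV : Nontrivial V
  swap
  · rw [not_nontrivial_iff_subsingleton] at hV
    have : ρ.character = 0 := by
      ext g
      have : ρ g = 0 := Subsingleton.elim _ _
      simp [character, this]
    rw [this]; exact zero_mem _
  have : ∃ W : Submodule ℂ V, ρ.Stable W ∧ W ≠ ⊥ ∧ W ≠ ⊤ := by
    by_contra hc
    push Not at hc
    exact hirr (isIrreducible_of_forall fun W hW => or_iff_not_imp_left.2 (hc W hW))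
  obtain ⟨W, hW, hW0, hW1⟩ := this
  have : NeZero (Nat.card G : ℂ) := ⟨by exact_mod_cast Nat.card_pos.ne'⟩
  obtain ⟨W', hc⟩ := exists_isCompl (⟨W, fun g v hv => hW g v hv⟩ : Subrepresentation ρ)
  have hc' : IsCompl W W'.toSubmodule := by
    constructor
    · rw [disjoint_iff]; exact congrArg Subrepresentation.toSubmodule hc.inf_eq_bot
    · rw [codisjoint_iff]; exact congrArg Subrepresentation.toSubmodule hc.sup_eq_top
  have hW' : ρ.Stable W'.toSubmodule := fun g v hv => W'.apply_mem_toSubmodule g hv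
  have hsum := Submodule.finrank_add_eq_of_isCompl hc'
  have h1 : Module.finrank ℂ W < n := hn ▸ Submodule.finrank_lt hW1
  have h2 : 0 < Module.finrank ℂ W := by
    have := (Submodule.nontrivial_iff_ne_bot).2 hW0
    exact Module.finrank_pos
  rw [character_of_isCompl ρ hW hW' hc']
  exact add_mem (ih _ h1 _ rfl) (ih _ (by omega) _ rfl)

end Basic

end Representation

/-! ### Orthogonality relations and the regular representation. -/

section Characters

variable {G : Type*} [Group G]

theorem irrCharacters_one {χ : G → ℂ} (h : χ ∈ irrCharacters G) :
    ∃ n : ℕ, 0 < n ∧ χ 1 = n := by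
  obtain ⟨n, ρ, hρ, rfl⟩ := h
  have := hρ.nontrivial
  refine ⟨n, ?_, by simp⟩
  have : 0 < Module.finrank ℂ (Fin n → ℂ) := Module.finrank_pos
  simpa using this

/-- The standard bilinear pairing of functions on a finite group. -/
def charPairing [Finite G] (f f' : G → ℂ) : ℂ :=
  have := Fintype.ofFinite G
  (Nat.card G : ℂ)⁻¹ * ∑ g : G, f g * f' g⁻¹

theorem charPairing_def [Fintype G] (f f' : G → ℂ) :
    charPairing f f' = (Nat.card G : ℂ)⁻¹ * ∑ g : G, f g * f' g⁻¹ := by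
  unfold charPairing
  congr!

theorem charPairing_add [Finite G] (f₁ f₂ f' : G → ℂ) :
    charPairing (f₁ + f₂) f' = charPairing f₁ f' + charPairing f₂ f' := by
  simp [charPairing, add_mul, Finset.sum_add_distrib, mul_add]

theorem charPairing_nsmul [Finite G] (k : ℕ) (f f' : G → ℂ) :
    charPairing (k • f) f' = k * charPairing f f' := by
  simp only [charPairing, Pi.smul_apply, nsmul_eq_mul, Finset.mul_sum]
  exact Finset.sum_congr rfl fun _ _ => by ring

theorem charPairing_sum [Finite G] {ι : Type*} (s : Finset ι) (f : ι → G → ℂ) (f' : G → ℂ) :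
    charPairing (∑ i ∈ s, f i) f' = ∑ i ∈ s, charPairing (f i) f' := by
  classical
  induction s using Finset.induction_on with
  | empty => simp [charPairing]
  | insert i s hi ih => rw [Finset.sum_insert hi, Finset.sum_insert hi, charPairing_add, ih]

theorem charPairing_comm [Finite G] (f f' : G → ℂ) : charPairing f f' = charPairing f' f := by
  have := Fintype.ofFinite G
  rw [charPairing_def, charPairing_def]
  congr 1
  exact Fintype.sum_equiv (Equiv.inv G) _ _ fun g => by
    simp only [Equiv.inv_apply, inv_inv]; rw [mul_comm]

-- Orthogonality for characters as functions rather than for isomorphism classes: equal characters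
-- reduce to the norm of a single one, and distinct characters force nonisomorphic representations.
open Classical in
theorem charPairing_irr [Finite G] {χ χ' : G → ℂ} (h : χ ∈ irrCharacters G)
    (h' : χ' ∈ irrCharacters G) : charPairing χ χ' = if χ = χ' then 1 else 0 := by
  have := Fintype.ofFinite G
  have : Invertible (Nat.card G : ℂ) := invertibleOfNonzero (by exact_mod_cast Nat.card_pos.ne')
  obtain ⟨n, ρ, hρ, rfl⟩ := h
  obtain ⟨n', ρ', hρ', rfl⟩ := h'
  have h1 := Representation.char_orthonormal ρ ρ'
  have h2 := Representation.char_orthonormal ρ ρ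
  rw [if_pos ⟨Representation.Equiv.refl ρ⟩] at h2
  rw [charPairing_def, h1]
  by_cases hc : ρ.character = ρ'.character
  · rw [if_pos hc, ← h1, ← hc, h2]
  · rw [if_neg hc, if_neg]
    rintro ⟨e⟩
    exact hc (Representation.char_iso e).symm

/-- The left regular representation on functions. -/
def regularRep (G : Type*) [Group G] : Representation ℂ G (G → ℂ) where
  toFun g := LinearMap.funLeft ℂ ℂ (fun x => g⁻¹ * x)
  map_one' := by ext; simp [LinearMap.funLeft]
  map_mul' g h := by
    ext1; ext; simp [LinearMap.funLeft_apply, mul_assoc]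

open Classical in
theorem regularRep_character [Finite G] (g : G) :
    (regularRep G).character g = if g = 1 then (Nat.card G : ℂ) else 0 := by
  have := Fintype.ofFinite G
  rw [Representation.character, LinearMap.trace_eq_matrix_trace ℂ (Pi.basisFun ℂ G), Matrix.trace]
  have : ∀ x : G, (LinearMap.toMatrix (Pi.basisFun ℂ G) (Pi.basisFun ℂ G) (regularRep G g)).diag x
      = if g = 1 then 1 else 0 := by
    intro x
    rw [Matrix.diag_apply, LinearMap.toMatrix_apply]
    simp [regularRep, LinearMap.funLeft_apply, Pi.single_apply]
  simp only [this]
  split_ifs <;> simp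

theorem exists_finsupp_of_mem_closure {θ : G → ℂ}
    (h : θ ∈ AddSubmonoid.closure (irrCharacters G)) :
    ∃ m : (G → ℂ) →₀ ℕ, (∀ χ ∈ m.support, χ ∈ irrCharacters G) ∧
      θ = ∑ χ ∈ m.support, m χ • χ := by
  classical
  change ∃ m : (G → ℂ) →₀ ℕ, (∀ χ ∈ m.support, χ ∈ irrCharacters G) ∧
      θ = m.sum fun χ k => k • χ
  induction h using AddSubmonoid.closure_induction with
  | mem χ h =>
    refine ⟨Finsupp.single χ 1, fun χ' h' => ?_, by simp⟩
    have := Finsupp.support_single_subset h'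
    rw [Finset.mem_singleton] at this
    exact this ▸ h
  | zero => exact ⟨0, by simp, by simp⟩
  | add x y _ _ hx hy =>
    obtain ⟨m, hm, rfl⟩ := hx
    obtain ⟨m', hm', rfl⟩ := hy
    refine ⟨m + m', fun χ h => ?_, ?_⟩
    · rcases Finset.mem_union.1 (Finsupp.support_add h) with h | h
      exacts [hm _ h, hm' _ h]
    · rw [Finsupp.sum_add_index'] <;> intros <;> simp [add_smul]

theorem charPairing_of_finsupp [Finite G] {m : (G → ℂ) →₀ ℕ}
    (hm : ∀ χ ∈ m.support, χ ∈ irrCharacters G) {χ : G → ℂ} (h : χ ∈ irrCharacters G) :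
    charPairing (∑ χ ∈ m.support, m χ • χ) χ = m χ := by
  classical
  rw [charPairing_sum]
  simp only [charPairing_nsmul]
  rw [Finset.sum_congr rfl fun ψ hψ => by rw [charPairing_irr (hm ψ hψ) h]]
  simp only [mul_ite, mul_one, mul_zero, Finset.sum_ite_eq', Finsupp.mem_support_iff, ne_eq,
    ite_not, ite_eq_right_iff]
  intro h0; simp [h0]

/-- The multiplicity of χ in the regular character is its pairing with χ, namely χ(1), which is
never zero. So the finite support of the decomposition is the whole set of irreducible characters,
and finiteness of that set comes for free. -/
theorem exists_regular_decomposition (G : Type*) [Group G] [Finite G] :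
    ∃ S : Finset (G → ℂ), (S : Set (G → ℂ)) = irrCharacters G ∧
      (regularRep G).character = ∑ χ ∈ S, χ 1 • χ := by
  classical
  have := Fintype.ofFinite G
  obtain ⟨m, hm, hr⟩ := exists_finsupp_of_mem_closure
    ((regularRep G).character_mem_closure _ rfl)
  have key : ∀ χ ∈ irrCharacters G, (m χ : ℂ) = χ 1 := by
    intro χ hχ
    rw [← charPairing_of_finsupp hm hχ, ← hr, charPairing_def]
    simp only [regularRep_character, ite_mul, zero_mul, Finset.sum_ite_eq', Finset.mem_univ,
      if_true, inv_one]
    rw [← mul_assoc, inv_mul_cancel₀, one_mul]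
    exact_mod_cast Nat.card_pos.ne'
  refine ⟨m.support, ?_, ?_⟩
  · ext χ
    refine ⟨fun h => hm χ h, fun h => ?_⟩
    obtain ⟨n, hn, h1⟩ := irrCharacters_one h
    have := key χ h
    rw [h1] at this
    have : m χ = n := by exact_mod_cast this
    simp; omega
  · rw [hr]
    refine Finset.sum_congr rfl fun χ hχ => ?_
    rw [← key χ (hm χ hχ)]
    ext; simp

theorem irrCharacters_finite (G : Type*) [Group G] [Finite G] : (irrCharacters G).Finite := by
  obtain ⟨S, hS, -⟩ := exists_regular_decomposition G
  rw [← hS]; exact S.finite_toSet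

/-- The finite set of irreducible characters. -/
def irrFinset (G : Type*) [Group G] [Finite G] : Finset (G → ℂ) :=
  (irrCharacters_finite G).toFinset

@[simp] theorem mem_irrFinset [Finite G] {χ : G → ℂ} :
    χ ∈ irrFinset G ↔ χ ∈ irrCharacters G := by simp [irrFinset]

open Classical in
theorem sum_irr_one_mul [Finite G] (g : G) :
    ∑ χ ∈ irrFinset G, χ 1 * χ g = if g = 1 then (Nat.card G : ℂ) else 0 := by
  obtain ⟨S, hS, h⟩ := exists_regular_decomposition G
  have : irrFinset G = S := by
    ext χ; rw [mem_irrFinset, ← hS]; simp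
  rw [this, ← regularRep_character, h]
  simp

theorem totalCharacter_eq [Finite G] (g : G) :
    totalCharacter G g = ∑ χ ∈ irrFinset G, χ g := by
  rw [totalCharacter, finsum_mem_eq_finite_toFinset_sum _ (irrCharacters_finite G),
    Finset.sum_apply]
  rfl

/-- A group algebra element with nonzero coefficient at `1` acts nontrivially on some irreducible
representation. -/
theorem exists_irreducible_sum_smul_ne_zero [Fintype G] (a : G → ℂ) (ha : a 1 ≠ 0) :
    ∃ (n : ℕ) (ρ : Representation ℂ G (Fin n → ℂ)), ρ.IsIrreducible ∧
      ∑ g, a g • ρ g ≠ 0 := by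
  by_contra hc
  push Not at hc
  have h1 : ∀ χ ∈ irrFinset G, χ 1 * ∑ g, a g * χ g = 0 := by
    intro χ hχ
    obtain ⟨n, ρ, hρ, rfl⟩ := mem_irrFinset.1 hχ
    have := congrArg (LinearMap.trace ℂ (Fin n → ℂ)) (hc n ρ hρ)
    simp only [map_sum, map_smul, map_zero, smul_eq_mul] at this
    simp [Representation.character, this]
  -- Weighting the traces by the degrees and summing over χ gives the trace on the regular
  -- representation, which is |G| times the coefficient at 1.
  have h2 := Finset.sum_eq_zero h1
  simp only [Finset.mul_sum] at h2
  rw [Finset.sum_comm] at h2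
  have h3 : ∀ g, ∑ χ ∈ irrFinset G, χ 1 * (a g * χ g) = a g * ∑ χ ∈ irrFinset G, χ 1 * χ g := by
    intro g; rw [Finset.mul_sum]; exact Finset.sum_congr rfl fun _ _ => by ring
  classical
  simp only [h3, sum_irr_one_mul, mul_ite, mul_zero, Finset.sum_ite_eq', Finset.mem_univ,
    if_true] at h2
  rcases mul_eq_zero.1 h2 with h | h
  · exact ha h
  · exact Nat.card_pos.ne' (by exact_mod_cast h)

end Characters

/-! ### Sum of the degrees when all Frobenius–Schur indicators are 1. -/

section FrobeniusSchur

variable {G : Type*} [Group G]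

-- Since each indicator is 1, χ(1) is the average over g of χ(1)χ(g²). Summing over χ first, column
-- orthogonality keeps only the g with g² = 1.
open Classical in
theorem totalCharacter_one_of_indicator [Fintype G]
    (h : ∀ (n : ℕ) (ρ : Representation ℂ G (Fin n → ℂ)), ρ.IsIrreducible →
      ∑ g, ρ.character (g * g) = Nat.card G) :
    totalCharacter G 1 = Nat.card {g : G // g * g = 1} := by
  have hG : (Nat.card G : ℂ) ≠ 0 := by exact_mod_cast Nat.card_pos.ne'
  rw [totalCharacter_eq]
  have h1 : ∀ χ ∈ irrFinset G, χ 1 = (Nat.card G : ℂ)⁻¹ * ∑ g, χ 1 * χ (g * g) := by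
    intro χ hχ
    obtain ⟨n, ρ, hρ, rfl⟩ := mem_irrFinset.1 hχ
    rw [← Finset.mul_sum, h n ρ hρ]
    field_simp
  rw [Finset.sum_congr rfl h1, ← Finset.mul_sum, Finset.sum_comm]
  simp only [sum_irr_one_mul]
  rw [← Finset.sum_filter, Finset.sum_const, nsmul_eq_mul,
    Nat.card_eq_fintype_card (α := {g : G // g * g = 1}), Fintype.card_subtype]
  field_simp

end FrobeniusSchur

/-! ### The degree bound for strong Gelfand subgroups. -/

section StrongGelfand

variable {G : Type*} [Group G] [Finite G] (H : Subgroup G)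

/-- Frobenius reciprocity: χ is a class function, so each conjugate in the formula for the induced
character contributes the same sum over H. -/
theorem charPairing_inducedCharacter (ψ : H → ℂ) {χ : G → ℂ} (hχ : χ ∈ irrCharacters G) :
    charPairing (inducedCharacter H ψ) χ = charPairing (fun h : H => χ h) ψ := by
  classical
  have := Fintype.ofFinite G
  obtain ⟨n, ρ, hρ, rfl⟩ := hχ
  have hG : (Nat.card G : ℂ) ≠ 0 := by exact_mod_cast Nat.card_pos.ne'
  have hconj : ∀ x g : G, ρ.character (x * g * x⁻¹) = ρ.character g := fun x g => by
    simp
  set f : G → ℂ := fun g => if h : g ∈ H then ψ ⟨g, h⟩ else 0 with hf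
  have hind : inducedCharacter H ψ = fun g => (Nat.card H : ℂ)⁻¹ * ∑ x : G, f (x⁻¹ * g * x) := by
    ext g
    rw [inducedCharacter, finsum_eq_sum_of_fintype]
  have hsum : ∑ g : G, f g * ρ.character g⁻¹ = ∑ h : H, ψ h * ρ.character (h : G)⁻¹ := by
    rw [← Finset.sum_filter_of_ne (s := Finset.univ) (p := (· ∈ H)) fun g _ hg => by
      by_contra h0; exact hg (by simp [hf, h0]), Finset.sum_subtype (p := (· ∈ H)) _ (by simp)]
    refine Finset.sum_congr rfl fun x _ => ?_
    simp [hf]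
  rw [charPairing_comm (fun h : H => ρ.character h), charPairing_def, charPairing_def, hind]
  simp only [Finset.mul_sum, Finset.sum_mul]
  rw [Finset.sum_comm]
  have h1 : ∀ x : G, ∑ g : G, (Nat.card G : ℂ)⁻¹ *
      ((Nat.card H : ℂ)⁻¹ * f (x⁻¹ * g * x) * ρ.character g⁻¹) =
      (Nat.card G : ℂ)⁻¹ * ((Nat.card H : ℂ)⁻¹ * ∑ h : H, ψ h * ρ.character (h : G)⁻¹) := by
    intro x
    rw [← hsum, Finset.mul_sum, Finset.mul_sum]
    refine Fintype.sum_equiv (MulAut.conj x⁻¹).toEquiv _ _ fun g => ?_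
    have : ρ.character g⁻¹ = ρ.character (x⁻¹ * g * x)⁻¹ := by
      rw [← hconj x⁻¹ g⁻¹]; congr 1; group
    rw [this]
    simp [mul_assoc]
  rw [Finset.sum_congr rfl fun x _ => h1 x]
  simp only [Finset.sum_const, Finset.card_univ, nsmul_eq_mul, ← Nat.card_eq_fintype_card]
  rw [← mul_assoc, mul_inv_cancel₀ hG, one_mul, Finset.mul_sum]
  rfl

/-- The degree d is Σ ψ(1)⟨χ|H, ψ⟩ over the irreducible ψ of H. By reciprocity each multiplicity is
that of χ in a multiplicity-free character, hence 0 or 1. -/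
theorem IsStrongGelfandSubgroup.degree_le {H : Subgroup G} (h : IsStrongGelfandSubgroup H)
    {d N : ℕ} (hd : d ∈ irrDegrees G) (hN : totalCharacter H 1 = N) : d ≤ N := by
  classical
  have := Fintype.ofFinite G
  obtain ⟨χ, hχ, hχd⟩ := hd
  have hH : (Nat.card H : ℂ) ≠ 0 := by exact_mod_cast Nat.card_pos.ne'
  -- This is the pairing of the restriction with the regular character of H, so the restriction
  -- itself need not be decomposed.
  have h1 : (d : ℂ) = ∑ ψ ∈ irrFinset H, ψ 1 * charPairing (fun h : H => χ h) ψ := by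
    simp only [charPairing_def, Finset.mul_sum]
    rw [Finset.sum_comm]
    have : ∀ x : H, ∑ ψ ∈ irrFinset H, ψ 1 * ((Nat.card H : ℂ)⁻¹ * (χ x * ψ x⁻¹)) =
        (Nat.card H : ℂ)⁻¹ * χ x * ∑ ψ ∈ irrFinset H, ψ 1 * ψ x⁻¹ := by
      intro x; rw [Finset.mul_sum]; exact Finset.sum_congr rfl fun _ _ => by ring
    rw [Finset.sum_congr rfl fun x _ => this x,
      Finset.sum_congr rfl fun x _ => by rw [sum_irr_one_mul]]
    simp only [inv_eq_one, mul_ite, mul_zero, Finset.sum_ite_eq', Finset.mem_univ, if_true]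
    rw [Subgroup.coe_one, hχd]
    field_simp
  have h2 : ∀ ψ ∈ irrFinset H, charPairing (fun h : H => χ h) ψ = 1 ∨
      charPairing (fun h : H => χ h) ψ = 0 := by
    intro ψ hψ
    obtain ⟨S, hS, hSθ⟩ := h ψ (mem_irrFinset.1 hψ)
    have : ∑ χ' ∈ S, charPairing χ' χ = if χ ∈ S then 1 else 0 := by
      rw [Finset.sum_congr rfl fun χ' h' => charPairing_irr (hS χ' h') hχ]
      convert Finset.sum_ite_eq' S χ fun _ => (1 : ℂ)
    rw [← charPairing_inducedCharacter H ψ hχ, hSθ, charPairing_sum, this]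
    split_ifs <;> simp
  have h3 : (d : ℝ) ≤ N := by
    have e1 := congrArg Complex.re h1
    have e2 := congrArg Complex.re ((totalCharacter_eq (G := H) 1).symm.trans hN)
    rw [Complex.re_sum, Complex.natCast_re] at e1 e2
    rw [e1, ← e2]
    refine Finset.sum_le_sum fun ψ hψ => ?_
    obtain ⟨k, -, hk⟩ := irrCharacters_one (mem_irrFinset.1 hψ)
    rcases h2 ψ hψ with h | h <;> simp [h, hk]
  exact_mod_cast h3

end StrongGelfand

/-! ### Weight spaces of a linear character and the operators e g e. -/

namespace Representation

variable {G V : Type*} [Group G] [AddCommGroup V] [Module ℂ V]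
variable {S : Type*} [Group S]

/-- The space of vectors on which `S` acts through the character `χ`. -/
def wtSpace (ρ : Representation ℂ G V) (ι : S →* G) (χ : S →* ℂ) : Submodule ℂ V where
  carrier := {v | ∀ s, ρ (ι s) v = χ s • v}
  add_mem' ha hb s := by rw [map_add, ha s, hb s, smul_add]
  zero_mem' s := by simp
  smul_mem' c v hv s := by rw [map_smul, hv s, smul_comm]

/-- The projection onto `wtSpace`. -/
def wtProj [Fintype S] (ρ : Representation ℂ G V) (ι : S →* G) (χ : S →* ℂ) : Module.End ℂ V :=
  (Fintype.card S : ℂ)⁻¹ • ∑ s, χ s⁻¹ • ρ (ι s)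

section

variable [Fintype S] (ρ : Representation ℂ G V) (ι : S →* G) (χ : S →* ℂ)

omit [Fintype S] in
theorem wt_mul_wt_inv (s : S) : χ s * χ s⁻¹ = 1 := by
  rw [← map_mul, mul_inv_cancel, map_one]

theorem wtProj_apply (v : V) :
    ρ.wtProj ι χ v = (Fintype.card S : ℂ)⁻¹ • ∑ s, χ s⁻¹ • ρ (ι s) v := by
  simp [wtProj]

theorem rho_mul_wtProj (s : S) : ρ (ι s) * ρ.wtProj ι χ = χ s • ρ.wtProj ι χ := by
  rw [wtProj, mul_smul_comm, smul_comm (χ s), Finset.mul_sum]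
  congr 1
  rw [Finset.smul_sum]
  refine Fintype.sum_equiv (Equiv.mulLeft s) _ _ fun t => ?_
  simp only [Equiv.coe_mulLeft, _root_.mul_inv_rev, map_mul, mul_smul_comm, smul_smul]
  rw [mul_left_comm, wt_mul_wt_inv, mul_one]

theorem wtProj_mul_rho (s : S) : ρ.wtProj ι χ * ρ (ι s) = χ s • ρ.wtProj ι χ := by
  rw [wtProj, smul_mul_assoc, smul_comm (χ s), Finset.sum_mul]
  congr 1
  rw [Finset.smul_sum]
  refine Fintype.sum_equiv (Equiv.mulRight s) _ _ fun t => ?_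
  simp only [Equiv.coe_mulRight, _root_.mul_inv_rev, map_mul, smul_mul_assoc, smul_smul]
  rw [← mul_assoc, wt_mul_wt_inv, one_mul]

theorem wtProj_mem (v : V) : ρ.wtProj ι χ v ∈ ρ.wtSpace ι χ := fun s =>
  LinearMap.congr_fun (rho_mul_wtProj ρ ι χ s) v

variable {ρ ι χ} in
theorem wtProj_of_mem {v : V} (hv : v ∈ ρ.wtSpace ι χ) : ρ.wtProj ι χ v = v := by
  rw [wtProj_apply]
  have : ∀ s, χ s⁻¹ • ρ (ι s) v = v := fun s => by
    rw [hv s, smul_smul, mul_comm, wt_mul_wt_inv, one_smul]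
  simp only [this, Finset.sum_const, Finset.card_univ]
  rw [← Nat.cast_smul_eq_nsmul ℂ, smul_smul, inv_mul_cancel₀, one_smul]
  exact_mod_cast Fintype.card_ne_zero

theorem wtProj_mul_self : ρ.wtProj ι χ * ρ.wtProj ι χ = ρ.wtProj ι χ := by
  ext v; exact wtProj_of_mem (wtProj_mem ρ ι χ v)

theorem range_wtProj : LinearMap.range (ρ.wtProj ι χ) = ρ.wtSpace ι χ := by
  ext v
  refine ⟨?_, fun h => ⟨v, wtProj_of_mem h⟩⟩
  rintro ⟨w, rfl⟩; exact wtProj_mem ρ ι χ w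

/-- `e g e` where `e` is the projection onto the weight space. -/
def sandwich (g : G) : Module.End ℂ V := ρ.wtProj ι χ * ρ g * ρ.wtProj ι χ

theorem sandwich_mul (s t : S) (g : G) :
    ρ.sandwich ι χ (ι s * g * ι t) = (χ s * χ t) • ρ.sandwich ι χ g := by
  simp only [sandwich, map_mul]
  rw [mul_assoc, mul_assoc (_ * _), rho_mul_wtProj, mul_smul_comm, mul_smul_comm,
    ← mul_assoc, ← mul_assoc, wtProj_mul_rho, smul_mul_assoc, smul_mul_assoc, smul_smul, mul_comm]

theorem sandwich_mul_left (s : S) (g : G) :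
    ρ.sandwich ι χ (ι s * g) = χ s • ρ.sandwich ι χ g := by
  simpa using sandwich_mul ρ ι χ s 1 g

theorem sandwich_mul_right (t : S) (g : G) :
    ρ.sandwich ι χ (g * ι t) = χ t • ρ.sandwich ι χ g := by
  simpa using sandwich_mul ρ ι χ 1 t g

-- Absorbing s on the left and t on the right multiplies the same operator by two different scalars.
-- This is the Mackey-type vanishing on a double coset.
variable {ι χ} in
theorem sandwich_eq_zero {s t : S} {g : G} (h : ι s * g = g * ι t) (hne : χ s ≠ χ t) :
    ρ.sandwich ι χ g = 0 := by
  have h1 := sandwich_mul_left ρ ι χ s g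
  rw [h, sandwich_mul_right] at h1
  have h2 : (χ t - χ s) • ρ.sandwich ι χ g = 0 := by rw [sub_smul, h1, sub_self]
  exact (smul_eq_zero.1 h2).resolve_left (sub_ne_zero.2 hne.symm)

theorem sandwich_apply_of_mem {w : V} (hw : w ∈ ρ.wtSpace ι χ) (g : G) :
    ρ.sandwich ι χ g w = ρ.wtProj ι χ (ρ g w) := by
  simp [sandwich, wtProj_of_mem hw]

/-- Invariance of the Gelfand condition under multiplication by `S` on both sides. -/
theorem sandwich_anti_of_mul {τ : G → G} {τS : S → S} (hτ : ∀ g h, τ (g * h) = τ h * τ g)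
    (hS : ∀ s, τ (ι s) = ι (τS s)) (hχ : ∀ s, χ (τS s) = χ s) {s t : S} {g : G}
    (h : ρ.sandwich ι χ g = ρ.sandwich ι χ (τ g)) :
    ρ.sandwich ι χ (ι s * g * ι t) = ρ.sandwich ι χ (τ (ι s * g * ι t)) := by
  rw [hτ, hτ, hS, hS, ← mul_assoc, sandwich_mul, sandwich_mul, hχ, hχ, h, mul_comm]

/-- The two inner idempotents merge into one; expanding it expresses the multiplication of the Hecke
algebra e ℂ[G] e through the spanning elements e g e. -/
theorem sandwich_mul_sandwich (g h : G) :
    ρ.sandwich ι χ g * ρ.sandwich ι χ h =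
      (Fintype.card S : ℂ)⁻¹ • ∑ s, χ s⁻¹ • ρ.sandwich ι χ (g * ι s * h) := by
  have : ρ.sandwich ι χ g * ρ.sandwich ι χ h =
      ρ.wtProj ι χ * ρ g * ρ.wtProj ι χ * (ρ h * ρ.wtProj ι χ) := by
    simp only [sandwich]
    rw [mul_assoc (_ * _), ← mul_assoc (ρ.wtProj ι χ), ← mul_assoc (ρ.wtProj ι χ),
      wtProj_mul_self]
    simp only [mul_assoc]
  rw [this]
  conv_lhs => enter [1, 2]; rw [wtProj]
  simp only [mul_smul_comm, smul_mul_assoc, Finset.mul_sum, Finset.sum_mul, sandwich, map_mul,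
    mul_assoc]

/-- Gelfand's trick: τ reverses products but fixes every sandwich, and it permutes the sum over S
coming from the inner idempotent. -/
theorem sandwich_comm {τ : G → G} {τS : S ≃ S} (hτ : ∀ g h, τ (g * h) = τ h * τ g)
    (hS : ∀ s, τ (ι s) = ι (τS s)) (hχ : ∀ s, χ (τS s) = χ s)
    (h : ∀ g, ρ.sandwich ι χ g = ρ.sandwich ι χ (τ g)) (g k : G) :
    ρ.sandwich ι χ g * ρ.sandwich ι χ k = ρ.sandwich ι χ k * ρ.sandwich ι χ g := by
  have hinv : ∀ s, χ (τS s)⁻¹ = χ s⁻¹ := fun s => by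
    have h1 := wt_mul_wt_inv χ (τS s)
    have h2 := wt_mul_wt_inv χ s
    rw [hχ] at h1
    exact mul_left_cancel₀ (left_ne_zero_of_mul_eq_one h2) (h1.trans h2.symm)
  conv_rhs => rw [h g, h k]
  rw [sandwich_mul_sandwich, sandwich_mul_sandwich]
  congr 1
  refine Fintype.sum_equiv τS _ _ fun s => ?_
  rw [h, hτ, hτ, hS, hinv, mul_assoc]

end

end Representation

/-! ### Schur's lemma, multiplicity one, and the orthogonality criterion. -/

namespace Representation

variable {G V : Type*} [Group G] [AddCommGroup V] [Module ℂ V]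

theorem stable_span_orbit (ρ : Representation ℂ G V) (w : V) :
    ρ.Stable (Submodule.span ℂ (Set.range fun g => ρ g w)) := by
  intro g v hv
  induction hv using Submodule.span_induction with
  | mem x hx =>
    obtain ⟨h, rfl⟩ := hx
    exact Submodule.subset_span ⟨g * h, by simp⟩
  | zero => simp
  | add x y _ _ hx hy => rw [map_add]; exact add_mem hx hy
  | smul c x _ hx => rw [map_smul]; exact Submodule.smul_mem _ _ hx

theorem IsIrreducible.span_orbit {ρ : Representation ℂ G V} (h : ρ.IsIrreducible) {w : V}
    (hw : w ≠ 0) : Submodule.span ℂ (Set.range fun g => ρ g w) = ⊤ := by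
  refine (h.eq_bot_or_eq_top (stable_span_orbit ρ w)).resolve_left fun h0 => hw ?_
  have : w ∈ Submodule.span ℂ (Set.range fun g => ρ g w) :=
    Submodule.subset_span ⟨1, by simp⟩
  rwa [h0, Submodule.mem_bot] at this

/-- Two linear maps agreeing on an orbit agree. -/
theorem IsIrreducible.ext_orbit {W : Type*} [AddCommGroup W] [Module ℂ W]
    {ρ : Representation ℂ G V} (h : ρ.IsIrreducible) {w : V}
    (hw : w ≠ 0) {f f' : V →ₗ[ℂ] W} (hf : ∀ g, f (ρ g w) = f' (ρ g w)) : f = f' := by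
  apply LinearMap.ext_on_range (h.span_orbit hw) hf

theorem IsIrreducible.eq_smul_one_of_commute [FiniteDimensional ℂ V] {ρ : Representation ℂ G V}
    (h : ρ.IsIrreducible) {Y : Module.End ℂ V} (hY : ∀ g, Y * ρ g = ρ g * Y) :
    ∃ c : ℂ, Y = c • 1 := by
  have := h.nontrivial
  obtain ⟨c, hc⟩ := Module.End.exists_eigenvalue Y
  refine ⟨c, ?_⟩
  have hs : ρ.Stable (Module.End.eigenspace Y c) := by
    intro g v hv
    rw [Module.End.mem_eigenspace_iff] at hv ⊢
    rw [← Module.End.mul_apply, hY, Module.End.mul_apply, hv, map_smul]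
  have := (h.eq_bot_or_eq_top hs).resolve_left hc
  ext v
  have hv : v ∈ Module.End.eigenspace Y c := this ▸ Submodule.mem_top
  simpa using Module.End.mem_eigenspace_iff.1 hv

/-- By Schur's lemma the average is a scalar, and its trace determines which one. -/
theorem IsIrreducible.sum_conj [Fintype G] [FiniteDimensional ℂ V] {ρ : Representation ℂ G V}
    (h : ρ.IsIrreducible) (X : Module.End ℂ V) :
    ∑ g, ρ g * X * ρ g⁻¹ =
      ((Fintype.card G : ℂ) * LinearMap.trace ℂ V X / Module.finrank ℂ V) • 1 := by
  have := h.nontrivial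
  have hn : (Module.finrank ℂ V : ℂ) ≠ 0 := by exact_mod_cast Module.finrank_pos.ne'
  obtain ⟨c, hc⟩ := h.eq_smul_one_of_commute (Y := ∑ g, ρ g * X * ρ g⁻¹) (by
    intro k
    rw [Finset.sum_mul, Finset.mul_sum]
    refine Fintype.sum_equiv (Equiv.mulLeft k⁻¹) _ _ fun g => ?_
    simp only [Equiv.coe_mulLeft, _root_.mul_inv_rev, inv_inv, map_mul]
    have : ρ k * ρ k⁻¹ = 1 := by rw [← map_mul, mul_inv_cancel, map_one]
    simp only [← mul_assoc, this, one_mul])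
  have h1 := congrArg (LinearMap.trace ℂ V) hc
  rw [map_sum, map_smul, LinearMap.trace_one, smul_eq_mul] at h1
  have h2 : ∀ g, LinearMap.trace ℂ V (ρ g * X * ρ g⁻¹) = LinearMap.trace ℂ V X := by
    intro g
    rw [LinearMap.trace_mul_comm, ← mul_assoc, ← map_mul, inv_mul_cancel, map_one, one_mul]
  simp only [h2, Finset.sum_const, Finset.card_univ, nsmul_eq_mul] at h1
  rw [hc, h1, mul_div_assoc, div_self hn, mul_one]

variable {S : Type*} [Group S] [Fintype S]

/-- An eigenvector w of one operator e g e exists in the weight space. As the operators e k e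
commute and the translates of w span V, e g e is the same scalar on the whole weight space. So e
maps every translate of w into the line through w, and that line is the whole weight space. -/
theorem IsIrreducible.finrank_wtSpace_le_one [FiniteDimensional ℂ V] {ρ : Representation ℂ G V}
    (hρ : ρ.IsIrreducible) {ι : S →* G} {χ : S →* ℂ} {τ : G → G} {τS : S ≃ S}
    (hτ : ∀ g h, τ (g * h) = τ h * τ g)
    (hS : ∀ s, τ (ι s) = ι (τS s)) (hχ : ∀ s, χ (τS s) = χ s)
    (h : ∀ g, ρ.sandwich ι χ g = ρ.sandwich ι χ (τ g)) :
    Module.finrank ℂ (ρ.wtSpace ι χ) ≤ 1 := by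
  by_cases h0 : ρ.wtSpace ι χ = ⊥
  · rw [h0]; simp
  have hscalar : ∀ g, ∃ c : ℂ, ∀ v ∈ ρ.wtSpace ι χ, ρ.sandwich ι χ g v = c • v := by
    intro g
    have hmaps : ∀ v ∈ ρ.wtSpace ι χ, ρ.sandwich ι χ g v ∈ ρ.wtSpace ι χ :=
      fun v _ => wtProj_mem ρ ι χ _
    have : Nontrivial (ρ.wtSpace ι χ) := Submodule.nontrivial_iff_ne_bot.2 h0
    obtain ⟨c, hc⟩ := Module.End.exists_eigenvalue ((ρ.sandwich ι χ g).restrict hmaps)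
    obtain ⟨⟨w, hw⟩, hwc⟩ := hc.exists_hasEigenvector
    have hw0 : w ≠ 0 := fun hh => hwc.2 (Subtype.ext hh)
    have hwe : ρ.sandwich ι χ g w = c • w := congrArg Subtype.val hwc.apply_eq_smul
    refine ⟨c, fun v hv => ?_⟩
    have : ρ.sandwich ι χ g * ρ.wtProj ι χ = c • ρ.wtProj ι χ := by
      refine hρ.ext_orbit hw0 fun k => ?_
      have h1 : ρ.wtProj ι χ (ρ k w) = ρ.sandwich ι χ k w :=
        (sandwich_apply_of_mem ρ ι χ hw k).symm
      rw [Module.End.mul_apply, LinearMap.smul_apply, h1, ← Module.End.mul_apply,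
        sandwich_comm ρ ι χ hτ hS hχ h, Module.End.mul_apply, hwe, map_smul]
    have := LinearMap.congr_fun this v
    rwa [Module.End.mul_apply, LinearMap.smul_apply, wtProj_of_mem hv] at this
  obtain ⟨w, hw, hw0⟩ := (Submodule.ne_bot_iff _).1 h0
  refine finrank_le_one (⟨w, hw⟩ : ρ.wtSpace ι χ) fun ⟨v, hv⟩ => ?_
  suffices h : v ∈ Submodule.span ℂ {w} by
    obtain ⟨c, hc⟩ := Submodule.mem_span_singleton.1 h
    exact ⟨c, Subtype.ext hc⟩
  have h1 : Submodule.span ℂ (Set.range fun g => ρ g w) ≤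
      (Submodule.span ℂ {w}).comap (ρ.wtProj ι χ) := by
    rw [Submodule.span_le]
    rintro _ ⟨g, rfl⟩
    obtain ⟨c, hc⟩ := hscalar g
    rw [SetLike.mem_coe, Submodule.mem_comap, ← sandwich_apply_of_mem ρ ι χ hw, hc w hw]
    exact Submodule.smul_mem _ _ (Submodule.mem_span_singleton_self w)
  rw [hρ.span_orbit hw0] at h1
  have := h1 (Submodule.mem_top (x := v))
  rwa [Submodule.mem_comap, wtProj_of_mem hv] at this

/-- A representation with a one-dimensional weight space on which the Gelfand condition holds for
inversion is of orthogonal type. -/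
theorem IsIrreducible.sum_character_sq [Fintype G] [FiniteDimensional ℂ V]
    {ρ : Representation ℂ G V} (hρ : ρ.IsIrreducible) {ι : S →* G} {χ : S →* ℂ}
    (hχ : ∀ s, χ s⁻¹ = χ s) (h : ∀ g, ρ.sandwich ι χ g = ρ.sandwich ι χ g⁻¹)
    (hne : ρ.wtSpace ι χ ≠ ⊥) : ∑ g, ρ.character (g * g) = Fintype.card G := by
  have hle := hρ.finrank_wtSpace_le_one (τ := fun g => g⁻¹) (τS := Equiv.inv S)
    (fun g h => by simp) (fun s => by simp) hχ h
  have hnt := hρ.nontrivial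
  have hn : (Module.finrank ℂ V : ℂ) ≠ 0 := by exact_mod_cast Module.finrank_pos.ne'
  have hG : (Fintype.card G : ℂ) ≠ 0 := by exact_mod_cast Fintype.card_ne_zero
  set n := Module.finrank ℂ V with hn_def
  obtain ⟨w, hw, hw0⟩ := (Submodule.ne_bot_iff _).1 hne
  have hspan : ∀ v ∈ ρ.wtSpace ι χ, ∃ c : ℂ, c • w = v := by
    intro v hv
    have := finrank_le_one_iff.1 hle
    obtain ⟨⟨u, hu⟩, h⟩ := this
    obtain ⟨a, ha⟩ := h ⟨w, hw⟩
    obtain ⟨b, hb⟩ := h ⟨v, hv⟩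
    have ha' : a • u = w := congrArg Subtype.val ha
    have hb' : b • u = v := congrArg Subtype.val hb
    have ha0 : a ≠ 0 := by rintro rfl; simp at ha'; exact hw0 ha'.symm
    exact ⟨b * a⁻¹, by rw [← ha', smul_smul, inv_mul_cancel_right₀ ha0, hb']⟩
  obtain ⟨f, hf⟩ : ∃ f : V →ₗ[ℂ] ℂ, f w = 1 := by
    by_contra hc
    refine hw0 ((Module.forall_dual_apply_eq_zero_iff ℂ w).1 fun f => ?_)
    by_contra hfw
    exact hc ⟨(f w)⁻¹ • f, by simp [hfw]⟩
  -- The function g ↦ l (ρ g w) is the spherical function of the weight; `hsym` below is its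
  -- invariance under inversion, which is where the Gelfand condition enters.
  set l : V →ₗ[ℂ] ℂ := f ∘ₗ ρ.wtProj ι χ with hl
  have hlw : l w = 1 := by rw [hl, LinearMap.comp_apply, wtProj_of_mem hw, hf]
  have hsym : ∀ g, l (ρ g w) = l (ρ g⁻¹ w) := by
    intro g
    rw [hl, LinearMap.comp_apply, LinearMap.comp_apply, ← sandwich_apply_of_mem ρ ι χ hw,
      ← sandwich_apply_of_mem ρ ι χ hw, h]
  have htr : ∀ (l' : V →ₗ[ℂ] ℂ) (u : V),
      LinearMap.trace ℂ V (l'.smulRight u) = l' u := fun l' u => LinearMap.trace_smulRight l' u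
  -- Tested on a translate ρ k w: symmetry turns l (g k w) into l (k⁻¹ g⁻¹ w), which makes the sum
  -- an average by conjugation of a rank one operator.
  have hM : ∑ g, (l ∘ₗ ρ g).smulRight (ρ g w) = ((Fintype.card G : ℂ) / n) • l.smulRight w := by
    refine hρ.ext_orbit hw0 fun k => ?_
    have h1 := LinearMap.congr_fun (hρ.sum_conj ((l ∘ₗ ρ k⁻¹).smulRight w)) w
    rw [htr, LinearMap.comp_apply, ← hsym] at h1
    simp only [LinearMap.sum_apply, Module.End.mul_apply, LinearMap.smulRight_apply,
      LinearMap.comp_apply, map_smul, LinearMap.smul_apply, Module.End.one_apply] at h1 ⊢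
    rw [smul_smul]
    have h2 : ∀ g, l (ρ g (ρ k w)) = l (ρ k⁻¹ (ρ g⁻¹ w)) := by
      intro g
      rw [← Module.End.mul_apply, ← map_mul, hsym, _root_.mul_inv_rev, map_mul, Module.End.mul_apply]
    simp only [h2]
    rw [h1]
    congr 1; ring
  -- The trace of this identity is the sum of the spherical function over all squares, equal to
  -- |G|/n.
  have h3 := congrArg (LinearMap.trace ℂ V) hM
  rw [map_sum, map_smul, htr, hlw] at h3
  simp only [htr, LinearMap.comp_apply, smul_eq_mul, mul_one] at h3
  -- The character is, up to the factor n/|G|, the average by conjugation of the spherical function,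
  -- so its sum over squares is now known.
  have h4 : ∀ g, ρ.character g * ((Fintype.card G : ℂ) / n) = ∑ x, l (ρ (x⁻¹ * g * x) w) := by
    intro g
    have h5 := congrArg (fun Y => LinearMap.trace ℂ V (ρ g * Y)) (hρ.sum_conj (l.smulRight w))
    simp only [htr, hlw, mul_one, mul_smul_comm, map_smul, smul_eq_mul, Finset.mul_sum,
      map_sum] at h5
    rw [mul_comm, character, ← h5]
    refine Finset.sum_congr rfl fun x _ => ?_
    rw [← mul_assoc, LinearMap.trace_mul_comm, ← mul_assoc, ← mul_assoc, ← map_mul, ← map_mul,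
      show ρ (x⁻¹ * g * x) * l.smulRight w = l.smulRight (ρ (x⁻¹ * g * x) w) by
        ext v; simp, htr]
  have h6 : (∑ g, ρ.character (g * g)) * ((Fintype.card G : ℂ) / n) =
      Fintype.card G * ((Fintype.card G : ℂ) / n) := by
    rw [Finset.sum_mul]
    simp only [h4]
    rw [Finset.sum_comm]
    have : ∀ x : G, ∑ g, l (ρ (x⁻¹ * (g * g) * x) w) = (Fintype.card G : ℂ) / n := by
      intro x
      rw [← h3]
      refine Fintype.sum_equiv (MulAut.conj x⁻¹).toEquiv _ _ fun g => ?_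
      have : x⁻¹ * (g * g) * x = (x⁻¹ * g * x) * (x⁻¹ * g * x) := by group
      rw [this, map_mul]
      simp
    rw [Finset.sum_congr rfl fun x _ => this x, Finset.sum_const, Finset.card_univ, nsmul_eq_mul]
  exact mul_right_cancel₀ (div_ne_zero hG hn) h6

end Representation

/-! ### Bounds for dimensions by indices, Gram matrices and weights. -/

namespace Representation

variable {G V : Type*} [Group G] [AddCommGroup V] [Module ℂ V]

/-- An irreducible representation is spanned by the translates of a subspace stable under a
subgroup. -/
theorem IsIrreducible.finrank_le_index_mul [Finite G] [FiniteDimensional ℂ V]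
    {ρ : Representation ℂ G V} (hρ : ρ.IsIrreducible) (P : Subgroup G) {W : Submodule ℂ V}
    (hW : W ≠ ⊥) (hP : ∀ p ∈ P, ∀ w ∈ W, ρ p w ∈ W) :
    Module.finrank ℂ V ≤ P.index * Module.finrank ℂ W := by
  have := Fintype.ofFinite (G ⧸ P)
  set Φ : (G ⧸ P → W) →ₗ[ℂ] V :=
    ∑ x : G ⧸ P, ρ x.out ∘ₗ W.subtype ∘ₗ LinearMap.proj x with hΦ
  have hsurj : LinearMap.range Φ = ⊤ := by
    obtain ⟨w, hw, hw0⟩ := (Submodule.ne_bot_iff _).1 hW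
    rw [eq_top_iff, ← hρ.span_orbit hw0, Submodule.span_le]
    rintro _ ⟨g, rfl⟩
    classical
    obtain ⟨p, hp⟩ := QuotientGroup.mk_out_eq_mul P g
    refine ⟨Pi.single (g : G ⧸ P) ⟨ρ (p : G)⁻¹ w, hP _ (inv_mem p.2) w hw⟩, ?_⟩
    rw [hΦ, LinearMap.sum_apply, Finset.sum_eq_single (g : G ⧸ P)]
    · simp [hp]
    · intro x _ hx
      simp [Pi.single_eq_of_ne hx]
    · simp
  have h1 := LinearMap.finrank_range_le Φ
  rw [hsurj, finrank_top, Module.finrank_pi_fintype, Finset.sum_const, Finset.card_univ,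
    smul_eq_mul] at h1
  rwa [Subgroup.index, Nat.card_eq_fintype_card]

/-- The operators A i act as coordinate functionals along w; a linear relation between the v j would
give a kernel vector of M. Lower bounds for degrees come from here. -/
theorem card_le_finrank_of_gram {ι : Type*} [Fintype ι] [DecidableEq ι] [FiniteDimensional ℂ V]
    (v : ι → V) (A : ι → Module.End ℂ V) {w : V} (hw : w ≠ 0) (M : Matrix ι ι ℂ)
    (hM : M.det ≠ 0) (h : ∀ i j, A i (v j) = M i j • w) :
    Fintype.card ι ≤ Module.finrank ℂ V := by
  have hli : LinearIndependent ℂ v := by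
    rw [Fintype.linearIndependent_iff]
    intro c hc
    have h1 : M *ᵥ c = 0 := by
      ext i
      have h2 := congrArg (A i) hc
      simp only [map_sum, map_smul, h, map_zero, smul_smul, ← Finset.sum_smul] at h2
      have h3 := (smul_eq_zero.1 h2).resolve_right hw
      simp only [Matrix.mulVec, dotProduct, Pi.zero_apply, ← h3]
      exact Finset.sum_congr rfl fun j _ => mul_comm _ _
    exact fun i => congrFun (Matrix.eq_zero_of_mulVec_eq_zero hM h1) i
  exact hli.fintype_card_le_finrank

variable {S : Type*} [Group S] [Fintype S] {I : Type*} [Fintype I]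

-- The hypothesis is the column orthogonality relation. It stands in for saying that the family χ
-- runs once over the whole dual of an abelian group.
open Classical in
theorem sum_wtProj (ρ : Representation ℂ G V) (ι : S →* G) (χ : I → S →* ℂ)
    (hχ : ∀ s, ∑ i, χ i s = if s = 1 then (Fintype.card S : ℂ) else 0) :
    ∑ i, ρ.wtProj ι (χ i) = 1 := by
  simp only [wtProj]
  rw [← Finset.smul_sum, Finset.sum_comm]
  simp only [← Finset.sum_smul, hχ, inv_eq_one, ite_smul, zero_smul, Finset.sum_ite_eq',
    Finset.mem_univ, if_true, map_one]
  rw [smul_smul, inv_mul_cancel₀, one_smul]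
  exact_mod_cast Fintype.card_ne_zero

open Classical in
theorem finrank_le_sum_wtSpace [FiniteDimensional ℂ V] (ρ : Representation ℂ G V) (ι : S →* G)
    (χ : I → S →* ℂ) (hχ : ∀ s, ∑ i, χ i s = if s = 1 then (Fintype.card S : ℂ) else 0)
    (W : Submodule ℂ V) (hW : ∀ s, ∀ w ∈ W, ρ (ι s) w ∈ W) :
    Module.finrank ℂ W ≤ ∑ i, Module.finrank ℂ (W ⊓ ρ.wtSpace ι (χ i) : Submodule ℂ V) := by
  set Φ : ((i : I) → (W ⊓ ρ.wtSpace ι (χ i) : Submodule ℂ V)) →ₗ[ℂ] V :=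
    ∑ i, (W ⊓ ρ.wtSpace ι (χ i)).subtype ∘ₗ LinearMap.proj i with hΦ
  have hle : W ≤ LinearMap.range Φ := by
    intro w hw
    have hmem : ∀ i, ρ.wtProj ι (χ i) w ∈ W ⊓ ρ.wtSpace ι (χ i) := by
      refine fun i => ⟨?_, wtProj_mem _ _ _ _⟩
      rw [wtProj_apply]
      exact Submodule.smul_mem _ _
        (Submodule.sum_mem _ fun s _ => Submodule.smul_mem _ _ (hW s w hw))
    refine ⟨fun i => ⟨_, hmem i⟩, ?_⟩
    have h1 := LinearMap.congr_fun (sum_wtProj ρ ι χ hχ) w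
    rw [LinearMap.sum_apply, Module.End.one_apply] at h1
    rw [hΦ, LinearMap.sum_apply]
    exact h1
  calc Module.finrank ℂ W ≤ Module.finrank ℂ (LinearMap.range Φ) := Submodule.finrank_mono hle
    _ ≤ _ := LinearMap.finrank_range_le Φ
    _ = _ := Module.finrank_pi_fintype ℂ

/-- Weight spaces of conjugate weights have the same dimension. -/
theorem finrank_wtSpace_conj_le [FiniteDimensional ℂ V] (ρ : Representation ℂ G V)
    {W W' : Submodule ℂ V} (g : G) (h : ∀ w ∈ W, ρ g w ∈ W') :
    Module.finrank ℂ W ≤ Module.finrank ℂ W' := by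
  refine LinearMap.finrank_le_finrank_of_injective (f := (ρ g).restrict h) ?_
  intro x y hxy
  have h1 : ρ g x = ρ g y := congrArg Subtype.val hxy
  have h2 := congrArg (ρ g⁻¹) h1
  simpa using h2

end Representation

/-! ### Weights of a finite abelian group. -/

section CommGroup

variable {T : Type*} [CommGroup T] [Fintype T]

/-- The character of `T` attached to an additive character. -/
def AddChar.toHom (ν : AddChar (Additive T) ℂ) : T →* ℂ where
  toFun t := ν (Additive.ofMul t)
  map_one' := by simp
  map_mul' s t := by simp [AddChar.map_add_eq_mul]

open Classical in
theorem AddChar.sum_toHom (t : T) :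
    ∑ ν : AddChar (Additive T) ℂ, ν.toHom t = if t = 1 then (Fintype.card T : ℂ) else 0 := by
  have := AddChar.sum_apply_eq_ite (α := Additive T) (Additive.ofMul t)
  simp only [AddChar.toHom, MonoidHom.coe_mk, OneHom.coe_mk]
  rw [this]
  simp [Fintype.card_congr Additive.toMul]

namespace Representation

variable {G V : Type*} [Group G] [AddCommGroup V] [Module ℂ V]

/-- If all weight spaces of an abelian group on a stable subspace have dimension at most `1`, the
dimension of that subspace is at most the order of the group. -/
theorem finrank_le_card_of_wtSpace_le_one [FiniteDimensional ℂ V] (ρ : Representation ℂ G V)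
    (ι : T →* G) (W : Submodule ℂ V) (hW : ∀ s, ∀ w ∈ W, ρ (ι s) w ∈ W)
    (h : ∀ ν : T →* ℂ, Module.finrank ℂ (W ⊓ ρ.wtSpace ι ν : Submodule ℂ V) ≤ 1) :
    Module.finrank ℂ W ≤ Fintype.card T := by
  classical
  have h1 := finrank_le_sum_wtSpace ρ ι (fun ν : AddChar (Additive T) ℂ => ν.toHom)
    (fun t => by convert AddChar.sum_toHom t) W hW
  refine h1.trans ((Finset.sum_le_sum fun ν _ => h ν.toHom).trans ?_)
  rw [Finset.sum_const, Finset.card_univ, smul_eq_mul, mul_one, ← Nat.card_eq_fintype_card,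
    ← Nat.card_eq_fintype_card]
  have := AddChar.card_eq (α := Additive T)
  rw [← Nat.card_eq_fintype_card, ← Nat.card_eq_fintype_card] at this
  exact this.le

end Representation

end CommGroup

/-- The special linear group of degree two, in coordinates. -/
@[ext]
structure SL2 (R : Type*) [CommRing R] where
  /-- The upper left entry. -/
  a : R
  /-- The upper right entry. -/
  b : R
  /-- The lower left entry. -/
  c : R
  /-- The lower right entry. -/
  d : R
  det : a * d - b * c = 1

/-! ### The group structure on SL₂. -/

namespace SL2

variable {R : Type*} [CommRing R]

instance : Mul (SL2 R) :=
  ⟨fun g h => ⟨g.a * h.a + g.b * h.c, g.a * h.b + g.b * h.d, g.c * h.a + g.d * h.c,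
    g.c * h.b + g.d * h.d, by linear_combination (h.a * h.d - h.b * h.c) * g.det + h.det⟩⟩

instance : One (SL2 R) := ⟨⟨1, 0, 0, 1, by ring⟩⟩

instance : Inv (SL2 R) := ⟨fun g => ⟨g.d, -g.b, -g.c, g.a, by linear_combination g.det⟩⟩

@[simp] theorem mul_a (g h : SL2 R) : (g * h).a = g.a * h.a + g.b * h.c := rfl
@[simp] theorem mul_b (g h : SL2 R) : (g * h).b = g.a * h.b + g.b * h.d := rfl
@[simp] theorem mul_c (g h : SL2 R) : (g * h).c = g.c * h.a + g.d * h.c := rfl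
@[simp] theorem mul_d (g h : SL2 R) : (g * h).d = g.c * h.b + g.d * h.d := rfl
@[simp] theorem one_a : (1 : SL2 R).a = 1 := rfl
@[simp] theorem one_b : (1 : SL2 R).b = 0 := rfl
@[simp] theorem one_c : (1 : SL2 R).c = 0 := rfl
@[simp] theorem one_d : (1 : SL2 R).d = 1 := rfl
@[simp] theorem inv_a (g : SL2 R) : g⁻¹.a = g.d := rfl
@[simp] theorem inv_b (g : SL2 R) : g⁻¹.b = -g.b := rfl
@[simp] theorem inv_c (g : SL2 R) : g⁻¹.c = -g.c := rfl
@[simp] theorem inv_d (g : SL2 R) : g⁻¹.d = g.a := rfl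

instance : Group (SL2 R) :=
  Group.ofLeftAxioms
    (fun f g h => by ext <;> simp <;> ring)
    (fun g => by ext <;> simp)
    (fun g => by
      ext <;> simp
      · linear_combination g.det
      · ring
      · ring
      · linear_combination g.det)

theorem toProd_injective :
    Function.Injective fun g : SL2 R => (g.a, g.b, g.c, g.d) := by
  intro g h hgh
  simp only [Prod.mk.injEq] at hgh
  obtain ⟨h1, h2, h3, h4⟩ := hgh
  ext <;> assumption

instance [Finite R] : Finite (SL2 R) := Finite.of_injective _ toProd_injective

/-- The matrix of an element of `SL2`. -/
def toMat (g : SL2 R) : Matrix (Fin 2) (Fin 2) R := !![g.a, g.b; g.c, g.d]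

theorem toMat_mul (g h : SL2 R) : (g * h).toMat = g.toMat * h.toMat := by
  simp [toMat]

@[simp] theorem toMat_one : (1 : SL2 R).toMat = 1 := by
  simp [toMat, Matrix.one_fin_two]

theorem toMat_inv_mul (g : SL2 R) : g⁻¹.toMat * g.toMat = 1 := by
  rw [← toMat_mul, inv_mul_cancel, toMat_one]

theorem toMat_injective : Function.Injective (toMat : SL2 R → _) := by
  intro g h hgh
  ext
  · exact congrFun (congrFun hgh 0) 0
  · exact congrFun (congrFun hgh 0) 1
  · exact congrFun (congrFun hgh 1) 0
  · exact congrFun (congrFun hgh 1) 1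

end SL2

/-! ### Characteristic two: Artin–Schreier parameters and the nonsplit torus of SL₂. -/

section CharTwo

variable {F : Type*} [Field F]

/-- The map x ↦ x² + x takes the same value at 0 and 1, so on a finite field it misses some value δ,
and X² + X + δ is then irreducible. -/
theorem exists_sq_add_self_add_ne_zero [Finite F] [CharP F 2] :
    ∃ δ : F, ∀ x : F, x ^ 2 + x + δ ≠ 0 := by
  have h2 : (2 : F) = 0 := CharTwo.two_eq_zero
  have hni : ¬ Function.Injective fun x : F => x ^ 2 + x := by
    intro h
    have : (0 : F) = 1 := h (by simp only; linear_combination -h2)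
    exact zero_ne_one this
  have hns : ¬ Function.Surjective fun x : F => x ^ 2 + x := fun h =>
    hni (Finite.injective_iff_surjective.2 h)
  simp only [Function.Surjective, not_forall, not_exists] at hns
  obtain ⟨δ, hδ⟩ := hns
  exact ⟨δ, fun x hx => hδ x (by linear_combination hx - δ * h2)⟩

theorem exists_sq_eq [Finite F] [CharP F 2] (a : F) : ∃ b : F, b ^ 2 = a := by
  have : Function.Injective fun x : F => x ^ 2 := by
    intro x y hxy
    exact CharTwo.sq_injective hxy
  exact Finite.injective_iff_surjective.1 this a

/-- The form is the norm of x + yθ with θ a root of X² + X + δ, hence anisotropic. -/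
theorem normForm_eq_zero {δ : F} (hδ : ∀ x : F, x ^ 2 + x + δ ≠ 0) {x y : F}
    (h : x ^ 2 + x * y + δ * y ^ 2 = 0) : x = 0 ∧ y = 0 := by
  by_cases hy : y = 0
  · subst hy; simpa using h
  · exfalso
    apply hδ (x / y)
    field_simp
    linear_combination h

/-- The torus of norm one elements of the quadratic extension with parameter `δ`, in the regular
representation. -/
def normOneTorus [CharP F 2] (δ : F) : Subgroup (SL2 F) where
  carrier := {g | g.b = δ * g.c ∧ g.d = g.a + g.c}
  one_mem' := by simp
  mul_mem' := by
    rintro g h ⟨g1, g2⟩ ⟨h1, h2⟩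
    constructor <;> simp only [SL2.mul_a, SL2.mul_b, SL2.mul_c, SL2.mul_d, g1, g2, h1, h2] <;> ring
  inv_mem' := by
    rintro g ⟨g1, g2⟩
    constructor <;> simp only [SL2.inv_a, SL2.inv_b, SL2.inv_c, SL2.inv_d, g1, g2] <;> ring

variable [CharP F 2]

theorem normOneTorus_comm {δ : F} {g h : SL2 F}
    (hg : g ∈ normOneTorus δ) (hh : h ∈ normOneTorus δ) : g * h = h * g := by
  obtain ⟨g1, g2⟩ := hg
  obtain ⟨h1, h2⟩ := hh
  ext <;> simp only [SL2.mul_a, SL2.mul_b, SL2.mul_c, SL2.mul_d, g1, g2, h1, h2] <;> ring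

instance (δ : F) : CommGroup (normOneTorus δ) :=
  { (inferInstance : Group (normOneTorus δ)) with
    mul_comm := fun g h => Subtype.ext (normOneTorus_comm g.2 h.2) }

theorem normForm_of_mem {δ : F} {g : SL2 F} (hg : g ∈ normOneTorus δ) :
    g.a ^ 2 + g.a * g.c + δ * g.c ^ 2 = 1 := by
  have hd := g.det
  have h2 : (2 : F) = 0 := CharTwo.two_eq_zero
  rw [hg.1, hg.2] at hd
  linear_combination hd + δ * g.c ^ 2 * h2

/-- The element of the torus with given first column. -/
def torusMk (δ x y : F) (h : x ^ 2 + x * y + δ * y ^ 2 = 1) : SL2 F :=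
  ⟨x, δ * y, y, x + y, by
    have h2 : (2 : F) = 0 := CharTwo.two_eq_zero
    linear_combination h - δ * y ^ 2 * h2⟩

theorem torusMk_mem (δ x y : F) (h : x ^ 2 + x * y + δ * y ^ 2 = 1) :
    torusMk δ x y h ∈ normOneTorus δ := ⟨rfl, rfl⟩

/-- Multiplying the first column of a torus element by a unit c gives a nonzero vector of norm c².
Square roots are unique, so c and the element are recovered, and (q − 1)|T| ≤ q² − 1. -/
theorem card_normOneTorus_le [Finite F] (δ : F) :
    Nat.card (normOneTorus δ) ≤ Nat.card F + 1 := by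
  have := Fintype.ofFinite F
  classical
  let f : normOneTorus δ × Fˣ → {v : F × F // v ≠ 0} := fun p =>
    ⟨(p.2 * p.1.1.a, p.2 * p.1.1.c), by
      intro h
      have h1 := normForm_of_mem p.1.2
      rw [Prod.mk_eq_zero] at h
      have e1 := (mul_eq_zero.1 h.1).resolve_left p.2.ne_zero
      have e2 := (mul_eq_zero.1 h.2).resolve_left p.2.ne_zero
      rw [e1, e2] at h1
      simp at h1⟩
  have hf : Function.Injective f := by
    rintro ⟨⟨g, hg⟩, c⟩ ⟨⟨g', hg'⟩, c'⟩ h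
    have h1 := normForm_of_mem hg
    have h2 := normForm_of_mem hg'
    simp only [f, Subtype.mk.injEq, Prod.mk.injEq] at h
    obtain ⟨e1, e2⟩ := h
    have hc : (c : F) ^ 2 = (c' : F) ^ 2 := by
      calc (c : F) ^ 2 = (c * g.a) ^ 2 + (c * g.a) * (c * g.c)
            + δ * (c * g.c) ^ 2 := by linear_combination -(c : F) ^ 2 * h1
        _ = (c' : F) ^ 2 := by rw [e1, e2]; linear_combination (c' : F) ^ 2 * h2
    have hc' : (c : F) = c' := CharTwo.sq_injective hc
    rw [hc'] at e1 e2
    have e3 := mul_left_cancel₀ c'.ne_zero e1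
    have e4 := mul_left_cancel₀ c'.ne_zero e2
    have : g = g' := by
      ext <;> simp [hg.1, hg.2, hg'.1, hg'.2, e3, e4]
    subst this
    rw [Units.val_inj] at hc'
    rw [hc']
  have h1 := Nat.card_le_card_of_injective f hf
  have h2 : Nat.card {v : F × F // v ≠ 0} = Nat.card F ^ 2 - 1 := by
    simp only [Nat.card_eq_fintype_card]
    rw [Fintype.card_subtype_compl, Fintype.card_subtype_eq, Fintype.card_prod, sq]
  rw [Nat.card_prod, Nat.card_units, h2] at h1
  have h3 : Nat.card F ^ 2 - 1 = (Nat.card F + 1) * (Nat.card F - 1) := by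
    simpa using Nat.sq_sub_sq (Nat.card F) 1
  rw [h3] at h1
  exact Nat.le_of_mul_le_mul_right h1 (Nat.sub_pos_of_lt (Finite.one_lt_card))

variable (F) in
/-- The reflection normalising the torus. -/
def torusRefl : SL2 F := ⟨1, 1, 0, 1, by ring⟩

/-- Identify F² with the quadratic extension generated by a root θ of X² + X + δ, so that
`torusRefl` is conjugation. A bilinear form is Tr(α x y + β x ȳ). An element t of norm one replaces
α by α t² and fixes β; transposing and conjugating replaces α by ᾱ and fixes β. So t² = ᾱ/α is
needed, and t = ᾱ/√N(α) has norm one. -/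
theorem exists_torus_transpose [Finite F] {δ : F} (hδ : ∀ x : F, x ^ 2 + x + δ ≠ 0)
    (C : Matrix (Fin 2) (Fin 2) F) :
    ∃ t ∈ normOneTorus δ,
      (torusRefl F).toMatᵀ * Cᵀ * (torusRefl F).toMat = t.toMatᵀ * C * t.toMat := by
  have h2 : (2 : F) = 0 := CharTwo.two_eq_zero
  obtain ⟨p, r, s, u, hC⟩ : ∃ p r s u, C = !![p, r; s, u] := ⟨_, _, _, _, Matrix.eta_fin_two C⟩
  -- The element a0 + a1 θ is the coefficient α of the form.
  set a1 := p + r + s with ha1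
  set a0 := u + p + r + s + δ * p with ha0
  by_cases hN : a0 ^ 2 + a0 * a1 + δ * a1 ^ 2 = 0
  · refine ⟨1, one_mem _, ?_⟩
    obtain ⟨e0, e1⟩ := normForm_eq_zero hδ hN
    rw [hC]
    ext i j
    fin_cases i <;> fin_cases j <;>
      simp [torusRefl, SL2.toMat, Matrix.mul_apply, Fin.sum_univ_two] <;> grind
  · obtain ⟨n, hn⟩ := exists_sq_eq (a0 ^ 2 + a0 * a1 + δ * a1 ^ 2)
    have hn0 : n ≠ 0 := by rintro rfl; apply hN; rw [← hn]; simp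
    have hx : ((a0 + a1) / n) ^ 2 + ((a0 + a1) / n) * (a1 / n) + δ * (a1 / n) ^ 2 = 1 := by
      field_simp
      rw [hn]; linear_combination (a0 * a1 + a1 ^ 2) * h2
    refine ⟨_, torusMk_mem δ _ _ hx, ?_⟩
    rw [hC]
    ext i j
    fin_cases i <;> fin_cases j <;>
      simp [torusRefl, torusMk, SL2.toMat, Matrix.mul_apply, Fin.sum_univ_two] <;>
      field_simp <;> grind

end CharTwo

/-! ### Transposition, unitriangular and diagonal elements, Bruhat decomposition. -/

namespace SL2

variable {R : Type*} [CommRing R]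

/-- The transpose. -/
def tr (g : SL2 R) : SL2 R := ⟨g.a, g.c, g.b, g.d, by linear_combination g.det⟩

@[simp] theorem tr_a (g : SL2 R) : g.tr.a = g.a := rfl
@[simp] theorem tr_b (g : SL2 R) : g.tr.b = g.c := rfl
@[simp] theorem tr_c (g : SL2 R) : g.tr.c = g.b := rfl
@[simp] theorem tr_d (g : SL2 R) : g.tr.d = g.d := rfl

theorem tr_mul (g h : SL2 R) : (g * h).tr = h.tr * g.tr := by ext <;> simp <;> ring

theorem tr_inv (g : SL2 R) : g⁻¹.tr = g.tr⁻¹ := by ext <;> simp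

/-- The Weyl element. -/
def swap : SL2 R := ⟨0, 1, -1, 0, by ring⟩

/-- Upper unitriangular elements. -/
def up (b : R) : SL2 R := ⟨1, b, 0, 1, by ring⟩

@[simp] theorem swap_a : (swap : SL2 R).a = 0 := rfl
@[simp] theorem swap_b : (swap : SL2 R).b = 1 := rfl
@[simp] theorem swap_c : (swap : SL2 R).c = -1 := rfl
@[simp] theorem swap_d : (swap : SL2 R).d = 0 := rfl
@[simp] theorem up_a (b : R) : (up b).a = 1 := rfl
@[simp] theorem up_b (b : R) : (up b).b = b := rfl
@[simp] theorem up_c (b : R) : (up b).c = 0 := rfl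
@[simp] theorem up_d (b : R) : (up b).d = 1 := rfl

theorem up_mul_up (b b' : R) : up b * up b' = up (b + b') := by ext <;> simp; ring

/-- Diagonal elements. -/
def diag (t : Rˣ) : SL2 R := ⟨t, 0, 0, (t⁻¹ : Rˣ), by simp⟩

@[simp] theorem diag_a (t : Rˣ) : (diag t).a = t := rfl
@[simp] theorem diag_b (t : Rˣ) : (diag t).b = 0 := rfl
@[simp] theorem diag_c (t : Rˣ) : (diag t).c = 0 := rfl
@[simp] theorem diag_d (t : Rˣ) : (diag t).d = (t⁻¹ : Rˣ) := rfl

variable {F : Type*} [Field F]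

/-- Bruhat decomposition. -/
theorem bruhat (h : SL2 F) :
    (∃ b t, h = up b * diag t) ∨ (∃ b t b', h = up b * (swap * diag t) * up b') := by
  by_cases hc : h.c = 0
  · left
    have hd : h.a * h.d = 1 := by have := h.det; rw [hc] at this; linear_combination this
    have ha0 : h.a ≠ 0 := left_ne_zero_of_mul_eq_one hd
    have hd0 : h.d ≠ 0 := right_ne_zero_of_mul_eq_one hd
    refine ⟨h.b * h.a, Units.mk0 h.a ha0, ?_⟩
    ext <;> simp [hc]
    · field_simp
    · field_simp; linear_combination hd
  · right
    refine ⟨h.a / h.c, Units.mk0 (-h.c) (neg_ne_zero.2 hc), h.d / h.c, ?_⟩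
    have := h.det
    ext <;> simp <;> field_simp <;> try ring1
    linear_combination -this

/-- Bruhat decomposition, with lower unitriangular matrices on the left. -/
theorem bruhat_lower (h : SL2 F) :
    (∃ b t b', h = (up b).tr * diag t * up b') ∨
      (∃ b t b', h = (up b).tr * (swap * diag t) * up b') := by
  by_cases ha : h.a = 0
  · right
    have hd : -h.b * h.c = 1 := by have := h.det; rw [ha] at this; linear_combination this
    have hb0 : h.b ≠ 0 := fun h0 => by simp [h0] at hd
    have hc0 : h.c ≠ 0 := fun h0 => by simp [h0] at hd
    refine ⟨0, Units.mk0 (-h.c) (neg_ne_zero.2 hc0), h.d / h.c, ?_⟩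
    ext <;> simp [ha] <;> field_simp <;> try ring1
    linear_combination -hd
  · left
    refine ⟨h.c / h.a, Units.mk0 h.a ha, h.b / h.a, ?_⟩
    have := h.det
    ext <;> simp <;> field_simp <;> try ring1
    linear_combination this

end SL2

/-! ### Conjugation of elements of SL₂ to their reflected inverses by the nonsplit torus. -/

section Torus

variable {F : Type*} [Field F] [CharP F 2]

theorem torusRefl_inv : (torusRefl F)⁻¹ = torusRefl F := by
  have h2 : (2 : F) = 0 := CharTwo.two_eq_zero
  ext <;> simp [torusRefl]
  linear_combination -h2

theorem torusRefl_conj {δ : F} {t : SL2 F} (ht : t ∈ normOneTorus δ) :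
    torusRefl F * t⁻¹ * (torusRefl F)⁻¹ = t := by
  have h2 : (2 : F) = 0 := CharTwo.two_eq_zero
  obtain ⟨h1, h3⟩ := ht
  ext <;> simp [torusRefl, h1, h3] <;> grind

theorem exists_torus_tr [Finite F] {δ : F} (hδ : ∀ x : F, x ^ 2 + x + δ ≠ 0) (h : SL2 F) :
    ∃ t ∈ normOneTorus δ, (torusRefl F).tr * h.tr * torusRefl F = t.tr * h * t := by
  obtain ⟨t, ht, he⟩ := exists_torus_transpose hδ h.toMat
  refine ⟨t, ht, SL2.toMat_injective ?_⟩
  have htr : ∀ g : SL2 F, g.tr.toMat = g.toMatᵀ := by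
    intro g; ext i j; fin_cases i <;> fin_cases j <;> rfl
  simpa only [SL2.toMat_mul, htr] using he

/-- Multiplication by `swap` turns bilinear forms into endomorphisms and transposition into
inversion, so this is the transposed version applied to `swap * h`. -/
theorem exists_torus_inv [Finite F] {δ : F} (hδ : ∀ x : F, x ^ 2 + x + δ ≠ 0) (h : SL2 F) :
    ∃ t ∈ normOneTorus δ, torusRefl F * h⁻¹ * (torusRefl F)⁻¹ = t⁻¹ * h * t := by
  obtain ⟨t, ht, he⟩ := exists_torus_tr hδ (SL2.swap * h)
  refine ⟨t, ht, ?_⟩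
  have hs : ∀ g : SL2 F, g.tr * SL2.swap = SL2.swap * g⁻¹ := by
    intro g; ext <;> simp
  have h2 : (2 : F) = 0 := CharTwo.two_eq_zero
  have hsw : (SL2.swap : SL2 F).tr = SL2.swap := by
    ext <;> simp
    · linear_combination -h2
    · linear_combination h2
  rw [SL2.tr_mul, hsw, ← mul_assoc, ← mul_assoc, mul_assoc _ h.tr, hs h, hs t, ← mul_assoc,
    hs, torusRefl_inv] at he
  rw [torusRefl_inv]
  simpa only [mul_assoc, mul_right_inj] using he

end Torus

/-! ### Degrees of F× × SL₂(F). -/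

section LeviBound

variable {F : Type*} [Field F] [CharP F 2] [Finite F]
variable {V : Type*} [AddCommGroup V] [Module ℂ V] [FiniteDimensional ℂ V]

/-- The anti-automorphism h ↦ r h⁻¹ r⁻¹, with r the reflection, fixes the nonsplit torus pointwise
and moves every h only within its torus conjugacy class. By Gelfand's trick each torus character
occurs at most once, and the torus has at most q + 1 elements. -/
theorem Representation.IsIrreducible.finrank_le_of_levi {ρ : Representation ℂ (Fˣ × SL2 F) V}
    (hρ : ρ.IsIrreducible) : Module.finrank ℂ V ≤ Nat.card F + 1 := by
  obtain ⟨δ, hδ⟩ := exists_sq_add_self_add_ne_zero (F := F)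
  have := Fintype.ofFinite (normOneTorus δ)
  let ι : normOneTorus δ →* Fˣ × SL2 F := (MonoidHom.inr Fˣ (SL2 F)).comp (normOneTorus δ).subtype
  have hι : ∀ t : normOneTorus δ, ι t = (1, t.1) := fun t => rfl
  let τ : Fˣ × SL2 F → Fˣ × SL2 F := fun g => (g.1, torusRefl F * g.2⁻¹ * (torusRefl F)⁻¹)
  have hwt : ∀ ν : normOneTorus δ →* ℂ, Module.finrank ℂ (ρ.wtSpace ι ν) ≤ 1 := by
    intro ν
    refine hρ.finrank_wtSpace_le_one (τ := τ) (τS := _root_.Equiv.refl _) ?_ ?_ ?_ ?_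
    · rintro ⟨a, g⟩ ⟨b, h⟩
      simp only [τ, Prod.mk_mul_mk, Prod.mk.injEq]
      exact ⟨mul_comm _ _, by group⟩
    · rintro ⟨t, ht⟩
      simp only [τ, hι, _root_.Equiv.refl_apply]
      rw [torusRefl_conj ht]
    · intro s; rfl
    · rintro ⟨c, h⟩
      obtain ⟨t, ht, he⟩ := exists_torus_inv hδ h
      have : τ (c, h) = ι (⟨t, ht⟩⁻¹) * (c, h) * ι ⟨t, ht⟩ := by
        simp [τ, hι, he]
      rw [this, Representation.sandwich_mul, ← map_mul, inv_mul_cancel, map_one, one_smul]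
  have h1 := Representation.finrank_le_card_of_wtSpace_le_one ρ ι ⊤ (fun _ _ _ => Submodule.mem_top)
    (fun ν => by rw [top_inf_eq]; exact hwt ν)
  rw [finrank_top, ← Nat.card_eq_fintype_card] at h1
  exact h1.trans (card_normOneTorus_le δ)

end LeviBound

/-! ### Root, torus and Weyl elements of Sp₄ and their commutation rules. -/

namespace Sp4

variable {F : Type*} [Field F] [CharP F 2]

theorem mk_mem {A B C D : Matrix (Fin 2) (Fin 2) F} (h1 : Aᵀ * C = Cᵀ * A)
    (h2 : Bᵀ * D = Dᵀ * B) (h3 : Aᵀ * D - Cᵀ * B = 1) :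
    fromBlocks A B C D ∈ symplecticGroup (Fin 2) F :=
  SymplecticGroup.fromBlocks_mem_iff.2 ⟨h1, h2, h3⟩

theorem zero_fin_two : (!![0, 0; 0, 0] : Matrix (Fin 2) (Fin 2) F) = 0 := by
  ext i j; fin_cases i <;> fin_cases j <;> rfl

/-- Unipotent radical of the stabiliser of a Lagrangian subspace. -/
def uQ : Multiplicative (F × F × F) →* Sp 2 F where
  toFun x := ⟨fromBlocks 1 !![x.toAdd.1, x.toAdd.2.1; x.toAdd.2.1, x.toAdd.2.2] 0 1,
    mk_mem (by simp) (by ext i j; fin_cases i <;> fin_cases j <;> simp) (by simp)⟩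
  map_one' := by
    apply Subtype.ext
    simp [← fromBlocks_one, fromBlocks_inj, zero_fin_two]
  map_mul' x y := by
    apply Subtype.ext
    simp [fromBlocks_multiply, fromBlocks_inj, add_comm]

theorem uQ_coe (x : Multiplicative (F × F × F)) : (uQ x).1 =
    fromBlocks 1 !![x.toAdd.1, x.toAdd.2.1; x.toAdd.2.1, x.toAdd.2.2] 0 1 := rfl

/-- An element of `uQ` in coordinates. -/
abbrev qq (s t u : F) : Sp 2 F := uQ (Multiplicative.ofAdd (s, t, u))

theorem qq_coe (s t u : F) : (qq s t u).1 = fromBlocks 1 !![s, t; t, u] 0 1 := rfl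

/-- The Levi subgroup. -/
def levi : Fˣ × SL2 F →* Sp 2 F where
  toFun l := ⟨fromBlocks ((l.1 : F) • l.2.toMat) 0 0 (((l.1⁻¹ : Fˣ) : F) • l.2.tr⁻¹.toMat),
    mk_mem (by simp) (by simp) (by
      have h1 := l.2.det
      ext i j
      fin_cases i <;> fin_cases j <;> simp [SL2.toMat, Matrix.mul_apply] <;> field_simp <;> grind)⟩
  map_one' := by
    apply Subtype.ext
    have : (1 : SL2 F).tr = 1 := by ext <;> simp
    simp [← fromBlocks_one, this]
  map_mul' x y := by
    apply Subtype.ext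
    simp [fromBlocks_multiply, SL2.toMat_mul, SL2.tr_mul, _root_.mul_inv_rev, smul_smul, mul_comm]

theorem levi_coe (l : Fˣ × SL2 F) : (levi l).1 =
    fromBlocks ((l.1 : F) • l.2.toMat) 0 0 (((l.1⁻¹ : Fˣ) : F) • l.2.tr⁻¹.toMat) := rfl

/-- The diagonal torus. -/
def dT : Fˣ × Fˣ →* Sp 2 F where
  toFun t := ⟨fromBlocks !![(t.1 : F), 0; 0, (t.2 : F)] 0 0
      !![((t.1⁻¹ : Fˣ) : F), 0; 0, ((t.2⁻¹ : Fˣ) : F)],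
    mk_mem (by simp) (by simp) (by
      ext i j
      fin_cases i <;> fin_cases j <;> simp [Matrix.mul_apply])⟩
  map_one' := by
    apply Subtype.ext
    simp [← fromBlocks_one, fromBlocks_inj, Matrix.one_fin_two]
  map_mul' x y := by
    apply Subtype.ext
    simp [fromBlocks_multiply, mul_comm]

theorem dT_coe (t : Fˣ × Fˣ) : (dT t).1 = fromBlocks !![(t.1 : F), 0; 0, (t.2 : F)] 0 0
      !![((t.1⁻¹ : Fˣ) : F), 0; 0, ((t.2⁻¹ : Fˣ) : F)] := rfl

/-- Root elements in the Levi subgroup. -/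
def xa : Multiplicative F →* Sp 2 F where
  toFun b := levi (1, SL2.up b.toAdd)
  map_one' := by
    rw [show ((1, SL2.up (Multiplicative.toAdd (1 : Multiplicative F))) : Fˣ × SL2 F) = 1 from
      Prod.ext rfl (by ext <;> simp), map_one]
  map_mul' b b' := by
    rw [← map_mul, Prod.mk_mul_mk, SL2.up_mul_up, one_mul, toAdd_mul]

/-- A root element in coordinates. -/
abbrev xx (b : F) : Sp 2 F := xa (Multiplicative.ofAdd b)

theorem xx_eq (b : F) : xx b = levi (1, SL2.up b) := rfl

theorem xx_coe (b : F) : (xx b).1 = fromBlocks !![1, b; 0, 1] 0 0 !![1, 0; -b, 1] := by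
  rw [xx_eq, levi_coe]
  simp [SL2.toMat]

/-- The short Weyl reflection. -/
def sw : Sp 2 F := levi (1, SL2.swap)

theorem sw_coe : (sw : Sp 2 F).1 = fromBlocks !![0, 1; -1, 0] 0 0 !![0, 1; -1, 0] := by
  rw [sw, levi_coe]
  simp [SL2.toMat]

variable (F) in
/-- The matrix `J` as an element of the group. -/
def jj : Sp 2 F := SymplecticGroup.symJ (Fin 2) F

theorem jj_coe : (jj F).1 = fromBlocks 0 (-1) 1 0 := rfl

variable (F) in
/-- The long Weyl reflection. -/
def rr : Sp 2 F := ⟨fromBlocks !![1, 0; 0, 0] !![0, 0; 0, -1] !![0, 0; 0, 1] !![1, 0; 0, 0],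
  mk_mem (by ext i j; fin_cases i <;> fin_cases j <;> simp [Matrix.mul_apply])
    (by ext i j; fin_cases i <;> fin_cases j <;> simp [Matrix.mul_apply])
    (by ext i j; fin_cases i <;> fin_cases j <;> simp [Matrix.mul_apply])⟩

theorem rr_coe : (rr F).1 = fromBlocks !![1, 0; 0, 0] !![0, 0; 0, -1] !![0, 0; 0, 1] !![1, 0; 0, 0] :=
  rfl

theorem jj_sq : jj F * jj F = 1 := by
  apply Subtype.ext
  simp [jj_coe, fromBlocks_multiply, ← fromBlocks_one, fromBlocks_inj]
  ext i j; fin_cases i <;> fin_cases j <;> simp [CharTwo.neg_eq]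

theorem rr_sq : rr F * rr F = 1 := by
  apply Subtype.ext
  simp [rr_coe, fromBlocks_multiply, ← fromBlocks_one, fromBlocks_inj, Matrix.one_fin_two,
    CharTwo.neg_eq, zero_fin_two]

theorem sw_sq : (sw : Sp 2 F) * sw = 1 := by
  apply Subtype.ext
  simp [sw_coe, fromBlocks_multiply, ← fromBlocks_one, fromBlocks_inj, Matrix.one_fin_two,
    CharTwo.neg_eq]

/-- The action of the Levi subgroup on the unipotent radical, in coordinates. -/
def actQ (l : Fˣ × SL2 F) (x : F × F × F) : F × F × F :=
  (l.1 ^ 2 * (l.2.a ^ 2 * x.1 + l.2.b ^ 2 * x.2.2),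
   l.1 ^ 2 * (l.2.a * l.2.c * x.1 + (l.2.a * l.2.d + l.2.b * l.2.c) * x.2.1 + l.2.b * l.2.d * x.2.2),
   l.1 ^ 2 * (l.2.c ^ 2 * x.1 + l.2.d ^ 2 * x.2.2))

theorem levi_mul_uQ (l : Fˣ × SL2 F) (x : F × F × F) :
    levi l * uQ (Multiplicative.ofAdd x) = uQ (Multiplicative.ofAdd (actQ l x)) * levi l := by
  have h1 := l.2.det
  have h2 : (2 : F) = 0 := CharTwo.two_eq_zero
  apply Subtype.ext
  simp only [Submonoid.coe_mul, levi_coe, uQ_coe, fromBlocks_multiply, fromBlocks_inj]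
  refine ⟨by simp, ?_, by simp, by simp⟩
  ext i j
  fin_cases i <;> fin_cases j <;> simp [SL2.toMat, Matrix.mul_apply, actQ] <;> field_simp <;> grind

theorem jj_mul_levi (c : Fˣ) (h : SL2 F) : jj F * levi (c, h) = levi (c⁻¹, h.tr⁻¹) * jj F := by
  apply Subtype.ext
  simp only [Submonoid.coe_mul, levi_coe, jj_coe, fromBlocks_multiply, fromBlocks_inj]
  simp [SL2.tr_inv, show h.tr.tr = h from rfl]

theorem jj_mul_sw : jj F * sw = sw * jj F := by
  have : (SL2.swap.tr⁻¹ : SL2 F) = SL2.swap := by ext <;> simp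
  rw [sw, jj_mul_levi, this, inv_one]

theorem dT_mul_jj (t : Fˣ × Fˣ) : dT t * jj F = jj F * dT t⁻¹ := by
  apply Subtype.ext
  simp only [Submonoid.coe_mul, dT_coe, jj_coe, fromBlocks_multiply, fromBlocks_inj]
  simp

theorem dT_mul_sw (t t' : Fˣ) : dT (t, t') * sw = sw * dT (t', t) := by
  apply Subtype.ext
  simp only [Submonoid.coe_mul, dT_coe, sw_coe, fromBlocks_multiply, fromBlocks_inj]
  simp

theorem dT_mul_rr (t t' : Fˣ) : dT (t, t') * rr F = rr F * dT (t, t'⁻¹) := by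
  apply Subtype.ext
  simp only [Submonoid.coe_mul, dT_coe, rr_coe, fromBlocks_multiply, fromBlocks_inj]
  simp

theorem qq_mul_dT (s t u : F) (c c' : Fˣ) :
    qq s t u * dT (c, c') = dT (c, c') * qq (s / c ^ 2) (t / (c * c')) (u / c' ^ 2) := by
  apply Subtype.ext
  simp only [Submonoid.coe_mul, dT_coe, qq_coe, fromBlocks_multiply, fromBlocks_inj]
  refine ⟨by simp, ?_, by simp, by simp⟩
  ext i j
  fin_cases i <;> fin_cases j <;> simp [Matrix.mul_apply] <;> field_simp

theorem xx_mul_dT (b : F) (c c' : Fˣ) :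
    xx b * dT (c, c') = dT (c, c') * xx (b * c' / c) := by
  apply Subtype.ext
  simp only [Submonoid.coe_mul, dT_coe, xx_coe, fromBlocks_multiply, fromBlocks_inj]
  refine ⟨?_, by simp, by simp, ?_⟩ <;> ext i j <;>
  fin_cases i <;> fin_cases j <;> simp [Matrix.mul_apply] <;> field_simp

theorem qq_mul_sw (s t u : F) : qq s t u * sw = sw * qq u t s := by
  apply Subtype.ext
  simp only [Submonoid.coe_mul, sw_coe, qq_coe, fromBlocks_multiply, fromBlocks_inj]
  simp [CharTwo.neg_eq]

theorem qq_mul_rr (s : F) : qq s 0 0 * rr F = rr F * qq s 0 0 := by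
  apply Subtype.ext
  simp only [Submonoid.coe_mul, rr_coe, qq_coe, fromBlocks_multiply, fromBlocks_inj]
  simp

theorem xx_mul_rr (b : F) : xx b * rr F = rr F * qq 0 b 0 := by
  apply Subtype.ext
  simp only [Submonoid.coe_mul, rr_coe, qq_coe, xx_coe, fromBlocks_multiply, fromBlocks_inj]
  simp [CharTwo.neg_eq]

theorem qq_mul_xx (s t u b : F) :
    xx b * qq s t u = qq (s + b ^ 2 * u) (t + b * u) u * xx b := by
  rw [xx_eq, levi_mul_uQ]
  simp [actQ]

end Sp4

/-! ### The action of the Levi subgroup on the radical, and subgroups of the Lagrangian parabolic.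
-/

namespace Sp4

variable {F : Type*} [Field F] [CharP F 2]

theorem uQ_mul_levi_coe (x : Multiplicative (F × F × F)) (l : Fˣ × SL2 F) :
    (uQ x * levi l).1 = fromBlocks ((l.1 : F) • l.2.toMat)
      (!![x.toAdd.1, x.toAdd.2.1; x.toAdd.2.1, x.toAdd.2.2] * (((l.1⁻¹ : Fˣ) : F) • l.2.tr⁻¹.toMat)) 0
      (((l.1⁻¹ : Fˣ) : F) • l.2.tr⁻¹.toMat) := by
  simp [uQ_coe, levi_coe, fromBlocks_multiply]

theorem uQ_injective : Function.Injective (uQ : Multiplicative (F × F × F) →* Sp 2 F) := by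
  intro x y h
  have h1 := congrArg Subtype.val h
  rw [uQ_coe, uQ_coe, fromBlocks_inj] at h1
  have h2 := h1.2.1
  have e1 := congrFun (congrFun h2 0) 0
  have e2 := congrFun (congrFun h2 0) 1
  have e3 := congrFun (congrFun h2 1) 1
  simp at e1 e2 e3
  exact Multiplicative.toAdd.injective (Prod.ext e1 (Prod.ext e2 e3))

theorem units_sq_injective {c c' : Fˣ} (h : (c : F) ^ 2 = (c' : F) ^ 2) : c = c' :=
  Units.ext (CharTwo.sq_injective h)

theorem levi_injective : Function.Injective (levi : Fˣ × SL2 F →* Sp 2 F) := by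
  rintro ⟨c, h⟩ ⟨c', h'⟩ he
  have h1 := congrArg Subtype.val he
  rw [levi_coe, levi_coe, fromBlocks_inj] at h1
  have h2 := h1.1
  have e1 := congrFun (congrFun h2 0) 0
  have e2 := congrFun (congrFun h2 0) 1
  have e3 := congrFun (congrFun h2 1) 0
  have e4 := congrFun (congrFun h2 1) 1
  simp [SL2.toMat] at e1 e2 e3 e4
  have hd := h.det
  have hd' := h'.det
  have hc : c = c' := units_sq_injective (by grind)
  subst hc
  simp at e1 e2 e3 e4
  rw [SL2.ext e1 e2 e3 e4]

theorem uQ_mul_levi_injective : Function.Injective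
    fun p : Multiplicative (F × F × F) × (Fˣ × SL2 F) => uQ p.1 * levi p.2 := by
  rintro ⟨x, l⟩ ⟨x', l'⟩ he
  have he' : uQ x * levi l = uQ x' * levi l' := he
  have h1 := congrArg Subtype.val he
  simp only [uQ_mul_levi_coe, fromBlocks_inj] at h1
  have hl : l = l' := levi_injective (Subtype.ext (by
    rw [levi_coe, levi_coe, h1.1, h1.2.2.2]))
  subst hl
  rw [uQ_injective (mul_right_cancel he')]

theorem levi_conj_uQ (l : Fˣ × SL2 F) (x : F × F × F) :
    levi l * uQ (Multiplicative.ofAdd x) * (levi l)⁻¹ = uQ (Multiplicative.ofAdd (actQ l x)) := by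
  rw [levi_mul_uQ, mul_inv_cancel_right]

/-- The action of the Levi subgroup on the unipotent radical. -/
def actHom : Fˣ × SL2 F →* MulAut (Multiplicative (F × F × F)) := by
  -- All axioms are transported from conjugation in `Sp 2 F` along the injection `uQ`.
  refine MonoidHom.mk' (fun l =>
    { toFun := fun x => Multiplicative.ofAdd (actQ l x.toAdd)
      invFun := fun x => Multiplicative.ofAdd (actQ l⁻¹ x.toAdd)
      left_inv := fun x => uQ_injective ?_
      right_inv := fun x => uQ_injective ?_
      map_mul' := fun x y => uQ_injective ?_ }) fun l l' => ?_
  · simp only [← levi_conj_uQ, toAdd_ofAdd, ofAdd_toAdd, map_inv]; group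
  · simp only [← levi_conj_uQ, toAdd_ofAdd, ofAdd_toAdd, map_inv]; group
  · simp only [← levi_conj_uQ, map_mul, toAdd_ofAdd, ofAdd_toAdd]; group
  · refine MulEquiv.ext fun x => uQ_injective ?_
    simp only [MulEquiv.coe_mk, Equiv.coe_fn_mk, MulAut.mul_apply, ← levi_conj_uQ, map_mul,
      toAdd_ofAdd, ofAdd_toAdd]
    group

theorem actHom_apply (l : Fˣ × SL2 F) (x : Multiplicative (F × F × F)) :
    actHom l x = Multiplicative.ofAdd (actQ l x.toAdd) := rfl

theorem levi_mul_uQ' (l : Fˣ × SL2 F) (x : Multiplicative (F × F × F)) :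
    levi l * uQ x = uQ (actHom l x) * levi l := levi_mul_uQ l x.toAdd

section SD

variable {M : Type*} [Group M] (m : M →* Fˣ × SL2 F)

/-- The semidirect product of the unipotent radical with a group mapping to the Levi subgroup. -/
abbrev SD := Multiplicative (F × F × F) ⋊[actHom.comp m] M

instance [Finite F] [Finite M] : Finite (SD m) :=
  Finite.of_equiv _ (SemidirectProduct.equivProd (φ := actHom.comp m)).symm

/-- The embedding of the semidirect product. -/
def iSD : SD m →* Sp 2 F :=
  SemidirectProduct.lift uQ (levi.comp m) fun g => by
    refine MonoidHom.ext fun x => ?_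
    simp only [MonoidHom.comp_apply, MulEquiv.coe_toMonoidHom, MulAut.conj_apply,
      levi_mul_uQ', mul_inv_cancel_right]

theorem iSD_apply (s : SD m) : iSD m s = uQ s.left * levi (m s.right) := rfl

theorem iSD_mk (x : Multiplicative (F × F × F)) (g : M) : iSD m ⟨x, g⟩ = uQ x * levi (m g) := rfl

theorem iSD_inl (x : Multiplicative (F × F × F)) : iSD m (SemidirectProduct.inl x) = uQ x := by
  simp [iSD]

theorem iSD_inr (g : M) : iSD m (SemidirectProduct.inr g) = levi (m g) := by
  simp [iSD]

theorem iSD_injective (hm : Function.Injective m) : Function.Injective (iSD m) := by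
  rintro ⟨x, g⟩ ⟨y, g'⟩ h
  have := uQ_mul_levi_injective (a₁ := (x, m g)) (a₂ := (y, m g')) h
  rw [Prod.mk.injEq] at this
  rw [this.1, hm this.2]

/-- Linear characters of the semidirect product. -/
def cSD (μ : Multiplicative (F × F × F) →* ℂ) (ν : M →* ℂ)
    (h : ∀ g x, μ (actHom (m g) x) = μ x) : SD m →* ℂ where
  toFun s := μ s.left * ν s.right
  map_one' := by simp
  map_mul' s t := by simp [h]; ring

variable {μ : Multiplicative (F × F × F) →* ℂ} {ν : M →* ℂ}
    (h : ∀ g x, μ (actHom (m g) x) = μ x)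

theorem cSD_inl (x : Multiplicative (F × F × F)) :
    cSD m μ ν h (SemidirectProduct.inl x) = μ x := by simp [cSD]

theorem cSD_inr (g : M) : cSD m μ ν h (SemidirectProduct.inr g) = ν g := by simp [cSD]

theorem wtSpace_iSD {V : Type*} [AddCommGroup V] [Module ℂ V] (ρ : Representation ℂ (Sp 2 F) V) :
    ρ.wtSpace (iSD m) (cSD m μ ν h) = ρ.wtSpace uQ μ ⊓ ρ.wtSpace (levi.comp m) ν := by
  ext v
  refine ⟨fun hv => ⟨fun x => ?_, fun g => ?_⟩, fun ⟨h1, h2⟩ s => ?_⟩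
  · rw [← iSD_inl m, hv, cSD_inl]
  · rw [MonoidHom.comp_apply, ← iSD_inr m, hv, cSD_inr]
  · have h2' := h2 s.right
    rw [MonoidHom.comp_apply] at h2'
    rw [iSD_apply, map_mul, Module.End.mul_apply, h2', map_smul, h1, smul_smul, mul_comm]
    rfl

end SD

end Sp4

namespace Representation

variable {G S V : Type*} [Group G] [Group S] [AddCommGroup V] [Module ℂ V] [Fintype S]
  (ρ : Representation ℂ G V) {ι : S →* G} {χ : S →* ℂ}

/-- Applying τ to s g = g t gives a relation of the same kind for τ g, so both sandwiches vanish and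
the Gelfand condition holds trivially. -/
theorem sandwich_anti_of_ne {τ : G → G} {τS : S → S} (hτ : ∀ g h, τ (g * h) = τ h * τ g)
    (hS : ∀ s, τ (ι s) = ι (τS s)) (hχ : ∀ s, χ (τS s) = χ s) {s t : S} {g : G}
    (h : ι s * g = g * ι t) (hne : χ s ≠ χ t) :
    ρ.sandwich ι χ g = ρ.sandwich ι χ (τ g) := by
  rw [ρ.sandwich_eq_zero h hne, ρ.sandwich_eq_zero (s := τS t) (t := τS s)]
  · rw [← hS, ← hτ, ← h, hτ, hS]
  · rw [hχ, hχ]; exact hne.symm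

end Representation

/-! ### Double cosets of the Lagrangian parabolic. -/

namespace Sp4

variable {F : Type*} [Field F] [CharP F 2]

/-- Lower-left and diagonal relations of a symplectic matrix in block form. -/
theorem exists_blocks (g : Sp 2 F) : ∃ A B C D : Matrix (Fin 2) (Fin 2) F,
    g.1 = fromBlocks A B C D ∧ Aᵀ * C = Cᵀ * A ∧ Bᵀ * D = Dᵀ * B ∧ Aᵀ * D - Cᵀ * B = 1 := by
  refine ⟨g.1.toBlocks₁₁, g.1.toBlocks₁₂, g.1.toBlocks₂₁, g.1.toBlocks₂₂,
    (fromBlocks_toBlocks _).symm, ?_⟩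
  have := g.2
  rw [← fromBlocks_toBlocks g.1, SymplecticGroup.fromBlocks_mem_iff] at this
  exact this

/-- Every element of F is a square, so each determinant is removed by a scalar: GL₂(F) is scalars
times SL₂(F). This is why the Levi subgroup has the form F× × SL₂(F). -/
theorem exists_levi [Finite F] (A : Matrix (Fin 2) (Fin 2) F) (hA : A.det ≠ 0) :
    ∃ l : Fˣ × SL2 F, (l.1 : F) • l.2.toMat = A := by
  obtain ⟨c, hc⟩ := exists_sq_eq A.det
  have hc0 : c ≠ 0 := by rintro rfl; simp at hc; exact hA hc.symm
  rw [det_fin_two] at hc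
  refine ⟨⟨Units.mk0 c hc0, ⟨A 0 0 / c, A 0 1 / c, A 1 0 / c, A 1 1 / c, ?_⟩⟩, ?_⟩
  · field_simp
    linear_combination -hc
  · ext i j
    fin_cases i <;> fin_cases j <;> simp [SL2.toMat] <;> field_simp

/-- The three double cosets of the stabiliser of a Lagrangian are told apart by the rank of the
lower left block. Rank 0 is treated here, rank 2 in `eq_uQ_mul_jj`, rank 1 in `eq_uQ_mul_rr`. -/
theorem eq_uQ_mul_levi [Finite F] (g : Sp 2 F) (hg : g.1.toBlocks₂₁ = 0) :
    ∃ x l, g = uQ x * levi l := by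
  obtain ⟨A, B, C, D, he, h1, h2, h3⟩ := exists_blocks g
  rw [he, toBlocks_fromBlocks₂₁] at hg
  subst hg
  simp only [transpose_zero, zero_mul, sub_zero] at h3
  have hA : A.det ≠ 0 := by
    intro h0
    have := congrArg det h3
    simp [det_transpose, h0] at this
  obtain ⟨l, rfl⟩ := exists_levi A hA
  have hS : (B * ((l.1 : F) • l.2.toMat)ᵀ)ᵀ = B * ((l.1 : F) • l.2.toMat)ᵀ := by
    have e1 : ((l.1 : F) • l.2.toMat) * Dᵀ = 1 := by
      have := congrArg transpose h3
      rw [transpose_mul, transpose_transpose, transpose_one] at this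
      exact mul_eq_one_comm.1 this
    have e2 : D * ((l.1 : F) • l.2.toMat)ᵀ = 1 := by
      rw [← transpose_one, ← e1, transpose_mul, transpose_transpose]
    set A := ((l.1 : F) • l.2.toMat)
    calc (B * Aᵀ)ᵀ = A * Bᵀ := by rw [transpose_mul, transpose_transpose]
      _ = A * (Bᵀ * D) * Aᵀ := by rw [mul_assoc, mul_assoc, e2, mul_one]
      _ = B * Aᵀ := by rw [h2, ← mul_assoc, e1, one_mul]
  have hD : D = ((l.1⁻¹ : Fˣ) : F) • l.2.tr⁻¹.toMat := by
    have e2 : (((l.1⁻¹ : Fˣ) : F) • l.2.tr⁻¹.toMat) * ((l.1 : F) • l.2.toMat)ᵀ = 1 := by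
      have : l.2.toMatᵀ = l.2.tr.toMat := by
        ext i j; fin_cases i <;> fin_cases j <;> rfl
      rw [transpose_smul, this, smul_mul_smul_comm, SL2.toMat_inv_mul]
      simp
    rw [← one_mul D, ← e2, mul_assoc, h3, mul_one]
  set S := B * ((l.1 : F) • l.2.toMat)ᵀ with hSdef
  refine ⟨Multiplicative.ofAdd (S 0 0, S 0 1, S 1 1), l, Subtype.ext ?_⟩
  rw [he, uQ_mul_levi_coe, fromBlocks_inj]
  refine ⟨rfl, ?_, rfl, hD⟩
  have : !![S 0 0, S 0 1; S 0 1, S 1 1] = S := by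
    have h01 : S 1 0 = S 0 1 := congrFun (congrFun hS 0) 1
    ext i j
    fin_cases i <;> fin_cases j <;> simp [h01]
  simp only [toAdd_ofAdd]
  rw [this, ← hD, hSdef, mul_assoc, h3, mul_one]

theorem jj_mul_coe (g : Sp 2 F) {A B C D : Matrix (Fin 2) (Fin 2) F}
    (hg : g.1 = fromBlocks A B C D) : (jj F * g).1 = fromBlocks (-C) (-D) A B := by
  rw [Submonoid.coe_mul, hg, jj_coe, fromBlocks_multiply]
  simp

theorem eq_uQ_mul_jj [Finite F] (g : Sp 2 F) (hg : g.1.toBlocks₂₁.det ≠ 0) :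
    ∃ x l y, g = uQ x * (jj F * levi l) * uQ y := by
  obtain ⟨A, B, C, D, he, h1, h2, h3⟩ := exists_blocks g
  rw [he, toBlocks_fromBlocks₂₁] at hg
  have hu : IsUnit C.det := isUnit_iff_ne_zero.2 hg
  set S := A * C⁻¹ with hSdef
  have hS : Sᵀ = S := by
    have hC : C⁻¹ᵀ * Cᵀ = 1 := by rw [← transpose_mul, mul_nonsing_inv _ hu, transpose_one]
    calc Sᵀ = C⁻¹ᵀ * (Aᵀ * C) * C⁻¹ := by
          rw [mul_assoc, mul_assoc, mul_nonsing_inv _ hu, mul_one, hSdef, transpose_mul]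
      _ = S := by rw [h1, ← mul_assoc, hC, one_mul]
  have hS' : !![S 0 0, S 0 1; S 0 1, S 1 1] = S := by
    have h01 : S 1 0 = S 0 1 := congrFun (congrFun hS 0) 1
    ext i j
    fin_cases i <;> fin_cases j <;> simp [h01]
  set x : Multiplicative (F × F × F) := Multiplicative.ofAdd (S 0 0, S 0 1, S 1 1)
  have hx : (uQ x⁻¹).1 = fromBlocks 1 (-S) 0 1 := by
    rw [uQ_coe, ← hS']
    congr 1
    ext i j
    fin_cases i <;> fin_cases j <;> rfl
  obtain ⟨y, l, hyl⟩ := eq_uQ_mul_levi (jj F * (uQ x⁻¹ * g)) (by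
    have : (uQ x⁻¹ * g).1 = fromBlocks 0 (B - S * D) C D := by
      rw [Submonoid.coe_mul, hx, he, fromBlocks_multiply, hSdef, neg_mul, mul_assoc,
        nonsing_inv_mul _ hu]
      simp
      abel
    rw [jj_mul_coe _ this, toBlocks_fromBlocks₂₁])
  refine ⟨x, l, actHom l⁻¹ y, ?_⟩
  have e1 : uQ x⁻¹ * g = jj F * (uQ y * levi l) := by
    rw [← hyl, ← mul_assoc, jj_sq, one_mul]
  have e2 : levi l * uQ (actHom l⁻¹ y) = uQ y * levi l := by
    rw [levi_mul_uQ', ← MulAut.mul_apply, ← map_mul]; simp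
  rw [mul_assoc, mul_assoc, e2, ← e1, ← mul_assoc, ← map_mul]
  simp

end Sp4

theorem SL2.exists_row {F : Type*} [Field F] (x y : F) (h : x ≠ 0 ∨ y ≠ 0) :
    ∃ g : SL2 F, g.a = x ∧ g.b = y := by
  by_cases hx : x = 0
  · subst hx
    have hy : y ≠ 0 := by simpa using h
    exact ⟨⟨0, y, -y⁻¹, 0, by simp [hy]⟩, rfl, rfl⟩
  · exact ⟨⟨x, y, 0, x⁻¹, by simp [hx]⟩, rfl, rfl⟩

theorem SL2.exists_mul_mul_eq {F : Type*} [Field F] (C : Matrix (Fin 2) (Fin 2) F)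
    (hC : C.det = 0) (h0 : C ≠ 0) :
    ∃ g h : SL2 F, g.toMat * C * h.toMat = !![0, 0; 0, 1] := by
  rw [det_fin_two] at hC
  obtain ⟨g, hg⟩ : ∃ g : SL2 F, g.a * C 0 0 + g.b * C 1 0 = 0 ∧ g.a * C 0 1 + g.b * C 1 1 = 0 := by
    by_cases h1 : C 1 0 ≠ 0 ∨ -C 0 0 ≠ 0
    · obtain ⟨g, ha, hb⟩ := SL2.exists_row _ _ h1
      exact ⟨g, by rw [ha, hb]; ring, by rw [ha, hb]; linear_combination -hC⟩
    · by_cases h2 : C 1 1 ≠ 0 ∨ -C 0 1 ≠ 0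
      · obtain ⟨g, ha, hb⟩ := SL2.exists_row _ _ h2
        exact ⟨g, by rw [ha, hb]; linear_combination hC, by rw [ha, hb]; ring⟩
      · exfalso
        push Not at h1 h2
        apply h0
        ext i j
        fin_cases i <;> fin_cases j
        · exact neg_eq_zero.1 h1.2
        · exact neg_eq_zero.1 h2.2
        · exact h1.1
        · exact h2.1
  have h1 : (g.c * C 0 1 + g.d * C 1 1) ≠ 0 ∨ (g.c * C 0 0 + g.d * C 1 0) ≠ 0 := by
    by_contra hcon
    push Not at hcon
    have hgC : g.toMat * C = 0 := by
      ext i j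
      fin_cases i <;> fin_cases j <;> simp [SL2.toMat, Matrix.mul_apply, hg.1, hg.2, hcon.1, hcon.2]
    apply h0
    rw [← one_mul C, ← SL2.toMat_inv_mul g, mul_assoc, hgC, mul_zero]
  obtain ⟨h, ha, hb⟩ := SL2.exists_row _ _ h1
  have hd := h.det
  refine ⟨g, ⟨h.a, -h.c, -h.b, h.d, by linear_combination hd⟩, ?_⟩
  rw [eta_fin_two C]
  simp only [SL2.toMat, mul_fin_two, hg.1, hg.2]
  ext i j
  fin_cases i <;> fin_cases j <;> simp
  · rw [ha, hb]; ring
  · linear_combination hd - h.d * ha + h.c * hb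

namespace Sp4

variable {F : Type*} [Field F] [CharP F 2]

/-- The diagonal torus inside the Levi subgroup. -/
theorem exists_dT_eq_levi [Finite F] (t : Fˣ × Fˣ) : ∃ c d : Fˣ, dT t = levi (c, SL2.diag d) := by
  obtain ⟨c, hc⟩ := exists_sq_eq ((t.1 : F) * t.2)
  have hc0 : c ≠ 0 := by rintro rfl; simp at hc
  refine ⟨Units.mk0 c hc0, t.1 / Units.mk0 c hc0, Subtype.ext ?_⟩
  rw [dT_coe, levi_coe, fromBlocks_inj]
  refine ⟨?_, rfl, rfl, ?_⟩
  · ext i j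
    fin_cases i <;> fin_cases j <;> simp [SL2.toMat] <;> field_simp
    linear_combination -hc
  · ext i j
    fin_cases i <;> fin_cases j <;> simp [SL2.toMat] <;> field_simp
    linear_combination hc

theorem eq_uQ_mul_rr_of_eq (g : Sp 2 F) (hg : g.1.toBlocks₂₁ = !![0, 0; 0, 1]) :
    ∃ x t y, g = uQ x * (rr F * dT t) * uQ y := by
  obtain ⟨A, B, C, D, he, h1, h2, h3⟩ := exists_blocks g
  rw [he, toBlocks_fromBlocks₂₁] at hg
  subst hg
  have r1 := congrFun (congrFun h1 0) 1
  have r2 := congrFun (congrFun h2 0) 1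
  have s1 := congrFun (congrFun h3 0) 0
  have s2 := congrFun (congrFun h3 0) 1
  have s3 := congrFun (congrFun h3 1) 0
  have s4 := congrFun (congrFun h3 1) 1
  simp [Matrix.mul_apply] at r1 r2 s1 s2 s3 s4
  rw [r1] at s1 s2
  have ha : A 0 0 ≠ 0 := by intro h; simp [h] at s1
  have hd : D 0 1 = 0 := by simpa [ha] using s2
  refine ⟨Multiplicative.ofAdd (0, A 0 1, A 1 1), (Units.mk0 _ ha, 1),
    Multiplicative.ofAdd ((B 0 0 - A 0 1 * D 1 0) / A 0 0, D 1 0, D 1 1), Subtype.ext ?_⟩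
  rw [hd] at r2 s4
  have ha' : (A 0 0)⁻¹ = D 0 0 := by field_simp; linear_combination -s1
  simp only [Submonoid.coe_mul, he, uQ_coe, rr_coe, dT_coe, fromBlocks_multiply, fromBlocks_inj]
  refine ⟨?_, ?_, ?_, ?_⟩ <;> ext i j <;> fin_cases i <;> fin_cases j <;>
    simp [Matrix.mul_apply, r1, hd, ha', div_eq_mul_inv]
  · linear_combination -(B 0 0 - A 0 1 * D 1 0) * s1
  · grind
  · linear_combination -s3
  · linear_combination -s4

theorem eq_uQ_mul_rr [Finite F] (g : Sp 2 F) (hg : g.1.toBlocks₂₁.det = 0)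
    (h0 : g.1.toBlocks₂₁ ≠ 0) :
    ∃ x l l' y, g = uQ x * (levi l * rr F * levi l') * uQ y := by
  obtain ⟨h, h', hh⟩ := SL2.exists_mul_mul_eq _ hg h0
  obtain ⟨x, t, y, hg'⟩ := eq_uQ_mul_rr_of_eq (levi (1, h⁻¹.tr) * g * levi (1, h')) (by
    rw [← fromBlocks_toBlocks g.1] at hh
    rw [toBlocks_fromBlocks₂₁] at hh
    rw [Submonoid.coe_mul, Submonoid.coe_mul, levi_coe, levi_coe, ← fromBlocks_toBlocks g.1,
      fromBlocks_multiply, fromBlocks_multiply, toBlocks_fromBlocks₂₁]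
    simp only [fromBlocks_toBlocks]
    have : h⁻¹.tr.tr⁻¹ = h := by rw [show h⁻¹.tr.tr = h⁻¹ from rfl, inv_inv]
    simp [this, hh])
  obtain ⟨c, d, hd⟩ := exists_dT_eq_levi t
  set l : Fˣ × SL2 F := (1, h⁻¹.tr)
  set l' : Fˣ × SL2 F := (1, h')
  refine ⟨actHom l⁻¹ x, l⁻¹, (c, SL2.diag d) * l'⁻¹, actHom l' y, ?_⟩
  have e1 : uQ (actHom l⁻¹ x) = (levi l)⁻¹ * uQ x * levi l := by
    rw [← map_inv levi, levi_mul_uQ', mul_assoc, ← map_mul, inv_mul_cancel, map_one, mul_one]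
  have e2 : uQ (actHom l' y) = levi l' * uQ y * (levi l')⁻¹ := by
    rw [levi_mul_uQ', mul_assoc, mul_inv_cancel, mul_one]
  rw [e1, e2, map_mul, ← hd, map_inv, map_inv]
  have : g = (levi l)⁻¹ * (levi l * g * levi l') * (levi l')⁻¹ := by group
  rw [this, hg']
  group

end Sp4

theorem AddChar.exists_apply_mul_ne {F : Type*} [Field F] {ψ : AddChar F ℂ} (hψ : ∃ z, ψ z ≠ 1)
    {a b : F} (h : a ≠ b) : ∃ x, ψ (a * x) ≠ ψ (b * x) := by
  obtain ⟨z, hz⟩ := hψ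
  refine ⟨z / (a - b), fun he => hz ?_⟩
  have h1 : z = a * (z / (a - b)) - b * (z / (a - b)) := by
    have := sub_ne_zero.2 h
    field_simp
  rw [h1, AddChar.map_sub_eq_div, he, div_self]
  exact (ψ.val_isUnit _).ne_zero

/-! ### Characters of the radical as binary quadratic forms; the nonsplit torus in Sp₄. -/

namespace Sp4

variable {F : Type*} [Field F] [CharP F 2]

/-- The characters of the unipotent radical. -/
def lam (ψ : AddChar F ℂ) (α β γ : F) : Multiplicative (F × F × F) →* ℂ where
  toFun x := ψ (α * x.toAdd.1 + β * x.toAdd.2.1 + γ * x.toAdd.2.2)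
  map_one' := by simp
  map_mul' x y := by
    rw [← AddChar.map_add_eq_mul]
    simp only [toAdd_mul, Prod.fst_add, Prod.snd_add]
    congr 1; ring

theorem lam_apply (ψ : AddChar F ℂ) (α β γ : F) (x : Multiplicative (F × F × F)) :
    lam ψ α β γ x = ψ (α * x.toAdd.1 + β * x.toAdd.2.1 + γ * x.toAdd.2.2) := rfl

/-- The character (α, β, γ) is the binary form f = αx² + βxy + γy². The Levi subgroup substitutes
its columns and scales by a square; the cross coefficient only gets scaled, because 2 = 0 and the
determinant is 1. -/
theorem lam_actHom (ψ : AddChar F ℂ) (α β γ : F) (l : Fˣ × SL2 F)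
    (x : Multiplicative (F × F × F)) :
    lam ψ α β γ (actHom l x) =
      lam ψ (l.1 ^ 2 * (α * l.2.a ^ 2 + β * (l.2.a * l.2.c) + γ * l.2.c ^ 2)) (l.1 ^ 2 * β)
        (l.1 ^ 2 * (α * l.2.b ^ 2 + β * (l.2.b * l.2.d) + γ * l.2.d ^ 2)) x := by
  have h2 : (2 : F) = 0 := CharTwo.two_eq_zero
  have hd := l.2.det
  rw [lam_apply, lam_apply, actHom_apply]
  simp only [toAdd_ofAdd, actQ]
  congr 1
  linear_combination (l.1 ^ 2 * β * x.toAdd.2.1) * hd +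
    l.1 ^ 2 * β * x.toAdd.2.1 * l.2.b * l.2.c * h2

theorem inv_eq_self' (x : Multiplicative (F × F × F)) : x⁻¹ = x := by
  apply Multiplicative.toAdd.injective
  rw [toAdd_inv]
  ext <;> simp [CharTwo.neg_eq]

theorem xx_inv (b : F) : (xx b)⁻¹ = xx b := by
  rw [xx, ← map_inv]
  congr 1
  exact Multiplicative.toAdd.injective (CharTwo.neg_eq b)

/-- The upper unitriangular subgroup of the Levi subgroup. -/
def mU : Multiplicative F →* Fˣ × SL2 F where
  toFun b := (1, SL2.up b.toAdd)
  map_one' := Prod.ext rfl (by ext <;> simp)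
  map_mul' b b' := by simp [SL2.up_mul_up]

theorem levi_mU (b : F) : levi (mU (Multiplicative.ofAdd b)) = xx b := rfl

/-- The nonsplit torus in the Levi subgroup. -/
def mT (δ : F) : normOneTorus δ →* Fˣ × SL2 F := (MonoidHom.inr _ _).comp (Subgroup.subtype _)

theorem mT_apply (δ : F) (t : normOneTorus δ) : mT δ t = (1, t.1) := rfl

theorem mT_injective (δ : F) : Function.Injective (mT δ) := fun t t' h =>
  Subtype.ext (congrArg Prod.snd h)

section bessel

variable {V : Type*} [AddCommGroup V] [Module ℂ V] (ρ : Representation ℂ (Sp 2 F) V)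

/-- The weight is the norm form x² + xy + δy², which multiplication by an element of norm one
preserves; `lam_torusRefl` is its invariance under conjugation. -/
theorem lam_mT (ψ : AddChar F ℂ) {δ : F} (t : normOneTorus δ) (x : Multiplicative (F × F × F)) :
    lam ψ 1 1 δ (actHom (mT δ t) x) = lam ψ 1 1 δ x := by
  have h2 : (2 : F) = 0 := CharTwo.two_eq_zero
  have h1 := normForm_of_mem t.2
  obtain ⟨hb, hd⟩ := t.2
  rw [lam_actHom, mT_apply]
  simp only [hb, hd, Units.val_one]
  congr 2
  · linear_combination h1
  · ring
  · linear_combination δ * h1 + δ * t.1.a * t.1.c * h2 + δ * t.1.c ^ 2 * h2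

theorem lam_torusRefl (ψ : AddChar F ℂ) {δ : F} (x : Multiplicative (F × F × F)) :
    lam ψ 1 1 δ (actHom (1, torusRefl F) x) = lam ψ 1 1 δ x := by
  have h2 : (2 : F) = 0 := CharTwo.two_eq_zero
  rw [lam_actHom]
  simp only [torusRefl, Units.val_one]
  congr 2
  · ring
  · ring
  · linear_combination h2

/-- Iwasawa decomposition with respect to the nonsplit torus. -/
theorem exists_torus_mul_up [Finite F] {δ : F} (hδ : ∀ x : F, x ^ 2 + x + δ ≠ 0) (h : SL2 F) :
    ∃ t ∈ normOneTorus δ, ∃ b c, h = t * (SL2.diag c * SL2.up b) := by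
  have hdet := h.det
  obtain ⟨n, hn⟩ := exists_sq_eq (h.a ^ 2 + h.a * h.c + δ * h.c ^ 2)
  have hn0 : n ≠ 0 := by
    rintro rfl
    have := normForm_eq_zero hδ (x := h.a) (y := h.c) (by rw [← hn]; ring)
    rw [this.1, this.2] at hdet
    simp at hdet
  have ht : (h.a / n) ^ 2 + (h.a / n) * (h.c / n) + δ * (h.c / n) ^ 2 = 1 := by
    field_simp; linear_combination -hn
  refine ⟨torusMk δ _ _ ht, torusMk_mem δ _ _ ht, ?_⟩
  set t := torusMk δ _ _ ht with hT
  have hta : t.a = h.a / n := rfl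
  have htc : t.c = h.c / n := rfl
  have h1 : (t⁻¹ * h).c = 0 := by
    simp only [SL2.mul_c, SL2.inv_c, SL2.inv_d, hta, htc]; field_simp; ring
  have h2 : (t⁻¹ * h).a * (t⁻¹ * h).d = 1 := by
    have := (t⁻¹ * h).det
    rw [h1] at this; linear_combination this
  have ha : (t⁻¹ * h).a ≠ 0 := left_ne_zero_of_mul_eq_one h2
  refine ⟨(t⁻¹ * h).b / (t⁻¹ * h).a, Units.mk0 _ ha, ?_⟩
  rw [eq_comm, ← eq_inv_mul_iff_mul_eq]
  ext
  · simp
  · rw [SL2.mul_b]; simp only [SL2.diag_a, SL2.diag_b, SL2.up_b, Units.val_mk0]; field_simp; simp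
  · rw [h1]; simp
  · rw [SL2.mul_d]
    simp only [SL2.diag_c, SL2.diag_d, Units.val_inv_eq_inv_val, Units.val_mk0, SL2.up_d, zero_mul,
      zero_add, mul_one]
    field_simp; exact h2.symm

end bessel

theorem exists_diag_eq_dT (c d : Fˣ) : ∃ t, levi (c, SL2.diag d) = dT t := by
  refine ⟨(c * d, c * d⁻¹), Subtype.ext ?_⟩
  rw [dT_coe, levi_coe, fromBlocks_inj]
  refine ⟨?_, rfl, rfl, ?_⟩ <;> ext i j <;> fin_cases i <;> fin_cases j <;>
    simp [SL2.toMat, mul_comm]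

theorem levi_eq_mul (c : Fˣ) (h h' : SL2 F) : levi (c, h * h') = levi (c, h) * levi (1, h') := by
  rw [← map_mul, Prod.mk_mul_mk, mul_one]

theorem levi_eq_mul' (c : Fˣ) (h h' : SL2 F) : levi (c, h * h') = levi (1, h) * levi (c, h') := by
  rw [← map_mul, Prod.mk_mul_mk, one_mul]

theorem rr_mul_xx (b : F) : rr F * xx b = qq 0 b 0 * rr F := by
  calc rr F * xx b = rr F * (xx b * rr F) * rr F := by
        rw [mul_assoc, mul_assoc, rr_sq, mul_one]
    _ = _ := by rw [xx_mul_rr, ← mul_assoc, rr_sq, one_mul]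

theorem uQ_mul_levi (l : Fˣ × SL2 F) (x : Multiplicative (F × F × F)) :
    uQ x * levi l = levi l * uQ (actHom l⁻¹ x) := by
  rw [levi_mul_uQ', ← MulAut.mul_apply, ← map_mul, mul_inv_cancel, map_one, MulAut.one_apply]

/-- The reflection `rr` exchanges two short root subgroups whose commutator carries the coefficient
2 and so is trivial. Unipotent Levi factors next to `rr` can thus be pushed into the radical. -/
theorem xx_mul_rr_mul_xx (b b' : F) : xx b * rr F * xx b' = qq 0 b' 0 * rr F * qq 0 b 0 := by
  have : qq 0 b 0 * xx b' = xx b' * qq 0 b 0 := by rw [qq_mul_xx]; simp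
  rw [xx_mul_rr, mul_assoc, this, ← mul_assoc, rr_mul_xx]

/-- The rank one cell with respect to the nonsplit torus. -/
theorem rr_cell_torus [Finite F] {δ : F} (hδ : ∀ x : F, x ^ 2 + x + δ ≠ 0) (l l' : Fˣ × SL2 F) :
    ∃ x y, ∃ t ∈ normOneTorus δ, ∃ t' ∈ normOneTorus δ, ∃ d,
      levi l * rr F * levi l' = uQ x * (levi (1, t) * (rr F * dT d) * levi (1, t')) * uQ y := by
  obtain ⟨c, h⟩ := l
  obtain ⟨c', h'⟩ := l'
  obtain ⟨t, ht, b, d, rfl⟩ := exists_torus_mul_up hδ h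
  obtain ⟨t', ht', b', d', e'⟩ := exists_torus_mul_up hδ h'⁻¹
  have e'' : h' = SL2.up (-b') * (SL2.diag d'⁻¹ * t'⁻¹) := by
    have h1 : (SL2.up b' : SL2 F)⁻¹ = SL2.up (-b') := by ext <;> simp
    have h2 : (SL2.diag d' : SL2 F)⁻¹ = SL2.diag d'⁻¹ := by ext <;> simp
    rw [← inv_inv h', e', _root_.mul_inv_rev, _root_.mul_inv_rev, h1, h2, mul_assoc]
  subst e''
  have e1 : levi (c, t * (SL2.diag d * SL2.up b)) * rr F *
      levi (c', SL2.up (-b') * (SL2.diag d'⁻¹ * t'⁻¹)) = levi (c, t * SL2.diag d) *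
        (xx b * rr F * xx (-b')) * levi (c', SL2.diag d'⁻¹ * t'⁻¹) := by
    rw [← mul_assoc t, levi_eq_mul c _ (SL2.up b), levi_eq_mul' c' (SL2.up (-b')), ← xx_eq, ← xx_eq]
    simp only [mul_assoc]
  obtain ⟨⟨d1, d2⟩, hd⟩ := exists_diag_eq_dT c d
  obtain ⟨⟨d1', d2'⟩, hd'⟩ := exists_diag_eq_dT c' d'⁻¹
  rw [e1, xx_mul_rr_mul_xx]
  refine ⟨actHom (c, t * SL2.diag d) (Multiplicative.ofAdd (0, -b', 0)),
    actHom (c', SL2.diag d'⁻¹ * t'⁻¹)⁻¹ (Multiplicative.ofAdd (0, b, 0)), t, ht, t'⁻¹, inv_mem ht', (d1, d2⁻¹) * (d1', d2'), ?_⟩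
  have e2 : levi (c, t * SL2.diag d) * (qq 0 (-b') 0 * rr F * qq 0 b 0) *
      levi (c', SL2.diag d'⁻¹ * t'⁻¹) = (levi (c, t * SL2.diag d) * qq 0 (-b') 0) * rr F *
      (qq 0 b 0 * levi (c', SL2.diag d'⁻¹ * t'⁻¹)) := by simp only [mul_assoc]
  rw [e2, levi_mul_uQ', uQ_mul_levi (c', SL2.diag d'⁻¹ * t'⁻¹), levi_eq_mul' c t, levi_eq_mul c' _ t'⁻¹, hd, hd', map_mul,
    ← mul_assoc (rr F), ← dT_mul_rr]
  simp only [mul_assoc]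

end Sp4

/-! ### Uniqueness of Bessel models. -/

namespace Sp4

variable {F : Type*} [Field F] [CharP F 2] [Finite F]
variable {V : Type*} [AddCommGroup V] [Module ℂ V] [FiniteDimensional ℂ V]
  {ρ : Representation ℂ (Sp 2 F) V}

omit [Finite F] in
theorem mul_self_eq_one' (x : Multiplicative (F × F × F)) : x * x = 1 := by
  nth_rw 2 [← inv_eq_self' x]
  exact mul_inv_cancel x

/-- The anti-automorphism used for the nonsplit torus. -/
def refl (g : Sp 2 F) : Sp 2 F := levi (1, torusRefl F) * g⁻¹ * (levi (1, torusRefl F))⁻¹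

omit [Finite F] in
theorem refl_mul (g h : Sp 2 F) : refl (g * h) = refl h * refl g := by
  simp only [refl, _root_.mul_inv_rev]; group

omit [Finite F] in
theorem refl_iSD {δ : F} (s : SD (mT δ)) : refl (iSD (mT δ) s) =
    iSD (mT δ) (SemidirectProduct.inr s.right * SemidirectProduct.inl
      (actHom (1, torusRefl F) s.left)) := by
  have h1 : levi (1, torusRefl F) * (levi (mT δ s.right))⁻¹ * (levi (1, torusRefl F))⁻¹ =
      levi (mT δ s.right) := by
    rw [mT_apply, ← map_inv, ← map_inv, ← map_mul, ← map_mul]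
    congr 1
    refine Prod.ext (by simp) ?_
    exact torusRefl_conj s.right.2
  have h2 : levi (1, torusRefl F) * uQ s.left * (levi (1, torusRefl F))⁻¹ =
      uQ (actHom (1, torusRefl F) s.left) := by
    rw [levi_mul_uQ', mul_inv_cancel_right]
  rw [map_mul, iSD_inr, iSD_inl, refl, iSD_apply, ← h2]
  nth_rw 2 [← inv_eq_self' s.left]
  nth_rw 2 [← h1]
  rw [map_inv]
  group

omit [Finite F] in
theorem levi_mul_jj (c : Fˣ) (h : SL2 F) : levi (c, h) * jj F = jj F * levi (c⁻¹, h⁻¹.tr) := by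
  rw [jj_mul_levi, inv_inv, show h⁻¹.tr.tr⁻¹ = h from inv_inv h]

omit [Finite F] in
theorem jj_inv : (jj F)⁻¹ = jj F := inv_eq_of_mul_eq_one_left jj_sq

omit [Finite F] in
theorem rr_inv : (rr F)⁻¹ = rr F := inv_eq_of_mul_eq_one_left rr_sq

-- On the open cell the anti-automorphism replaces h by its reflected transpose, which
-- `exists_torus_tr` realises inside the nonsplit torus; hence it acts there as conjugation by a
-- torus element.
omit [Finite F] in
theorem refl_jj {c : Fˣ} {h t : SL2 F}
    (he : (torusRefl F).tr * h.tr * torusRefl F = t.tr * h * t) :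
    refl (jj F * levi (c, h)) = levi (1, t⁻¹) * (jj F * levi (c, h)) * levi (1, t) := by
  have e1 : (levi (1, torusRefl F))⁻¹ = levi (1, torusRefl F) := by
    rw [← map_inv]; congr 1; exact Prod.ext (by simp) torusRefl_inv
  rw [refl, _root_.mul_inv_rev, jj_inv, ← map_inv, Prod.inv_mk, levi_mul_jj, ← mul_assoc, levi_mul_jj,
    e1, ← mul_assoc (levi _) (jj F), levi_mul_jj, mul_assoc, mul_assoc, ← map_mul, ← map_mul,
    mul_assoc, mul_assoc, ← map_mul, ← map_mul]
  congr 2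
  refine Prod.ext (by simp) ?_
  simp only [Prod.mk_mul_mk, torusRefl_inv, inv_inv]
  rw [← mul_assoc, he, mul_assoc]

omit [Finite F] in
theorem refl_rr (c : Fˣ) : refl (rr F * dT (1, c)) =
    qq 0 (1 / (c : F)) 0 * (rr F * dT (1, c)) * qq 0 (1 / (c : F)) 0 := by
  have e0 : levi (1, torusRefl F) = xx 1 := rfl
  have e1 : (dT (1, c))⁻¹ * rr F = rr F * dT (1, c) := by
    rw [← map_inv, Prod.inv_mk, inv_one, dT_mul_rr, inv_inv]
  have e2 : dT (1, c) * xx 1 = xx (1 / (c : F)) * dT (1, c) := by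
    rw [xx_mul_dT]; congr 2; field_simp; simp
  have e3 : dT (1, c) * qq 0 (1 / (c : F)) 0 = qq 0 1 0 * dT (1, c) := by
    rw [qq_mul_dT]; congr 2 <;> simp
  rw [refl, _root_.mul_inv_rev, rr_inv, e1, e0, xx_inv, mul_assoc, mul_assoc, e2, ← mul_assoc, ← mul_assoc,
    xx_mul_rr_mul_xx, mul_assoc, mul_assoc, ← e3]
  simp only [mul_assoc]

/-- Gelfand's trick for the radical extended by the nonsplit torus, with anti-automorphism `refl`.
On the closed cell the weight forces the scalar c to be 1, and `refl` is then a torus conjugation;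
on the open cell it always is. On the middle cell the torus reduces to `rr` times a diagonal
element; a long root element forces its first entry to be 1, and `refl` then multiplies both sides
by the same radical element, on which the two character values cancel. -/
theorem finrank_bessel {δ : F} (hδ : ∀ x : F, x ^ 2 + x + δ ≠ 0) {ψ : AddChar F ℂ}
    (hψ : ∃ z, ψ z ≠ 1) (hρ : ρ.IsIrreducible) (ν : normOneTorus δ →* ℂ) :
    Module.finrank ℂ
      (ρ.wtSpace uQ (lam ψ 1 1 δ) ⊓ ρ.wtSpace (levi.comp (mT δ)) ν : Submodule ℂ V) ≤ 1 := by
  classical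
  have := Fintype.ofFinite (SD (mT δ))
  rw [← wtSpace_iSD (mT δ) (lam_mT ψ)]
  set ι := iSD (mT δ)
  set χ := cSD (mT δ) (lam ψ 1 1 δ) ν (lam_mT ψ)
  set τ' : SD (mT δ) → SD (mT δ) := fun s => SemidirectProduct.inr s.right * SemidirectProduct.inl
      (actHom (1, torusRefl F) s.left)
  have hinj : Function.Injective τ' := by
    intro s s' h
    have h1 := congrArg (iSD (mT δ)) h
    simp only [τ', ← refl_iSD, refl] at h1
    exact iSD_injective _ (mT_injective δ) (by simpa using h1)
  have hτ : ∀ g h : Sp 2 F, refl (g * h) = refl h * refl g := refl_mul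
  have hS : ∀ s, refl (ι s) = ι (τ' s) := refl_iSD
  have hχ : ∀ s, χ (τ' s) = χ s := fun s => by
    simp only [χ, τ', map_mul, cSD_inr, cSD_inl, lam_torusRefl]
    rw [mul_comm]; rfl
  refine hρ.finrank_wtSpace_le_one (τ := refl)
    (τS := Equiv.ofBijective τ' (Finite.injective_iff_bijective.1 hinj)) hτ hS hχ ?_
  have hmul : ∀ (s t : SD (mT δ)) (g : Sp 2 F), ρ.sandwich ι χ g = ρ.sandwich ι χ (refl g) →
      ρ.sandwich ι χ (ι s * g * ι t) = ρ.sandwich ι χ (refl (ι s * g * ι t)) := fun s t g h =>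
    ρ.sandwich_anti_of_mul ι χ hτ hS hχ h
  have hmulQ : ∀ x y (g : Sp 2 F), ρ.sandwich ι χ g = ρ.sandwich ι χ (refl g) →
      ρ.sandwich ι χ (uQ x * g * uQ y) = ρ.sandwich ι χ (refl (uQ x * g * uQ y)) := fun x y g h => by
    have := hmul (SemidirectProduct.inl x) (SemidirectProduct.inl y) g h
    rwa [iSD_inl, iSD_inl] at this
  have hmulT : ∀ t ∈ normOneTorus δ, ∀ t' ∈ normOneTorus δ, ∀ (g : Sp 2 F),
      ρ.sandwich ι χ g = ρ.sandwich ι χ (refl g) →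
      ρ.sandwich ι χ (levi (1, t) * g * levi (1, t')) =
        ρ.sandwich ι χ (refl (levi (1, t) * g * levi (1, t'))) := fun t ht t' ht' g h => by
    have := hmul (SemidirectProduct.inr ⟨t, ht⟩) (SemidirectProduct.inr ⟨t', ht'⟩) g h
    rwa [iSD_inr, iSD_inr] at this
  have hkill : ∀ x y (g : Sp 2 F), uQ x * g = g * uQ y → lam ψ 1 1 δ x ≠ lam ψ 1 1 δ y →
      ρ.sandwich ι χ g = ρ.sandwich ι χ (refl g) := fun x y g h hne => by
    refine ρ.sandwich_anti_of_ne hτ hS hχ (s := SemidirectProduct.inl x)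
      (t := SemidirectProduct.inl y) ?_ ?_
    · rw [iSD_inl, iSD_inl, h]
    · rwa [cSD_inl, cSD_inl]
  have hconj : ∀ t ∈ normOneTorus δ, ∀ g : Sp 2 F,
      refl g = levi (1, t⁻¹) * g * levi (1, t) → ρ.sandwich ι χ g = ρ.sandwich ι χ (refl g) := by
    intro t ht g h
    have h1 := ρ.sandwich_mul ι χ (SemidirectProduct.inr (⟨t, ht⟩ : normOneTorus δ)⁻¹)
      (SemidirectProduct.inr ⟨t, ht⟩) g
    rw [iSD_inr, iSD_inr, ← map_mul, ← map_mul] at h1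
    rw [h]
    simp only [inv_mul_cancel, map_one, one_smul] at h1
    exact h1.symm
  have hC0 : ∀ l, ρ.sandwich ι χ (levi l) = ρ.sandwich ι χ (refl (levi l)) := by
    rintro ⟨c, h⟩
    by_cases hc : (1 : F) = c ^ 2
    · have hc1 : c = 1 := units_sq_injective (by rw [← hc]; simp)
      subst hc1
      obtain ⟨t, ht, he⟩ := exists_torus_inv hδ h
      refine hconj t ht _ ?_
      rw [refl, ← map_inv, ← map_inv, ← map_mul, ← map_mul, ← map_mul, ← map_mul]
      congr 1
      exact Prod.ext (by simp) he
    · obtain ⟨z, hz⟩ := AddChar.exists_apply_mul_ne hψ hc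
      refine hkill (actHom (c, h) (Multiplicative.ofAdd (0, z, 0))) (Multiplicative.ofAdd (0, z, 0)) _
        (levi_mul_uQ' _ _).symm ?_
      rw [lam_actHom, lam_apply, lam_apply]
      simpa using hz.symm
  have hjj : ∀ l, ρ.sandwich ι χ (jj F * levi l) = ρ.sandwich ι χ (refl (jj F * levi l)) := by
    rintro ⟨c, h⟩
    obtain ⟨t, ht, he⟩ := exists_torus_tr hδ h
    refine hconj t ht _ ?_
    exact refl_jj he
  have hrr : ∀ d, ρ.sandwich ι χ (rr F * dT d) = ρ.sandwich ι χ (refl (rr F * dT d)) := by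
    rintro ⟨a, c⟩
    by_cases ha : (1 : F) = 1 / a ^ 2
    · have hc1 : a = 1 := units_sq_injective (by field_simp at ha; simpa using ha)
      subst hc1
      rw [refl_rr]
      have h1 := ρ.sandwich_mul ι χ (SemidirectProduct.inl (Multiplicative.ofAdd (0, 1 / (c : F), 0)))
        (SemidirectProduct.inl (Multiplicative.ofAdd (0, 1 / (c : F), 0))) (rr F * dT (1, c))
      rw [iSD_inl] at h1
      rw [h1, ← map_mul, ← map_mul, mul_self_eq_one', map_one, map_one, one_smul]
    · obtain ⟨z, hz⟩ := AddChar.exists_apply_mul_ne hψ ha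
      refine hkill (Multiplicative.ofAdd (z, 0, 0)) (Multiplicative.ofAdd (z / a ^ 2, 0, 0)) _ ?_ ?_
      · rw [← mul_assoc, qq_mul_rr, mul_assoc, qq_mul_dT]
        simp [mul_assoc]
      · rw [lam_apply, lam_apply]
        convert hz using 2 <;> simp
        ring
  intro g
  by_cases h0 : g.1.toBlocks₂₁ = 0
  · obtain ⟨x, l, rfl⟩ := eq_uQ_mul_levi g h0
    have := hmulQ x 1 _ (hC0 l)
    rwa [map_one, mul_one] at this
  by_cases h1 : g.1.toBlocks₂₁.det = 0
  · obtain ⟨x, l, l', y, rfl⟩ := eq_uQ_mul_rr g h1 h0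
    obtain ⟨x', y', t, ht, t', ht', d, he⟩ := rr_cell_torus hδ l l'
    rw [he]
    exact hmulQ _ _ _ (hmulQ _ _ _ (hmulT t ht t' ht' _ (hrr d)))
  · obtain ⟨x, l, y, rfl⟩ := eq_uQ_mul_jj g h1
    exact hmulQ _ _ _ (hjj l)

end Sp4

/-! ### Uniqueness of Whittaker models. -/

namespace Sp4

variable {F : Type*} [Field F] [CharP F 2]

@[simp] theorem qq_zero : qq (0 : F) 0 0 = 1 := map_one uQ

@[simp] theorem xx_zero : xx (0 : F) = 1 := map_one xa

@[simp] theorem dT_one : dT ((1, 1) : Fˣ × Fˣ) = 1 := map_one dT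

/-- The characters of the root subgroup `xa`. -/
def lamU (ψ : AddChar F ℂ) (κ : F) : Multiplicative F →* ℂ where
  toFun b := ψ (κ * b.toAdd)
  map_one' := by simp
  map_mul' x y := by rw [← AddChar.map_add_eq_mul, toAdd_mul, mul_add]

theorem lamU_apply (ψ : AddChar F ℂ) (κ b : F) : lamU ψ κ (Multiplicative.ofAdd b) = ψ (κ * b) := rfl

theorem lam_mU (ψ : AddChar F ℂ) (γ : F) (b : Multiplicative F) (x : Multiplicative (F × F × F)) :
    lam ψ 0 0 γ (actHom (mU b) x) = lam ψ 0 0 γ x := by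
  rw [lam_actHom]
  simp [mU]

theorem levi_bruhat (l : Fˣ × SL2 F) : ∃ b d b', levi l = xx b * dT d * xx b' ∨
    levi l = xx b * (sw * dT d) * xx b' := by
  obtain ⟨c, h⟩ := l
  obtain ⟨b, t, rfl⟩ | ⟨b, t, b', rfl⟩ := SL2.bruhat h
  · obtain ⟨d, hd⟩ := exists_diag_eq_dT c t
    refine ⟨b, d, 0, Or.inl ?_⟩
    rw [levi_eq_mul', hd, ← xx_eq, xx, xx, ofAdd_zero, map_one, mul_one]
  · obtain ⟨d, hd⟩ := exists_diag_eq_dT c t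
    refine ⟨b, d, b', Or.inr ?_⟩
    rw [levi_eq_mul, levi_eq_mul', levi_eq_mul', hd]; rfl

theorem jj_levi_bruhat (l : Fˣ × SL2 F) : ∃ b d b', jj F * levi l = xx b * (jj F * dT d) * xx b' ∨
    jj F * levi l = xx b * (jj F * (sw * dT d)) * xx b' := by
  obtain ⟨c, h⟩ := l
  have key : ∀ b, jj F * levi (1, (SL2.up b).tr) = xx (-b) * jj F := fun b => by
    rw [jj_mul_levi, xx_eq, show (SL2.up b).tr.tr = SL2.up b from rfl, inv_one]
    congr 3
    ext <;> simp
  obtain ⟨b, t, b', rfl⟩ | ⟨b, t, b', rfl⟩ := SL2.bruhat_lower h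
  · obtain ⟨d, hd⟩ := exists_diag_eq_dT c t
    refine ⟨-b, d, b', Or.inl ?_⟩
    rw [levi_eq_mul, levi_eq_mul', hd, ← mul_assoc, ← mul_assoc, key, ← xx_eq, mul_assoc (xx _)]
  · obtain ⟨d, hd⟩ := exists_diag_eq_dT c t
    refine ⟨-b, d, b', Or.inr ?_⟩
    rw [levi_eq_mul, levi_eq_mul', levi_eq_mul', hd, ← mul_assoc, ← mul_assoc, key, ← xx_eq,
      mul_assoc (xx _)]
    rfl

/-- The rank one cells of the Bruhat decomposition. -/
theorem rr_cell [Finite F] (l l' : Fˣ × SL2 F) : ∃ x y b b' d w w', (w = 1 ∨ w = sw) ∧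
    (w' = 1 ∨ w' = sw) ∧
    levi l * rr F * levi l' = uQ x * (xx b * (w * rr F * w' * dT d) * xx b') * uQ y := by
  have h1 : ∀ l : Fˣ × SL2 F, ∃ b d b' w, (w = 1 ∨ w = sw) ∧ levi l = xx b * (w * dT d) * xx b' := by
    intro l
    obtain ⟨b, d, b', h | h⟩ := levi_bruhat l
    · exact ⟨b, d, b', 1, Or.inl rfl, by rw [h, one_mul]⟩
    · exact ⟨b, d, b', sw, Or.inr rfl, h⟩
  have h2 : ∀ l : Fˣ × SL2 F, ∃ b d b' w, (w = 1 ∨ w = sw) ∧ levi l = xx b * (w * dT d) * xx b' := h1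
  obtain ⟨b, d, b1, w, hw, e⟩ := h1 l
  obtain ⟨b2, d', b', w', hw', e'⟩ := h2 l'
  obtain ⟨L, hL⟩ : ∃ L, levi L = xx b * (w * dT d) := by
    refine ⟨l * (1, SL2.up b1)⁻¹, ?_⟩
    rw [map_mul, map_inv, ← xx_eq, e, mul_inv_cancel_right]
  obtain ⟨R, hR⟩ : ∃ R, levi R = w' * dT d' * xx b' := by
    refine ⟨(1, SL2.up b2)⁻¹ * l', ?_⟩
    rw [map_mul, map_inv, ← xx_eq, e']
    simp only [mul_assoc, inv_mul_cancel_left]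
  obtain ⟨d'', hd''⟩ : ∃ d'', dT d * rr F * w' = rr F * w' * dT d'' := by
    obtain ⟨d1, d2⟩ := d
    rcases hw' with rfl | rfl
    · exact ⟨(d1, d2⁻¹), by rw [mul_one, mul_one, dT_mul_rr]⟩
    · exact ⟨(d2⁻¹, d1), by rw [dT_mul_rr, mul_assoc, dT_mul_sw, mul_assoc]⟩
  refine ⟨actHom L (Multiplicative.ofAdd (0, b2, 0)), actHom R⁻¹ (Multiplicative.ofAdd (0, b1, 0)),
    b, b', d'' * d', w, w', hw, hw', ?_⟩
  calc levi l * rr F * levi l' = (levi L * xx b1) * rr F * (xx b2 * levi R) := by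
        rw [e, e', hL, hR]; simp only [mul_assoc]
    _ = levi L * (xx b1 * rr F * xx b2) * levi R := by simp only [mul_assoc]
    _ = (levi L * qq 0 b2 0) * rr F * (qq 0 b1 0 * levi R) := by
        rw [xx_mul_rr_mul_xx]; simp only [mul_assoc]
    _ = uQ (actHom L (Multiplicative.ofAdd (0, b2, 0))) * (xx b * w * (dT d * rr F * w') * dT d' * xx b') *
          uQ (actHom R⁻¹ (Multiplicative.ofAdd (0, b1, 0))) := by
        rw [levi_mul_uQ', uQ_mul_levi R, hL, hR]; simp only [mul_assoc]
    _ = _ := by rw [hd'', map_mul]; simp only [mul_assoc]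

variable [Finite F]
variable {V : Type*} [AddCommGroup V] [Module ℂ V] [FiniteDimensional ℂ V]
  {ρ : Representation ℂ (Sp 2 F) V}

/-- Gelfand's trick for the full unipotent group with inversion, which preserves the weight because
in characteristic two root elements are involutions and the values are signs. A representative of a
Bruhat cell is either an involution or carries a root element to one on which the nondegenerate
character differs, so that its sandwich vanishes. -/
theorem finrank_gelfandGraev {γ κ : F} (hγ : γ ≠ 0) (hκ : κ ≠ 0) {ψ : AddChar F ℂ}
    (hψ : ∃ z, ψ z ≠ 1) (hρ : ρ.IsIrreducible) :
    Module.finrank ℂ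
      (ρ.wtSpace uQ (lam ψ 0 0 γ) ⊓ ρ.wtSpace xa (lamU ψ κ) : Submodule ℂ V) ≤ 1 := by
  classical
  have := Fintype.ofFinite (SD (mU (F := F)))
  suffices h : Module.finrank ℂ (ρ.wtSpace (iSD (F := F) mU)
      (cSD (F := F) mU (lam ψ 0 0 γ) (lamU ψ κ) (lam_mU ψ γ))) ≤ 1 by
    rw [wtSpace_iSD] at h; exact h
  set ι := iSD (F := F) mU
  set χ := cSD (F := F) mU (lam ψ 0 0 γ) (lamU ψ κ) (lam_mU ψ γ)
  have hτ : ∀ g h : Sp 2 F, (g * h)⁻¹ = h⁻¹ * g⁻¹ := _root_.mul_inv_rev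
  have hS : ∀ s, (ι s)⁻¹ = ι s⁻¹ := fun s => (map_inv ι s).symm
  have hχ : ∀ s, χ s⁻¹ = χ s := fun s => by
    have h1 : s⁻¹ = SemidirectProduct.inr s.right⁻¹ * SemidirectProduct.inl s.left⁻¹ := by
      conv_lhs => rw [← SemidirectProduct.inl_left_mul_inr_right s]
      rw [_root_.mul_inv_rev, map_inv, map_inv]
    have h2 : s.right⁻¹ = s.right := Multiplicative.toAdd.injective (CharTwo.neg_eq _)
    simp only [χ, h1, map_mul, cSD_inr, cSD_inl, inv_eq_self', h2]
    rw [mul_comm]; rfl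
  refine hρ.finrank_wtSpace_le_one (τ := fun g => g⁻¹) (τS := Equiv.inv _) hτ hS hχ ?_
  have hmulQ : ∀ x y (g : Sp 2 F), ρ.sandwich ι χ g = ρ.sandwich ι χ g⁻¹ →
      ρ.sandwich ι χ (uQ x * g * uQ y) = ρ.sandwich ι χ (uQ x * g * uQ y)⁻¹ := fun x y g h => by
    have := ρ.sandwich_anti_of_mul ι χ hτ hS hχ (s := SemidirectProduct.inl x)
      (t := SemidirectProduct.inl y) h
    rwa [iSD_inl, iSD_inl] at this
  have hmulU : ∀ b b' (g : Sp 2 F), ρ.sandwich ι χ g = ρ.sandwich ι χ g⁻¹ →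
      ρ.sandwich ι χ (xx b * g * xx b') = ρ.sandwich ι χ (xx b * g * xx b')⁻¹ := fun b b' g h => by
    have := ρ.sandwich_anti_of_mul ι χ hτ hS hχ
      (s := SemidirectProduct.inr (Multiplicative.ofAdd b))
      (t := SemidirectProduct.inr (Multiplicative.ofAdd b')) h
    rwa [iSD_inr, iSD_inr] at this
  have hinv : ∀ g : Sp 2 F, g * g = 1 → ρ.sandwich ι χ g = ρ.sandwich ι χ g⁻¹ := fun g h => by
    rw [inv_eq_of_mul_eq_one_left h]
  have hkill : ∀ s t s' t' (g : Sp 2 F), qq s 0 t * g = g * qq s' 0 t' → ψ (γ * t) ≠ ψ (γ * t') →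
      ρ.sandwich ι χ g = ρ.sandwich ι χ g⁻¹ := fun s t s' t' g h hne => by
    refine ρ.sandwich_anti_of_ne hτ hS hχ (s := SemidirectProduct.inl (Multiplicative.ofAdd (s, 0, t)))
      (t := SemidirectProduct.inl (Multiplicative.ofAdd (s', 0, t'))) ?_ ?_
    · rw [iSD_inl, iSD_inl, h]
    · rw [cSD_inl, cSD_inl, lam_apply, lam_apply]; simpa using hne
  have hkillU : ∀ b t b' (g : Sp 2 F), xx b * g = g * (qq 0 t 0 * xx b') → ψ (κ * b) ≠ ψ (κ * b') →
      ρ.sandwich ι χ g = ρ.sandwich ι χ g⁻¹ := fun b t b' g h hne => by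
    refine ρ.sandwich_anti_of_ne hτ hS hχ (s := SemidirectProduct.inr (Multiplicative.ofAdd b))
      (t := SemidirectProduct.inl (Multiplicative.ofAdd (0, t, 0)) *
        SemidirectProduct.inr (Multiplicative.ofAdd b')) ?_ ?_
    · rw [map_mul, iSD_inr, iSD_inr, iSD_inl, levi_mU, levi_mU, h]
    · rw [map_mul, cSD_inl, cSD_inr, cSD_inr, lam_apply, lamU_apply, lamU_apply]; simpa using hne
  have hex : ∀ {c : F} (a b : F), c ≠ 0 → a ≠ b → ∃ z, ψ (c * (a * z)) ≠ ψ (c * (b * z)) := by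
    intro c a b hc hab
    obtain ⟨z, hz⟩ := AddChar.exists_apply_mul_ne hψ hab
    refine ⟨z / c, ?_⟩
    convert hz using 2 <;> · field_simp
  have hex1 : ∀ (a : Fˣ), a ≠ 1 → ∃ z, ψ (γ * z) ≠ ψ (γ * (z / a ^ 2)) := by
    intro a ha
    obtain ⟨z, hz⟩ := hex (c := γ) 1 (1 / a ^ 2 : F) hγ (fun h => ha (units_sq_injective (by
      field_simp at h; simpa using h)))
    exact ⟨z, by convert hz using 2 <;> ring⟩
  obtain ⟨zγ, hzγ⟩ := hex (c := γ) 1 0 hγ one_ne_zero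
  obtain ⟨zκ, hzκ⟩ := hex (c := κ) 1 0 hκ one_ne_zero
  simp only [one_mul, zero_mul] at hzγ hzκ
  have hd : ∀ d, ρ.sandwich ι χ (dT d) = ρ.sandwich ι χ (dT d)⁻¹ := by
    rintro ⟨t0, t1⟩
    by_cases h1 : t1 = 1
    · subst h1
      by_cases h0 : t0 = 1
      · subst h0; exact hinv _ (by rw [← map_mul]; simp)
      · obtain ⟨z, hz⟩ := hex (c := κ) 1 (1 / t0 : F) hκ (fun h => h0 (Units.ext (by
          field_simp at h; simpa using h)))
        refine hkillU z 0 (z / t0) _ ?_ (by convert hz using 2 <;> ring)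
        rw [xx_mul_dT]; simp
    · obtain ⟨z, hz⟩ := hex1 t1 h1
      refine hkill 0 z 0 (z / t1 ^ 2) _ ?_ hz
      rw [qq_mul_dT]; simp
  have hsd : ∀ d, ρ.sandwich ι χ (sw * dT d) = ρ.sandwich ι χ (sw * dT d)⁻¹ := by
    rintro ⟨t0, t1⟩
    refine hkill 0 zγ (zγ / t0 ^ 2) 0 _ ?_ hzγ
    rw [← mul_assoc, qq_mul_sw, mul_assoc, qq_mul_dT]; simp [mul_assoc]
  have hjd : ∀ d, ρ.sandwich ι χ (jj F * dT d) = ρ.sandwich ι χ (jj F * dT d)⁻¹ := by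
    intro d
    refine hinv _ ?_
    rw [mul_assoc, ← mul_assoc (dT d), dT_mul_jj, mul_assoc, ← map_mul, inv_mul_cancel, map_one,
      mul_one, jj_sq]
  have hjsd : ∀ d, ρ.sandwich ι χ (jj F * (sw * dT d)) = ρ.sandwich ι χ (jj F * (sw * dT d))⁻¹ := by
    rintro ⟨t0, t1⟩
    by_cases h0 : t0 = t1
    · subst h0
      refine hinv _ ?_
      have e1 : sw * dT (t0, t0) * jj F = jj F * (sw * dT (t0⁻¹, t0⁻¹)) := by
        rw [mul_assoc, dT_mul_jj, ← mul_assoc, ← jj_mul_sw, mul_assoc]; rfl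
      rw [mul_assoc, ← mul_assoc (sw * _), e1, mul_assoc, ← mul_assoc (jj F), jj_sq, one_mul, mul_assoc,
        ← mul_assoc (dT _), dT_mul_sw, mul_assoc, ← map_mul, ← mul_assoc, sw_sq]
      simp
    · obtain ⟨z, hz⟩ := hex (c := κ) 1 (t1 / t0 : F) hκ (fun h => h0 (Units.ext (by
        field_simp at h; simpa using h)))
      refine hkillU z 0 (z * t1 / t0) _ ?_ (by convert hz using 2 <;> ring)
      have e1 : xx z * (jj F * sw) = jj F * sw * xx z := by
        rw [sw, xx_eq, ← mul_assoc, levi_mul_jj, mul_assoc, mul_assoc, ← map_mul, ← map_mul]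
        congr 2
        refine Prod.ext (by simp) ?_
        ext <;> simp [CharTwo.neg_eq]
      rw [← mul_assoc (jj F), ← mul_assoc, e1, mul_assoc, xx_mul_dT]; simp [mul_assoc]
  have hrd : ∀ w w' d, (w = 1 ∨ w = sw) → (w' = 1 ∨ w' = sw) →
      ρ.sandwich ι χ (w * rr F * w' * dT d) = ρ.sandwich ι χ (w * rr F * w' * dT d)⁻¹ := by
    rintro w w' ⟨t0, t1⟩ (rfl | rfl) (rfl | rfl)
    · simp only [one_mul, mul_one]
      refine hkillU zκ (zκ / (t0 * t1)) 0 _ ?_ (by simpa using hzκ)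
      rw [← mul_assoc, xx_mul_rr, mul_assoc, qq_mul_dT]; simp [mul_assoc]
    · simp only [one_mul]
      obtain ⟨z, hz⟩ := hex (c := γ) 0 (1 / t1 ^ 2 : F) hγ (one_div_ne_zero (pow_ne_zero 2 t1.ne_zero)).symm
      refine hkill z 0 0 (z / t1 ^ 2) _ ?_ (by convert hz using 2 <;> ring)
      rw [← mul_assoc, ← mul_assoc, qq_mul_rr, mul_assoc (rr F), qq_mul_sw, mul_assoc (rr F),
        mul_assoc sw, qq_mul_dT]; simp [mul_assoc]
    · simp only [mul_one]
      refine hkill 0 zγ (zγ / t0 ^ 2) 0 _ ?_ hzγ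
      rw [← mul_assoc, ← mul_assoc, qq_mul_sw, mul_assoc sw, qq_mul_rr, mul_assoc sw,
        mul_assoc (rr F), qq_mul_dT]; simp [mul_assoc]
    · have e2 : ∀ a b, dT (a, b) * (sw * rr F * sw) = sw * rr F * sw * dT (a⁻¹, b) := fun a b => by
        rw [mul_assoc, ← mul_assoc, dT_mul_sw, mul_assoc, ← mul_assoc (dT _), dT_mul_rr, mul_assoc,
          dT_mul_sw]; simp only [mul_assoc]
      by_cases h1 : t1 = 1
      · subst h1
        refine hinv _ ?_
        rw [mul_assoc, ← mul_assoc (dT _), e2, mul_assoc (sw * rr F * sw), ← map_mul]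
        have e3 : sw * rr F * sw * (sw * rr F * sw) = 1 := by
          calc sw * rr F * sw * (sw * rr F * sw) = sw * (rr F * (sw * sw) * rr F) * sw := by
                simp only [mul_assoc]
            _ = 1 := by rw [sw_sq, mul_one, rr_sq, mul_one, sw_sq]
        rw [← mul_assoc, e3]; simp
      · obtain ⟨z, hz⟩ := hex1 t1 h1
        refine hkill 0 z 0 (z / t1 ^ 2) _ ?_ hz
        have e4 : qq 0 0 z * (sw * rr F * sw) = sw * rr F * sw * qq 0 0 z := by
          rw [mul_assoc, ← mul_assoc, qq_mul_sw, mul_assoc, ← mul_assoc (qq _ _ _), qq_mul_rr, mul_assoc,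
            qq_mul_sw]; simp only [mul_assoc]
        rw [← mul_assoc, e4, mul_assoc, qq_mul_dT]; simp [mul_assoc]
  intro g
  by_cases h0 : g.1.toBlocks₂₁ = 0
  · obtain ⟨x, l, rfl⟩ := eq_uQ_mul_levi g h0
    suffices h : ρ.sandwich ι χ (levi l) = ρ.sandwich ι χ (levi l)⁻¹ by
      have := hmulQ x 1 _ h
      rwa [map_one, mul_one] at this
    obtain ⟨b, d, b', h | h⟩ := levi_bruhat l <;> rw [h]
    · exact hmulU _ _ _ (hd d)
    · exact hmulU _ _ _ (hsd d)
  by_cases h1 : g.1.toBlocks₂₁.det = 0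
  · obtain ⟨x, l, l', y, rfl⟩ := eq_uQ_mul_rr g h1 h0
    obtain ⟨x', y', b, b', d, w, w', hw, hw', he⟩ := rr_cell l l'
    rw [he]
    exact hmulQ _ _ _ (hmulQ _ _ _ (hmulU _ _ _ (hrd _ _ _ hw hw')))
  · obtain ⟨x, l, y, rfl⟩ := eq_uQ_mul_jj g h1
    refine hmulQ _ _ _ ?_
    obtain ⟨b, d, b', h | h⟩ := jj_levi_bruhat l <;> rw [h]
    · exact hmulU _ _ _ (hjd d)
    · exact hmulU _ _ _ (hjsd d)

end Sp4

/-- The first column is any nonzero vector; it leaves one free entry, d when a = 0 and b otherwise.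
-/
theorem SL2.natCard {F : Type*} [Field F] [Finite F] :
    Nat.card (SL2 F) = Nat.card F * (Nat.card F ^ 2 - 1) := by
  classical
  have := Fintype.ofFinite F
  have e : SL2 F ≃ {x : F × F // x ≠ 0} × F :=
    { toFun := fun g => (⟨(g.a, g.c), fun h => by
          have := g.det
          rw [Prod.mk_eq_zero] at h
          rw [h.1, h.2] at this; simp at this⟩, if g.a = 0 then g.d else g.b)
      invFun := fun p => if h : p.1.1.1 = 0 then
          ⟨0, -p.1.1.2⁻¹, p.1.1.2, p.2, by
            have : p.1.1.2 ≠ 0 := fun h' => p.1.2 (Prod.ext h h')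
            field_simp; ring⟩ else
          ⟨p.1.1.1, p.2, p.1.1.2, (1 + p.2 * p.1.1.2) / p.1.1.1, by field_simp; ring⟩
      left_inv := fun g => by
        have hd := g.det
        by_cases h : g.a = 0
        · simp only [h]
          simp only [dif_pos, if_true]
          rw [h] at hd
          have hc : g.c ≠ 0 := by intro h'; rw [h'] at hd; simp at hd
          ext
          · exact h.symm
          · simp; field_simp; linear_combination hd
          · rfl
          · rfl
        · simp only [h, dif_neg, if_false, not_false_eq_true]
          ext
          · rfl
          · rfl
          · rfl
          · simp; field_simp; linear_combination -hd
      right_inv := fun ⟨⟨⟨x, y⟩, h0⟩, z⟩ => by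
        by_cases h : x = 0
        · subst h; simp
        · simp [h] }
  rw [Nat.card_congr e, Nat.card_prod, mul_comm]
  congr 1
  rw [Nat.card_eq_fintype_card, Fintype.card_subtype_compl, Fintype.card_prod, Fintype.card_subtype_eq,
    ← Nat.card_eq_fintype_card, sq]

/-! ### The stabiliser of a line, and the order of Sp₄. -/

namespace Sp4

variable {F : Type*} [Field F] [CharP F 2]

/-- Abelian normal subgroup of the unipotent radical of the stabiliser of a line; in characteristic
two this is the whole unipotent radical. -/
def uQ' : Multiplicative (F × F × F) →* Sp 2 F where
  toFun x := xx x.toAdd.1 * qq x.toAdd.2.1 x.toAdd.2.2 0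
  map_one' := by simp
  map_mul' x y := by
    simp only [toAdd_mul, Prod.fst_add, Prod.snd_add]
    have h1 : ∀ b b' : F, xx (b + b') = xx b * xx b' := fun b b' => by
      rw [xx, ofAdd_add, map_mul]
    have h2 : ∀ s t s' t' : F, qq (s + s') (t + t') 0 = qq s t 0 * qq s' t' 0 := fun s t s' t' => by
      rw [qq, qq, qq, ← map_mul, ← ofAdd_add]; simp
    have h3 : ∀ b s t : F, qq s t 0 * xx b = xx b * qq s t 0 := fun b s t => by
      rw [qq_mul_xx]; simp
    rw [h1, h2, mul_assoc, mul_assoc, ← mul_assoc (xx _) (qq _ _ _) (qq _ _ _), ← h3]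
    simp only [mul_assoc]

theorem uQ'_apply (b s t : F) : uQ' (Multiplicative.ofAdd (b, s, t)) = xx b * qq s t 0 := rfl

theorem uQ'_coe (b s t : F) : (uQ' (Multiplicative.ofAdd (b, s, t))).1 =
    fromBlocks !![1, b; 0, 1] !![s + b * t, t; t, 0] 0 !![1, 0; b, 1] := by
  rw [uQ'_apply, Submonoid.coe_mul, xx_coe, qq_coe, fromBlocks_multiply, fromBlocks_inj]
  refine ⟨by simp, ?_, by simp, by simp [CharTwo.neg_eq]⟩
  simp

/-- The Levi subgroup of the stabiliser of a line. -/
def levi' : Fˣ × SL2 F →* Sp 2 F where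
  toFun l := ⟨fromBlocks !![(l.1 : F), 0; 0, l.2.a] !![0, 0; 0, l.2.b] !![0, 0; 0, l.2.c]
    !![((l.1⁻¹ : Fˣ) : F), 0; 0, l.2.d],
    mk_mem (by ext i j; fin_cases i <;> fin_cases j <;> simp [Matrix.mul_apply]; ring)
      (by ext i j; fin_cases i <;> fin_cases j <;> simp [Matrix.mul_apply]; ring) (by
      have h1 := l.2.det
      ext i j
      fin_cases i <;> fin_cases j <;> simp [Matrix.mul_apply] 
      linear_combination h1)⟩
  map_one' := by
    apply Subtype.ext
    simp [← fromBlocks_one, zero_fin_two, Matrix.one_fin_two]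
  map_mul' x y := by
    apply Subtype.ext
    simp [fromBlocks_multiply, mul_comm]

theorem levi'_coe (l : Fˣ × SL2 F) : (levi' l).1 =
    fromBlocks !![(l.1 : F), 0; 0, l.2.a] !![0, 0; 0, l.2.b] !![0, 0; 0, l.2.c]
    !![((l.1⁻¹ : Fˣ) : F), 0; 0, l.2.d] := rfl

/-- The action of `levi'` on `uQ'`. -/
def actQ' (l : Fˣ × SL2 F) (x : F × F × F) : F × F × F :=
  (l.1 * (l.2.d * x.1 + l.2.c * x.2.2),
   l.1 ^ 2 * (x.2.1 + l.2.b * l.2.d * x.1 ^ 2 + l.2.a * l.2.c * x.2.2 ^ 2),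
   l.1 * (l.2.b * x.1 + l.2.a * x.2.2))

theorem levi'_mul_uQ' (l : Fˣ × SL2 F) (x : F × F × F) :
    levi' l * uQ' (Multiplicative.ofAdd x) = uQ' (Multiplicative.ofAdd (actQ' l x)) * levi' l := by
  have h1 := l.2.det
  have h2 : (2 : F) = 0 := CharTwo.two_eq_zero
  obtain ⟨b, s, t⟩ := x
  apply Subtype.ext
  rw [actQ']
  simp only [Submonoid.coe_mul, levi'_coe, uQ'_coe, fromBlocks_multiply, fromBlocks_inj]
  refine ⟨?_, ?_, ?_, ?_⟩ <;>
  ext i j <;>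
  fin_cases i <;> fin_cases j <;> simp [Matrix.mul_apply] <;> field_simp <;> grind

theorem uQ'_mul_levi'_coe (b s t : F) (l : Fˣ × SL2 F) :
    (uQ' (Multiplicative.ofAdd (b, s, t)) * levi' l).1 =
      fromBlocks !![(l.1 : F), b * l.2.a + t * l.2.c; 0, l.2.a]
        !![(s + b * t) * (l.1⁻¹ : Fˣ), b * l.2.b + t * l.2.d; t * (l.1⁻¹ : Fˣ), l.2.b]
        !![0, 0; 0, l.2.c] !![((l.1⁻¹ : Fˣ) : F), 0; b * (l.1⁻¹ : Fˣ), l.2.d] := by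
  rw [Submonoid.coe_mul, levi'_coe, uQ'_coe, fromBlocks_multiply, fromBlocks_inj]
  refine ⟨?_, ?_, ?_, ?_⟩ <;> ext i j <;> fin_cases i <;> fin_cases j <;> simp

theorem uQ'_mul_levi'_injective : Function.Injective
    fun p : Multiplicative (F × F × F) × (Fˣ × SL2 F) => uQ' p.1 * levi' p.2 := by
  rintro ⟨⟨b, s, t⟩, ⟨c, h⟩⟩ ⟨⟨b', s', t'⟩, ⟨c', h'⟩⟩ he
  have h1 := congrArg Subtype.val he
  replace h1 := (uQ'_mul_levi'_coe b s t (c, h)).symm.trans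
    (h1.trans (uQ'_mul_levi'_coe b' s' t' (c', h')))
  rw [fromBlocks_inj] at h1
  obtain ⟨hA, hB, hC, hD⟩ := h1
  simp at hA hB hC hD
  have hc : c = c' := Units.ext hA.1.1
  subst hc
  have hh : h = h' := SL2.ext hA.2 hB.2.2 hC hD.2.2
  subst hh
  have hb : b = b' := by simpa using hD.2.1
  have ht : t = t' := by simpa using hB.2.1
  subst hb ht
  have hs : s = s' := by simpa using hB.1.1
  subst hs
  rfl

/-- The action on column vectors. -/
instance : MulAction (Sp 2 F) (Fin 2 ⊕ Fin 2 → F) where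
  smul g v := g.1 *ᵥ v
  one_smul v := one_mulVec v
  mul_smul g h v := (mulVec_mulVec v g.1 h.1).symm

theorem smul_def (g : Sp 2 F) (v : Fin 2 ⊕ Fin 2 → F) : g • v = g.1 *ᵥ v := rfl

variable (F) in
/-- The first basis vector. -/
def e1 : Fin 2 ⊕ Fin 2 → F := Pi.single (Sum.inl 0) 1

theorem smul_e1 (g : Sp 2 F) : g • e1 F = fun i => g.1 i (Sum.inl 0) := by
  rw [smul_def, e1, mulVec_single_one]; rfl

theorem e1_ne_zero : e1 F ≠ 0 := by
  intro h
  simpa [e1] using congrFun h (Sum.inl 0)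

theorem smul_inl (A B C D : Matrix (Fin 2) (Fin 2) F) (g : Sp 2 F) (hg : g.1 = fromBlocks A B C D)
    (v : Fin 2 ⊕ Fin 2 → F) (i : Fin 2) :
    (g • v) (Sum.inl i) = (A *ᵥ (v ∘ Sum.inl)) i + (B *ᵥ (v ∘ Sum.inr)) i := by
  rw [smul_def, hg, fromBlocks_mulVec]; rfl

/-- An explicit symplectic matrix works when the first coordinate is nonzero; `sw` and `jj` move
some nonzero coordinate there. -/
theorem exists_smul_e1_eq (v : Fin 2 ⊕ Fin 2 → F) (hv : v ≠ 0) : ∃ g : Sp 2 F, g • e1 F = v := by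
  have h0 : ∀ v : Fin 2 ⊕ Fin 2 → F, v (Sum.inl 0) ≠ 0 → ∃ g : Sp 2 F, g • e1 F = v := by
    intro v hv
    refine ⟨⟨fromBlocks !![v (Sum.inl 0), 0; v (Sum.inl 1), 1] 0
      !![v (Sum.inr 0), v (Sum.inr 1) / v (Sum.inl 0); v (Sum.inr 1), 0]
      !![1 / v (Sum.inl 0), - v (Sum.inl 1) / v (Sum.inl 0); 0, 1], mk_mem ?_ (by simp) ?_⟩, ?_⟩
    · ext i j
      fin_cases i <;> fin_cases j <;> simp [Matrix.mul_apply] <;> field_simp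
    · ext i j
      fin_cases i <;> fin_cases j <;> simp [Matrix.mul_apply] <;> field_simp
      ring
    · rw [smul_e1]
      ext (i | i) <;> fin_cases i <;> simp
  have h1 : ∀ v : Fin 2 ⊕ Fin 2 → F, v ∘ Sum.inl ≠ 0 → ∃ g : Sp 2 F, g • e1 F = v := by
    intro v hv
    by_cases hv0 : v (Sum.inl 0) = 0
    · have hv1 : v (Sum.inl 1) ≠ 0 := by
        intro h
        apply hv
        ext i
        fin_cases i
        · exact hv0
        · exact h
      obtain ⟨g, hg⟩ := h0 ((sw : Sp 2 F) • v) (by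
        rw [smul_inl _ _ _ _ _ sw_coe]; simpa [vecHead, vecTail] using hv1)
      exact ⟨sw⁻¹ * g, by rw [mul_smul, hg, inv_smul_smul]⟩
    · exact h0 v hv0
  by_cases hl : v ∘ Sum.inl = 0
  · obtain ⟨g, hg⟩ := h1 (jj F • v) (fun h => hv (by
      have h2 : v ∘ Sum.inr = 0 := by
        ext i
        have := congrFun h i
        rw [Function.comp_apply, smul_inl _ _ _ _ _ jj_coe] at this
        fin_cases i <;> simpa using this
      ext (i | i)
      · exact congrFun hl i
      · exact congrFun h2 i))
    exact ⟨(jj F)⁻¹ * g, by rw [mul_smul, hg, inv_smul_smul]⟩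
  · exact h1 v hl

theorem mem_stabilizer_e1 (g : Sp 2 F) (hg : g • e1 F = e1 F) :
    ∃ x h, g = uQ' x * levi' (1, h) := by
  rw [smul_e1] at hg
  obtain ⟨A, B, C, D, he, h1, h2, h3⟩ := exists_blocks g
  have a0 := congrFun hg (Sum.inl 0)
  have a1 := congrFun hg (Sum.inl 1)
  have c0 := congrFun hg (Sum.inr 0)
  have c1 := congrFun hg (Sum.inr 1)
  simp only [he, fromBlocks_apply₁₁, fromBlocks_apply₂₁, e1] at a0 a1 c0 c1
  simp at a0 a1 c0 c1
  have r1 := congrFun (congrFun h1 0) 1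
  have r2 := congrFun (congrFun h2 0) 1
  have s1 := congrFun (congrFun h3 0) 0
  have s2 := congrFun (congrFun h3 0) 1
  have s3 := congrFun (congrFun h3 1) 0
  have s4 := congrFun (congrFun h3 1) 1
  simp [Matrix.mul_apply, a0, a1, c0, c1] at r1 r2 s1 s2 s3 s4
  simp [r1, s1, s2] at r2 s3 s4
  refine ⟨Multiplicative.ofAdd (D 1 0, B 0 0 - D 1 0 * B 1 0, B 1 0),
    ⟨A 1 1, B 1 1, C 1 1, D 1 1, by linear_combination s4⟩, Subtype.ext ?_⟩
  have h2 : (2 : F) = 0 := CharTwo.two_eq_zero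
  rw [uQ'_mul_levi'_coe, he, fromBlocks_inj]
  refine ⟨?_, ?_, ?_, ?_⟩ <;> ext i j <;> fin_cases i <;> fin_cases j <;>
    simp [a0, a1, c0, c1, r1, s1, s2] <;> grind

theorem natCard_units [Finite F] : Nat.card Fˣ = Nat.card F - 1 := by
  classical
  have := Fintype.ofFinite F
  rw [Nat.card_eq_fintype_card, Nat.card_eq_fintype_card, Fintype.card_units]

/-- Orbit–stabiliser for the first basis vector: the orbit is all nonzero vectors, the stabiliser is
the radical extended by SL₂(F). -/
theorem natCard [Finite F] : Nat.card (Sp 2 F) =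
    (Nat.card F ^ 4 - 1) * (Nat.card F ^ 3 * (Nat.card F * (Nat.card F ^ 2 - 1))) := by
  classical
  have := Fintype.ofFinite F
  have h1 : MulAction.orbit (Sp 2 F) (e1 F) = {v | v ≠ 0} := by
    ext v
    constructor
    · rintro ⟨g, rfl⟩ h
      refine e1_ne_zero (F := F) ?_
      rw [← inv_smul_smul g (e1 F), show g • e1 F = 0 from h]
      exact mulVec_zero _
    · exact exists_smul_e1_eq v
  have h2 : Nat.card (MulAction.orbit (Sp 2 F) (e1 F)) = Nat.card F ^ 4 - 1 := by
    rw [h1, Set.coe_ofPred, Nat.card_eq_fintype_card, Fintype.card_subtype_compl,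
      Fintype.card_subtype_eq, Fintype.card_fun, Nat.card_eq_fintype_card]
    rfl
  have h3 : Nat.card (MulAction.stabilizer (Sp 2 F) (e1 F)) =
      Nat.card F ^ 3 * (Nat.card F * (Nat.card F ^ 2 - 1)) := by
    have : Function.Bijective (fun p : Multiplicative (F × F × F) × SL2 F =>
        (⟨uQ' p.1 * levi' (1, p.2), by
          obtain ⟨⟨b, s, t⟩, h⟩ := p
          have := uQ'_mul_levi'_coe b s t (1, h)
          rw [MulAction.mem_stabilizer_iff, smul_e1]
          ext (i | i) <;> fin_cases i <;> erw [this] <;> simp [e1]⟩ :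
            MulAction.stabilizer (Sp 2 F) (e1 F))) := by
      constructor
      · rintro ⟨x, h⟩ ⟨x', h'⟩ he
        have := uQ'_mul_levi'_injective (a₁ := (x, (1, h))) (a₂ := (x', (1, h')))
          (congrArg Subtype.val he)
        simp only [Prod.mk.injEq, true_and] at this
        rw [this.1, this.2]
      · rintro ⟨g, hg⟩
        obtain ⟨x, h, rfl⟩ := mem_stabilizer_e1 g hg
        exact ⟨(x, h), rfl⟩
    rw [← Nat.card_congr (Equiv.ofBijective _ this), Nat.card_prod, SL2.natCard]
    have : Nat.card (Multiplicative (F × F × F)) = Nat.card F ^ 3 := by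
      rw [Nat.card_congr Multiplicative.toAdd, Nat.card_prod, Nat.card_prod]; ring
    rw [this]
  rw [← h2, ← h3, ← Nat.card_congr (MulAction.orbitProdStabilizerEquivGroup (Sp 2 F) (e1 F)),
    Nat.card_prod]

end Sp4

/-! ### Dimension bounds from stable subspaces. -/

namespace Representation

variable {G V : Type*} [Group G] [AddCommGroup V] [Module ℂ V]

/-- The subgroup mapping a subspace to itself. -/
def stabilizerOf (ρ : Representation ℂ G V) (W : Submodule ℂ V) : Subgroup G where
  carrier := {g | ∀ w, ρ g w ∈ W ↔ w ∈ W}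
  one_mem' w := by simp
  mul_mem' {g h} hg hh w := by
    rw [map_mul, Module.End.mul_apply, hg, hh]
  inv_mem' {g} hg w := by
    rw [← hg, ← Module.End.mul_apply, ← map_mul, mul_inv_cancel, map_one, Module.End.one_apply]

theorem mem_stabilizerOf [Finite G] (ρ : Representation ℂ G V) {W : Submodule ℂ V} {g : G}
    (h : ∀ w ∈ W, ρ g w ∈ W) : g ∈ ρ.stabilizerOf W := fun w => by
  refine ⟨fun hw => ?_, h w⟩
  have h1 : ∀ n : ℕ, ∀ w ∈ W, ρ (g ^ n) w ∈ W := by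
    intro n
    induction n with
    | zero => simp
    | succ n ih =>
      intro w hw
      rw [pow_succ, map_mul]
      exact ih _ (h w hw)
  have h2 := h1 (orderOf g - 1) _ hw
  rwa [← Module.End.mul_apply, ← map_mul, ← pow_succ, Nat.sub_add_cancel (orderOf_pos g),
    pow_orderOf_eq_one, map_one] at h2

/-- The inequality dim V ≤ [G : P] dim W, cleared of denominators. The parabolic enters only as a
set of distinct elements preserving W, so its closure under multiplication need not be checked. -/
theorem IsIrreducible.finrank_mul_card_le [Finite G] [FiniteDimensional ℂ V]
    {ρ : Representation ℂ G V} (hρ : ρ.IsIrreducible) {X : Type*} {f : X → G}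
    (hf : Function.Injective f) {W : Submodule ℂ V}
    (hW : W ≠ ⊥) (hP : ∀ x, ∀ w ∈ W, ρ (f x) w ∈ W) :
    Module.finrank ℂ V * Nat.card X ≤ Nat.card G * Module.finrank ℂ W := by
  have h1 := hρ.finrank_le_index_mul (ρ.stabilizerOf W) hW fun p hp w hw => (hp w).2 hw
  have h2 : Nat.card X ≤ Nat.card (ρ.stabilizerOf W) :=
    Nat.card_le_card_of_injective (fun x => (⟨f x, ρ.mem_stabilizerOf (hP x)⟩ : ρ.stabilizerOf W))
      fun x y h => hf (congrArg Subtype.val h)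
  calc _ ≤ (ρ.stabilizerOf W).index * Module.finrank ℂ W * Nat.card (ρ.stabilizerOf W) :=
        Nat.mul_le_mul h1 h2
    _ = Nat.card (ρ.stabilizerOf W) * (ρ.stabilizerOf W).index * Module.finrank ℂ W := by ring
    _ = _ := by rw [Subgroup.card_mul_index]

theorem rho_wtProj_of_comm {S : Type*} [Group S] [Fintype S] (ρ : Representation ℂ G V)
    {ι : S →* G} (χ : S →* ℂ) {g : G} (hg : ∀ s, g * ι s = ι s * g) (v : V) :
    ρ g (ρ.wtProj ι χ v) = ρ.wtProj ι χ (ρ g v) := by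
  rw [wtProj_apply, wtProj_apply, map_smul, map_sum]
  simp only [map_smul, ← Module.End.mul_apply, ← map_mul, hg]

theorem wtProj_apply_of_ne {S : Type*} [Group S] [Fintype S] (ρ : Representation ℂ G V)
    {ι : S →* G} {χ χ' : S →* ℂ} {v : V} (hv : v ∈ ρ.wtSpace ι χ') {s : S} (hs : χ s ≠ χ' s) :
    ρ.wtProj ι χ v = 0 := by
  have h1 := LinearMap.congr_fun (ρ.wtProj_mul_rho ι χ s) v
  rw [Module.End.mul_apply, hv s, map_smul, LinearMap.smul_apply] at h1
  have h2 : (χ' s - χ s) • ρ.wtProj ι χ v = 0 := by rw [sub_smul, h1, sub_self]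
  exact (smul_eq_zero.1 h2).resolve_left (sub_ne_zero.2 hs.symm)

end Representation

/-! ### Dimensions of the weight spaces of the two radicals. -/

namespace Sp4

variable {F : Type*} [Field F] [CharP F 2]

theorem exists_addChar (F : Type*) [Field F] [Finite F] : ∃ ψ : AddChar F ℂ, ∃ z, ψ z ≠ 1 := by
  obtain ⟨ψ, h⟩ := AddChar.exists_apply_ne_zero.2 (one_ne_zero (α := F))
  exact ⟨ψ, 1, h⟩

theorem sum_addChar [Fintype F] [DecidableEq F] {ψ : AddChar F ℂ} (hψ : ∃ z, ψ z ≠ 1) (b : F) :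
    ∑ x, ψ (x * b) = if b = 0 then (Fintype.card F : ℂ) else 0 := by
  refine (AddChar.sum_mulShift b (AddChar.IsPrimitive.of_ne_one ?_)).trans (by split_ifs <;> simp)
  rintro rfl
  obtain ⟨z, hz⟩ := hψ
  exact hz rfl

variable [Finite F]
variable {V : Type*} [AddCommGroup V] [Module ℂ V] [FiniteDimensional ℂ V]
  {ρ : Representation ℂ (Sp 2 F) V}

theorem two_le_card : 2 ≤ Nat.card F := Finite.one_lt_card

/-- The fixed vectors of the radical form a representation of the Levi subgroup. An irreducible
piece has dimension at most q + 1, and its translates over the (q + 1)(q² + 1) cosets span V. The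
maps u and m are kept general so that both maximal parabolics are covered. -/
theorem finrank_le_of_fixed (u : Multiplicative (F × F × F) →* Sp 2 F)
    (m : Fˣ × SL2 F →* Sp 2 F)
    (hinj : Function.Injective fun p : Multiplicative (F × F × F) × (Fˣ × SL2 F) => u p.1 * m p.2)
    (hn : ∀ l x, ∃ x', u x * m l = m l * u x') (hρ : ρ.IsIrreducible)
    (hne : ρ.wtSpace u 1 ≠ ⊥) :
    Module.finrank ℂ V ≤ (Nat.card F + 1) ^ 2 * (Nat.card F ^ 2 + 1) := by
  have hst : Representation.Stable (ρ.comp m) (ρ.wtSpace u 1) := by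
    intro l v hv x
    obtain ⟨x', hx⟩ := hn l x
    rw [MonoidHom.comp_apply, ← Module.End.mul_apply, ← map_mul, hx, map_mul, Module.End.mul_apply,
      hv x']
    simp
  obtain ⟨W, hW, hle, hW0, hirr⟩ := Representation.exists_minimal_stable (ρ.comp m) hst hne
  have h1 := hirr.finrank_le_of_levi
  have h2 := hρ.finrank_mul_card_le hinj hW0 (by
    rintro ⟨x, l⟩ w hw
    rw [map_mul, Module.End.mul_apply]
    have h3 : ρ (m l) w ∈ W := hW l w hw
    rw [hle h3 x]
    simpa using h3)
  have hX : Nat.card (Multiplicative (F × F × F) × (Fˣ × SL2 F)) =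
      Nat.card F ^ 3 * ((Nat.card F - 1) * (Nat.card F * (Nat.card F ^ 2 - 1))) := by
    rw [Nat.card_prod, Nat.card_prod, natCard_units, SL2.natCard,
      Nat.card_congr Multiplicative.toAdd, Nat.card_prod, Nat.card_prod]; ring
  rw [hX, natCard] at h2
  obtain ⟨k, hk⟩ : ∃ k, Nat.card F = k + 2 := ⟨_, (Nat.sub_add_cancel two_le_card).symm⟩
  rw [hk] at h1 h2 ⊢
  have e4 : (k + 2) ^ 4 - 1 = (k + 1) * ((k + 3) * ((k + 2) ^ 2 + 1)) := by
    rw [Nat.sub_eq_iff_eq_add (Nat.one_le_pow _ _ (by omega))]; ring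
  have e2 : (k + 2) ^ 2 - 1 = (k + 1) * (k + 3) := by
    rw [Nat.sub_eq_iff_eq_add (Nat.one_le_pow _ _ (by omega))]; ring
  have e1 : k + 2 - 1 = k + 1 := rfl
  rw [e4, e2, e1] at h2
  have hpos : 0 < (k + 2) ^ 3 * ((k + 1) * ((k + 2) * ((k + 1) * (k + 3)))) := by positivity
  refine Nat.le_of_mul_le_mul_right (h2.trans ?_) hpos
  calc _ ≤ (k + 1) * ((k + 3) * ((k + 2) ^ 2 + 1)) * ((k + 2) ^ 3 * ((k + 2) * ((k + 1) * (k + 3)))) *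
        (k + 2 + 1) := Nat.mul_le_mul_left _ h1
    _ = _ := by ring

theorem finrank_wtSpace_conj {ψ : AddChar F ℂ} {α β γ α' β' γ' : F} (l : Fˣ × SL2 F)
    (h : ∀ x, lam ψ α β γ (actHom l x) = lam ψ α' β' γ' x) :
    Module.finrank ℂ (ρ.wtSpace uQ (lam ψ α β γ)) ≤
      Module.finrank ℂ (ρ.wtSpace uQ (lam ψ α' β' γ')) := by
  refine ρ.finrank_wtSpace_conj_le (levi l⁻¹) fun w hw x => ?_
  have e : uQ x * levi l⁻¹ = levi l⁻¹ * uQ (actHom l x) := by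
    rw [uQ_mul_levi, inv_inv]
  rw [← Module.End.mul_apply, ← map_mul, e, map_mul, Module.End.mul_apply, hw, map_smul, h]

theorem finrank_le_of_lamU {ψ : AddChar F ℂ} (hψ : ∃ z, ψ z ≠ 1) (ι : Multiplicative F →* Sp 2 F)
    (W : Submodule ℂ V) (hW : ∀ s, ∀ w ∈ W, ρ (ι s) w ∈ W)
    (h : ∀ κ, Module.finrank ℂ (W ⊓ ρ.wtSpace ι (lamU ψ κ) : Submodule ℂ V) ≤ 1) :
    Module.finrank ℂ W ≤ Nat.card F := by
  classical
  have := Fintype.ofFinite F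
  refine (Representation.finrank_le_sum_wtSpace ρ ι (fun κ => lamU ψ κ) (fun s => ?_) W hW).trans ?_
  · have := sum_addChar hψ s.toAdd
    refine this.trans ?_
    rw [Fintype.card_multiplicative]
    rfl
  · refine (Finset.sum_le_sum fun κ _ => h κ).trans ?_
    simp [Nat.card_eq_fintype_card]

/-- The character (0, 0, γ) is trivial on the root elements that `uQ'` shares with `uQ`, so a vector
also fixed by `xa` is fixed by all of `uQ'`. -/
theorem inf_eq_bot_of_fixed {ψ : AddChar F ℂ} (hQ' : ρ.wtSpace uQ' 1 = ⊥) (γ : F) :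
    ρ.wtSpace uQ (lam ψ 0 0 γ) ⊓ ρ.wtSpace xa (lamU ψ 0) = ⊥ := by
  rw [eq_bot_iff, ← hQ']
  rintro v ⟨h1, h2⟩ ⟨b, s, t⟩
  change ρ (uQ' (Multiplicative.ofAdd (b, s, t))) v = (1 : ℂ) • v
  rw [uQ'_apply, map_mul, Module.End.mul_apply, h1, map_smul, h2, lam_apply, lamU_apply]
  simp

/-- The root subgroup `xa` stabilises the degenerate form γy². Its nontrivial characters occur at
most once by uniqueness of Whittaker models, and the trivial one would give a vector fixed by `uQ'`.
-/
theorem finrank_lam_le_of_eq {ψ : AddChar F ℂ} (hψ : ∃ z, ψ z ≠ 1) (hρ : ρ.IsIrreducible)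
    (hQ' : ρ.wtSpace uQ' 1 = ⊥) {γ : F} (hγ : γ ≠ 0) :
    Module.finrank ℂ (ρ.wtSpace uQ (lam ψ 0 0 γ)) ≤ Nat.card F := by
  refine finrank_le_of_lamU (ρ := ρ) hψ xa _ (fun s w hw x => ?_) fun κ => ?_
  · have e : uQ x * xa s = xa s * uQ (actHom (mU s)⁻¹ x) := uQ_mul_levi (mU s) x
    rw [← Module.End.mul_apply, ← map_mul, e, map_mul, Module.End.mul_apply, hw, map_smul,
      ← map_inv, lam_mU]
  · by_cases hκ : κ = 0
    · subst hκ
      rw [inf_eq_bot_of_fixed hQ', finrank_bot]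
      exact zero_le_one
    · exact finrank_gelfandGraev hγ hκ hψ hρ

/-- The root subgroup of the long root. -/
def zz : Multiplicative F →* Sp 2 F where
  toFun u := qq 0 0 u.toAdd
  map_one' := by simp
  map_mul' x y := by rw [qq, qq, qq, ← map_mul, ← ofAdd_add]; simp

theorem qq_add (s t u s' t' u' : F) : qq s t u * qq s' t' u' = qq (s + s') (t + t') (u + u') := by
  rw [qq, qq, qq, ← map_mul, ← ofAdd_add]; rfl

/-- The mirror image for the other parabolic: split under the long root subgroup, where the trivial
character would give a vector fixed by `uQ` and the others are Whittaker weights. -/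
theorem finrank_uQ'_le {ψ : AddChar F ℂ} (hψ : ∃ z, ψ z ≠ 1) (hρ : ρ.IsIrreducible)
    (hQ : ρ.wtSpace uQ 1 = ⊥) {β : F} (hβ : β ≠ 0) :
    Module.finrank ℂ (ρ.wtSpace uQ' (lam ψ β 0 0)) ≤ Nat.card F := by
  have key : ∀ v ∈ ρ.wtSpace uQ' (lam ψ β 0 0), (∀ s t, ρ (qq s t 0) v = v) ∧
      (∀ b, ρ (xx b) v = ψ (β * b) • v) := by
    refine fun v hv => ⟨fun s t => ?_, fun b => ?_⟩
    · have := hv (Multiplicative.ofAdd (0, s, t))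
      rw [uQ'_apply, lam_apply] at this
      simpa using this
    · have := hv (Multiplicative.ofAdd (b, 0, 0))
      rw [uQ'_apply, lam_apply] at this
      simpa using this
  refine finrank_le_of_lamU (ρ := ρ) hψ zz _ (fun u w hw x => ?_) fun γ => ?_
  · obtain ⟨b, s, t⟩ := x
    change ρ (uQ' (Multiplicative.ofAdd (b, s, t))) (ρ (qq 0 0 u.toAdd) w) =
      lam ψ β 0 0 (Multiplicative.ofAdd (b, s, t)) • ρ (qq 0 0 u.toAdd) w
    obtain ⟨k1, k2⟩ := key w hw
    have e : uQ' (Multiplicative.ofAdd (b, s, t)) * qq 0 0 u.toAdd =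
        qq 0 0 u.toAdd * (qq (s + b ^ 2 * u.toAdd) (t + b * u.toAdd) 0 * xx b) := by
      rw [uQ'_apply, mul_assoc, qq_add, qq_mul_xx, ← mul_assoc, qq_add]; simp
    rw [← Module.End.mul_apply, ← map_mul, e, map_mul, Module.End.mul_apply, map_mul,
      Module.End.mul_apply, k2, map_smul, map_smul, k1, lam_apply]
    simp
  · by_cases hγ : γ = 0
    · subst hγ
      have : ρ.wtSpace uQ' (lam ψ β 0 0) ⊓ ρ.wtSpace zz (lamU ψ 0) = ⊥ := by
        rw [eq_bot_iff, ← hQ]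
        rintro v ⟨h1, h2⟩ ⟨s, t, u⟩
        change ρ (qq s t u) v = (1 : ℂ) • v
        have e : qq s t u = zz (Multiplicative.ofAdd u) * qq s t 0 := by
          change _ = qq 0 0 u * _
          rw [qq_add]; simp
        rw [e, map_mul, Module.End.mul_apply, (key v h1).1, h2, lamU_apply]
        simp
      rw [this, finrank_bot]
      exact zero_le_one
    · refine le_trans (Submodule.finrank_mono ?_) (finrank_gelfandGraev hγ hβ hψ hρ)
      rintro v ⟨h1, h2⟩
      refine ⟨?_, fun b => (key v h1).2 b.toAdd⟩
      rintro ⟨s, t, u⟩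
      change ρ (qq s t u) v = ψ _ • v
      have e : qq s t u = zz (Multiplicative.ofAdd u) * qq s t 0 := by
        change _ = qq 0 0 u * _
        rw [qq_add]; simp
      rw [e, map_mul, Module.End.mul_apply, (key v h1).1, h2, lamU_apply]
      congr 2
      change γ * u = 0 * s + 0 * t + γ * u
      ring

/-- Averaging over `xa` maps this weight space to one for `uQ'`. It is injective: the element of
`xa` with parameter b moves the form to one with γ + βb, so the nontrivial translates lie in other
weight spaces, and projecting back returns v/q. Then `rr` carries the target to the weight bounded
by `finrank_uQ'_le`. -/
theorem finrank_lam_isotropic {ψ : AddChar F ℂ} (hψ : ∃ z, ψ z ≠ 1) (hρ : ρ.IsIrreducible)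
    (hQ : ρ.wtSpace uQ 1 = ⊥) {β γ : F} (hβ : β ≠ 0) :
    Module.finrank ℂ (ρ.wtSpace uQ (lam ψ 0 β γ)) ≤ Nat.card F := by
  classical
  have := Fintype.ofFinite F
  have h1 : Module.finrank ℂ (ρ.wtSpace uQ (lam ψ 0 β γ)) ≤
      Module.finrank ℂ (ρ.wtSpace uQ' (lam ψ 0 0 β)) := by
    have hmap : ∀ v ∈ ρ.wtSpace uQ (lam ψ 0 β γ), ρ.wtProj xa 1 v ∈ ρ.wtSpace uQ' (lam ψ 0 0 β) := by
      rintro v hv ⟨b, s, t⟩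
      change ρ (uQ' (Multiplicative.ofAdd (b, s, t))) _ = ψ _ • _
      have e1 : ρ (qq s t 0) (ρ.wtProj xa 1 v) = ψ (β * t) • ρ.wtProj xa 1 v := by
        have e2 : ∀ c, qq s t 0 * xa c = xa c * qq s t 0 := fun c => by
          have : qq s t 0 * xx c.toAdd = xx c.toAdd * qq s t 0 := by rw [qq_mul_xx]; simp
          exact this
        rw [ρ.rho_wtProj_of_comm 1 e2, hv, map_smul, lam_apply]
        simp
      rw [uQ'_apply, map_mul, Module.End.mul_apply, e1, map_smul,
        (Representation.wtProj_mem ρ xa 1 v) (Multiplicative.ofAdd b)]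
      rw [MonoidHom.one_apply, one_smul]
      congr 2
      change β * t = 0 * b + 0 * s + β * t
      ring
    have hz : ∀ v ∈ ρ.wtSpace uQ (lam ψ 0 β γ), ρ.wtProj uQ (lam ψ 0 β γ) (ρ.wtProj xa 1 v) =
        (Fintype.card (Multiplicative F) : ℂ)⁻¹ • v := by
      intro v hv
      rw [Representation.wtProj_apply ρ xa 1 v, map_smul, map_sum, Finset.sum_eq_single 1]
      · simp [Representation.wtProj_of_mem hv]
      · intro b _ hb
        have hb' : b.toAdd ≠ 0 := fun h => hb (Multiplicative.toAdd.injective h)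
        have hmem : ρ (xa b) v ∈ ρ.wtSpace uQ (lam ψ 0 β (γ + β * b.toAdd)) := by
          rintro ⟨s, t, u⟩
          have e2 : qq s t u * xx b.toAdd = xx b.toAdd * qq (s + b.toAdd ^ 2 * u) (t + b.toAdd * u) u := by
            rw [qq_mul_xx]
            congr 2
            · linear_combination -(b.toAdd ^ 2 * u) * (CharTwo.two_eq_zero (R := F))
            · linear_combination -(b.toAdd * u) * (CharTwo.two_eq_zero (R := F))
          change ρ (qq s t u) (ρ (xx b.toAdd) v) = ψ _ • ρ (xx b.toAdd) v
          rw [← Module.End.mul_apply, ← map_mul, e2, map_mul, Module.End.mul_apply, hv, map_smul,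
            lam_apply]
          congr 2
          change 0 * _ + β * (t + b.toAdd * u) + γ * u = 0 * _ + β * t + (γ + β * b.toAdd) * u
          ring
        obtain ⟨z, hz⟩ := AddChar.exists_apply_mul_ne hψ (a := γ) (b := γ + β * b.toAdd)
          (by simpa using ⟨hβ, hb'⟩)
        rw [MonoidHom.one_apply, one_smul]
        refine Representation.wtProj_apply_of_ne ρ hmem (s := Multiplicative.ofAdd (0, 0, z)) ?_
        rw [lam_apply, lam_apply]
        simpa using hz
      · simp
    refine LinearMap.finrank_le_finrank_of_injective (f := (ρ.wtProj xa 1).restrict hmap) ?_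
    rw [← LinearMap.ker_eq_bot, LinearMap.ker_eq_bot']
    rintro ⟨v, hv⟩ h0
    have h1 := congrArg Subtype.val h0
    rw [LinearMap.coe_restrict_apply] at h1
    have h2 := hz v hv
    rw [h1] at h2
    simp only [ZeroMemClass.coe_zero, map_zero] at h2
    have h3 := (smul_eq_zero.1 h2.symm).resolve_left (by simp)
    exact Subtype.ext h3
  refine h1.trans (le_trans ?_ (finrank_uQ'_le hψ hρ hQ hβ))
  refine ρ.finrank_wtSpace_conj_le (rr F) fun w hw x => ?_
  obtain ⟨b, s, t⟩ := x
  have e : uQ' (Multiplicative.ofAdd (b, s, t)) * rr F = rr F * uQ' (Multiplicative.ofAdd (t, s, b)) := by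
    have e2 : qq s t 0 = qq s 0 0 * qq 0 t 0 := by rw [qq_add]; simp
    have e3 : qq 0 t 0 * rr F = rr F * xx t := (rr_mul_xx t).symm
    have e4 : qq 0 b 0 * qq s 0 0 = qq s b 0 := by rw [qq_add]; simp
    have e5 : qq s b 0 * xx t = xx t * qq s b 0 := by rw [qq_mul_xx]; simp
    rw [uQ'_apply, uQ'_apply, e2, mul_assoc, mul_assoc, e3, ← mul_assoc (qq s 0 0), qq_mul_rr,
      ← mul_assoc, ← mul_assoc, xx_mul_rr, mul_assoc (rr F), e4, mul_assoc, e5]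
  change ρ (uQ' (Multiplicative.ofAdd (b, s, t))) (ρ (rr F) w) = ψ _ • _
  rw [← Module.End.mul_apply, ← map_mul, e, map_mul, Module.End.mul_apply, hw, map_smul, lam_apply]
  congr 2
  change 0 * t + 0 * s + β * b = β * b + 0 * s + 0 * t
  ring

end Sp4

/-! ### The upper bound for the degrees. -/

namespace Sp4

variable {F : Type*} [Field F] [CharP F 2] [Finite F]
variable {V : Type*} [AddCommGroup V] [Module ℂ V] [FiniteDimensional ℂ V]
  {ρ : Representation ℂ (Sp 2 F) V}

/-- The nonsplit torus stabilises the form, and each of its at most q + 1 characters occurs at most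
once by uniqueness of Bessel models. -/
theorem finrank_lam_anisotropic {ψ : AddChar F ℂ} (hψ : ∃ z, ψ z ≠ 1) (hρ : ρ.IsIrreducible)
    {δ : F} (hδ : ∀ x : F, x ^ 2 + x + δ ≠ 0) :
    Module.finrank ℂ (ρ.wtSpace uQ (lam ψ 1 1 δ)) ≤ Nat.card F + 1 := by
  have := Fintype.ofFinite (normOneTorus δ)
  refine (Representation.finrank_le_card_of_wtSpace_le_one ρ (levi.comp (mT δ))
    (ρ.wtSpace uQ (lam ψ 1 1 δ))
    (fun t w hw x => ?_) fun ν => finrank_bessel hδ hψ hρ ν).trans ?_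
  · have e : uQ x * levi (mT δ t) = levi (mT δ t) * uQ (actHom (mT δ t)⁻¹ x) := uQ_mul_levi _ x
    rw [MonoidHom.comp_apply, ← Module.End.mul_apply, ← map_mul, e, map_mul, Module.End.mul_apply, hw,
      map_smul, ← map_inv, lam_mT]
  · rw [← Nat.card_eq_fintype_card]
    exact card_normOneTorus_le δ

theorem exists_column (x y : F) (h : x ≠ 0 ∨ y ≠ 0) : ∃ g : SL2 F, g.a = x ∧ g.c = y := by
  obtain ⟨g, h1, h2⟩ := SL2.exists_row x y h
  exact ⟨g.tr, h1, h2⟩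

/-- In a representation without fixed vectors under the two unipotent radicals the weight spaces of
nontrivial characters are small. -/
theorem finrank_lam_le {ψ : AddChar F ℂ} (hψ : ∃ z, ψ z ≠ 1) (hρ : ρ.IsIrreducible)
    (hQ : ρ.wtSpace uQ 1 = ⊥) (hQ' : ρ.wtSpace uQ' 1 = ⊥) {α β γ : F}
    (h : ¬ (α = 0 ∧ β = 0 ∧ γ = 0)) :
    Module.finrank ℂ (ρ.wtSpace uQ (lam ψ α β γ)) ≤ Nat.card F + 1 := by
  have h2 : (2 : F) = 0 := CharTwo.two_eq_zero
  -- Without cross term the form is the square of a linear form, since all coefficients are squares;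
  -- the Levi subgroup moves it to y².
  by_cases hβ : β = 0
  · subst hβ
    obtain ⟨a, ha⟩ := exists_sq_eq γ
    obtain ⟨c, hc⟩ := exists_sq_eq α
    obtain ⟨g, rfl, rfl⟩ := exists_column a c (by
      by_contra hcon
      push Not at hcon
      apply h
      rw [← ha, ← hc, hcon.1, hcon.2]
      simp)
    have hd := g.det
    refine ((finrank_wtSpace_conj (1, g) (α' := 0) (β' := 0) (γ' := 1) fun x => ?_).trans
      (finrank_lam_le_of_eq hψ hρ hQ' one_ne_zero)).trans (Nat.le_succ _)
    rw [lam_actHom, ← ha, ← hc]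
    simp only [Units.val_one]
    congr 2
    · linear_combination g.a ^ 2 * g.c ^ 2 * h2
    · simp
    · linear_combination (g.a * g.d - g.b * g.c + 1) * hd + g.a * g.b * g.c * g.d * h2
  -- A nontrivial zero, used as first column, removes the coefficient α.
  · by_cases hiso : ∃ x y : F, (x ≠ 0 ∨ y ≠ 0) ∧ α * x ^ 2 + β * (x * y) + γ * y ^ 2 = 0
    · obtain ⟨x, y, hxy, he⟩ := hiso
      obtain ⟨g, rfl, rfl⟩ := exists_column x y hxy
      refine ((finrank_wtSpace_conj (1, g) (α' := 0) (β' := β)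
        (γ' := α * g.b ^ 2 + β * (g.b * g.d) + γ * g.d ^ 2) fun x => ?_).trans
        (finrank_lam_isotropic hψ hρ hQ hβ)).trans (Nat.le_succ _)
      rw [lam_actHom]
      simp only [he, Units.val_one]
      simp
    -- Anisotropic case: scaling brings the form to x² + xy + δy² with δ = αγ/β².
    · push Not at hiso
      have hα : α ≠ 0 := by simpa using hiso 1 0 (Or.inl one_ne_zero)
      obtain ⟨c, hc⟩ := exists_sq_eq β
      obtain ⟨a, ha⟩ := exists_sq_eq (β / α)
      have hc0 : c ≠ 0 := by rintro rfl; simp at hc; exact hβ hc.symm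
      have ha0 : a ≠ 0 := by rintro rfl; simp at ha; exact (div_ne_zero hβ hα) (by simpa using ha.symm)
      have hδ : ∀ x : F, x ^ 2 + x + α * γ / β ^ 2 ≠ 0 := by
        intro x hx
        refine hiso (x * β / α) 1 (Or.inr one_ne_zero) ?_
        field_simp
        field_simp at hx
        linear_combination hx
      refine (finrank_wtSpace_conj ((Units.mk0 c hc0)⁻¹, SL2.diag (Units.mk0 a ha0)) fun x => ?_).trans
        (finrank_lam_anisotropic hψ hρ hδ)
      rw [lam_actHom]
      simp only [SL2.diag_a, SL2.diag_b, SL2.diag_c, SL2.diag_d, Units.val_mk0,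
        Units.val_inv_eq_inv_val, inv_pow, hc, ha]
      congr 2 <;> field_simp <;> simp

/-- The degrees of the irreducible representations of `Sp 2 F` are at most `(q + 1)² (q² + 1)`. -/
theorem finrank_le (hρ : ρ.IsIrreducible) :
    Module.finrank ℂ V ≤ (Nat.card F + 1) ^ 2 * (Nat.card F ^ 2 + 1) := by
  classical
  have := Fintype.ofFinite F
  by_cases hQ : ρ.wtSpace uQ 1 = ⊥
  swap
  · exact finrank_le_of_fixed uQ levi uQ_mul_levi_injective (fun l x => ⟨_, uQ_mul_levi l x⟩) hρ hQ
  by_cases hQ' : ρ.wtSpace uQ' 1 = ⊥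
  swap
  · refine finrank_le_of_fixed uQ' levi' uQ'_mul_levi'_injective (fun l x => ?_) hρ hQ'
    refine ⟨Multiplicative.ofAdd (actQ' l⁻¹ x.toAdd), ?_⟩
    have := levi'_mul_uQ' l⁻¹ x.toAdd
    rw [map_inv] at this
    rw [eq_mul_inv_of_mul_eq this.symm, inv_inv, ← mul_assoc, ← mul_assoc, mul_inv_cancel, one_mul]
    rfl
  obtain ⟨ψ, hψ⟩ := exists_addChar F
  have h1 := ρ.finrank_le_sum_wtSpace uQ (fun p : F × F × F => lam ψ p.1 p.2.1 p.2.2) (fun s => by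
    simp only [lam_apply, AddChar.map_add_eq_mul]
    simp only [Fintype.sum_prod_type, ← Finset.mul_sum, ← Finset.sum_mul]
    rw [sum_addChar hψ, sum_addChar hψ, sum_addChar hψ]
    have : s = 1 ↔ s.toAdd.1 = 0 ∧ s.toAdd.2.1 = 0 ∧ s.toAdd.2.2 = 0 := by
      rw [← toAdd_eq_zero, Prod.ext_iff, Prod.ext_iff]; rfl
    simp only [this]
    split_ifs <;> simp_all [Fintype.card_multiplicative]
    ring) ⊤ (fun _ _ _ => trivial)
  rw [finrank_top] at h1
  have h2 : ∀ p ∈ (Finset.univ : Finset (F × F × F)).erase 0,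
      Module.finrank ℂ (⊤ ⊓ ρ.wtSpace uQ (lam ψ p.1 p.2.1 p.2.2) : Submodule ℂ V) ≤
        Nat.card F + 1 := by
    intro p hp
    rw [top_inf_eq]
    refine finrank_lam_le hψ hρ hQ hQ' fun h => (Finset.ne_of_mem_erase hp) ?_
    exact Prod.ext h.1 (Prod.ext h.2.1 h.2.2)
  rw [← Finset.add_sum_erase _ _ (Finset.mem_univ (0 : F × F × F))] at h1
  have h3 : Module.finrank ℂ (⊤ ⊓ ρ.wtSpace uQ (lam ψ (0 : F × F × F).1 (0 : F × F × F).2.1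
      (0 : F × F × F).2.2) : Submodule ℂ V) = 0 := by
    have : lam ψ (0 : F × F × F).1 (0 : F × F × F).2.1 (0 : F × F × F).2.2 = 1 := by
      refine MonoidHom.ext fun x => ?_
      rw [lam_apply]; simp
    rw [this, hQ, inf_bot_eq, finrank_bot]
  rw [h3, zero_add] at h1
  refine h1.trans ((Finset.sum_le_card_nsmul _ _ _ h2).trans ?_)
  rw [Finset.card_erase_of_mem (Finset.mem_univ _), Finset.card_univ, Fintype.card_prod,
    Fintype.card_prod, ← Nat.card_eq_fintype_card, smul_eq_mul]
  set q := Nat.card F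
  calc (q * (q * q) - 1) * (q + 1) ≤ (q * (q * q)) * (q + 1) := Nat.mul_le_mul_right _ (Nat.sub_le _ _)
    _ ≤ (q + 1) ^ 2 * (q ^ 2 + 1) := by nlinarith [Nat.zero_le q]

end Sp4

/-! ### Irreducible representations containing a given weight. -/

namespace Representation

variable {G S : Type*} [Group G] [Group S] [Fintype G] [Fintype S]

open Classical in
/-- The coefficients of `wtProj` in the group algebra. -/
def wtCoeff (ι : S →* G) (χ : S →* ℂ) (g : G) : ℂ :=
  (Fintype.card S : ℂ)⁻¹ * ∑ s, if ι s = g then χ s⁻¹ else 0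

theorem sum_wtCoeff {V : Type*} [AddCommGroup V] [Module ℂ V] (ρ : Representation ℂ G V)
    (ι : S →* G) (χ : S →* ℂ) : ∑ g, wtCoeff ι χ g • ρ g = ρ.wtProj ι χ := by
  classical
  simp only [wtCoeff, wtProj, mul_smul, ← Finset.smul_sum, Finset.sum_smul]
  rw [Finset.sum_comm]
  congr 1
  refine Finset.sum_congr rfl fun s _ => ?_
  rw [Finset.sum_eq_single (ι s)]
  · simp
  · intro g _ hg
    simp [hg.symm]
  · simp

theorem wtCoeff_one {ι : S →* G} (hι : Function.Injective ι) (χ : S →* ℂ) :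
    wtCoeff ι χ 1 = (Fintype.card S : ℂ)⁻¹ := by
  rw [wtCoeff, Finset.sum_eq_single 1]
  · simp
  · intro s _ hs
    rw [if_neg]
    rwa [map_eq_one_iff ι hι]
  · simp

/-- The idempotent has coefficient 1/|S| at the identity, so it is nonzero in the group algebra and
acts nontrivially on some irreducible representation. This replaces constituents of an induced
representation. -/
theorem exists_irreducible_wtSpace_ne_bot {ι : S →* G} (hι : Function.Injective ι) (χ : S →* ℂ) :
    ∃ (n : ℕ) (ρ : Representation ℂ G (Fin n → ℂ)), ρ.IsIrreducible ∧ ρ.wtSpace ι χ ≠ ⊥ := by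
  obtain ⟨n, ρ, hρ, h⟩ := exists_irreducible_sum_smul_ne_zero (wtCoeff ι χ)
    (by rw [wtCoeff_one hι]; simp)
  refine ⟨n, ρ, hρ, fun h0 => h ?_⟩
  rw [sum_wtCoeff, ← LinearMap.range_eq_bot, range_wtProj, h0]

end Representation

/-! ### The Borel subgroup, the Bruhat decomposition, and torus characters under the Weyl group. -/

namespace Sp4

variable {F : Type*} [Field F] [CharP F 2]

variable (F) in
/-- The Borel subgroup of the Levi subgroup. -/
def borelLevi : Subgroup (Fˣ × SL2 F) where
  carrier := {l | l.2.c = 0}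
  one_mem' := by simp
  mul_mem' {l l'} h h' := by
    simp only [Set.mem_ofPred_eq] at h h' ⊢
    simp [h, h']
  inv_mem' {l} h := by
    simp only [Set.mem_ofPred_eq] at h ⊢
    simp [h]

theorem mem_borelLevi {l : Fˣ × SL2 F} : l ∈ borelLevi F ↔ l.2.c = 0 := Iff.rfl

variable (F) in
/-- The inclusion of the Borel subgroup of the Levi subgroup. -/
abbrev mB : borelLevi F →* Fˣ × SL2 F := (borelLevi F).subtype

theorem card_borelLevi_le [Finite F] :
    Nat.card (borelLevi F) ≤ (Nat.card F - 1) * ((Nat.card F - 1) * Nat.card F) := by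
  rw [← natCard_units, ← Nat.card_prod, ← Nat.card_prod]
  refine Nat.card_le_card_of_injective (fun l : borelLevi F =>
    (l.1.1, Units.mk0 l.1.2.a (fun h => by
      have := l.1.2.det
      rw [h, mem_borelLevi.1 l.2] at this; simp at this), l.1.2.b)) ?_
  rintro ⟨⟨c, h⟩, hl⟩ ⟨⟨c', h'⟩, hl'⟩ he
  simp only [Prod.mk.injEq, Units.mk0_inj] at he
  have hc := mem_borelLevi.1 hl
  have hc' := mem_borelLevi.1 hl'
  simp only at hc hc'
  have hd := h.det
  have hd' := h'.det
  rw [hc] at hd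
  rw [hc', ← he.2.1] at hd'
  have ha : h.a ≠ 0 := by intro h0; rw [h0] at hd; simp at hd
  have : h = h' := SL2.ext he.2.1 he.2.2 (hc.trans hc'.symm) (mul_left_cancel₀ ha (by
    linear_combination hd - hd'))
  rw [Subtype.mk.injEq, he.1, this]

/-- Linear characters of the Borel subgroup of the Levi subgroup. -/
def nuB (χ₁ χ₂ : MulChar F ℂ) : borelLevi F →* ℂ where
  toFun l := χ₁ (l.1.1 * l.1.2.a) * χ₂ (l.1.1 * l.1.2.d)
  map_one' := by simp
  map_mul' l l' := by
    have h := mem_borelLevi.1 l.2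
    have h' := mem_borelLevi.1 l'.2
    simp [h, h']
    ring

/-- Linear characters of the Borel subgroup. -/
def chB (χ₁ χ₂ : MulChar F ℂ) : SD (mB F) →* ℂ := cSD (mB F) 1 (nuB χ₁ χ₂) fun _ _ => rfl

theorem chB_apply (χ₁ χ₂ : MulChar F ℂ) (s : SD (mB F)) :
    chB χ₁ χ₂ s = χ₁ (s.right.1.1 * s.right.1.2.a) * χ₂ (s.right.1.1 * s.right.1.2.d) :=
  one_mul _

theorem iSD_mB_injective : Function.Injective (iSD (mB F)) :=
  iSD_injective _ (Subgroup.subtype_injective _)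

theorem uQ_mem_range (x : Multiplicative (F × F × F)) : uQ x ∈ (iSD (mB F)).range :=
  ⟨SemidirectProduct.inl x, iSD_inl _ x⟩

theorem levi_mem_range {l : Fˣ × SL2 F} (hl : l.2.c = 0) : levi l ∈ (iSD (mB F)).range :=
  ⟨SemidirectProduct.inr ⟨l, hl⟩, iSD_inr _ _⟩

theorem xx_mem_range (b : F) : xx b ∈ (iSD (mB F)).range := levi_mem_range rfl

theorem exists_iSD_eq_dT [Finite F] (d : Fˣ × Fˣ) : ∃ s : SD (mB F), iSD (mB F) s = dT d ∧
    ∀ χ₁ χ₂ : MulChar F ℂ, chB χ₁ χ₂ s = χ₁ d.1 * χ₂ d.2 := by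
  obtain ⟨c, a, h⟩ := exists_dT_eq_levi d
  refine ⟨SemidirectProduct.inr ⟨(c, SL2.diag a), rfl⟩, (iSD_inr _ _).trans h.symm, fun χ₁ χ₂ => ?_⟩
  have h1 := congrArg Subtype.val h
  rw [dT_coe, levi_coe, fromBlocks_inj] at h1
  have h2 := congrFun (congrFun h1.1 0) 0
  have h3 := congrFun (congrFun h1.1 1) 1
  simp [SL2.toMat] at h2 h3
  rw [chB_apply]
  simp only [SemidirectProduct.right_inr, SL2.diag_a, SL2.diag_d, Units.val_inv_eq_inv_val, h2, h3]

theorem dT_mem_range [Finite F] (d : Fˣ × Fˣ) : dT d ∈ (iSD (mB F)).range := by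
  obtain ⟨s, h, -⟩ := exists_iSD_eq_dT d
  exact ⟨s, h⟩

/-- Representatives of the Weyl group. -/
def IsWeyl (w : Sp 2 F) : Prop :=
  w = 1 ∨ w = sw ∨ w = jj F ∨ w = jj F * sw ∨ w = rr F ∨ w = rr F * sw ∨ w = sw * rr F ∨
    w = sw * rr F * sw

/-- The Bruhat decomposition. -/
theorem bruhat [Finite F] (g : Sp 2 F) : ∃ s ∈ (iSD (mB F)).range, ∃ t ∈ (iSD (mB F)).range,
    ∃ w, IsWeyl w ∧ g = s * w * t := by
  by_cases h0 : g.1.toBlocks₂₁ = 0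
  · obtain ⟨x, l, rfl⟩ := eq_uQ_mul_levi g h0
    obtain ⟨b, d, b', h | h⟩ := levi_bruhat l <;> rw [h]
    · exact ⟨uQ x * xx b, mul_mem (uQ_mem_range x) (xx_mem_range b), dT d * xx b',
        mul_mem (dT_mem_range d) (xx_mem_range b'), 1, Or.inl rfl, by simp only [mul_assoc, one_mul]⟩
    · exact ⟨uQ x * xx b, mul_mem (uQ_mem_range x) (xx_mem_range b), dT d * xx b',
        mul_mem (dT_mem_range d) (xx_mem_range b'), sw, Or.inr (Or.inl rfl), by simp only [mul_assoc]⟩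
  by_cases h1 : g.1.toBlocks₂₁.det = 0
  · obtain ⟨x, l, l', y, rfl⟩ := eq_uQ_mul_rr g h1 h0
    obtain ⟨x', y', b, b', d, w, w', hw, hw', he⟩ := rr_cell l l'
    refine ⟨uQ x * uQ x' * xx b, mul_mem (mul_mem (uQ_mem_range x) (uQ_mem_range x')) (xx_mem_range b),
      dT d * xx b' * uQ y' * uQ y, mul_mem (mul_mem (mul_mem (dT_mem_range d) (xx_mem_range b'))
      (uQ_mem_range y')) (uQ_mem_range y), w * rr F * w', ?_, by rw [he]; simp only [mul_assoc]⟩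
    rcases hw with rfl | rfl <;> rcases hw' with rfl | rfl <;> simp [IsWeyl]
  · obtain ⟨x, l, y, rfl⟩ := eq_uQ_mul_jj g h1
    obtain ⟨b, d, b', h | h⟩ := jj_levi_bruhat l <;> rw [h]
    · exact ⟨uQ x * xx b, mul_mem (uQ_mem_range x) (xx_mem_range b), dT d * xx b' * uQ y,
        mul_mem (mul_mem (dT_mem_range d) (xx_mem_range b')) (uQ_mem_range y), jj F,
        by simp [IsWeyl], by simp only [mul_assoc]⟩
    · exact ⟨uQ x * xx b, mul_mem (uQ_mem_range x) (xx_mem_range b), dT d * xx b' * uQ y,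
        mul_mem (mul_mem (dT_mem_range d) (xx_mem_range b')) (uQ_mem_range y), jj F * sw,
        by simp [IsWeyl], by simp only [mul_assoc]⟩

variable [Finite F]
variable {V : Type*} [AddCommGroup V] [Module ℂ V] (ρ : Representation ℂ (Sp 2 F) V)

/-- Vanishing of `sandwich` on a Bruhat cell. -/
theorem sandwich_eq_zero_of_dT [Fintype (SD (mB F))] {χ₁ χ₂ : MulChar F ℂ} {w : Sp 2 F}
    {d d' : Fˣ × Fˣ} (h : dT d * w = w * dT d') (hne : χ₁ d.1 * χ₂ d.2 ≠ χ₁ d'.1 * χ₂ d'.2) :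
    ρ.sandwich (iSD (mB F)) (chB χ₁ χ₂) w = 0 := by
  obtain ⟨s, hs, hs'⟩ := exists_iSD_eq_dT d
  obtain ⟨t, ht, ht'⟩ := exists_iSD_eq_dT d'
  refine ρ.sandwich_eq_zero (s := s) (t := t) ?_ ?_
  · rw [hs, ht, h]
  · rwa [hs', ht']

omit [Finite F] in
theorem dT_mul_weyl (t t' : Fˣ) :
    dT (t, t') * (jj F * sw) = jj F * sw * dT (t'⁻¹, t⁻¹) ∧
    dT (t, t') * (rr F * sw) = rr F * sw * dT (t'⁻¹, t) ∧
    dT (t, t') * (sw * rr F) = sw * rr F * dT (t', t⁻¹) ∧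
    dT (t, t') * (sw * rr F * sw) = sw * rr F * sw * dT (t⁻¹, t') := by
  refine ⟨?_, ?_, ?_, ?_⟩
  · rw [← mul_assoc, dT_mul_jj, Prod.inv_mk, mul_assoc, dT_mul_sw, mul_assoc]
  · rw [← mul_assoc, dT_mul_rr, mul_assoc, dT_mul_sw, mul_assoc]
  · rw [← mul_assoc, dT_mul_sw, mul_assoc, dT_mul_rr, mul_assoc]
  · rw [← mul_assoc, ← mul_assoc, dT_mul_sw, mul_assoc sw, dT_mul_rr, ← mul_assoc, mul_assoc (sw * rr F),
      dT_mul_sw, ← mul_assoc]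

/-- The torus character (χ, χ²) is moved by every nontrivial Weyl element: this needs χ, χ², χ³ and
χ⁴ to be nontrivial at t, which the two hypotheses give. So only the trivial cell survives. -/
theorem sandwich_weyl_eq_zero [Fintype (SD (mB F))] {χ : MulChar F ℂ} {t : Fˣ}
    (h3 : χ t ^ 3 ≠ 1) (h4 : χ t ^ 4 ≠ 1) {w : Sp 2 F} (hw : IsWeyl w) (hw1 : w ≠ 1) :
    ρ.sandwich (iSD (mB F)) (chB χ (χ ^ 2)) w = 0 := by
  have h0 : χ t ≠ 0 := (t.isUnit.map χ).ne_zero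
  have h1 : χ t ≠ 1 := fun h => h3 (by rw [h, one_pow])
  have h2 : χ t ^ 2 ≠ 1 := fun h => h4 (by rw [show 4 = 2 * 2 from rfl, pow_mul, h, one_pow])
  have hi : χ ((t⁻¹ : Fˣ) : F) = (χ t)⁻¹ :=
    eq_inv_of_mul_eq_one_left (by rw [← map_mul]; simp)
  have k1 : χ t ≠ χ t ^ 2 := fun h => h1 (mul_left_cancel₀ h0 (by linear_combination -h))
  have k2 : χ t ≠ (χ t)⁻¹ := fun h => h2 (by field_simp at h; exact h)
  have k3 : χ t ≠ (χ t)⁻¹ ^ 2 := fun h => h3 (by field_simp at h; exact h)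
  have k4 : χ t ^ 2 ≠ (χ t)⁻¹ ^ 2 := fun h => h4 (by field_simp at h; exact h)
  rcases hw with rfl | rfl | rfl | rfl | rfl | rfl | rfl | rfl
  · exact absurd rfl hw1
  · refine sandwich_eq_zero_of_dT ρ (dT_mul_sw t 1) ?_
    simpa only [MulChar.pow_apply_coe, Units.val_one, map_one, one_pow, mul_one, one_mul] using k1
  · refine sandwich_eq_zero_of_dT ρ (dT_mul_jj (t, 1)) ?_
    simpa only [MulChar.pow_apply_coe, Units.val_one, map_one, one_pow, mul_one, one_mul, Prod.inv_mk,
      inv_one, hi] using k2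
  · refine sandwich_eq_zero_of_dT ρ (dT_mul_weyl t 1).1 ?_
    simpa only [MulChar.pow_apply_coe, Units.val_one, map_one, one_pow, mul_one, one_mul,
      inv_one, hi] using k3
  · refine sandwich_eq_zero_of_dT ρ (dT_mul_rr 1 t) ?_
    simpa only [MulChar.pow_apply_coe, Units.val_one, map_one, one_pow, mul_one, one_mul,
      inv_one, hi] using k4
  · refine sandwich_eq_zero_of_dT ρ (dT_mul_weyl t 1).2.1 ?_
    simpa only [MulChar.pow_apply_coe, Units.val_one, map_one, one_pow, mul_one, one_mul,
      inv_one, hi] using k1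
  · refine sandwich_eq_zero_of_dT ρ (dT_mul_weyl t 1).2.2.1 ?_
    simpa only [MulChar.pow_apply_coe, Units.val_one, map_one, one_pow, mul_one, one_mul,
      inv_one, hi] using k3
  · refine sandwich_eq_zero_of_dT ρ (dT_mul_weyl t 1).2.2.2 ?_
    simpa only [MulChar.pow_apply_coe, Units.val_one, map_one, one_pow, mul_one, one_mul,
      inv_one, hi] using k2

/-- The character (χ, 1) is fixed only by the reflection `rr`, which lies in the stabiliser of the
line. -/
theorem sandwich_weyl_eq_zero' [Fintype (SD (mB F))] {χ : MulChar F ℂ} {t : Fˣ}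
    (h2 : χ t ^ 2 ≠ 1) {w : Sp 2 F} (hw : IsWeyl w) (hw1 : w ≠ 1) (hw2 : w ≠ rr F) :
    ρ.sandwich (iSD (mB F)) (chB χ 1) w = 0 := by
  have h0 : χ t ≠ 0 := (t.isUnit.map χ).ne_zero
  have h1 : χ t ≠ 1 := fun h => h2 (by rw [h, one_pow])
  have hi : χ ((t⁻¹ : Fˣ) : F) = (χ t)⁻¹ :=
    eq_inv_of_mul_eq_one_left (by rw [← map_mul]; simp)
  have k2 : χ t ≠ (χ t)⁻¹ := fun h => h2 (by field_simp at h; exact h)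
  rcases hw with rfl | rfl | rfl | rfl | rfl | rfl | rfl | rfl
  · exact absurd rfl hw1
  · refine sandwich_eq_zero_of_dT ρ (dT_mul_sw t 1) ?_
    simpa only [MulChar.one_apply_coe, Units.val_one, map_one, mul_one] using h1
  · refine sandwich_eq_zero_of_dT ρ (dT_mul_jj (t, 1)) ?_
    simpa only [MulChar.one_apply_coe, mul_one, Prod.inv_mk, hi] using k2
  · refine sandwich_eq_zero_of_dT ρ (dT_mul_weyl t 1).1 ?_
    simpa only [MulChar.one_apply_coe, Units.val_one, map_one, mul_one, inv_one] using h1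
  · exact absurd rfl hw2
  · refine sandwich_eq_zero_of_dT ρ (dT_mul_weyl t 1).2.1 ?_
    simpa only [MulChar.one_apply_coe, Units.val_one, map_one, mul_one, inv_one] using h1
  · refine sandwich_eq_zero_of_dT ρ (dT_mul_weyl t 1).2.2.1 ?_
    simpa only [MulChar.one_apply_coe, Units.val_one, map_one, mul_one, inv_one] using h1
  · refine sandwich_eq_zero_of_dT ρ (dT_mul_weyl t 1).2.2.2 ?_
    simpa only [MulChar.one_apply_coe, mul_one, hi] using k2

end Sp4

namespace Representation

theorem wtProj_mul_apply {G S V : Type*} [Group G] [Group S] [AddCommGroup V] [Module ℂ V] [Fintype S]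
    (ρ : Representation ℂ G V) {ι : S →* G} {χ : S →* ℂ} {w : V} (hw : w ∈ ρ.wtSpace ι χ) (g h : G) :
    (ρ.wtProj ι χ * ρ g) (ρ h w) = ρ.sandwich ι χ (g * h) w := by
  rw [sandwich_apply_of_mem _ _ _ hw, map_mul]
  rfl

end Representation

theorem MulChar.exists_apply_eq (F : Type*) [Field F] [Finite F] : ∃ (χ : MulChar F ℂ) (t : Fˣ),
    ∀ k : ℕ, χ t ^ k = 1 ↔ (Nat.card F - 1) ∣ k := by
  classical
  have := Fintype.ofFinite F
  obtain ⟨t, ht⟩ := IsCyclic.exists_generator (α := Fˣ)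
  have hn : Fintype.card Fˣ ≠ 0 := Fintype.card_ne_zero
  have hζ := Complex.isPrimitiveRoot_exp _ hn
  have hu := (hζ.isUnit hn)
  have hmem : hu.unit ∈ rootsOfUnity (Fintype.card Fˣ) ℂ := by
    rw [mem_rootsOfUnity]
    exact Units.ext (by simpa using hζ.pow_eq_one)
  refine ⟨MulChar.ofRootOfUnity hmem ht, t, fun k => ?_⟩
  rw [MulChar.ofRootOfUnity_spec, IsUnit.unit_spec, hζ.pow_eq_one_iff_dvd, Fintype.card_units,
    Nat.card_eq_fintype_card]

/-! ### The principal series of degree (q + 1)²(q² + 1). -/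

namespace Sp4

variable {F : Type*} [Field F] [CharP F 2] [Finite F]

theorem card_range_le : Nat.card (iSD (mB F)).range ≤
    Nat.card F ^ 3 * ((Nat.card F - 1) * ((Nat.card F - 1) * Nat.card F)) := by
  rw [← Nat.card_congr (MonoidHom.ofInjective (iSD_mB_injective (F := F))).toEquiv,
    Nat.card_congr (SemidirectProduct.equivProd (φ := actHom.comp (mB F))), Nat.card_prod,
    Nat.card_congr Multiplicative.toAdd, Nat.card_prod, Nat.card_prod]
  calc _ ≤ Nat.card F * (Nat.card F * Nat.card F) * _ := Nat.mul_le_mul_left _ card_borelLevi_le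
    _ = _ := by ring

theorem le_card_quotient : (Nat.card F + 1) ^ 2 * (Nat.card F ^ 2 + 1) ≤
    Nat.card (Sp 2 F ⧸ (iSD (mB F)).range) := by
  have h1 := Subgroup.card_eq_card_quotient_mul_card_subgroup (iSD (mB F)).range
  have h2 := card_range_le (F := F)
  rw [natCard] at h1
  obtain ⟨k, hk⟩ : ∃ k, Nat.card F = k + 2 := ⟨_, (Nat.sub_add_cancel two_le_card).symm⟩
  rw [hk] at h1 h2 ⊢
  have e4 : (k + 2) ^ 4 - 1 = (k + 1) * ((k + 3) * ((k + 2) ^ 2 + 1)) := by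
    rw [Nat.sub_eq_iff_eq_add (Nat.one_le_pow _ _ (by omega))]; ring
  have e2 : (k + 2) ^ 2 - 1 = (k + 1) * (k + 3) := by
    rw [Nat.sub_eq_iff_eq_add (Nat.one_le_pow _ _ (by omega))]; ring
  have e1 : k + 2 - 1 = k + 1 := rfl
  rw [e4, e2] at h1
  rw [e1] at h2
  have hpos : 0 < (k + 2) ^ 3 * ((k + 1) * ((k + 1) * (k + 2))) := by positivity
  refine Nat.le_of_mul_le_mul_right ?_ hpos
  calc _ = (k + 1) * ((k + 3) * ((k + 2) ^ 2 + 1)) * ((k + 2) ^ 3 * ((k + 2) * ((k + 1) * (k + 3)))) := by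
        ring
    _ = _ := h1
    _ ≤ _ := Nat.mul_le_mul_left _ h2

/-- For `q ≥ 8` there is an irreducible representation of degree at least `(q + 1)² (q² + 1)`. -/
theorem exists_le_finrank (hq : 6 ≤ Nat.card F) :
    ∃ (n : ℕ) (ρ : Representation ℂ (Sp 2 F) (Fin n → ℂ)), ρ.IsIrreducible ∧
      (Nat.card F + 1) ^ 2 * (Nat.card F ^ 2 + 1) ≤ n := by
  classical
  have := Fintype.ofFinite (Sp 2 F)
  have := Fintype.ofFinite (SD (mB F))
  obtain ⟨χ, t, ht⟩ := MulChar.exists_apply_eq F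
  -- Here χ t is a primitive root of unity of order q − 1 ≥ 5.
  have h3 : χ t ^ 3 ≠ 1 := fun h => absurd (Nat.le_of_dvd (by norm_num) ((ht 3).1 h)) (by omega)
  have h4 : χ t ^ 4 ≠ 1 := fun h => absurd (Nat.le_of_dvd (by norm_num) ((ht 4).1 h)) (by omega)
  obtain ⟨n, ρ, hρ, hne⟩ := Representation.exists_irreducible_wtSpace_ne_bot
    (iSD_mB_injective (F := F)) (chB χ (χ ^ 2))
  refine ⟨n, ρ, hρ, ?_⟩
  obtain ⟨w, hw, hw0⟩ := (Submodule.ne_bot_iff _).1 hne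
  have hkill : ∀ g ∉ (iSD (mB F)).range, ρ.sandwich (iSD (mB F)) (chB χ (χ ^ 2)) g = 0 := by
    intro g hg
    obtain ⟨_, ⟨s, rfl⟩, _, ⟨t, rfl⟩, w, hw, rfl⟩ := bruhat g
    rw [ρ.sandwich_mul, sandwich_weyl_eq_zero ρ h3 h4 hw, smul_zero]
    rintro rfl
    exact hg (mul_mem (mul_mem ⟨s, rfl⟩ (one_mem _)) ⟨t, rfl⟩)
  have := Fintype.ofFinite (Sp 2 F ⧸ (iSD (mB F)).range)
  -- Sandwiches vanish off the Borel subgroup, so the translates of w along its cosets have the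
  -- identity as Gram matrix and are independent.
  have h := Representation.card_le_finrank_of_gram
    (fun j : Sp 2 F ⧸ (iSD (mB F)).range => ρ j.out w)
    (fun i => ρ.wtProj (iSD (mB F)) (chB χ (χ ^ 2)) * ρ i.out⁻¹) hw0 (1 : Matrix _ _ ℂ) (by simp) (fun i j => by
      rw [ρ.wtProj_mul_apply hw]
      by_cases hij : i = j
      · subst hij
        rw [inv_mul_cancel, Matrix.one_apply_eq, one_smul, ρ.sandwich_apply_of_mem _ _ hw]
        simp [Representation.wtProj_of_mem hw]
      · rw [hkill, Matrix.one_apply_ne hij]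
        · simp
        · intro hmem
          apply hij
          rw [← QuotientGroup.out_eq' i, ← QuotientGroup.out_eq' j]
          exact QuotientGroup.eq.2 hmem)
  rw [Module.finrank_fin_fun, ← Nat.card_eq_fintype_card] at h
  exact le_card_quotient.trans h

/-! ### The stabiliser of a line: its linear characters, order and index. -/

theorem smul_smul_vec (g : Sp 2 F) (c : F) (v : Fin 2 ⊕ Fin 2 → F) : g • (c • v) = c • (g • v) :=
  mulVec_smul _ _ _

variable (F) in
/-- The stabiliser of a line. -/
def lineStab : Subgroup (Sp 2 F) where
  carrier := {g | ∃ c : F, g • e1 F = c • e1 F}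
  one_mem' := ⟨1, by simp⟩
  mul_mem' := by
    rintro g h ⟨c, hg⟩ ⟨d, hh⟩
    exact ⟨d * c, by rw [mul_smul, hh, smul_smul_vec, hg, smul_smul]⟩
  inv_mem' := by
    rintro g ⟨c, hg⟩
    have hc : c ≠ 0 := by
      rintro rfl
      rw [zero_smul] at hg
      refine e1_ne_zero (F := F) ?_
      rw [← inv_smul_smul g (e1 F), hg]
      exact mulVec_zero _
    refine ⟨c⁻¹, ?_⟩
    rw [inv_smul_eq_iff, smul_smul_vec, hg, smul_smul, inv_mul_cancel₀ hc, one_smul]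

theorem lineStab_apply {g : Sp 2 F} {c : F} (h : g • e1 F = c • e1 F) : g.1 (Sum.inl 0) (Sum.inl 0) = c := by
  have := congrFun h (Sum.inl 0)
  rw [smul_e1] at this
  simpa [e1] using this

theorem mem_lineStab_apply {g : Sp 2 F} (h : g ∈ lineStab F) {i : Fin 2 ⊕ Fin 2} (hi : i ≠ Sum.inl 0) :
    g.1 i (Sum.inl 0) = 0 := by
  obtain ⟨c, h⟩ := h
  have := congrFun h i
  rw [smul_e1] at this
  simpa [e1, hi] using this

/-- Linear characters of the stabiliser of a line. -/
def chLine (χ : MulChar F ℂ) : lineStab F →* ℂ where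
  toFun g := χ (g.1.1 (Sum.inl 0) (Sum.inl 0))
  map_one' := by simp
  map_mul' := by
    rintro ⟨g, c, hg⟩ ⟨h, d, hh⟩
    have h1 : (g * h) • e1 F = (c * d) • e1 F := by
      rw [mul_smul, hh, smul_smul_vec, hg, smul_smul, mul_comm]
    simp only [Subgroup.coe_mul]
    change χ ((g * h).1 _ _) = _
    rw [lineStab_apply h1, lineStab_apply hg, lineStab_apply hh, map_mul]

theorem iSD_smul_e1 (s : SD (mB F)) :
    iSD (mB F) s • e1 F = ((s.right.1.1 : F) * s.right.1.2.a) • e1 F := by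
  have hc := mem_borelLevi.1 s.right.2
  rw [smul_e1, iSD_apply, uQ_mul_levi_coe]
  ext (i | i) <;> fin_cases i <;> simp [e1, SL2.toMat, hc]

theorem iSD_mem_lineStab (s : SD (mB F)) : iSD (mB F) s ∈ lineStab F := ⟨_, iSD_smul_e1 s⟩

theorem chLine_iSD (χ : MulChar F ℂ) (s : SD (mB F)) :
    chLine χ ⟨iSD (mB F) s, iSD_mem_lineStab s⟩ = chB χ 1 s := by
  have hd := s.right.1.2.det
  rw [mem_borelLevi.1 s.right.2] at hd
  have hu : IsUnit ((s.right.1.1 : F) * s.right.1.2.d) := by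
    refine (s.right.1.1.isUnit).mul (isUnit_iff_ne_zero.2 fun h => ?_)
    rw [h] at hd; simp at hd
  rw [chB_apply, MulChar.one_apply hu, mul_one]
  exact congrArg χ (lineStab_apply (iSD_smul_e1 s))

theorem rr_smul_e1 : rr F • e1 F = (1 : F) • e1 F := by
  rw [smul_e1, rr_coe]
  ext (i | i) <;> fin_cases i <;> simp [e1]

theorem eq_of_mem_lineStab {w : Sp 2 F} (hw : IsWeyl w) (h : w ∈ lineStab F) : w = 1 ∨ w = rr F := by
  have h1 := mem_lineStab_apply h (i := Sum.inl 1) (by simp)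
  have h2 := mem_lineStab_apply h (i := Sum.inr 0) (by simp)
  have h3 := mem_lineStab_apply h (i := Sum.inr 1) (by simp)
  rcases hw with rfl | rfl | rfl | rfl | rfl | rfl | rfl | rfl
  · exact Or.inl rfl
  · simp [sw_coe] at h1
  · simp [jj_coe] at h2
  · simp [jj_coe, sw_coe, fromBlocks_multiply] at h3
  · exact Or.inr rfl
  · simp [rr_coe, sw_coe, fromBlocks_multiply] at h3
  · simp [rr_coe, sw_coe, fromBlocks_multiply] at h1
  · simp [rr_coe, sw_coe, fromBlocks_multiply] at h2

theorem card_lineStab : Nat.card (lineStab F) = Nat.card F ^ 3 *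
    ((Nat.card F - 1) * (Nat.card F * (Nat.card F ^ 2 - 1))) := by
  have h1 : Nat.card (Multiplicative (F × F × F) × (Fˣ × SL2 F)) =
      Nat.card F ^ 3 * ((Nat.card F - 1) * (Nat.card F * (Nat.card F ^ 2 - 1))) := by
    rw [Nat.card_prod, Nat.card_prod, natCard_units, SL2.natCard,
      Nat.card_congr Multiplicative.toAdd, Nat.card_prod, Nat.card_prod]; ring
  have h2 : ∀ p : Multiplicative (F × F × F) × (Fˣ × SL2 F),
      (uQ' p.1 * levi' p.2) • e1 F = (p.2.1 : F) • e1 F := by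
    rintro ⟨⟨b, s, t⟩, l⟩
    have := uQ'_mul_levi'_coe b s t l
    rw [smul_e1]
    ext (i | i) <;> fin_cases i <;> erw [this] <;> simp [e1]
  let f : Multiplicative (F × F × F) × (Fˣ × SL2 F) → lineStab F :=
    fun p => ⟨uQ' p.1 * levi' p.2, (p.2.1 : F), h2 p⟩
  have hf : ∀ p, (f p).1 = uQ' p.1 * levi' p.2 := fun p => rfl
  have hinj : Function.Injective f := by
    intro p p' h
    have h3 := congrArg Subtype.val h
    rw [hf, hf] at h3
    exact uQ'_mul_levi'_injective h3
  suffices hsurj : Function.Surjective f by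
    rw [← h1]
    exact (Nat.card_congr (Equiv.ofBijective f ⟨hinj, hsurj⟩)).symm
  rintro ⟨g, c, hg⟩
  have hc : c ≠ 0 := by
    rintro rfl
    rw [zero_smul] at hg
    refine e1_ne_zero (F := F) ?_
    rw [← inv_smul_smul g (e1 F), hg]
    exact mulVec_zero _
  have h3 : levi' (Units.mk0 c hc, 1) • e1 F = c • e1 F := by
    simpa using h2 (1, (Units.mk0 c hc, 1))
  obtain ⟨x, h, hx⟩ := mem_stabilizer_e1 (g * (levi' (Units.mk0 c hc, 1))⁻¹) (by
    have : (levi' (Units.mk0 c hc, 1))⁻¹ • e1 F = c⁻¹ • e1 F := by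
      rw [inv_smul_eq_iff, smul_smul_vec, h3, smul_smul, inv_mul_cancel₀ hc, one_smul]
    rw [mul_smul, this, smul_smul_vec, hg, smul_smul, inv_mul_cancel₀ hc, one_smul])
  refine ⟨(x, (Units.mk0 c hc, h)), Subtype.ext ?_⟩
  rw [hf]
  rw [mul_inv_eq_iff_eq_mul, mul_assoc, ← map_mul] at hx
  simp only [hx, Prod.mk_mul_mk, one_mul, mul_one]

theorem card_range_mul_le : (Nat.card F + 1) * Nat.card (iSD (mB F)).range ≤
    Nat.card (lineStab F) := by
  have h2 := card_range_le (F := F)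
  rw [card_lineStab]
  obtain ⟨k, hk⟩ : ∃ k, Nat.card F = k + 2 := ⟨_, (Nat.sub_add_cancel two_le_card).symm⟩
  rw [hk] at h2 ⊢
  have e2 : (k + 2) ^ 2 - 1 = (k + 1) * (k + 3) := by
    rw [Nat.sub_eq_iff_eq_add (Nat.one_le_pow _ _ (by omega))]; ring
  have e1 : k + 2 - 1 = k + 1 := rfl
  rw [e1] at h2
  rw [e1, e2]
  exact (Nat.mul_le_mul_left _ h2).trans (le_of_eq (by ring))

theorem card_quotient_lineStab : Nat.card (Sp 2 F ⧸ lineStab F) =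
    (Nat.card F + 1) * (Nat.card F ^ 2 + 1) := by
  have h1 := Subgroup.card_eq_card_quotient_mul_card_subgroup (lineStab F)
  rw [natCard, card_lineStab] at h1
  obtain ⟨k, hk⟩ : ∃ k, Nat.card F = k + 2 := ⟨_, (Nat.sub_add_cancel two_le_card).symm⟩
  rw [hk] at h1 ⊢
  have e4 : (k + 2) ^ 4 - 1 = (k + 1) * ((k + 3) * ((k + 2) ^ 2 + 1)) := by
    rw [Nat.sub_eq_iff_eq_add (Nat.one_le_pow _ _ (by omega))]; ring
  have e2 : (k + 2) ^ 2 - 1 = (k + 1) * (k + 3) := by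
    rw [Nat.sub_eq_iff_eq_add (Nat.one_le_pow _ _ (by omega))]; ring
  have e1 : k + 2 - 1 = k + 1 := rfl
  rw [e4, e2, e1] at h1
  have hpos : 0 < (k + 2) ^ 3 * ((k + 1) * ((k + 2) * ((k + 1) * (k + 3)))) := by positivity
  refine Nat.eq_of_mul_eq_mul_right hpos (h1.symm.trans ?_)
  ring

end Sp4

/-- The matrix is block diagonal with blocks (1 + a)·1 − a·(all ones), whose eigenvalues are 1 + a
and 1 + a − |X| a. -/
theorem Matrix.det_block_ne_zero {I X : Type*} [Fintype I] [Fintype X] [DecidableEq I] [DecidableEq X]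
    {a : ℂ} (h1 : 1 + a ≠ 0) (h2 : 1 + a - Fintype.card X * a ≠ 0) :
    (Matrix.of fun i j : I × X => if i.1 = j.1 then (if i.2 = j.2 then 1 else -a) else 0).det ≠ 0 := by
  intro h0
  obtain ⟨v, hv, hv'⟩ := Matrix.exists_mulVec_eq_zero_iff.2 h0
  apply hv
  have h3 : ∀ i x, (1 + a) * v (i, x) = a * ∑ y, v (i, y) := by
    intro i x
    have h4 := congrFun hv' (i, x)
    simp only [mulVec, dotProduct, of_apply, Pi.zero_apply, Fintype.sum_prod_type] at h4
    rw [Finset.sum_eq_single i] at h4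
    · simp only [if_true] at h4
      have h5 : ∀ y, (if x = y then (1 : ℂ) else -a) * v (i, y) =
          (if x = y then (1 + a) * v (i, y) else 0) - a * v (i, y) := by
        intro y
        split_ifs <;> ring
      simp only [h5, Finset.sum_sub_distrib, ← Finset.mul_sum, Finset.sum_ite_eq, Finset.mem_univ,
        if_true] at h4
      exact sub_eq_zero.1 h4
    · intro j _ hj
      simp [hj.symm]
    · simp
  have h6 : ∀ i, ∑ y, v (i, y) = 0 := by
    intro i
    have h7 : ∑ y, (1 + a) * v (i, y) = ∑ _y : X, a * ∑ y, v (i, y) :=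
      Finset.sum_congr rfl fun x _ => h3 i x
    rw [← Finset.mul_sum, Finset.sum_const, Finset.card_univ, nsmul_eq_mul] at h7
    have h8 : (1 + a - Fintype.card X * a) * ∑ y, v (i, y) = 0 := by linear_combination h7
    exact (mul_eq_zero.1 h8).resolve_left h2
  ext ⟨i, x⟩
  have h9 := h3 i x
  rw [h6, mul_zero] at h9
  exact (mul_eq_zero.1 h9).resolve_left h1

/-! ### A representation of degree at least q(q + 1)(q² + 1). -/

namespace Sp4

variable {F : Type*} [Field F] [CharP F 2] [Finite F]

theorem exists_eq_of_mem_lineStab {g : Sp 2 F} (hg : g ∈ lineStab F) (h : g ∉ (iSD (mB F)).range) :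
    ∃ s t, g = iSD (mB F) s * rr F * iSD (mB F) t := by
  obtain ⟨_, ⟨s, rfl⟩, _, ⟨t, rfl⟩, w, hw, rfl⟩ := bruhat g
  have h1 : w ∈ lineStab F := by
    rwa [Subgroup.mul_mem_cancel_right _ (iSD_mem_lineStab t),
      Subgroup.mul_mem_cancel_left _ (iSD_mem_lineStab s)] at hg
  rcases eq_of_mem_lineStab hw h1 with rfl | rfl
  · have hmem : iSD (mB F) s * 1 * iSD (mB F) t ∈ (iSD (mB F)).range :=
      mul_mem (mul_mem ⟨s, rfl⟩ (one_mem _)) ⟨t, rfl⟩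
    exact absurd hmem h
  · exact ⟨s, t, rfl⟩

theorem rr_mem_lineStab : rr F ∈ lineStab F := ⟨1, rr_smul_e1⟩

theorem range_le_lineStab : (iSD (mB F)).range ≤ lineStab F := by
  rintro _ ⟨s, rfl⟩
  exact iSD_mem_lineStab s

theorem rr_zz_rr_coe (x : F) : (rr F * qq 0 0 x * rr F).1 (Sum.inr 1) (Sum.inl 1) = x := by
  simp [rr_coe, qq_coe, fromBlocks_multiply]

theorem rr_zz_rr_not_mem {x : F} (hx : x ≠ 0) : rr F * qq 0 0 x * rr F ∉ (iSD (mB F)).range := by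
  rintro ⟨s, hs⟩
  apply hx
  rw [← rr_zz_rr_coe x, ← hs, iSD_apply, uQ_mul_levi_coe]
  rfl

theorem rr_zz_rr_smul (x : F) : (rr F * qq 0 0 x * rr F) • e1 F = (1 : F) • e1 F := by
  rw [smul_e1]
  ext (i | i) <;> fin_cases i <;> simp [rr_coe, qq_coe, fromBlocks_multiply, e1]

/-- There is an irreducible representation of degree at least `q (q + 1) (q² + 1)`. -/
theorem exists_le_finrank' (hq : 4 ≤ Nat.card F) :
    ∃ (n : ℕ) (ρ : Representation ℂ (Sp 2 F) (Fin n → ℂ)), ρ.IsIrreducible ∧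
      Nat.card F * ((Nat.card F + 1) * (Nat.card F ^ 2 + 1)) ≤ n := by
  classical
  have := Fintype.ofFinite F
  have := Fintype.ofFinite (Sp 2 F)
  have := Fintype.ofFinite (SD (mB F))
  have := Fintype.ofFinite (lineStab F)
  obtain ⟨χ, t, ht⟩ := MulChar.exists_apply_eq F
  have h2 : χ t ^ 2 ≠ 1 := fun h => absurd (Nat.le_of_dvd (by norm_num) ((ht 2).1 h)) (by omega)
  set ι := iSD (mB F)
  set θ := chB χ 1
  set κ := (lineStab F).subtype
  set η := chLine χ
  have hcard := card_range_mul_le (F := F)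
  have hcS : Nat.card ι.range = Fintype.card (SD (mB F)) := by
    rw [← Nat.card_eq_fintype_card]
    exact Nat.card_congr (MonoidHom.ofInjective (iSD_mB_injective (F := F))).toEquiv.symm
  have hpos : 0 < Nat.card ι.range := Nat.card_pos
  have hlt : Nat.card ι.range < Nat.card (lineStab F) := by nlinarith
  -- Let B be the Borel subgroup and P the stabiliser of the line. The difference of their
  -- idempotents for matching characters has coefficient 1/|B| − 1/|P| at 1, hence is nonzero
  -- somewhere. Its image there consists of weight vectors for B killed by the idempotent of P: this
  -- selects the Steinberg rather than the linear character on the Levi subgroup of P.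
  obtain ⟨n, ρ, hρ, hne⟩ := exists_irreducible_sum_smul_ne_zero
    (fun g => Representation.wtCoeff ι θ g - Representation.wtCoeff κ η g) (by
      rw [Representation.wtCoeff_one iSD_mB_injective,
        Representation.wtCoeff_one (Subgroup.subtype_injective _), sub_ne_zero, ← hcS,
        ← Nat.card_eq_fintype_card]
      intro h
      rw [_root_.inv_inj, Nat.cast_inj] at h
      omega)
  refine ⟨n, ρ, hρ, ?_⟩
  replace hne : ρ.wtProj ι θ - ρ.wtProj κ η ≠ 0 := by
    rw [← Representation.sum_wtCoeff, ← Representation.sum_wtCoeff, ← Finset.sum_sub_distrib]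
    refine fun h => hne (h ▸ Finset.sum_congr rfl fun g _ => LinearMap.ext fun v => ?_)
    exact sub_smul (Representation.wtCoeff ι θ g) (Representation.wtCoeff κ η g) (ρ g v)
  obtain ⟨v, hv⟩ : ∃ v, (ρ.wtProj ι θ - ρ.wtProj κ η) v ≠ 0 := by
    by_contra hcon
    push Not at hcon
    exact hne (LinearMap.ext hcon)
  set w := (ρ.wtProj ι θ - ρ.wtProj κ η) v with hw_def
  have hθη : ∀ s, η ⟨ι s, iSD_mem_lineStab s⟩ = θ s := chLine_iSD χ
  have hw : w ∈ ρ.wtSpace ι θ := by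
    refine Submodule.sub_mem _ (ρ.wtProj_mem ι θ v) fun s => ?_
    have := ρ.wtProj_mem κ η v ⟨ι s, iSD_mem_lineStab s⟩
    rwa [hθη] at this
  have hPw : ρ.wtProj κ η w = 0 := by
    have h3 : ρ.wtProj κ η * ρ.wtProj ι θ = ρ.wtProj κ η := by
      have h4 : ∀ s, ρ.wtProj κ η * ρ (ι s) = θ s • ρ.wtProj κ η := fun s => by
        have := ρ.wtProj_mul_rho κ η ⟨ι s, iSD_mem_lineStab s⟩
        rwa [hθη] at this
      conv_lhs => rw [Representation.wtProj.eq_1 ρ ι]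
      rw [mul_smul_comm, Finset.mul_sum]
      simp only [mul_smul_comm, h4, smul_smul]
      have h5 : ∀ s, θ s⁻¹ * θ s = 1 := fun s => by rw [← map_mul, inv_mul_cancel, map_one]
      simp only [h5, one_smul, Finset.sum_const, Finset.card_univ]
      rw [← Nat.cast_smul_eq_nsmul ℂ, smul_smul, inv_mul_cancel₀ (by simp), one_smul]
    rw [hw_def, LinearMap.sub_apply, map_sub, ← Module.End.mul_apply, ← Module.End.mul_apply, h3,
      Representation.wtProj_mul_self, sub_self]
  -- Only the cells of 1 and `rr` survive, and together they fill P; so every sandwich applied to w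
  -- is a multiple of w or of u.
  set u := ρ.sandwich ι θ (rr F) w with hu
  have hA : ∀ s, ρ.sandwich ι θ (ι s) w = θ s • w := fun s => by
    have := ρ.sandwich_mul_left ι θ s 1
    rw [mul_one] at this
    rw [this, LinearMap.smul_apply, ρ.sandwich_apply_of_mem ι θ hw]
    simp [Representation.wtProj_of_mem hw]
  have hB : ∀ p : lineStab F, p.1 ∉ ι.range → ρ.sandwich ι θ p.1 w = η p • u := by
    rintro ⟨p, hp⟩ hp'
    obtain ⟨s, t, rfl⟩ := exists_eq_of_mem_lineStab hp hp'
    have : (⟨iSD (mB F) s * rr F * iSD (mB F) t, hp⟩ : lineStab F) = ⟨ι s, iSD_mem_lineStab s⟩ *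
      ⟨rr F, rr_mem_lineStab⟩ * ⟨ι t, iSD_mem_lineStab t⟩ := rfl
    rw [this, map_mul, map_mul, hθη, hθη]
    have h6 : η ⟨rr F, rr_mem_lineStab⟩ = 1 := by
      change χ ((rr F).1 _ _) = 1
      rw [lineStab_apply rr_smul_e1, map_one]
    rw [h6, mul_one]
    change ρ.sandwich ι θ (ι s * rr F * ι t) w = _
    rw [ρ.sandwich_mul, LinearMap.smul_apply]
  have hC : ∀ g ∉ lineStab F, ρ.sandwich ι θ g = 0 := by
    intro g hg
    obtain ⟨_, ⟨s, rfl⟩, _, ⟨t, rfl⟩, w, hw, rfl⟩ := bruhat g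
    have h6 : ρ.sandwich ι θ w = 0 := by
      refine sandwich_weyl_eq_zero' ρ h2 hw ?_ ?_
      · rintro rfl
        exact hg (range_le_lineStab (mul_mem (mul_mem ⟨s, rfl⟩ (one_mem _)) ⟨t, rfl⟩))
      · rintro rfl
        exact hg (mul_mem (mul_mem (iSD_mem_lineStab s) rr_mem_lineStab) (iSD_mem_lineStab t))
    rw [ρ.sandwich_mul, h6, smul_zero]
  -- Projecting the vanishing of the P-average of w and sorting the elements of P by membership in B
  -- gives |B| w + (|P| − |B|) u = 0.
  have hsum : (Nat.card ι.range : ℂ) • w +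
      ((Nat.card (lineStab F) : ℂ) - Nat.card ι.range) • u = 0 := by
    have h7 : ∑ p : lineStab F, η p⁻¹ • ρ.sandwich ι θ p.1 w = 0 := by
      have h8 := congrArg (ρ.wtProj ι θ) hPw
      rw [ρ.wtProj_apply κ, map_smul, map_sum, map_zero] at h8
      have h9 := (smul_eq_zero.1 h8).resolve_left (by simp)
      rw [← h9]
      refine Finset.sum_congr rfl fun p _ => ?_
      rw [map_smul, ρ.sandwich_apply_of_mem ι θ hw]
      rfl
    have h8 : ∀ p : lineStab F, η p⁻¹ • ρ.sandwich ι θ p.1 w = if p.1 ∈ ι.range then w else u := by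
      intro p
      have h10 : η p⁻¹ * η p = 1 := by rw [← map_mul, inv_mul_cancel, map_one]
      split_ifs with hp
      · obtain ⟨s, hs⟩ := hp
        have h11 : p = ⟨ι s, iSD_mem_lineStab s⟩ := Subtype.ext hs.symm
        rw [← hs, hA, ← hθη, ← h11, smul_smul, h10, one_smul]
      · rw [hB p hp, smul_smul, h10, one_smul]
    have h12 : ∀ p : lineStab F, (if p.1 ∈ ι.range then w else u) =
        (if p.1 ∈ ι.range then w - u else 0) + u := fun p => by split_ifs <;> simp
    simp only [h8, h12, Finset.sum_add_distrib, Finset.sum_const, Finset.card_univ] at h7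
    rw [← Finset.sum_filter, Finset.sum_const] at h7
    have h13 : (Finset.univ.filter fun p : lineStab F => p.1 ∈ ι.range).card = Nat.card ι.range := by
      rw [← Fintype.card_subtype, ← Nat.card_eq_fintype_card]
      exact Nat.card_congr (Subgroup.subgroupOfEquivOfLe range_le_lineStab).toEquiv
    rw [h13, ← Nat.card_eq_fintype_card] at h7
    rw [← h7]
    simp only [← Nat.cast_smul_eq_nsmul ℂ]
    module
  have hsub : ((Nat.card (lineStab F) : ℂ) - Nat.card ι.range) ≠ 0 := by
    rw [sub_ne_zero, Ne, Nat.cast_inj]; omega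
  -- In fact a = 1/q, but only |P| ≥ (q + 1)|B| is needed to keep the eigenvalues of the Gram matrix
  -- nonzero.
  set a : ℂ := Nat.card ι.range / ((Nat.card (lineStab F) : ℂ) - Nat.card ι.range) with ha
  have hu' : u = -a • w := by
    have h14 : ((Nat.card (lineStab F) : ℂ) - Nat.card ι.range) • u =
        ((Nat.card (lineStab F) : ℂ) - Nat.card ι.range) • (-a • w) := by
      rw [eq_neg_of_add_eq_zero_right hsum, smul_smul, ← neg_smul, ha]
      congr 1
      field_simp
    exact smul_right_injective _ hsub h14
  have ha1 : 1 + a ≠ 0 := by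
    have : 1 + a = Nat.card (lineStab F) / ((Nat.card (lineStab F) : ℂ) - Nat.card ι.range) := by
      rw [ha]; field_simp; ring
    rw [this]
    exact div_ne_zero (Nat.cast_ne_zero.2 (by omega)) hsub
  have ha2 : 1 + a - Fintype.card F * a ≠ 0 := by
    have : 1 + a - Fintype.card F * a = (Nat.card (lineStab F) - (Nat.card F * Nat.card ι.range : ℕ)) /
        ((Nat.card (lineStab F) : ℂ) - Nat.card ι.range) := by
      rw [ha, Nat.card_eq_fintype_card (α := F)]; field_simp; push_cast; ring
    rw [this]
    refine div_ne_zero ?_ hsub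
    rw [sub_ne_zero, Ne, Nat.cast_inj]
    nlinarith
  have := Fintype.ofFinite (Sp 2 F ⧸ lineStab F)
  -- Over each coset of P the q translates by `qq 0 0 x * rr` are used. Distinct parameters differ
  -- by an element of P outside B, which contributes −a; different cosets contribute 0.
  have h := Representation.card_le_finrank_of_gram
    (fun j : (Sp 2 F ⧸ lineStab F) × F => ρ (j.1.out * (qq 0 0 j.2 * rr F)) w)
    (fun i => ρ.wtProj ι θ * ρ (i.1.out * (qq 0 0 i.2 * rr F))⁻¹) hv _
    (Matrix.det_block_ne_zero ha1 ha2) (fun i j => by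
      rw [ρ.wtProj_mul_apply hw, of_apply]
      have hq : ∀ x : F, qq 0 0 x * rr F ∈ lineStab F := fun x =>
        mul_mem (range_le_lineStab (uQ_mem_range _)) rr_mem_lineStab
      by_cases hij : i.1 = j.1
      · rw [if_pos hij, hij]
        have e1 : (j.1.out * (qq 0 0 i.2 * rr F))⁻¹ * (j.1.out * (qq 0 0 j.2 * rr F)) =
            rr F * qq 0 0 (i.2 + j.2) * rr F := by
          have e2 : (qq 0 0 i.2 : Sp 2 F)⁻¹ = qq 0 0 i.2 := by rw [← map_inv, inv_eq_self']
          have e3 : qq 0 0 (i.2 + j.2) = qq 0 0 i.2 * qq 0 0 j.2 := by rw [qq_add]; simp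
          rw [_root_.mul_inv_rev, _root_.mul_inv_rev, e2, rr_inv, e3]
          group
        rw [e1]
        by_cases hx : i.2 = j.2
        · rw [if_pos hx, hx, CharTwo.add_self_eq_zero, qq_zero, mul_one, rr_sq, one_smul,
            ρ.sandwich_apply_of_mem ι θ hw]
          simp [Representation.wtProj_of_mem hw]
        · rw [if_neg hx, ← hu']
          have hx' : i.2 + j.2 ≠ 0 := fun h => hx (CharTwo.add_eq_zero.1 h)
          rw [hB ⟨_, 1, rr_zz_rr_smul _⟩ (rr_zz_rr_not_mem hx')]
          have : η ⟨_, 1, rr_zz_rr_smul (i.2 + j.2)⟩ = 1 := by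
            change χ _ = 1
            rw [lineStab_apply (rr_zz_rr_smul (i.2 + j.2)), map_one]
          rw [this, one_smul]
      · rw [if_neg hij, hC, zero_smul, LinearMap.zero_apply]
        intro hmem
        apply hij
        rw [_root_.mul_inv_rev, mul_assoc, Subgroup.mul_mem_cancel_left _ (inv_mem (hq _)), ← mul_assoc,
          Subgroup.mul_mem_cancel_right _ (hq _)] at hmem
        rw [← QuotientGroup.out_eq' i.1, ← QuotientGroup.out_eq' j.1]
        exact QuotientGroup.eq.2 hmem)
  rw [Module.finrank_fin_fun, Fintype.card_prod, ← Nat.card_eq_fintype_card, ← Nat.card_eq_fintype_card,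
    card_quotient_lineStab, mul_comm] at h
  exact h

end Sp4

/-! ### The largest degree. -/

namespace Sp4

variable {F : Type*} [Field F] [CharP F 2] [Finite F]

theorem mem_irrDegrees_iff {G : Type*} [Group G] {d : ℕ} :
    d ∈ irrDegrees G ↔ ∃ ρ : Representation ℂ G (Fin d → ℂ), ρ.IsIrreducible := by
  constructor
  · rintro ⟨_, ⟨n, ρ, hρ, rfl⟩, h⟩
    rw [Representation.char_one, Module.finrank_fin_fun, Nat.cast_inj] at h
    subst h
    exact ⟨ρ, hρ⟩
  · rintro ⟨ρ, hρ⟩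
    exact ⟨_, ⟨d, ρ, hρ, rfl⟩, by rw [Representation.char_one, Module.finrank_fin_fun]⟩

/-- The largest degree of an irreducible character of `Sp 2 F`. -/
theorem exists_isGreatest_irrDegrees {e : ℕ} (he : 1 < e) (hF : Nat.card F = 2 ^ e) :
    ∃ m, IsGreatest (irrDegrees (Sp 2 F)) m ∧
      Nat.card F ^ 4 + Nat.card F ^ 3 + Nat.card F < m ∧
      (2 < e → m = (Nat.card F + 1) ^ 2 * (Nat.card F ^ 2 + 1)) := by
  have hub : ∀ d ∈ irrDegrees (Sp 2 F), d ≤ (Nat.card F + 1) ^ 2 * (Nat.card F ^ 2 + 1) := by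
    intro d hd
    obtain ⟨ρ, hρ⟩ := mem_irrDegrees_iff.1 hd
    simpa using finrank_le hρ
  rcases (Nat.succ_le_of_lt he).eq_or_lt with rfl | he'
  · have hq : Nat.card F = 4 := by rw [hF]; rfl
    -- For q = 4 the torus has no character in general position. The degree is at least 4·5·17 =
    -- 340, while 4⁴ + 4³ + 4 = 324; the maximum itself is not computed.
    obtain ⟨n, ρ, hρ, hn⟩ := exists_le_finrank' (F := F) hq.ge
    have hmem := mem_irrDegrees_iff.2 ⟨ρ, hρ⟩
    have hbdd : BddAbove (irrDegrees (Sp 2 F)) := ⟨_, hub⟩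
    have hgr : IsGreatest (irrDegrees (Sp 2 F)) (sSup (irrDegrees (Sp 2 F))) :=
      ⟨Nat.sSup_mem ⟨n, hmem⟩ hbdd, fun d hd => le_csSup hbdd hd⟩
    refine ⟨_, hgr, lt_of_lt_of_le ?_ (hgr.2 hmem), fun h => absurd h (lt_irrefl _)⟩
    rw [hq] at hn ⊢
    omega
  · have hq : 8 ≤ Nat.card F := by
      rw [hF]
      exact Nat.pow_le_pow_right (n := 2) (by norm_num) (Nat.succ_le_of_lt he')
    obtain ⟨n, ρ, hρ, hn⟩ := exists_le_finrank (F := F) (by omega)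
    have hmem := mem_irrDegrees_iff.2 ⟨ρ, hρ⟩
    have hn' : n = (Nat.card F + 1) ^ 2 * (Nat.card F ^ 2 + 1) := le_antisymm (hub n hmem) hn
    subst hn'
    exact ⟨_, ⟨hmem, hub⟩, by ring_nf; nlinarith, fun _ => rfl⟩

end Sp4

/-- `θ` is a root of the irreducible polynomial `X² + X + δ` over `F`, generating the quadratic
extension `K`, and `τ` is the nontrivial automorphism. -/
structure IsArtinSchreier {F K : Type*} [Field F] [Field K] [Algebra F K] (δ : F) (θ : K)
    (τ : K ≃ₐ[F] K) : Prop where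
  sq_eq : θ ^ 2 = θ + algebraMap F K δ
  map_eq : τ θ = θ + 1
  ne_zero : ∀ x : F, x ^ 2 + x + δ ≠ 0
  exists_eq : ∀ k : K, ∃ x y : F, k = algebraMap F K x + algebraMap F K y * θ

/-- The polynomial X² + X + δ has no root in F, hence is irreducible; quadratic extensions of a
finite field are isomorphic, so K contains a root θ. The other root is θ + 1, and the nontrivial
automorphism must exchange the two. -/
theorem exists_isArtinSchreier {F : Type*} (K : Type*) [Field F] [Finite F] [CharP F 2] [Field K]
    [Algebra F K] (hK : Module.finrank F K = 2) {δ : F} (hδ : ∀ x : F, x ^ 2 + x + δ ≠ 0) :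
    ∃ (θ : K) (τ : K ≃ₐ[F] K), IsArtinSchreier δ θ τ := by
  have : Module.Finite F K := Module.finite_of_finrank_pos (by omega)
  have : Finite K := Module.finite_of_finite F
  have hKc : CharP K 2 := charP_of_injective_algebraMap (algebraMap F K).injective 2
  set f : Polynomial F := Polynomial.X ^ 2 + Polynomial.X + Polynomial.C δ with hf
  have hdeg : f.natDegree = 2 := by rw [hf]; compute_degree!
  have hmon : f.Monic := by rw [hf]; monicity!
  have hirr : Irreducible f := by
    rw [hmon.irreducible_iff_roots_eq_zero_of_degree_le_three (by omega) (by omega)]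
    refine Multiset.eq_zero_of_forall_notMem fun x hx => hδ x ?_
    have := (Polynomial.mem_roots'.1 hx).2
    simpa [hf, Polynomial.IsRoot] using this
  have := Fact.mk hirr
  have hfr : Module.finrank F (AdjoinRoot f) = 2 := by
    rw [(AdjoinRoot.powerBasis hirr.ne_zero).finrank, AdjoinRoot.powerBasis_dim, hdeg]
  have : Module.Finite F (AdjoinRoot f) := Module.finite_of_finrank_pos (by omega)
  have : Finite (AdjoinRoot f) := Module.finite_of_finite F
  obtain ⟨ψ⟩ := FiniteField.nonempty_algHom_of_finrank_dvd (F := F) (K := AdjoinRoot f) (L := K)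
    (by rw [hfr, hK])
  set θ := ψ (AdjoinRoot.root f)
  have hroot : θ ^ 2 + θ + algebraMap F K δ = 0 := by
    have h1 : (AdjoinRoot.root f) ^ 2 + AdjoinRoot.root f + algebraMap F _ δ = 0 := by
      have := AdjoinRoot.eval₂_root f
      simpa [hf] using this
    have := congrArg ψ h1
    rwa [map_add, map_add, map_pow, AlgHom.commutes, map_zero] at this
  have hsq : θ ^ 2 = θ + algebraMap F K δ := by
    have h2 : (2 : K) = 0 := CharTwo.two_eq_zero
    linear_combination hroot - (θ + algebraMap F K δ) * h2
  have hθ : ∀ x : F, algebraMap F K x ≠ θ := by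
    intro x hx
    apply hδ x
    apply (algebraMap F K).injective
    rw [map_add, map_add, map_pow, hx, hroot, map_zero]
  have hli : LinearIndependent F ![(1 : K), θ] := by
    rw [LinearIndependent.pair_iff]
    intro s t hst
    rw [Algebra.smul_def, Algebra.smul_def, mul_one] at hst
    by_cases ht : t = 0
    · subst ht
      simpa using hst
    · exfalso
      apply hθ (-s / t)
      have : algebraMap F K t ≠ 0 := by simpa using ht
      rw [map_div₀, map_neg]
      field_simp
      linear_combination -hst
  have hex : ∀ k : K, ∃ x y : F, k = algebraMap F K x + algebraMap F K y * θ := by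
    intro k
    have hsp := hli.span_eq_top_of_card_eq_finrank (by simp [hK])
    have : k ∈ Submodule.span F (Set.range ![(1 : K), θ]) := hsp ▸ Submodule.mem_top
    rw [Matrix.range_cons, Matrix.range_cons, Matrix.range_empty, Set.union_empty,
      Set.singleton_union, Submodule.mem_span_pair] at this
    obtain ⟨x, y, h⟩ := this
    exact ⟨x, y, by rw [← h, Algebra.smul_def, Algebra.smul_def, mul_one]⟩
  have hcard : Nat.card (K ≃ₐ[F] K) = 2 := by rw [IsGalois.card_aut_eq_finrank, hK]
  have hnt : Nontrivial (K ≃ₐ[F] K) := Finite.one_lt_card_iff_nontrivial.1 (by omega)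
  obtain ⟨τ, hτ⟩ := exists_ne (1 : K ≃ₐ[F] K)
  refine ⟨θ, τ, hsq, ?_, hδ, hex⟩
  have h1 : (τ θ - θ) * (τ θ + θ + 1) = 0 := by
    have := congrArg τ hsq
    rw [map_pow, map_add, AlgEquiv.commutes] at this
    linear_combination this - hsq + (τ θ - θ) * CharTwo.two_eq_zero (R := K)
  rcases mul_eq_zero.1 h1 with h | h
  · refine absurd (AlgEquiv.ext fun k => ?_) hτ
    obtain ⟨x, y, rfl⟩ := hex k
    simp [sub_eq_zero.1 h]
  · have h2 : (2 : K) = 0 := CharTwo.two_eq_zero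
    linear_combination h - (θ + 1) * h2

/-! ### Coordinates, conjugation, trace and norm in the quadratic extension. -/

namespace IsArtinSchreier

variable {F K : Type*} [Field F] [Field K] [Algebra F K] [CharP F 2] {δ : F} {θ : K}
  {τ : K ≃ₐ[F] K}

theorem coord_inj (h : IsArtinSchreier δ θ τ) {x y x' y' : F}
    (he : algebraMap F K x + algebraMap F K y * θ = algebraMap F K x' + algebraMap F K y' * θ) :
    x = x' ∧ y = y' := by
  have h1 := congrArg τ he
  simp only [map_add, map_mul, AlgEquiv.commutes, h.map_eq] at h1
  have hy : algebraMap F K y = algebraMap F K y' := by linear_combination h1 - he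
  have hy' := (algebraMap F K).injective hy
  subst hy'
  exact ⟨(algebraMap F K).injective (add_right_cancel he), rfl⟩

theorem eq_one_or (h : IsArtinSchreier δ θ τ) (σ : K ≃ₐ[F] K) : σ = 1 ∨ σ = τ := by
  have : CharP K 2 := charP_of_injective_algebraMap (algebraMap F K).injective 2
  have h2 : (2 : K) = 0 := CharTwo.two_eq_zero
  have h1 : (σ θ - θ) * (σ θ + θ + 1) = 0 := by
    have := congrArg σ h.sq_eq
    rw [map_pow, map_add, AlgEquiv.commutes] at this
    linear_combination this - h.sq_eq + (σ θ - θ) * h2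
  rcases mul_eq_zero.1 h1 with h' | h'
  · left
    refine AlgEquiv.ext fun k => ?_
    obtain ⟨x, y, rfl⟩ := h.exists_eq k
    simp [sub_eq_zero.1 h']
  · right
    refine AlgEquiv.ext fun k => ?_
    obtain ⟨x, y, rfl⟩ := h.exists_eq k
    have : σ θ = θ + 1 := by linear_combination h' - (θ + 1) * h2
    simp [this, h.map_eq]

theorem ne_one (h : IsArtinSchreier δ θ τ) : τ ≠ 1 := by
  rintro rfl
  simpa using h.map_eq

theorem apply_apply (h : IsArtinSchreier δ θ τ) (k : K) : τ (τ k) = k := by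
  have : CharP K 2 := charP_of_injective_algebraMap (algebraMap F K).injective 2
  have h2 : (2 : K) = 0 := CharTwo.two_eq_zero
  obtain ⟨x, y, rfl⟩ := h.exists_eq k
  simp only [map_add, map_mul, AlgEquiv.commutes, h.map_eq, map_one]
  linear_combination algebraMap F K y * h2

theorem mul_self (h : IsArtinSchreier δ θ τ) : τ * τ = 1 := AlgEquiv.ext h.apply_apply

theorem mem_range (h : IsArtinSchreier δ θ τ) {k : K} (hk : τ k = k) :
    ∃ x, algebraMap F K x = k := by
  obtain ⟨x, y, rfl⟩ := h.exists_eq k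
  simp only [map_add, map_mul, AlgEquiv.commutes, h.map_eq] at hk
  have : algebraMap F K y = 0 := by linear_combination hk
  exact ⟨x, by rw [this]; ring⟩

variable [Finite F]

theorem finite (h : IsArtinSchreier δ θ τ) : Finite K :=
  Finite.of_surjective (fun p : F × F => algebraMap F K p.1 + algebraMap F K p.2 * θ) fun k => by
    obtain ⟨x, y, hk⟩ := h.exists_eq k
    exact ⟨(x, y), hk.symm⟩

theorem natCard (h : IsArtinSchreier δ θ τ) : Nat.card K = Nat.card F ^ 2 := by
  rw [sq, ← Nat.card_prod]
  refine (Nat.card_congr (Equiv.ofBijective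
    (fun p : F × F => algebraMap F K p.1 + algebraMap F K p.2 * θ) ⟨?_, fun k => ?_⟩)).symm
  · rintro ⟨x, y⟩ ⟨x', y'⟩ hxy
    obtain ⟨h1, h2⟩ := h.coord_inj hxy
    exact Prod.ext h1 h2
  · obtain ⟨x, y, hk⟩ := h.exists_eq k
    exact ⟨(x, y), hk.symm⟩

theorem algebraMap_trace (h : IsArtinSchreier δ θ τ) (k : K) :
    algebraMap F K (Algebra.trace F K k) = k + τ k := by
  classical
  have := h.finite
  rw [trace_eq_sum_automorphisms,
    Fintype.sum_eq_add 1 τ h.ne_one.symm fun σ hσ => absurd (h.eq_one_or σ) (by tauto)]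
  rfl

theorem algebraMap_norm (h : IsArtinSchreier δ θ τ) (k : K) :
    algebraMap F K (Algebra.norm F k) = k * τ k := by
  classical
  have := h.finite
  rw [Algebra.norm_eq_prod_automorphisms,
    Fintype.prod_eq_mul 1 τ h.ne_one.symm fun σ hσ => absurd (h.eq_one_or σ) (by tauto)]
  rfl

theorem trace_eq (h : IsArtinSchreier δ θ τ) (x y : F) :
    Algebra.trace F K (algebraMap F K x + algebraMap F K y * θ) = y := by
  have : CharP K 2 := charP_of_injective_algebraMap (algebraMap F K).injective 2
  have h2 : (2 : K) = 0 := CharTwo.two_eq_zero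
  apply (algebraMap F K).injective
  rw [h.algebraMap_trace]
  simp only [map_add, map_mul, AlgEquiv.commutes, h.map_eq]
  linear_combination (algebraMap F K x + algebraMap F K y * θ) * h2

theorem exists_norm_eq (h : IsArtinSchreier δ θ τ) (x : F) : ∃ k : K, k * τ k = algebraMap F K x := by
  have := h.finite
  obtain ⟨k, hk⟩ := FiniteField.norm_surjective F K x
  exact ⟨k, by rw [← h.algebraMap_norm, hk]⟩

end IsArtinSchreier

/-! ### The abstract group SL₂(K):Gal(K/F). -/

section GaloisAction

variable {F K : Type*} [Field F] [Field K] [Algebra F K]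

/-- The Galois group acts on `SL2 K` entrywise. -/
def SL2.galAction : (K ≃ₐ[F] K) →* MulAut (SL2 K) where
  toFun σ :=
    { toFun g := ⟨σ g.a, σ g.b, σ g.c, σ g.d, by
        rw [← map_mul, ← map_mul, ← map_sub, g.det, map_one]⟩
      invFun g := ⟨σ.symm g.a, σ.symm g.b, σ.symm g.c, σ.symm g.d, by
        rw [← map_mul, ← map_mul, ← map_sub, g.det, map_one]⟩
      left_inv g := by ext <;> simp
      right_inv g := by ext <;> simp
      map_mul' g h := by ext <;> simp }
  map_one' := by ext <;> rfl
  map_mul' σ τ := by ext <;> rfl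

@[simp] theorem SL2.galAction_a (σ : K ≃ₐ[F] K) (g : SL2 K) : (galAction σ g).a = σ g.a := rfl
@[simp] theorem SL2.galAction_b (σ : K ≃ₐ[F] K) (g : SL2 K) : (galAction σ g).b = σ g.b := rfl
@[simp] theorem SL2.galAction_c (σ : K ≃ₐ[F] K) (g : SL2 K) : (galAction σ g).c = σ g.c := rfl
@[simp] theorem SL2.galAction_d (σ : K ≃ₐ[F] K) (g : SL2 K) : (galAction σ g).d = σ g.d := rfl

@[simp] theorem SL2.galAction_symm_a (σ : K ≃ₐ[F] K) (g : SL2 K) :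
    ((galAction σ).symm g).a = σ.symm g.a := rfl
@[simp] theorem SL2.galAction_symm_b (σ : K ≃ₐ[F] K) (g : SL2 K) :
    ((galAction σ).symm g).b = σ.symm g.b := rfl
@[simp] theorem SL2.galAction_symm_c (σ : K ≃ₐ[F] K) (g : SL2 K) :
    ((galAction σ).symm g).c = σ.symm g.c := rfl
@[simp] theorem SL2.galAction_symm_d (σ : K ≃ₐ[F] K) (g : SL2 K) :
    ((galAction σ).symm g).d = σ.symm g.d := rfl

variable (F K) in
/-- The group `SL2(K):Gal(K/F)`. -/
abbrev SL2Gal := SL2 K ⋊[SL2.galAction] (K ≃ₐ[F] K)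

theorem SemidirectProduct.finite' {N G : Type*} [Group N] [Group G] [Finite N] [Finite G]
    (φ : G →* MulAut N) : Finite (N ⋊[φ] G) :=
  Finite.of_injective (fun x => (x.left, x.right)) fun x y h => by
    simp only [Prod.mk.injEq] at h
    exact SemidirectProduct.ext h.1 h.2

end GaloisAction

/-! ### Irreducible representations of SL₂(K):Gal(K/F) are of orthogonal type. -/

namespace SL2Gal

variable {F K : Type*} [Field F] [Field K] [Algebra F K]

variable (F K) in
/-- The subgroup `U:Gal` with `U` the upper unitriangular subgroup. -/
def unip : Subgroup (SL2Gal F K) where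
  carrier := {g | g.left.a = 1 ∧ g.left.c = 0 ∧ g.left.d = 1}
  one_mem' := by simp
  mul_mem' := by
    rintro g h ⟨g1, g2, g3⟩ ⟨h1, h2, h3⟩
    simp [g1, g2, g3, h1, h2, h3]
  inv_mem' := by
    rintro g ⟨g1, g2, g3⟩
    simp [g1, g2, g3]

/-- The character of `U:Gal` given by a Galois-invariant additive character and a sign. -/
def unipChar (ψ : AddChar K ℂ) (hψ : ∀ (σ : K ≃ₐ[F] K) x, ψ (σ x) = ψ x)
    (ε : (K ≃ₐ[F] K) →* ℂ) : unip F K →* ℂ where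
  toFun g := ψ g.1.left.b * ε g.1.right
  map_one' := by simp
  map_mul' g h := by
    obtain ⟨g, g1, g2, g3⟩ := g
    obtain ⟨h, h1, h2, h3⟩ := h
    simp only [Subgroup.coe_mul, SemidirectProduct.mul_left, SemidirectProduct.mul_right, map_mul,
      SL2.mul_b, SL2.galAction_b, SL2.galAction_d, g1, h3, map_one, mul_one, one_mul,
      AddChar.map_add_eq_mul, hψ]
    ring

/-- The elements of `U`. -/
def upHom : Multiplicative K →* SL2Gal F K where
  toFun x := SemidirectProduct.inl (SL2.up x.toAdd)
  map_one' := by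
    have : SL2.up (0 : K) = 1 := by ext <;> simp
    rw [toAdd_one, this, map_one]
  map_mul' x y := by rw [← map_mul, SL2.up_mul_up, toAdd_mul]

theorem upHom_apply (x : Multiplicative K) :
    (upHom x : SL2Gal F K) = SemidirectProduct.inl (SL2.up x.toAdd) := rfl

/-- The characters of `U`. -/
def upChar (ψ : AddChar K ℂ) (a : K) : Multiplicative K →* ℂ where
  toFun x := ψ (a * x.toAdd)
  map_one' := by simp
  map_mul' x y := by rw [toAdd_mul, mul_add, AddChar.map_add_eq_mul]

variable [CharP F 2] {δ : F} {θ : K} {τ : K ≃ₐ[F] K}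

theorem exists_sign (h : IsArtinSchreier δ θ τ) : ∃ ε : (K ≃ₐ[F] K) →* ℂ, ε τ = -1 := by
  classical
  refine ⟨⟨⟨fun σ => if σ = 1 then 1 else -1, if_pos rfl⟩, fun σ σ' => ?_⟩, if_neg h.ne_one⟩
  rcases h.eq_one_or σ with rfl | rfl <;> rcases h.eq_one_or σ' with rfl | rfl <;>
    simp [h.ne_one, h.mul_self]

/-- Since τ is an involution, v + τv is either a nonzero fixed vector or zero, and in the latter
case v is an eigenvector for −1. -/
theorem exists_eigenvector (h : IsArtinSchreier δ θ τ) {V : Type*} [AddCommGroup V] [Module ℂ V]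
    (ρ : Representation ℂ (SL2Gal F K) V) {W : Submodule ℂ V}
    (hW : ∀ w ∈ W, ρ (SemidirectProduct.inr τ) w ∈ W) (hne : W ≠ ⊥) :
    ∃ (ε : (K ≃ₐ[F] K) →* ℂ) (v : V), (∀ σ, ε σ * ε σ = 1) ∧ v ∈ W ∧ v ≠ 0 ∧
      ∀ σ, ρ (SemidirectProduct.inr σ) v = ε σ • v := by
  obtain ⟨v, hv, hv0⟩ := (Submodule.ne_bot_iff _).1 hne
  have hτ : ρ (SemidirectProduct.inr τ) (ρ (SemidirectProduct.inr τ) v) = v := by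
    rw [← Module.End.mul_apply, ← map_mul, ← map_mul, h.mul_self, map_one, map_one,
      Module.End.one_apply]
  by_cases h0 : v + ρ (SemidirectProduct.inr τ) v = 0
  · obtain ⟨ε, hε⟩ := exists_sign h
    refine ⟨ε, v, fun σ => ?_, hv, hv0, fun σ => ?_⟩
    · rcases h.eq_one_or σ with rfl | rfl <;> simp [hε]
    · rcases h.eq_one_or σ with rfl | rfl
      · simp
      · rw [hε, eq_neg_of_add_eq_zero_right h0, neg_smul, one_smul]
  · refine ⟨1, _, fun σ => by simp, add_mem hv (hW v hv), h0, fun σ => ?_⟩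
    rcases h.eq_one_or σ with rfl | rfl
    · simp
    · rw [map_add, hτ, add_comm]; simp

theorem exists_eq_unip (g : SL2Gal F K) : ∃ (s t : unip F K) (w : SL2 K),
    g = (s : SL2Gal F K) * SemidirectProduct.inl w * (t : SL2Gal F K) ∧
    ∃ x, w = SL2.diag x ∨ w = SL2.swap * SL2.diag x := by
  have hmem : ∀ b (σ : K ≃ₐ[F] K), SemidirectProduct.inl (SL2.up b) * SemidirectProduct.inr σ ∈ unip F K := by
    intro b σ
    simp [unip]
  have hg : g = SemidirectProduct.inl g.left * SemidirectProduct.inr g.right :=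
    (SemidirectProduct.inl_left_mul_inr_right g).symm
  have h1 : SL2.up (0 : K) = 1 := by ext <;> simp
  rcases SL2.bruhat g.left with ⟨b, x, hb⟩ | ⟨b, x, b', hb⟩
  · refine ⟨⟨_, hmem b 1⟩, ⟨_, hmem 0 g.right⟩, _, ?_, x, Or.inl rfl⟩
    change g = SemidirectProduct.inl _ * SemidirectProduct.inr 1 * SemidirectProduct.inl _ *
      (SemidirectProduct.inl _ * SemidirectProduct.inr g.right)
    rw [h1, map_one, map_one, mul_one, one_mul, ← map_mul, ← hb, ← hg]
  · refine ⟨⟨_, hmem b 1⟩, ⟨_, hmem b' g.right⟩, _, ?_, x, Or.inr rfl⟩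
    change g = SemidirectProduct.inl _ * SemidirectProduct.inr 1 * SemidirectProduct.inl _ *
      (SemidirectProduct.inl _ * SemidirectProduct.inr g.right)
    rw [map_one, mul_one, ← mul_assoc, ← map_mul, ← map_mul, ← hb, ← hg]

/-- The double cosets of U:Gal are represented by diagonal elements and by `swap` times diagonal
elements. The latter are involutions in characteristic two; a nontrivial diagonal element changes
the value of ψ on some unitriangular element, so its sandwich vanishes. -/
theorem sandwich_inv {V : Type*} [AddCommGroup V] [Module ℂ V]
    [Fintype (unip F K)] (ρ : Representation ℂ (SL2Gal F K) V) (hK : CharP K 2)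
    {ψ : AddChar K ℂ} (hψ1 : ∃ z, ψ z ≠ 1) (hψ : ∀ (σ : K ≃ₐ[F] K) x, ψ (σ x) = ψ x)
    (ε : (K ≃ₐ[F] K) →* ℂ) (hinv : ∀ s, unipChar ψ hψ ε s⁻¹ = unipChar ψ hψ ε s)
    (g : SL2Gal F K) :
    ρ.sandwich (unip F K).subtype (unipChar ψ hψ ε) g =
      ρ.sandwich (unip F K).subtype (unipChar ψ hψ ε) g⁻¹ := by
  have hmem : ∀ b, (SemidirectProduct.inl (SL2.up b) : SL2Gal F K) ∈ unip F K := by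
    intro b
    simp [unip]
  have hval : ∀ b, unipChar ψ hψ ε ⟨_, hmem b⟩ = ψ b := fun b => by simp [unipChar]
  obtain ⟨s, t, w, rfl, x, hw⟩ := exists_eq_unip g
  refine ρ.sandwich_anti_of_mul (unip F K).subtype _ (τ := fun g => g⁻¹) (τS := fun s => s⁻¹)
    (fun g h => _root_.mul_inv_rev g h) (fun s => rfl) hinv ?_
  rcases hw with rfl | rfl
  · by_cases hx : x = 1
    · subst hx
      have : SL2.diag (1 : Kˣ) = 1 := by ext <;> simp
      rw [this, map_one, inv_one]
    · have hne : (1 : K) ≠ (x⁻¹ : Kˣ) * (x⁻¹ : Kˣ) := by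
        intro h
        apply hx
        rw [← sq] at h
        have h2 : ((x⁻¹ : Kˣ) : K) = 1 := CharTwo.sq_injective (by simpa using h.symm)
        simpa using h2
      obtain ⟨y, hy⟩ := AddChar.exists_apply_mul_ne hψ1 hne
      refine Representation.sandwich_anti_of_ne ρ (τ := fun g => g⁻¹) (τS := fun s => s⁻¹)
        (ι := (unip F K).subtype) (s := ⟨_, hmem (1 * y)⟩)
        (t := ⟨_, hmem ((x⁻¹ : Kˣ) * (x⁻¹ : Kˣ) * y)⟩)
        (fun g h => _root_.mul_inv_rev g h) (fun s => rfl) hinv ?_ ?_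
      · simp only [Subgroup.coe_subtype, ← map_mul]
        congr 1
        ext <;> simp
        field_simp
      · rw [hval, hval]
        exact hy
  · have h2 : (2 : K) = 0 := CharTwo.two_eq_zero
    have : (SL2.swap * SL2.diag x : SL2 K)⁻¹ = SL2.swap * SL2.diag x := by
      ext <;> simp [CharTwo.neg_eq]
    simp only [← map_inv, this]

/-- SL₂(K) is generated by upper and lower unitriangular elements, and the latter are conjugate to
the former. -/
theorem eq_one_of_up {V : Type*} [AddCommGroup V] [Module ℂ V]
    (ρ : Representation ℂ (SL2Gal F K) V)
    (h : ∀ b, ρ (SemidirectProduct.inl (SL2.up b)) = 1) (A : SL2 K) :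
    ρ (SemidirectProduct.inl A) = 1 := by
  have hlow : ∀ b, ρ (SemidirectProduct.inl (SL2.up b).tr) = 1 := by
    intro b
    have : (SL2.up b).tr = SL2.swap⁻¹ * SL2.up (-b) * SL2.swap := by ext <;> simp
    rw [this, map_mul, map_mul, map_mul, map_mul, h, mul_one, ← map_mul, ← map_mul,
      inv_mul_cancel, map_one, map_one]
  have hc : ∀ A : SL2 K, A.c ≠ 0 → ρ (SemidirectProduct.inl A) = 1 := by
    intro A hA
    have : A = SL2.up ((A.a - 1) / A.c) * (SL2.up A.c).tr * SL2.up ((A.d - 1) / A.c) := by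
      have hd := A.det
      ext <;> simp <;> field_simp
      · ring
      · linear_combination -hd
      · ring
    rw [this, map_mul, map_mul, map_mul, map_mul, h, h, hlow, one_mul, one_mul]
  by_cases hA : A.c = 0
  · have h1 : A = A * (SL2.up 1).tr * (SL2.up (-1)).tr := by ext <;> simp
    have hd : A.d ≠ 0 := by
      intro h0
      have := A.det
      rw [h0, hA] at this
      simp at this
    rw [h1, map_mul, map_mul, hlow, mul_one]
    exact hc _ (by simpa [hA] using hd)
  · exact hc A hA

/-- Diagonal elements scale the characters of U by squares, and every element of K is a square, so
all nontrivial characters of U are conjugate. If one is absent, all are, and U acts trivially. -/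
theorem up_eq_one_of_wtSpace_eq_bot {V : Type*} [AddCommGroup V] [Module ℂ V] [Finite K]
    (ρ : Representation ℂ (SL2Gal F K) V) (hK : CharP K 2)
    {ψ : AddChar K ℂ} (hψ1 : ∃ z, ψ z ≠ 1) (h0 : ρ.wtSpace upHom (upChar ψ 1) = ⊥) (b : K) :
    ρ (SemidirectProduct.inl (SL2.up b)) = 1 := by
  classical
  have := Fintype.ofFinite K
  have h1 : ∀ a ≠ 0, ρ.wtSpace upHom (upChar ψ a) = ⊥ := by
    intro a ha
    obtain ⟨t, rfl⟩ := exists_sq_eq a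
    have ht : t ≠ 0 := by rintro rfl; simp at ha
    rw [eq_bot_iff]
    intro v hv
    have h2 : ρ (SemidirectProduct.inl (SL2.diag (Units.mk0 t ht))) v ∈
        ρ.wtSpace upHom (upChar ψ 1) := by
      intro x
      have h3 : SL2.up x.toAdd * SL2.diag (Units.mk0 t ht) =
          SL2.diag (Units.mk0 t ht) * SL2.up (x.toAdd / t ^ 2) := by
        ext <;> simp
        field_simp
      have h4 := hv (Multiplicative.ofAdd (x.toAdd / t ^ 2))
      rw [upHom_apply, toAdd_ofAdd] at h4
      rw [upHom_apply, ← Module.End.mul_apply, ← map_mul, ← map_mul, h3, map_mul, map_mul,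
        Module.End.mul_apply, h4, map_smul]
      congr 1
      simp only [upChar, MonoidHom.coe_mk, OneHom.coe_mk, toAdd_ofAdd]
      congr 1
      field_simp
    rw [h0, Submodule.mem_bot] at h2
    have h5 := congrArg (ρ (SemidirectProduct.inl (SL2.diag (Units.mk0 t ht)))⁻¹) h2
    simpa using h5
  have h2 := Representation.sum_wtProj ρ (upHom (F := F)) (fun a : K => upChar ψ a) fun s => by
    have := Sp4.sum_addChar (F := K) hψ1 s.toAdd
    simpa [upChar] using this
  rw [Finset.sum_eq_single 0 (fun a _ ha => by
    rw [← LinearMap.range_eq_bot, Representation.range_wtProj, h1 a ha]) (by simp)] at h2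
  ext v
  have h3 := ρ.wtProj_mem upHom (upChar ψ 0) v (Multiplicative.ofAdd b)
  rw [h2] at h3
  simpa [upChar, upHom_apply] using h3

variable [Finite F]

theorem exists_invariant_addChar (h : IsArtinSchreier δ θ τ) :
    ∃ ψ : AddChar K ℂ, (∃ z, ψ z ≠ 1) ∧ ∀ (σ : K ≃ₐ[F] K) x, ψ (σ x) = ψ x := by
  obtain ⟨ψ, z, hz⟩ := Sp4.exists_addChar F
  refine ⟨ψ.compAddMonoidHom (Algebra.trace F K).toAddMonoidHom,
    ⟨algebraMap F K 0 + algebraMap F K z * θ, ?_⟩, fun σ x => ?_⟩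
  · rw [AddChar.compAddMonoidHom_apply, LinearMap.toAddMonoidHom_coe, h.trace_eq]
    exact hz
  · rw [AddChar.compAddMonoidHom_apply, AddChar.compAddMonoidHom_apply,
      LinearMap.toAddMonoidHom_coe, Algebra.trace_eq_of_algEquiv]

/-- Every irreducible representation of `SL2(K):Gal(K/F)` is of orthogonal type. -/
theorem sum_character_sq (h : IsArtinSchreier δ θ τ) [Fintype (SL2Gal F K)] {V : Type*}
    [AddCommGroup V] [Module ℂ V] [FiniteDimensional ℂ V] {ρ : Representation ℂ (SL2Gal F K) V}
    (hρ : ρ.IsIrreducible) : ∑ g, ρ.character (g * g) = Fintype.card (SL2Gal F K) := by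
  have := h.finite
  have hK : CharP K 2 := charP_of_injective_algebraMap (algebraMap F K).injective 2
  obtain ⟨ψ, hψ1, hψ⟩ := exists_invariant_addChar h
  have := Fintype.ofFinite (unip F K)
  have hnt := hρ.nontrivial
  -- If the weight ψ of U is absent, SL₂(K) acts trivially, and the criterion applies to the whole
  -- group with a sign character of the Galois group. Otherwise a Galois eigenvector in the weight
  -- space gives a real character of U:Gal that occurs.
  by_cases h0 : ρ.wtSpace upHom (upChar ψ 1) = ⊥
  · have h1 := eq_one_of_up ρ (up_eq_one_of_wtSpace_eq_bot ρ hK hψ1 h0)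
    obtain ⟨ε, v, hε, -, hv0, hv⟩ := exists_eigenvector h ρ (W := ⊤) (by simp) top_ne_bot
    let r : SL2Gal F K →* (K ≃ₐ[F] K) := SemidirectProduct.rightHom
    have hχ : ∀ s, ε.comp r s⁻¹ = ε.comp r s := by
      intro s
      have h2 := hε (r s)
      have h3 : ε (r s)⁻¹ * ε (r s) = 1 := by
        rw [← map_mul, inv_mul_cancel, map_one]
      rw [MonoidHom.comp_apply, MonoidHom.comp_apply, map_inv]
      exact mul_right_cancel₀ (right_ne_zero_of_mul_eq_one h2) (h3.trans h2.symm)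
    refine hρ.sum_character_sq (ι := MonoidHom.id (SL2Gal F K))
      (χ := ε.comp r) hχ (fun g => ?_) fun hb => hv0 ?_
    · have h2 := ρ.sandwich_mul_left (MonoidHom.id (SL2Gal F K))
        (ε.comp r) g 1
      have h3 := ρ.sandwich_mul_left (MonoidHom.id (SL2Gal F K))
        (ε.comp r) g⁻¹ 1
      rw [mul_one, MonoidHom.id_apply] at h2 h3
      rw [h2, h3, hχ]
    · rw [← Submodule.mem_bot ℂ, ← hb]
      intro g
      change ρ g v = ε g.right • v
      conv_lhs => rw [← SemidirectProduct.inl_left_mul_inr_right g]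
      rw [map_mul, h1, one_mul, hv]
  · obtain ⟨ε, v, hε, hv1, hv0, hv⟩ := exists_eigenvector h ρ
      (W := ρ.wtSpace upHom (upChar ψ 1)) (fun w hw x => by
      have h2 : (upHom x : SL2Gal F K) * SemidirectProduct.inr τ =
          SemidirectProduct.inr τ * upHom (Multiplicative.ofAdd (τ x.toAdd)) := by
        rw [upHom_apply, upHom_apply]
        ext <;> simp [h.apply_apply]
      have h3 := hw (Multiplicative.ofAdd (τ x.toAdd))
      rw [← Module.End.mul_apply, ← map_mul, h2, map_mul, Module.End.mul_apply, h3, map_smul]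
      congr 1
      simp [upChar, hψ]) h0
    have hχ : ∀ s, unipChar ψ hψ ε s⁻¹ = unipChar ψ hψ ε s := by
      intro s
      have h2 : unipChar ψ hψ ε s * unipChar ψ hψ ε s = 1 := by
        change ψ _ * ε _ * (ψ _ * ε _) = 1
        rw [mul_mul_mul_comm, hε, mul_one, ← AddChar.map_add_eq_mul, CharTwo.add_self_eq_zero,
          AddChar.map_zero_eq_one]
      have h3 : unipChar ψ hψ ε s⁻¹ * unipChar ψ hψ ε s = 1 := by
        rw [← map_mul, inv_mul_cancel, map_one]
      exact mul_right_cancel₀ (right_ne_zero_of_mul_eq_one h2) (h3.trans h2.symm)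
    refine hρ.sum_character_sq hχ (sandwich_inv ρ hK hψ1 hψ ε hχ) fun hb => hv0 ?_
    rw [← Submodule.mem_bot ℂ, ← hb]
    rintro ⟨g, g1, g2, g3⟩
    have h2 : g.left = SL2.up g.left.b := by ext <;> simp [g1, g2, g3]
    have h3 := hv1 (Multiplicative.ofAdd g.left.b)
    rw [upHom_apply, toAdd_ofAdd, ← h2] at h3
    have h4 : ρ g v = (ψ g.left.b * ε g.right) • v := by
      conv_lhs => rw [← SemidirectProduct.inl_left_mul_inr_right g]
      rw [map_mul, Module.End.mul_apply, hv, map_smul, h3, smul_smul, mul_comm]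
      simp [upChar]
    exact h4

end SL2Gal

theorem Representation.isIrreducible_comp_mulEquiv {G H V : Type*} [Group G] [Group H]
    [AddCommGroup V] [Module ℂ V] {ρ : Representation ℂ G V} (hρ : ρ.IsIrreducible) (e : H ≃* G) :
    Representation.IsIrreducible (ρ.comp e.toMonoidHom : Representation ℂ H V) := by
  have := hρ.nontrivial
  refine isIrreducible_of_forall fun W hW => hρ.eq_bot_or_eq_top fun g v hv => ?_
  have := hW (e.symm g) v hv
  simpa using this

/-! ### Fibres of the norm. -/

namespace IsArtinSchreier

variable {F K : Type*} [Field F] [Field K] [Algebra F K] [CharP F 2] [Finite F] {δ : F} {θ : K}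
  {τ : K ≃ₐ[F] K}

theorem natCard_norm_fiber_zero :
    Nat.card {k : K // k * τ k = algebraMap F K 0} = 1 := by
  rw [Nat.card_eq_one_iff_unique]
  refine ⟨⟨fun ⟨a, ha⟩ ⟨b, hb⟩ => Subtype.ext ?_⟩, ⟨⟨0, by simp⟩⟩⟩
  have h0 : ∀ a : K, a * τ a = algebraMap F K 0 → a = 0 := fun a ha => by
    rw [map_zero, mul_eq_zero, map_eq_zero_iff _ τ.injective, or_self] at ha
    exact ha
  exact (h0 a ha).trans (h0 b hb).symm

/-- The norm is multiplicative and surjective, so all nonzero fibres have the same size N, and q² =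
1 + (q − 1)N. -/
theorem natCard_norm_fiber (h : IsArtinSchreier δ θ τ) {x : F} (hx : x ≠ 0) :
    Nat.card {k : K // k * τ k = algebraMap F K x} = Nat.card F + 1 := by
  classical
  have := h.finite
  have := Fintype.ofFinite F
  have hx1 : ∀ x : F, x ≠ 0 → Nat.card {k : K // k * τ k = algebraMap F K x} =
      Nat.card {k : K // k * τ k = algebraMap F K 1} := by
    intro x hx
    obtain ⟨a, ha⟩ := h.exists_norm_eq x
    have ha0 : a ≠ 0 := by
      rintro rfl
      rw [map_zero, mul_zero, eq_comm, map_eq_zero] at ha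
      exact hx ha
    have hx' : algebraMap F K x ≠ 0 := by simpa using hx
    refine (Nat.card_congr ((Equiv.mulLeft₀ a ha0).subtypeEquiv fun k => ?_)).symm
    change k * τ k = algebraMap F K 1 ↔ a * k * τ (a * k) = _
    rw [map_mul, map_one, mul_mul_mul_comm, ha]
    constructor
    · intro hk; rw [hk, mul_one]
    · intro hk; exact mul_left_cancel₀ hx' (by rw [hk, mul_one])
  rw [hx1 x hx]
  have h2 : Nat.card K = ∑ x : F, Nat.card {k : K // k * τ k = algebraMap F K x} := by
    rw [← Nat.card_sigma]
    refine (Nat.card_congr (Equiv.ofBijective (fun p : (x : F) ×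
      {k : K // k * τ k = algebraMap F K x} => p.2.1) ⟨?_, fun k =>
        ⟨⟨Algebra.norm F k, k, (h.algebraMap_norm k).symm⟩, rfl⟩⟩)).symm
    rintro ⟨x, k, hk⟩ ⟨x', k', hk'⟩ he
    obtain rfl : k = k' := he
    obtain rfl := (algebraMap F K).injective (hk.symm.trans hk')
    rfl
  rw [← Finset.add_sum_erase _ _ (Finset.mem_univ (0 : F)), natCard_norm_fiber_zero,
    Finset.sum_congr rfl fun x hx => hx1 x (Finset.ne_of_mem_erase hx), Finset.sum_const,
    Finset.card_erase_of_mem (Finset.mem_univ _), Finset.card_univ, h.natCard,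
    ← Nat.card_eq_fintype_card, smul_eq_mul] at h2
  have h3 : 1 < Nat.card F := Finite.one_lt_card
  obtain ⟨n, hn⟩ := Nat.exists_eq_add_of_lt h3
  rw [hn] at h2 ⊢
  simp only [Nat.add_sub_cancel] at h2
  nlinarith

end IsArtinSchreier

/-! ### Counting solutions of g² = 1. -/

namespace SL2Gal

variable {F K : Type*} [Field F] [Field K] [Algebra F K] [CharP F 2] [Finite F] {δ : F} {θ : K}
  {τ : K ≃ₐ[F] K}

/-- In characteristic two A = A⁻¹ just says d = a. Then b and c are arbitrary and a is the unique
square root of 1 + bc. -/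
theorem natCard_sq_eq_one (K : Type*) [Field K] [Finite K] [CharP K 2] :
    Nat.card {A : SL2 K // A * A = 1} = Nat.card K ^ 2 := by
  have h2 : (2 : K) = 0 := CharTwo.two_eq_zero
  have hd : ∀ A : SL2 K, A * A = 1 → A.d = A.a := fun A hA => by
    have : A = A⁻¹ := eq_inv_of_mul_eq_one_left hA
    have := congrArg SL2.d this
    simpa using this
  rw [sq, ← Nat.card_prod]
  refine Nat.card_congr (Equiv.ofBijective (fun A => (A.1.b, A.1.c)) ⟨?_, ?_⟩)
  · rintro ⟨A, hA⟩ ⟨B, hB⟩ hAB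
    simp only [Prod.mk.injEq] at hAB
    have ha : A.a = B.a := by
      have h3 := A.det
      have h4 := B.det
      rw [hd A hA, hAB.1, hAB.2] at h3
      rw [hd B hB] at h4
      apply CharTwo.sq_injective
      simp only
      linear_combination h3 - h4
    exact Subtype.ext (SL2.ext ha hAB.1 hAB.2 (by rw [hd A hA, hd B hB, ha]))
  · rintro ⟨b, c⟩
    obtain ⟨a, ha⟩ := exists_sq_eq (1 + b * c)
    refine ⟨⟨⟨a, b, c, a, by linear_combination ha⟩, ?_⟩, rfl⟩
    ext <;> simp
    · linear_combination ha + b * c * h2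
    · linear_combination a * b * h2
    · linear_combination a * c * h2
    · linear_combination ha + b * c * h2

/-- The condition says d = τ(a) with b, c in F, so a has norm 1 + bc. The q − 1 pairs with bc = 1
allow one a, all others q + 1, giving q²(q + 1) − q(q − 1) = q³ + q. -/
theorem natCard_mul_gal_eq_one (h : IsArtinSchreier δ θ τ) :
    Nat.card {A : SL2 K // A * SL2.galAction τ A = 1} = Nat.card F ^ 3 + Nat.card F := by
  classical
  have := h.finite
  have := Fintype.ofFinite F
  have hK : CharP K 2 := charP_of_injective_algebraMap (algebraMap F K).injective 2
  have h2 : (2 : K) = 0 := CharTwo.two_eq_zero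
  have hiff : ∀ A : SL2 K, A * SL2.galAction τ A = 1 ↔ A.d = τ A.a ∧ τ A.b = A.b ∧ τ A.c = A.c := by
    intro A
    rw [mul_eq_one_iff_inv_eq, SL2.ext_iff]
    simp only [SL2.inv_a, SL2.inv_b, SL2.inv_c, SL2.inv_d, SL2.galAction_a, SL2.galAction_b,
      SL2.galAction_c, SL2.galAction_d, CharTwo.neg_eq]
    constructor
    · rintro ⟨h1, h2, h3, -⟩
      exact ⟨h1, h2.symm, h3.symm⟩
    · rintro ⟨h1, h2, h3⟩
      exact ⟨h1, h2.symm, h3.symm, by rw [h1, h.apply_apply]⟩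
  have h3 : Nat.card {A : SL2 K // A * SL2.galAction τ A = 1} =
      ∑ p : F × F, Nat.card {k : K // k * τ k = algebraMap F K (1 + p.1 * p.2)} := by
    rw [← Nat.card_sigma]
    refine (Nat.card_congr (Equiv.ofBijective (fun p : (p : F × F) ×
      {k : K // k * τ k = algebraMap F K (1 + p.1 * p.2)} =>
      ⟨⟨p.2.1, algebraMap F K p.1.1, algebraMap F K p.1.2, τ p.2.1, by
        rw [p.2.2, map_add, map_mul, map_one]; ring⟩,
        (hiff _).2 ⟨rfl, AlgEquiv.commutes _ _, AlgEquiv.commutes _ _⟩⟩) ⟨?_, ?_⟩)).symm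
    · rintro ⟨⟨b, c⟩, a, ha⟩ ⟨⟨b', c'⟩, a', ha'⟩ hp
      simp only [Subtype.mk.injEq, SL2.mk.injEq] at hp
      obtain ⟨rfl, h4, h5, -⟩ := hp
      obtain rfl := (algebraMap F K).injective h4
      obtain rfl := (algebraMap F K).injective h5
      rfl
    · rintro ⟨A, hA⟩
      obtain ⟨h4, h5, h6⟩ := (hiff A).1 hA
      obtain ⟨b, hb⟩ := h.mem_range h5
      obtain ⟨c, hc⟩ := h.mem_range h6
      refine ⟨⟨(b, c), A.a, ?_⟩, Subtype.ext (SL2.ext rfl hb hc h4.symm)⟩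
      have := A.det
      rw [← h4, map_add, map_mul, map_one, hb, hc]
      linear_combination this
  have h4 : ∀ p : F × F, Nat.card {k : K // k * τ k = algebraMap F K (1 + p.1 * p.2)} +
      (if p.1 * p.2 = 1 then Nat.card F else 0) = Nat.card F + 1 := by
    intro p
    split_ifs with hp
    · rw [hp, CharTwo.add_self_eq_zero, IsArtinSchreier.natCard_norm_fiber_zero, add_comm]
    · rw [h.natCard_norm_fiber fun h0 => hp (CharTwo.add_eq_zero.1 h0).symm, add_zero]
  have h5 : (Finset.univ.filter fun p : F × F => p.1 * p.2 = 1).card = Nat.card Fˣ := by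
    rw [← Fintype.card_subtype, ← Nat.card_eq_fintype_card]
    refine Nat.card_congr ⟨fun p => ⟨p.1.1, p.1.2, p.2, by rw [mul_comm, p.2]⟩,
      fun u => ⟨(u, (u⁻¹ : Fˣ)), by simp⟩, fun _ => rfl, fun _ => Units.ext rfl⟩
  have h6 := Finset.sum_congr (rfl : (Finset.univ : Finset (F × F)) = _) fun p _ => h4 p
  rw [Finset.sum_add_distrib, ← h3, ← Finset.sum_filter, Finset.sum_const, Finset.sum_const, h5,
    Finset.card_univ, Fintype.card_prod, Sp4.natCard_units, ← Nat.card_eq_fintype_card, smul_eq_mul,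
    smul_eq_mul] at h6
  have h7 : 1 < Nat.card F := Finite.one_lt_card
  obtain ⟨n, hn⟩ := Nat.exists_eq_add_of_lt h7
  rw [hn] at h6 ⊢
  simp only [Nat.add_sub_cancel] at h6
  nlinarith

theorem natCard_mul_self_eq_one (h : IsArtinSchreier δ θ τ) :
    Nat.card {g : SL2Gal F K // g * g = 1} = Nat.card F ^ 4 + (Nat.card F ^ 3 + Nat.card F) := by
  have := h.finite
  have hK : CharP K 2 := charP_of_injective_algebraMap (algebraMap F K).injective 2
  have h1 : Nat.card F ^ 4 = Nat.card {A : SL2 K // A * A = 1} := by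
    rw [natCard_sq_eq_one, h.natCard]; ring
  rw [h1, ← natCard_mul_gal_eq_one h, ← Nat.card_sum]
  have e1 : ∀ A : SL2 K, A * A = 1 → (⟨A, 1⟩ * ⟨A, 1⟩ : SL2Gal F K) = 1 := fun A hA => by
    ext1 <;> simp [hA]
  have e2 : ∀ A : SL2 K, A * SL2.galAction τ A = 1 → (⟨A, τ⟩ * ⟨A, τ⟩ : SL2Gal F K) = 1 :=
    fun A hA => by ext1 <;> simp [hA, h.mul_self]
  refine (Nat.card_congr (Equiv.ofBijective
    (Sum.elim (fun A => (⟨⟨A.1, 1⟩, e1 A.1 A.2⟩ : {g : SL2Gal F K // g * g = 1}))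
      fun A => ⟨⟨A.1, τ⟩, e2 A.1 A.2⟩) ⟨?_, ?_⟩)).symm
  · rintro (⟨A, hA⟩ | ⟨A, hA⟩) (⟨B, hB⟩ | ⟨B, hB⟩) hAB
    · simp only [Sum.elim_inl, Subtype.mk.injEq, SemidirectProduct.ext_iff] at hAB
      simp [hAB.1]
    · simp only [Sum.elim_inl, Sum.elim_inr, Subtype.mk.injEq, SemidirectProduct.ext_iff] at hAB
      exact absurd hAB.2.symm h.ne_one
    · simp only [Sum.elim_inl, Sum.elim_inr, Subtype.mk.injEq, SemidirectProduct.ext_iff] at hAB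
      exact absurd hAB.2 h.ne_one
    · simp only [Sum.elim_inr, Subtype.mk.injEq, SemidirectProduct.ext_iff] at hAB
      simp [hAB.1]
  · rintro ⟨⟨A, σ⟩, hg⟩
    have hl := congrArg SemidirectProduct.left hg
    rcases h.eq_one_or σ with rfl | rfl
    · exact ⟨Sum.inl ⟨A, by simpa using hl⟩, rfl⟩
    · exact ⟨Sum.inr ⟨A, by simpa using hl⟩, rfl⟩

/-- The sum of the degrees of the irreducible characters of `SL2(K):Gal(K/F)`. -/
theorem totalCharacter_one (h : IsArtinSchreier δ θ τ) {G : Type*} [Group G]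
    (e : G ≃* SL2Gal F K) :
    totalCharacter G 1 = ((Nat.card F ^ 4 + Nat.card F ^ 3 + Nat.card F : ℕ) : ℂ) := by
  have := h.finite
  have : Finite (K ≃ₐ[F] K) := Finite.of_injective _ (DFunLike.coe_injective (F := K ≃ₐ[F] K))
  have : Finite (SL2Gal F K) := SemidirectProduct.finite' _
  have : Finite G := Finite.of_equiv _ e.symm.toEquiv
  have := Fintype.ofFinite (SL2Gal F K)
  have := Fintype.ofFinite G
  rw [totalCharacter_one_of_indicator fun n ρ hρ => ?_, add_assoc, ← natCard_mul_self_eq_one h]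
  · congr 1
    exact Nat.card_congr (e.toEquiv.subtypeEquiv fun g => by
      change g * g = 1 ↔ e g * e g = 1
      rw [← map_mul, map_eq_one_iff _ e.injective])
  · have h1 := sum_character_sq h (Representation.isIrreducible_comp_mulEquiv hρ e.symm)
    rw [Nat.card_congr e.toEquiv, Nat.card_eq_fintype_card, ← h1]
    refine Fintype.sum_equiv e.toEquiv _ _ fun g => ?_
    simp [Representation.character]

end SL2Gal

/-! ### The standard alternating form and homomorphisms into the symplectic group. -/

section SympForm

theorem sympForm_mulVec {n : ℕ} {R : Type*} [CommRing R] (A : Matrix (Fin n ⊕ Fin n) (Fin n ⊕ Fin n) R)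
    (v w : Fin n ⊕ Fin n → R) :
    sympForm (A *ᵥ v) (A *ᵥ w) = v ⬝ᵥ ((Aᵀ * J (Fin n) R * A) *ᵥ w) := by
  rw [sympForm, ← mulVec_mulVec, ← mulVec_mulVec, dotProduct_mulVec v, vecMul_transpose]

theorem mem_symplecticGroup_iff_sympForm {n : ℕ} {R : Type*} [CommRing R]
    {A : Matrix (Fin n ⊕ Fin n) (Fin n ⊕ Fin n) R} :
    A ∈ symplecticGroup (Fin n) R ↔ ∀ v w, sympForm (A *ᵥ v) (A *ᵥ w) = sympForm v w := by
  rw [SymplecticGroup.mem_iff']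
  constructor
  · intro h v w
    rw [sympForm_mulVec, h]; rfl
  · intro h
    ext i j
    have := h (Pi.single i 1) (Pi.single j 1)
    rw [sympForm_mulVec, sympForm] at this
    simpa using this

/-- An injection of `F⁴` into a representation space of `H` whose image is stable, and such that
the action preserves the standard alternating form, gives a homomorphism to `Sp 2 F`. -/
theorem exists_hom_symplecticGroup {F H M : Type*} [Field F] [Group H] [AddCommGroup M] [Module F M]
    {n : ℕ} (ι : (Fin n ⊕ Fin n → F) →ₗ[F] M) (hι : Function.Injective ι) (T : H →* Module.End F M)
    (hr : ∀ h v, ∃ w, ι w = T h (ι v))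
    (hform : ∀ h v w v' w', ι v' = T h (ι v) → ι w' = T h (ι w) → sympForm v' w' = sympForm v w) :
    ∃ f : H →* Sp n F, ∀ h v, ι ((f h).1 *ᵥ v) = T h (ι v) := by
  choose θ hθ using hr
  let L : H → ((Fin n ⊕ Fin n → F) →ₗ[F] (Fin n ⊕ Fin n → F)) := fun h =>
    { toFun := θ h
      map_add' := fun v w => hι (by simp [hθ])
      map_smul' := fun c v => hι (by simp [hθ]) }
  have hL : ∀ h v, (LinearMap.toMatrix' (L h)) *ᵥ v = θ h v := fun h v => by
    rw [LinearMap.toMatrix'_mulVec]; rfl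
  let f : H → Sp n F := fun h => ⟨LinearMap.toMatrix' (L h),
    mem_symplecticGroup_iff_sympForm.2 fun v w => by
      rw [hL, hL]; exact hform h _ _ _ _ (hθ h v) (hθ h w)⟩
  have hf : ∀ h v, ι ((f h).1 *ᵥ v) = T h (ι v) := fun h v => by rw [← hθ]; exact congrArg ι (hL h v)
  refine ⟨MonoidHom.mk' f fun g h => Subtype.ext (Matrix.ext_of_mulVec_single fun i => hι ?_), hf⟩
  rw [hf, map_mul, Module.End.mul_apply, Submonoid.coe_mul, ← mulVec_mulVec, hf, hf]

theorem sympForm_two {F : Type*} [Field F] [CharP F 2] (v w : Fin 2 ⊕ Fin 2 → F) :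
    sympForm v w = v (.inl 0) * w (.inr 0) + v (.inr 0) * w (.inl 0) +
      v (.inl 1) * w (.inr 1) + v (.inr 1) * w (.inl 1) := by
  simp only [sympForm, J, dotProduct, mulVec, Fintype.sum_sum_type, Fin.sum_univ_two, fromBlocks,
    of_apply, Sum.elim_inl, Sum.elim_inr, Matrix.zero_apply, Matrix.neg_apply, CharTwo.neg_eq]
  simp
  ring

theorem sympForm_one {F : Type*} [Field F] [CharP F 2] (v w : Fin 1 ⊕ Fin 1 → F) :
    sympForm v w = v (.inl 0) * w (.inr 0) + v (.inr 0) * w (.inl 0) := by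
  simp [sympForm, J, dotProduct, mulVec, Fintype.sum_sum_type, fromBlocks, CharTwo.neg_eq]

theorem exists_sympForm_eq_one {F : Type*} [Field F] [CharP F 2] {v : Fin 2 ⊕ Fin 2 → F}
    (hv : v ≠ 0) : ∃ w, sympForm v w = 1 := by
  obtain ⟨i, hi⟩ := Function.ne_iff.1 hv
  refine ⟨Pi.single i.swap (v i)⁻¹, ?_⟩
  rw [sympForm_two]
  rcases i with i | i <;> fin_cases i <;> simp at hi ⊢ <;> exact mul_inv_cancel₀ hi

end SympForm

/-! ### Existence of the identification F⁴ = K². -/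

section TraceIsometry

variable {F K : Type*} [Field F] [Field K] [Algebra F K] [CharP F 2] [Finite F]

theorem exists_isTraceIsometry (hK : Module.finrank F K = 2) :
    ∃ φ : (Fin 2 ⊕ Fin 2 → F) ≃ₗ[F] (Fin 1 ⊕ Fin 1 → K), IsTraceIsometry φ := by
  obtain ⟨δ, hδ⟩ := exists_sq_add_self_add_ne_zero (F := F)
  obtain ⟨θ, τ, h⟩ := exists_isArtinSchreier K hK hδ
  have hKc : CharP K 2 := charP_of_injective_algebraMap (algebraMap F K).injective 2
  have h2 : (2 : K) = 0 := CharTwo.two_eq_zero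
  -- The basis (θ + 1, 1) of the second coordinate is dual to (1, θ) for the trace form.
  let φ : (Fin 2 ⊕ Fin 2 → F) →ₗ[F] (Fin 1 ⊕ Fin 1 → K) :=
    { toFun := fun v => Sum.elim
        (fun _ => algebraMap F K (v (.inl 0)) + algebraMap F K (v (.inl 1)) * θ)
        (fun _ => algebraMap F K (v (.inr 0)) * (θ + 1) + algebraMap F K (v (.inr 1)))
      map_add' := fun v w => by
        ext (i | i) <;> simp <;> ring
      map_smul' := fun c v => by
        ext (i | i) <;> simp [Algebra.smul_def] <;> ring }
  have hφ : ∀ v w, Algebra.trace F K (sympForm (φ v) (φ w)) = sympForm v w := by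
    intro v w
    have : sympForm (φ v) (φ w) =
        algebraMap F K (v (.inl 0) * w (.inr 0) + v (.inr 0) * w (.inl 0) +
          v (.inl 0) * w (.inr 1) + v (.inr 1) * w (.inl 0) +
          δ * (v (.inl 1) * w (.inr 0) + v (.inr 0) * w (.inl 1))) +
        algebraMap F K (sympForm v w) * θ := by
      rw [sympForm_one, sympForm_two]
      simp only [φ, LinearMap.coe_mk, AddHom.coe_mk, Sum.elim_inl, Sum.elim_inr, map_add, map_mul]
      linear_combination (algebraMap F K (v (.inl 1)) * algebraMap F K (w (.inr 0)) +
        algebraMap F K (v (.inr 0)) * algebraMap F K (w (.inl 1))) * (h.sq_eq + θ * h2)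
    rw [this, h.trace_eq]
  have hinj : Function.Injective φ := by
    rw [injective_iff_map_eq_zero]
    intro v hv
    by_contra h0
    obtain ⟨w, hw⟩ := exists_sympForm_eq_one h0
    have := hφ v w
    rw [hv, hw, sympForm_one] at this
    simp at this
  have : Module.Finite F K := Module.finite_of_finrank_pos (by omega)
  refine ⟨LinearEquiv.ofInjectiveOfFinrankEq φ hinj ?_, fun v w => ?_⟩
  · rw [Module.finrank_fintype_fun_eq_card, Module.finrank_pi_fintype]
    simp [hK]
  · rw [← hφ]; rfl

end TraceIsometry

/-! ### The standard quadratic form of minus type. -/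

section MinusForm

variable {F : Type*} [Field F]

/-- The quadratic form `a d + x² + x y + δ y²`. -/
def stdForm (δ : F) : QuadraticForm F (Fin 2 ⊕ Fin 2 → F) :=
  QuadraticMap.linMulLin (LinearMap.proj (.inl 0)) (LinearMap.proj (.inr 0)) +
  QuadraticMap.linMulLin (LinearMap.proj (.inl 1)) (LinearMap.proj (.inl 1)) +
  QuadraticMap.linMulLin (LinearMap.proj (.inl 1)) (LinearMap.proj (.inr 1)) +
  δ • QuadraticMap.linMulLin (LinearMap.proj (.inr 1)) (LinearMap.proj (.inr 1))

theorem stdForm_apply (δ : F) (v : Fin 2 ⊕ Fin 2 → F) :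
    stdForm δ v = v (.inl 0) * v (.inr 0) + v (.inl 1) ^ 2 + v (.inl 1) * v (.inr 1) +
      δ * v (.inr 1) ^ 2 := by
  simp [stdForm, sq]

variable [CharP F 2]

theorem polar_stdForm (δ : F) (v w : Fin 2 ⊕ Fin 2 → F) :
    QuadraticMap.polar (stdForm δ) v w = sympForm v w := by
  have h2 : (2 : F) = 0 := CharTwo.two_eq_zero
  rw [QuadraticMap.polar, stdForm_apply, stdForm_apply, stdForm_apply, sympForm_two]
  simp only [Pi.add_apply]
  linear_combination (v (.inl 1) * w (.inl 1) + δ * v (.inr 1) * w (.inr 1)) * h2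

/-- The form is a hyperbolic plane plus an anisotropic plane. A totally singular subspace of
dimension at least 2 meets each coordinate hyperplane; by anisotropy the vectors found in two of
them are multiples of the two hyperbolic basis vectors, and their sum is not singular. -/
theorem isMinusForm_stdForm {δ : F} (hδ : ∀ x : F, x ^ 2 + x + δ ≠ 0) : IsMinusForm (stdForm δ) := by
  refine ⟨polar_stdForm δ, ⟨F ∙ (Pi.single (.inl 0) 1), finrank_span_singleton (by simp), ?_⟩, ?_⟩
  · intro w hw
    obtain ⟨c, rfl⟩ := Submodule.mem_span_singleton.1 hw
    simp [stdForm_apply]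
  · rintro d ⟨W, rfl, hW⟩
    by_contra hd
    push Not at hd
    have key : ∀ i : Fin 2 ⊕ Fin 2, ∃ w ∈ W, w ≠ 0 ∧ w i = 0 := by
      intro i
      have : 0 < Module.finrank F (LinearMap.ker ((LinearMap.proj i).domRestrict W)) := by
        have h1 := LinearMap.finrank_range_add_finrank_ker
          (((LinearMap.proj i : _ →ₗ[F] F)).domRestrict W)
        have h2 := Submodule.finrank_le (LinearMap.range
          (((LinearMap.proj i : (Fin 2 ⊕ Fin 2 → F) →ₗ[F] F)).domRestrict W))
        rw [Module.finrank_self] at h2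
        omega
      obtain ⟨⟨w, hw⟩, hw', h0⟩ := (Submodule.ne_bot_iff _).1 (Submodule.one_le_finrank_iff.1 this)
      exact ⟨w, hw, fun h => h0 (Subtype.ext h), hw'⟩
    have key2 : ∀ w ∈ W, w (.inl 0) * w (.inr 0) = 0 → w (.inl 1) = 0 ∧ w (.inr 1) = 0 := by
      intro w hw h0
      have := hW w hw
      rw [stdForm_apply, h0, zero_add] at this
      exact normForm_eq_zero hδ this
    obtain ⟨w, hw, hw0, hwi⟩ := key (.inr 0)
    obtain ⟨v, hv, hv0, hvi⟩ := key (.inl 0)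
    obtain ⟨w1, w2⟩ := key2 w hw (by rw [hwi, mul_zero])
    obtain ⟨v1, v2⟩ := key2 v hv (by rw [hvi, zero_mul])
    have h3 := hW (w + v) (add_mem hw hv)
    rw [stdForm_apply] at h3
    simp only [Pi.add_apply, w1, w2, v1, v2, hwi, hvi] at h3
    simp only [add_zero, zero_add, ne_eq, OfNat.ofNat_ne_zero, not_false_eq_true, zero_pow,
      mul_zero, mul_eq_zero] at h3
    rcases h3 with h3 | h3
    · exact hw0 (by ext (i | i) <;> fin_cases i <;> assumption)
    · exact hv0 (by ext (i | i) <;> fin_cases i <;> assumption)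

end MinusForm

/-! ### Classification of forms of minus type. -/

section MinusForm

variable {F : Type*} [Field F] [CharP F 2]

theorem sympForm_comm (v w : Fin 2 ⊕ Fin 2 → F) : sympForm v w = sympForm w v := by
  rw [sympForm_two, sympForm_two]; ring

theorem sympForm_self (v : Fin 2 ⊕ Fin 2 → F) : sympForm v v = 0 := by
  rw [sympForm_two]
  linear_combination (v (.inl 0) * v (.inr 0) + v (.inl 1) * v (.inr 1)) *
    CharTwo.two_eq_zero (R := F)

theorem sympForm_add_left (u v w : Fin 2 ⊕ Fin 2 → F) :
    sympForm (u + v) w = sympForm u w + sympForm v w := add_dotProduct ..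

theorem sympForm_smul_left (c : F) (v w : Fin 2 ⊕ Fin 2 → F) :
    sympForm (c • v) w = c * sympForm v w := smul_dotProduct ..

theorem sympForm_add_right (u v w : Fin 2 ⊕ Fin 2 → F) :
    sympForm u (v + w) = sympForm u v + sympForm u w := by
  rw [sympForm_comm, sympForm_add_left, sympForm_comm v, sympForm_comm w]

theorem sympForm_smul_right (c : F) (v w : Fin 2 ⊕ Fin 2 → F) :
    sympForm v (c • w) = c * sympForm v w := by
  rw [sympForm_comm, sympForm_smul_left, sympForm_comm w]

/-- Every quadratic form of minus type is isometric to a standard one. -/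
theorem IsMinusForm.exists_isometry [Finite F] {Q : QuadraticForm F (Fin 2 ⊕ Fin 2 → F)}
    (hQ : IsMinusForm Q) : ∃ (δ : F) (g : Sp 2 F), (∀ x : F, x ^ 2 + x + δ ≠ 0) ∧
      ∀ v, Q (g.1 *ᵥ v) = stdForm δ v := by
  have h2 : (2 : F) = 0 := CharTwo.two_eq_zero
  obtain ⟨hpol, ⟨W, hW1, hW⟩, hmax⟩ := hQ
  have hadd : ∀ v w, Q (v + w) = Q v + Q w + sympForm v w := fun v w => by
    rw [← hpol, QuadraticMap.polar]; ring
  have hsmul : ∀ (c : F) v, Q (c • v) = c * c * Q v := fun c v => by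
    rw [QuadraticMap.map_smul, smul_eq_mul]
  obtain ⟨e, heW, he0⟩ := (Submodule.ne_bot_iff _).1 (Submodule.one_le_finrank_iff.1 hW1.ge)
  have hQe := hW e heW
  -- Adding Q(f)·e to f makes it singular without changing its product with e.
  obtain ⟨f, hQf, hef⟩ : ∃ f, Q f = 0 ∧ sympForm e f = 1 := by
    obtain ⟨f, hf⟩ := exists_sympForm_eq_one he0
    refine ⟨f + Q f • e, ?_, ?_⟩
    · rw [hadd, hsmul, hQe, sympForm_smul_right, sympForm_comm, hf]
      linear_combination Q f * h2
    · rw [sympForm_add_right, sympForm_smul_right, hf, sympForm_self]; ring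
  have hfe : sympForm f e = 1 := by rw [sympForm_comm, hef]
  -- Such a z would span with e a totally singular plane, against Witt index 1; so the complement of
  -- the hyperbolic plane is anisotropic.
  have haniso : ∀ z, sympForm z e = 0 → sympForm z f = 0 → Q z = 0 → z = 0 := by
    intro z hze hzf hz
    by_contra hz0
    have hli : LinearIndependent F ![e, z] := by
      rw [LinearIndependent.pair_iff]
      intro s t hst
      have h3 : sympForm (s • e + t • z) f = s := by
        rw [sympForm_add_left, sympForm_smul_left, sympForm_smul_left, hef, hzf]; ring
      rw [hst, sympForm, zero_dotProduct] at h3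
      subst h3
      rw [zero_smul, zero_add, smul_eq_zero] at hst
      exact ⟨rfl, hst.resolve_right hz0⟩
    have h3 := hmax ⟨Submodule.span F (Set.range ![e, z]), rfl, fun w hw => ?_⟩
    · rw [finrank_span_eq_card hli] at h3
      simp at h3
    · rw [Matrix.range_cons, Matrix.range_cons, Matrix.range_empty, Set.union_empty,
        Set.singleton_union, Submodule.mem_span_pair] at hw
      obtain ⟨a, b, rfl⟩ := hw
      rw [hadd, hsmul, hsmul, hQe, hz, sympForm_smul_left, sympForm_smul_right, sympForm_comm, hze]
      ring
  -- The projection to the orthogonal complement of the hyperbolic plane.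
  let p : (Fin 2 ⊕ Fin 2 → F) → (Fin 2 ⊕ Fin 2 → F) := fun y =>
    y + (sympForm y f • e + sympForm y e • f)
  have hpe : ∀ y, sympForm (p y) e = 0 := fun y => by
    simp only [p, sympForm_add_left, sympForm_smul_left, sympForm_self, hfe]
    linear_combination sympForm y e * h2
  have hpf : ∀ y, sympForm (p y) f = 0 := fun y => by
    simp only [p, sympForm_add_left, sympForm_smul_left, sympForm_self, hef]
    linear_combination sympForm y f * h2
  -- Any nonzero vector of the complement has nonzero Q, which is a square, so it can be scaled to
  -- Q(u) = 1.
  obtain ⟨u, hue, huf, hQu⟩ : ∃ u, sympForm u e = 0 ∧ sympForm u f = 0 ∧ Q u = 1 := by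
    obtain ⟨y, hy⟩ : ∃ y, y ∉ Submodule.span F (Set.range ![e, f]) := by
      by_contra hcon
      push Not at hcon
      have h3 := finrank_range_le_card (R := F) ![e, f]
      rw [Set.finrank, (Submodule.eq_top_iff'.2 hcon), finrank_top,
        Module.finrank_fintype_fun_eq_card] at h3
      simp at h3
    have hp0 : p y ≠ 0 := by
      intro h0
      apply hy
      rw [Matrix.range_cons, Matrix.range_cons, Matrix.range_empty, Set.union_empty,
        Set.singleton_union, Submodule.mem_span_pair]
      exact ⟨-sympForm y f, -sympForm y e, by
        rw [neg_smul, neg_smul, ← neg_add]; exact (eq_neg_of_add_eq_zero_left h0).symm⟩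
    have hQp : Q (p y) ≠ 0 := fun h0 => hp0 (haniso _ (hpe y) (hpf y) h0)
    obtain ⟨c, hc⟩ := exists_sq_eq (Q (p y))
    have hc0 : c ≠ 0 := by rintro rfl; exact hQp (by rw [← hc]; ring)
    refine ⟨c⁻¹ • p y, ?_, ?_, ?_⟩
    · rw [sympForm_smul_left, hpe, mul_zero]
    · rw [sympForm_smul_left, hpf, mul_zero]
    · rw [hsmul, ← hc]; field_simp
  have hu0 : u ≠ 0 := by rintro rfl; simp at hQu
  obtain ⟨v, hve, hvf, huv⟩ : ∃ v, sympForm v e = 0 ∧ sympForm v f = 0 ∧ sympForm u v = 1 := by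
    obtain ⟨v, hv⟩ := exists_sympForm_eq_one hu0
    refine ⟨p v, hpe v, hpf v, ?_⟩
    simp only [p, sympForm_add_right, sympForm_smul_right, hue, huf, hv]
    ring
  let A : Matrix (Fin 2 ⊕ Fin 2) (Fin 2 ⊕ Fin 2) F := of fun i j => Sum.elim ![e, u] ![f, v] j i
  have hA : ∀ c, A *ᵥ c = c (.inl 0) • e + c (.inl 1) • u + (c (.inr 0) • f + c (.inr 1) • v) := by
    intro c
    ext i
    simp [A, mulVec, dotProduct, Fintype.sum_sum_type]
    ring
  have hQA : ∀ c, Q (A *ᵥ c) = stdForm (Q v) c := by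
    intro c
    rw [hA, stdForm_apply]
    simp only [hadd, hsmul, sympForm_add_left, sympForm_add_right, sympForm_smul_left,
      sympForm_smul_right, hQe, hQf, hQu, hef, huf, hue, huv, sympForm_comm e u, sympForm_comm f v,
      sympForm_comm e v, hve, hvf]
    ring
  refine ⟨Q v, ⟨A, mem_symplecticGroup_iff_sympForm.2 fun x y => ?_⟩, fun x hx => ?_, hQA⟩
  · rw [← hpol, ← polar_stdForm (Q v)]
    simp only [QuadraticMap.polar, ← mulVec_add, hQA]
  -- A root x of X² + X + Q(v) would make x u + v singular in the anisotropic complement.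
  · have h0 : x • u + v = 0 := by
      refine haniso _ ?_ ?_ ?_
      · rw [sympForm_add_left, sympForm_smul_left, hue, hve]; ring
      · rw [sympForm_add_left, sympForm_smul_left, huf, hvf]; ring
      · rw [hadd, hsmul, sympForm_smul_left, hQu, huv, ← hx]; ring
    have h1 : sympForm u (x • u + v) = 1 := by
      rw [sympForm_add_right, sympForm_smul_right, sympForm_self, huv]; ring
    rw [h0, sympForm, mulVec_zero, dotProduct_zero] at h1
    exact zero_ne_one h1

end MinusForm

/-! ### The semilinear subgroup is SL₂(K):Gal(K/F). -/

section Semilinear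

variable {F K : Type*} [Field F] [Field K] [Algebra F K]

theorem MonoidHom.nonempty_mulEquiv {H G : Type*} [Group H] [Group G] {f : H →* G}
    (hf : Function.Injective f) {S : Subgroup G} (hS : f.range = S) : Nonempty (S ≃* H) :=
  hS ▸ ⟨(MonoidHom.ofInjective hf).symm⟩

/-- The semilinear action on `K²`. -/
def SL2Gal.semilinear : SL2Gal F K →* Module.End F (Fin 1 ⊕ Fin 1 → K) where
  toFun g :=
    { toFun x := Sum.elim (fun _ => g.left.a * g.right (x (.inl 0)) + g.left.b * g.right (x (.inr 0)))
        (fun _ => g.left.c * g.right (x (.inl 0)) + g.left.d * g.right (x (.inr 0)))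
      map_add' x y := by ext (i | i) <;> simp <;> ring
      map_smul' c x := by ext (i | i) <;> simp [Algebra.smul_def] <;> ring }
  map_one' := by
    refine LinearMap.ext fun x => funext fun i => ?_
    rcases i with i | i <;> simp [Subsingleton.elim i 0]
  map_mul' g h := by
    refine LinearMap.ext fun x => funext fun i => ?_
    rcases i with i | i <;> simp <;> ring

theorem SL2Gal.semilinear_apply (g : SL2Gal F K) (x : Fin 1 ⊕ Fin 1 → K) :
    SL2Gal.semilinear g x =
      Sum.elim (fun _ => g.left.a * g.right (x (.inl 0)) + g.left.b * g.right (x (.inr 0)))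
        (fun _ => g.left.c * g.right (x (.inl 0)) + g.left.d * g.right (x (.inr 0))) := rfl

theorem SL2Gal.semilinear_injective : Function.Injective (SL2Gal.semilinear (F := F) (K := K)) := by
  intro g h hgh
  have h1 := fun x => LinearMap.congr_fun hgh x
  simp only [SL2Gal.semilinear_apply] at h1
  have h2 := fun x => congrFun (h1 x) (.inl 0)
  have h3 := fun x => congrFun (h1 x) (.inr 0)
  have e1 := h2 (Sum.elim 1 0)
  have e2 := h2 (Sum.elim 0 1)
  have e3 := h3 (Sum.elim 1 0)
  have e4 := h3 (Sum.elim 0 1)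
  simp at e1 e2 e3 e4
  refine SemidirectProduct.ext (SL2.ext e1 e2 e3 e4) (AlgEquiv.ext fun k => ?_)
  have e5 := h2 (Sum.elim (fun _ => k) 0)
  have e6 := h3 (Sum.elim (fun _ => k) 0)
  simp only [Sum.elim_inl, Sum.elim_inr, Pi.zero_apply, map_zero, mul_zero, add_zero, ← e1,
    ← e3] at e5 e6
  by_cases ha : g.left.a = 0
  · have hc : g.left.c ≠ 0 := by
      intro hc
      have := g.left.det
      rw [ha, hc] at this
      simp at this
    exact mul_left_cancel₀ hc e6
  · exact mul_left_cancel₀ ha e5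

variable [CharP F 2] [Finite F]

theorem mulVec_one_sum (A : Matrix (Fin 1 ⊕ Fin 1) (Fin 1 ⊕ Fin 1) K) (x : Fin 1 ⊕ Fin 1 → K) :
    A *ᵥ x = Sum.elim (fun _ => A (.inl 0) (.inl 0) * x (.inl 0) + A (.inl 0) (.inr 0) * x (.inr 0))
      (fun _ => A (.inr 0) (.inl 0) * x (.inl 0) + A (.inr 0) (.inr 0) * x (.inr 0)) := by
  ext (i | i)
  · rw [Subsingleton.elim i 0]; simp [mulVec, dotProduct]
  · rw [Subsingleton.elim i 0]; simp [mulVec, dotProduct]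

theorem mem_Sp_one_iff [CharP K 2] (A : Matrix (Fin 1 ⊕ Fin 1) (Fin 1 ⊕ Fin 1) K) :
    A ∈ Sp 1 K ↔ A (.inl 0) (.inl 0) * A (.inr 0) (.inr 0) -
      A (.inl 0) (.inr 0) * A (.inr 0) (.inl 0) = 1 := by
  rw [mem_symplecticGroup_iff_sympForm, CharTwo.sub_eq_add]
  constructor
  · intro h
    have := h (Sum.elim 1 0) (Sum.elim 0 1)
    rw [sympForm_one, sympForm_one, mulVec_one_sum, mulVec_one_sum] at this
    simp at this
    linear_combination this
  · intro h v w
    have h2 : (2 : K) = 0 := CharTwo.two_eq_zero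
    rw [sympForm_one, sympForm_one, mulVec_one_sum, mulVec_one_sum]
    simp only [Sum.elim_inl, Sum.elim_inr]
    linear_combination (v (.inl 0) * w (.inr 0) + v (.inr 0) * w (.inl 0)) * h +
      (v (.inl 0) * w (.inl 0) * A (.inl 0) (.inl 0) * A (.inr 0) (.inl 0) +
        v (.inr 0) * w (.inr 0) * A (.inl 0) (.inr 0) * A (.inr 0) (.inr 0)) * h2

/-- A map x ↦ A σ(x) with det A = 1 changes the K-valued form only by σ, which the trace ignores.
Conversely a 2 × 2 matrix is symplectic exactly when its determinant is 1, so the image is the whole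
subgroup. -/
theorem nonempty_semilinearSp_mulEquiv {φ : (Fin 2 ⊕ Fin 2 → F) ≃ₗ[F] (Fin 1 ⊕ Fin 1 → K)}
    (hφ : IsTraceIsometry φ) : Nonempty (semilinearSp φ ≃* SL2Gal F K) := by
  have hK : CharP K 2 := charP_of_injective_algebraMap (algebraMap F K).injective 2
  obtain ⟨f, hf⟩ := exists_hom_symplecticGroup φ.toLinearMap φ.injective SL2Gal.semilinear
    (fun h v => ⟨φ.symm (SL2Gal.semilinear h (φ v)), by simp⟩) (fun h v w v' w' hv hw => by
      simp only [LinearEquiv.coe_coe] at hv hw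
      rw [← hφ, ← hφ, hv, hw]
      rw [← Algebra.trace_eq_of_algEquiv h.right (sympForm (φ v) (φ w))]
      congr 1
      have hd := h.left.det
      have h2 : (2 : K) = 0 := CharTwo.two_eq_zero
      rw [sympForm_one, sympForm_one, SL2Gal.semilinear_apply, SL2Gal.semilinear_apply]
      simp only [Sum.elim_inl, Sum.elim_inr, map_add, map_mul]
      rw [CharTwo.sub_eq_add] at hd
      linear_combination (h.right (φ v (.inl 0)) * h.right (φ w (.inr 0)) +
        h.right (φ v (.inr 0)) * h.right (φ w (.inl 0))) * hd +
        (h.right (φ v (.inl 0)) * h.right (φ w (.inl 0)) * h.left.a * h.left.c +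
        h.right (φ v (.inr 0)) * h.right (φ w (.inr 0)) * h.left.b * h.left.d) * h2)
  simp only [LinearEquiv.coe_coe] at hf
  refine MonoidHom.nonempty_mulEquiv (f := f) (fun g h hgh => ?_) (Subgroup.ext fun x => ⟨?_, ?_⟩)
  · apply SL2Gal.semilinear_injective
    refine LinearMap.ext fun x => ?_
    obtain ⟨v, rfl⟩ := φ.surjective x
    rw [← hf, ← hf, hgh]
  · rintro ⟨h, rfl⟩
    refine ⟨⟨fromBlocks !![h.left.a] !![h.left.b] !![h.left.c] !![h.left.d], ?_⟩, h.right, ?_⟩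
    · rw [mem_Sp_one_iff]
      exact h.left.det
    · intro v
      rw [hf, mulVec_one_sum, SL2Gal.semilinear_apply]
      rfl
  · rintro ⟨A, σ, hA⟩
    refine ⟨⟨⟨_, _, _, _, (mem_Sp_one_iff A.1).1 A.2⟩, σ⟩, Subtype.ext ?_⟩
    refine Matrix.ext_of_mulVec_single fun i => φ.injective ?_
    rw [hf, hA, mulVec_one_sum, SL2Gal.semilinear_apply]

end Semilinear

/-! ### The action on Hermitian matrices. -/

section Hermitian

variable {F K : Type*} [Field F] [Field K] [Algebra F K]

/-- The coordinates on the Hermitian `2 × 2` matrices. -/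
def herm (θ : K) : (Fin 2 ⊕ Fin 2 → F) →ₗ[F] Matrix (Fin 2) (Fin 2) K where
  toFun v := !![algebraMap F K (v (.inl 0)),
      algebraMap F K (v (.inl 1)) + algebraMap F K (v (.inr 1)) * θ;
    algebraMap F K (v (.inl 1)) + algebraMap F K (v (.inr 1)) * (θ + 1),
      algebraMap F K (v (.inr 0))]
  map_add' v w := by
    ext i j; fin_cases i <;> fin_cases j <;> simp <;> ring
  map_smul' c v := by
    ext i j; fin_cases i <;> fin_cases j <;> simp [Algebra.smul_def] <;> ring

theorem herm_apply (θ : K) (v : Fin 2 ⊕ Fin 2 → F) : herm θ v =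
    !![algebraMap F K (v (.inl 0)),
      algebraMap F K (v (.inl 1)) + algebraMap F K (v (.inr 1)) * θ;
    algebraMap F K (v (.inl 1)) + algebraMap F K (v (.inr 1)) * (θ + 1),
      algebraMap F K (v (.inr 0))] := rfl

/-- The action of `SL2(K):Gal(K/F)` on matrices by `X ↦ A (σ X) (τ A)ᵀ`. -/
def SL2Gal.congruence (τ : K ≃ₐ[F] K) (hτ : ∀ (σ : K ≃ₐ[F] K) k, σ (τ k) = τ (σ k)) :
    SL2Gal F K →* Module.End F (Matrix (Fin 2) (Fin 2) K) where
  toFun g :=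
    { toFun X := g.left.toMat * g.right.mapMatrix X * (τ.mapMatrix g.left.toMat)ᵀ
      map_add' X Y := by rw [map_add, mul_add, add_mul]
      map_smul' c X := by rw [map_smul, mul_smul_comm, smul_mul_assoc, RingHom.id_apply] }
  map_one' := by
    refine LinearMap.ext fun X => ?_
    ext i j
    simp
  map_mul' g h := by
    refine LinearMap.ext fun X => ?_
    have h1 : (SL2.galAction g.right h.left).toMat = g.right.mapMatrix h.left.toMat := by
      ext i j; fin_cases i <;> fin_cases j <;> rfl
    have h2 : (τ.mapMatrix (g.right.mapMatrix h.left.toMat))ᵀ =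
        g.right.mapMatrix (τ.mapMatrix h.left.toMat)ᵀ := by
      ext i j; simp [hτ]
    have h3 : (g.right * h.right).mapMatrix X = g.right.mapMatrix (h.right.mapMatrix X) := by
      ext i j; simp
    simp only [LinearMap.coe_mk, AddHom.coe_mk, SemidirectProduct.mul_left,
      SemidirectProduct.mul_right, SL2.toMat_mul, map_mul, h1, h3, transpose_mul, h2,
      Module.End.mul_apply, mul_assoc]

namespace IsArtinSchreier

variable [CharP F 2] {δ : F} {θ : K} {τ : K ≃ₐ[F] K} (h : IsArtinSchreier δ θ τ)
include h

theorem gal_comm (σ : K ≃ₐ[F] K) (k : K) : σ (τ k) = τ (σ k) := by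
  rcases h.eq_one_or σ with rfl | rfl <;> rfl

theorem herm_injective : Function.Injective (herm (F := F) θ) := by
  intro v w hvw
  rw [herm_apply, herm_apply] at hvw
  have h1 := congrFun (congrFun hvw 0) 0
  have h2 := congrFun (congrFun hvw 0) 1
  have h3 := congrFun (congrFun hvw 1) 1
  simp at h1 h2 h3
  obtain ⟨h4, h5⟩ := h.coord_inj h2
  ext (i | i) <;> fin_cases i <;> assumption

theorem algebraMap_normForm (x y : F) : algebraMap F K (x ^ 2 + x * y + δ * y ^ 2) =
    (algebraMap F K x + algebraMap F K y * θ) * τ (algebraMap F K x + algebraMap F K y * θ) := by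
  have hK : CharP K 2 := charP_of_injective_algebraMap (algebraMap F K).injective 2
  have h2 : (2 : K) = 0 := CharTwo.two_eq_zero
  simp only [map_add, map_mul, map_pow, AlgEquiv.commutes, h.map_eq]
  linear_combination -(algebraMap F K y) ^ 2 * h.sq_eq -
    (algebraMap F K x * algebraMap F K y * θ + algebraMap F K y ^ 2 * θ) * h2

/-- The determinant of a Hermitian matrix is the product of its diagonal entries minus the norm of
the corner entry, and the sign disappears in characteristic two. -/
theorem det_herm (v : Fin 2 ⊕ Fin 2 → F) : (herm θ v).det = algebraMap F K (stdForm δ v) := by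
  have hK : CharP K 2 := charP_of_injective_algebraMap (algebraMap F K).injective 2
  have h1 := h.algebraMap_normForm (v (.inl 1)) (v (.inr 1))
  simp only [map_add, map_mul, map_pow, AlgEquiv.commutes, h.map_eq] at h1
  rw [herm_apply, det_fin_two_of, stdForm_apply, CharTwo.sub_eq_add]
  simp only [map_add, map_mul, map_pow]
  linear_combination -h1

theorem herm_conj (v : Fin 2 ⊕ Fin 2 → F) : (τ.mapMatrix (herm θ v))ᵀ = herm θ v := by
  have hK : CharP K 2 := charP_of_injective_algebraMap (algebraMap F K).injective 2
  have h2 : (2 : K) = 0 := CharTwo.two_eq_zero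
  rw [herm_apply]
  ext i j
  fin_cases i <;> fin_cases j <;> simp [h.map_eq]
  exact Or.inl (by linear_combination h2)

theorem exists_herm_eq {X : Matrix (Fin 2) (Fin 2) K} (hX : (τ.mapMatrix X)ᵀ = X) :
    ∃ v : Fin 2 ⊕ Fin 2 → F, herm θ v = X := by
  have hij : ∀ i j, τ (X j i) = X i j := fun i j => congrFun (congrFun hX i) j
  obtain ⟨a, ha⟩ := h.mem_range (hij 0 0)
  obtain ⟨d, hd⟩ := h.mem_range (hij 1 1)
  obtain ⟨x, y, hxy⟩ := h.exists_eq (X 0 1)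
  refine ⟨Sum.elim ![a, x] ![d, y], ?_⟩
  have h10 : X 1 0 = algebraMap F K x + algebraMap F K y * (θ + 1) := by
    rw [← hij 1 0, hxy]; simp [h.map_eq]
  rw [herm_apply]
  ext i j
  fin_cases i <;> fin_cases j <;> simp [ha, hd, hxy, h10]

theorem congruence_apply (g : SL2Gal F K) (X : Matrix (Fin 2) (Fin 2) K) :
    SL2Gal.congruence τ h.gal_comm g X =
      g.left.toMat * g.right.mapMatrix X * (τ.mapMatrix g.left.toMat)ᵀ := rfl

theorem det_congruence (g : SL2Gal F K) (X : Matrix (Fin 2) (Fin 2) K) :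
    (SL2Gal.congruence τ h.gal_comm g X).det = g.right X.det := by
  have h1 : g.left.toMat.det = 1 := by rw [SL2.toMat, det_fin_two_of]; exact g.left.det
  rw [h.congruence_apply, det_mul, det_mul, det_transpose, h1, ← AlgEquiv.map_det,
    ← AlgEquiv.map_det, h1, map_one, one_mul, mul_one]

theorem exists_herm_congruence (g : SL2Gal F K) (v : Fin 2 ⊕ Fin 2 → F) :
    ∃ w : Fin 2 ⊕ Fin 2 → F, herm θ w = SL2Gal.congruence τ h.gal_comm g (herm θ v) := by
  apply h.exists_herm_eq
  have h1 : τ.mapMatrix (τ.mapMatrix g.left.toMat)ᵀ = g.left.toMatᵀ := by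
    ext i j; simp [h.apply_apply]
  have h2 : (τ.mapMatrix (g.right.mapMatrix (herm θ v)))ᵀ = g.right.mapMatrix (herm θ v) := by
    conv_rhs => rw [← h.herm_conj v]
    ext i j; simp [h.gal_comm]
  rw [h.congruence_apply, map_mul, map_mul, transpose_mul, transpose_mul, h1, h2, transpose_transpose,
    mul_assoc]

theorem stdForm_congruence {g : SL2Gal F K} {v w : Fin 2 ⊕ Fin 2 → F}
    (hw : herm θ w = SL2Gal.congruence τ h.gal_comm g (herm θ v)) : stdForm δ w = stdForm δ v := by
  apply (algebraMap F K).injective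
  rw [← h.det_herm, hw, h.det_congruence, h.det_herm, AlgEquiv.commutes]

/-- The action preserves determinants, up to automorphisms fixing F; so it preserves the quadratic
form and with it the polar form. -/
theorem exists_hom_isometry : ∃ f : SL2Gal F K →* Sp 2 F,
    ∀ g v, herm θ ((f g).1 *ᵥ v) = SL2Gal.congruence τ h.gal_comm g (herm θ v) := by
  refine exists_hom_symplecticGroup (herm θ) h.herm_injective _ h.exists_herm_congruence
    fun g v w v' w' hv hw => ?_
  rw [← polar_stdForm δ, ← polar_stdForm δ, QuadraticMap.polar, QuadraticMap.polar,
    h.stdForm_congruence hv, h.stdForm_congruence hw,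
    h.stdForm_congruence (g := g) (v := v + w) (by rw [map_add, map_add, map_add, hv, hw])]

end IsArtinSchreier

end Hermitian

/-! ### The image of the Hermitian action is the full isometry group. -/

namespace IsArtinSchreier

variable {F K : Type*} [Field F] [Field K] [Algebra F K] [CharP F 2] {δ : F} {θ : K}
  {τ : K ≃ₐ[F] K}

theorem herm_inl_zero : herm θ (Pi.single (.inl 0) 1 : Fin 2 ⊕ Fin 2 → F) = !![1, 0; 0, 0] := by
  rw [herm_apply]; simp

theorem herm_inr_zero : herm θ (Pi.single (.inr 0) 1 : Fin 2 ⊕ Fin 2 → F) = !![0, 0; 0, 1] := by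
  rw [herm_apply]; simp

theorem herm_inl_one : herm θ (Pi.single (.inl 1) 1 : Fin 2 ⊕ Fin 2 → F) = !![0, 1; 1, 0] := by
  rw [herm_apply]; simp

theorem herm_inr_one :
    herm θ (Pi.single (.inr 1) 1 : Fin 2 ⊕ Fin 2 → F) = !![0, θ; θ + 1, 0] := by
  rw [herm_apply]; simp

theorem inv_mulVec_eq {x : Sp 2 F} {v w : Fin 2 ⊕ Fin 2 → F} (h : x.1 *ᵥ v = w) :
    x⁻¹.1 *ᵥ w = v := by
  rw [← h, mulVec_mulVec, ← Submonoid.coe_mul, inv_mul_cancel, Submonoid.coe_one, one_mulVec]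

theorem eq_of_mulVec_single {x y : Sp 2 F} (h : ∀ i, x.1 *ᵥ Pi.single i 1 = y.1 *ᵥ Pi.single i 1) :
    x = y := Subtype.ext (Matrix.ext_of_mulVec_single h)

variable (h : IsArtinSchreier δ θ τ) {f : SL2Gal F K →* Sp 2 F}
  (hf : ∀ g v, herm θ ((f g).1 *ᵥ v) = SL2Gal.congruence τ h.gal_comm g (herm θ v))
include h hf

theorem mulVec_eq_iff (g : SL2Gal F K) {v u : Fin 2 ⊕ Fin 2 → F} {x y z w x' y' z' w' : K}
    (hv : herm θ v = !![x, y; z, w]) (hu : herm θ u = !![x', y'; z', w']) :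
    (f g).1 *ᵥ v = u ↔
      ((g.left.a * g.right x + g.left.b * g.right z) * τ g.left.a +
        (g.left.a * g.right y + g.left.b * g.right w) * τ g.left.b = x' ∧
      (g.left.a * g.right x + g.left.b * g.right z) * τ g.left.c +
        (g.left.a * g.right y + g.left.b * g.right w) * τ g.left.d = y') ∧
      ((g.left.c * g.right x + g.left.d * g.right z) * τ g.left.a +
        (g.left.c * g.right y + g.left.d * g.right w) * τ g.left.b = z' ∧
      (g.left.c * g.right x + g.left.d * g.right z) * τ g.left.c +
        (g.left.c * g.right y + g.left.d * g.right w) * τ g.left.d = w') := by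
  rw [← h.herm_injective.eq_iff, hf, h.congruence_apply, hv, hu, ← Matrix.ext_iff]
  simp only [Fin.forall_fin_two, mul_apply, Fin.sum_univ_two, SL2.toMat, AlgEquiv.mapMatrix_apply,
    map_apply, transpose_apply, of_apply, cons_val_zero, cons_val_one, cons_val', cons_val_fin_one]

/-- Fixing the two diagonal basis matrices makes A diagonal, and fixing the symmetric corner matrix
makes it trivial; the corner matrix built from θ then detects τ. -/
theorem isometry_injective : Function.Injective f := by
  have hK : CharP K 2 := charP_of_injective_algebraMap (algebraMap F K).injective 2
  rw [injective_iff_map_eq_one]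
  intro g hg
  have hfix : ∀ v, (f g).1 *ᵥ v = v := fun v => by rw [hg, Submonoid.coe_one, one_mulVec]
  obtain ⟨-, -, e1⟩ := (h.mulVec_eq_iff hf g herm_inl_zero herm_inl_zero).1 (hfix _)
  obtain ⟨⟨e2, -⟩, -, e5⟩ := (h.mulVec_eq_iff hf g herm_inr_zero herm_inr_zero).1 (hfix _)
  obtain ⟨⟨-, e3⟩, -⟩ := (h.mulVec_eq_iff hf g herm_inl_one herm_inl_one).1 (hfix _)
  obtain ⟨⟨-, e4⟩, -⟩ := (h.mulVec_eq_iff hf g herm_inr_one herm_inr_one).1 (hfix _)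
  have hd := g.left.det
  simp at e1 e2 e3 e4 e5
  simp only [e1, e2, mul_zero, sub_zero, zero_mul, add_zero, zero_add, map_zero] at hd e3 e4 e5
  have ha : g.left.a ≠ 0 := left_ne_zero_of_mul_eq_one hd
  have hτd : τ g.left.d = g.left.d := mul_left_cancel₀ ha (e3.trans hd.symm)
  have hd1 : g.left.d = 1 := by
    rw [hτd, ← sq] at e5
    exact CharTwo.sq_injective (by simpa using e5)
  have ha1 : g.left.a = 1 := by rw [hd1, mul_one] at hd; exact hd
  refine SemidirectProduct.ext (SL2.ext ha1 e2 e1 hd1) ?_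
  rcases h.eq_one_or g.right with h5 | h5
  · exact h5
  · rw [h5, h.map_eq, ha1, hd1, map_one] at e4
    simp at e4

/-- The fourth basis vector can only stay or have the third one added to it, since its coordinate
there satisfies y(y + 1) = 0. The second possibility is the action of τ. -/
theorem mem_range_of_fix_three {x : Sp 2 F} (hx : x ∈ isometrySubgroup (stdForm δ))
    (h0 : x.1 *ᵥ Pi.single (.inl 0) 1 = Pi.single (.inl 0) 1)
    (h1 : x.1 *ᵥ Pi.single (.inr 0) 1 = Pi.single (.inr 0) 1)
    (h2 : x.1 *ᵥ Pi.single (.inl 1) 1 = Pi.single (.inl 1) 1) : x ∈ f.range := by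
  have hx' := mem_symplecticGroup_iff_sympForm.1 x.2
  set y := x.1 *ᵥ Pi.single (.inr 1) 1 with hy
  have e0 := hx' (Pi.single (.inr 1) 1) (Pi.single (.inl 0) 1)
  have e1 := hx' (Pi.single (.inr 1) 1) (Pi.single (.inr 0) 1)
  have e2 := hx' (Pi.single (.inr 1) 1) (Pi.single (.inl 1) 1)
  rw [h0, ← hy, sympForm_two, sympForm_two] at e0
  rw [h1, ← hy, sympForm_two, sympForm_two] at e1
  rw [h2, ← hy, sympForm_two, sympForm_two] at e2
  have e3 := hx (Pi.single (.inr 1) 1)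
  rw [← hy, stdForm_apply, stdForm_apply] at e3
  simp at e0 e1 e2
  simp [e0, e1, e2] at e3
  have e4 : y (.inl 1) * (y (.inl 1) + 1) = 0 := by linear_combination e3
  rcases mul_eq_zero.1 e4 with e5 | e5
  · have : x = 1 := by
      refine eq_of_mulVec_single fun i => ?_
      rcases i with i | i <;> fin_cases i
      · exact h0.trans (one_mulVec _).symm
      · exact h2.trans (one_mulVec _).symm
      · exact h1.trans (one_mulVec _).symm
      · refine Eq.trans (b := y) rfl (Eq.trans ?_ (one_mulVec _).symm)
        ext (i | i) <;> fin_cases i <;> simp [e0, e1, e2, e5]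
    rw [this]
    exact one_mem _
  · have e6 : y (.inl 1) = 1 := CharTwo.add_eq_zero.1 e5
    refine ⟨SemidirectProduct.inr τ, eq_of_mulVec_single fun i => ?_⟩
    have hyh : herm θ y = !![0, θ + 1; θ, 0] := by
      have h2 : (2 : K) = 0 := by rw [← map_ofNat (algebraMap F K) 2, CharTwo.two_eq_zero, map_zero]
      rw [herm_apply, e0, e1, e2, e6]
      ext i j
      fin_cases i <;> fin_cases j <;> simp [add_comm]
      linear_combination h2
    rcases i with i | i <;> fin_cases i
    · exact ((h.mulVec_eq_iff hf _ herm_inl_zero herm_inl_zero).2 (by simp)).trans h0.symm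
    · exact ((h.mulVec_eq_iff hf _ herm_inl_one herm_inl_one).2 (by simp)).trans h2.symm
    · exact ((h.mulVec_eq_iff hf _ herm_inr_zero herm_inr_zero).2 (by simp)).trans h1.symm
    · refine (h.mulVec_eq_iff hf _ herm_inr_one hyh).2 ?_
      have h2 : (2 : K) = 0 := by rw [← map_ofNat (algebraMap F K) 2, CharTwo.two_eq_zero, map_zero]
      simp [h.map_eq]
      linear_combination h2

/-- The third basis vector goes to an element of norm one of K, seen as the anisotropic plane. Its
square root t again has norm one, and the diagonal element of t does the same to that vector while
fixing the first two. -/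
theorem mem_range_of_fix_two {x : Sp 2 F} (hr : f.range ≤ isometrySubgroup (stdForm δ))
    (hx : x ∈ isometrySubgroup (stdForm δ))
    (h0 : x.1 *ᵥ Pi.single (.inl 0) 1 = Pi.single (.inl 0) 1)
    (h1 : x.1 *ᵥ Pi.single (.inr 0) 1 = Pi.single (.inr 0) 1) [Finite F] : x ∈ f.range := by
  have := h.finite
  have hK : CharP K 2 := charP_of_injective_algebraMap (algebraMap F K).injective 2
  have hx' := mem_symplecticGroup_iff_sympForm.1 x.2
  set y := x.1 *ᵥ Pi.single (.inl 1) 1 with hy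
  have e0 := hx' (Pi.single (.inl 1) 1) (Pi.single (.inl 0) 1)
  have e1 := hx' (Pi.single (.inl 1) 1) (Pi.single (.inr 0) 1)
  rw [h0, ← hy, sympForm_two, sympForm_two] at e0
  rw [h1, ← hy, sympForm_two, sympForm_two] at e1
  have e3 := hx (Pi.single (.inl 1) 1)
  rw [← hy, stdForm_apply, stdForm_apply] at e3
  simp at e0 e1
  simp [e0, e1] at e3
  have hN := h.algebraMap_normForm (y (.inl 1)) (y (.inr 1))
  rw [e3, map_one] at hN
  obtain ⟨t, ht⟩ := exists_sq_eq (algebraMap F K (y (.inl 1)) + algebraMap F K (y (.inr 1)) * θ)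
  have htt : t * τ t = 1 := by
    apply CharTwo.sq_injective
    simp only [mul_pow, one_pow, ← map_pow]
    rw [ht, ← hN]
  have ht0 : t ≠ 0 := left_ne_zero_of_mul_eq_one htt
  have hτt : τ t = t⁻¹ := eq_inv_of_mul_eq_one_right htt
  have hτt' : τ t⁻¹ = t := by rw [map_inv₀, hτt, inv_inv]
  have hyc : algebraMap F K (y (.inl 1)) + algebraMap F K (y (.inr 1)) * (θ + 1) = t⁻¹ ^ 2 := by
    rw [← hτt, ← map_pow, ht]
    simp [h.map_eq]
  set g : SL2Gal F K := SemidirectProduct.inl (SL2.diag (Units.mk0 t ht0)) with hg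
  have hgy : (f g).1 *ᵥ Pi.single (.inl 1) 1 = y := by
    refine (h.mulVec_eq_iff hf g herm_inl_one (herm_apply θ y)).2 ?_
    rw [hyc, ← ht]
    simp [hg, e0, e1, hτt, sq, ht0]
  have hg0 : (f g).1 *ᵥ Pi.single (.inl 0) 1 = Pi.single (.inl 0) 1 :=
    (h.mulVec_eq_iff hf g herm_inl_zero herm_inl_zero).2 (by simp [hg, htt])
  have hg1 : (f g).1 *ᵥ Pi.single (.inr 0) 1 = Pi.single (.inr 0) 1 :=
    (h.mulVec_eq_iff hf g herm_inr_zero herm_inr_zero).2 (by simp [hg, hτt, ht0])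
  have hg' : f g ∈ f.range := ⟨g, rfl⟩
  have key : (f g)⁻¹ * x ∈ f.range := by
    refine h.mem_range_of_fix_three hf (mul_mem (inv_mem (hr hg')) hx) ?_ ?_ ?_
    · rw [Submonoid.coe_mul, ← mulVec_mulVec, h0, inv_mulVec_eq hg0]
    · rw [Submonoid.coe_mul, ← mulVec_mulVec, h1, inv_mulVec_eq hg1]
    · rw [Submonoid.coe_mul, ← mulVec_mulVec, ← hy, inv_mulVec_eq hgy]
  rwa [Subgroup.mul_mem_cancel_left _ (inv_mem hg')] at key

/-- The second basis vector goes to a singular vector determined by its component s in the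
anisotropic plane, and the unitriangular element of s realises this. -/
theorem mem_range_of_fix_one {x : Sp 2 F} (hr : f.range ≤ isometrySubgroup (stdForm δ))
    (hx : x ∈ isometrySubgroup (stdForm δ))
    (h0 : x.1 *ᵥ Pi.single (.inl 0) 1 = Pi.single (.inl 0) 1) [Finite F] : x ∈ f.range := by
  have hx' := mem_symplecticGroup_iff_sympForm.1 x.2
  set y := x.1 *ᵥ Pi.single (.inr 0) 1 with hy
  have e0 := hx' (Pi.single (.inr 0) 1) (Pi.single (.inl 0) 1)
  rw [h0, ← hy, sympForm_two, sympForm_two] at e0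
  have e3 := hx (Pi.single (.inr 0) 1)
  rw [← hy, stdForm_apply, stdForm_apply] at e3
  simp at e0
  simp [e0] at e3
  have hN := h.algebraMap_normForm (y (.inl 1)) (y (.inr 1))
  have hy0 : y (.inl 0) = y (.inl 1) ^ 2 + y (.inl 1) * y (.inr 1) + δ * y (.inr 1) ^ 2 := by
    rw [← CharTwo.add_eq_zero, ← e3]; ring
  rw [← hy0] at hN
  set s := algebraMap F K (y (.inl 1)) + algebraMap F K (y (.inr 1)) * θ with hs
  have hyc : algebraMap F K (y (.inl 1)) + algebraMap F K (y (.inr 1)) * (θ + 1) = τ s := by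
    rw [hs]; simp [h.map_eq]
  set g : SL2Gal F K := SemidirectProduct.inl (SL2.up s) with hg
  have hgy : (f g).1 *ᵥ Pi.single (.inr 0) 1 = y := by
    refine (h.mulVec_eq_iff hf g herm_inr_zero (herm_apply θ y)).2 ?_
    rw [hyc, ← hs, hN]
    simp [hg, e0]
  have hg0 : (f g).1 *ᵥ Pi.single (.inl 0) 1 = Pi.single (.inl 0) 1 :=
    (h.mulVec_eq_iff hf g herm_inl_zero herm_inl_zero).2 (by simp [hg])
  have hg' : f g ∈ f.range := ⟨g, rfl⟩
  have key : (f g)⁻¹ * x ∈ f.range := by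
    refine h.mem_range_of_fix_two hf hr (mul_mem (inv_mem (hr hg')) hx) ?_ ?_
    · rw [Submonoid.coe_mul, ← mulVec_mulVec, h0, inv_mulVec_eq hg0]
    · rw [Submonoid.coe_mul, ← mulVec_mulVec, ← hy, inv_mulVec_eq hgy]
  rwa [Subgroup.mul_mem_cancel_left _ (inv_mem hg')] at key

/-- A chain of stabilisers: the action is transitive on nonzero singular vectors, and the preceding
lemmas deal in turn with isometries fixing one, two and three basis vectors. -/
theorem range_eq_isometrySubgroup [Finite F] : f.range = isometrySubgroup (stdForm δ) := by
  have hK : CharP K 2 := charP_of_injective_algebraMap (algebraMap F K).injective 2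
  have hr : f.range ≤ isometrySubgroup (stdForm δ) := by
    rintro _ ⟨g, rfl⟩ v
    exact h.stdForm_congruence (hf g v)
  refine le_antisymm hr fun x hx => ?_
  set y := x.1 *ᵥ Pi.single (.inl 0) 1 with hy
  have e3 := hx (Pi.single (.inl 0) 1)
  rw [← hy, stdForm_apply, stdForm_apply] at e3
  simp at e3
  have hN := h.algebraMap_normForm (y (.inl 1)) (y (.inr 1))
  have hy0 : y (.inl 0) * y (.inr 0) =
      y (.inl 1) ^ 2 + y (.inl 1) * y (.inr 1) + δ * y (.inr 1) ^ 2 := by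
    rw [← CharTwo.add_eq_zero, ← e3]; ring
  rw [← hy0, map_mul] at hN
  set s := algebraMap F K (y (.inl 1)) + algebraMap F K (y (.inr 1)) * θ with hs
  have hyc : algebraMap F K (y (.inl 1)) + algebraMap F K (y (.inr 1)) * (θ + 1) = τ s := by
    rw [hs]; simp [h.map_eq]
  -- A nonzero singular vector is a Hermitian matrix of rank one. As every element of F is a norm,
  -- it is a column times its conjugate transpose, and that column is completed to an element of
  -- SL₂(K).
  obtain ⟨A, ha, hb, hc, hd⟩ : ∃ A : SL2 K, A.a * τ A.a = algebraMap F K (y (.inl 0)) ∧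
      A.a * τ A.c = s ∧ A.c * τ A.a = τ s ∧ A.c * τ A.c = algebraMap F K (y (.inr 0)) := by
    by_cases hy1 : y (.inl 0) = 0
    · have hs0 : s = 0 := by
        rw [hy1, map_zero, zero_mul, eq_comm, mul_eq_zero, map_eq_zero_iff _ τ.injective,
          or_self] at hN
        exact hN
      have hy2 : y (.inr 0) ≠ 0 := by
        intro hy2
        have h1 : y = 0 := by
          apply h.herm_injective
          rw [herm_apply, hyc, ← hs, hs0, hy1, hy2, map_zero]
          ext i j
          fin_cases i <;> fin_cases j <;> simp
        have h2 : x⁻¹.1 *ᵥ y = Pi.single (.inl 0) 1 := inv_mulVec_eq hy.symm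
        rw [h1, mulVec_zero] at h2
        have := congrFun h2 (.inl 0)
        simp at this
      obtain ⟨r, hr'⟩ := h.exists_norm_eq (y (.inr 0))
      have hr0 : r ≠ 0 := by
        rintro rfl
        rw [zero_mul, eq_comm, map_eq_zero] at hr'
        exact hy2 hr'
      exact ⟨⟨0, r⁻¹, r, 0, by rw [inv_mul_cancel₀ hr0, CharTwo.sub_eq_add]; ring⟩,
        by simp [hy1], by simp [hs0], by simp [hs0], hr'⟩
    · obtain ⟨p, hp⟩ := h.exists_norm_eq (y (.inl 0))
      have hp0 : p ≠ 0 := by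
        rintro rfl
        rw [zero_mul, eq_comm, map_eq_zero] at hp
        exact hy1 hp
      have hτp0 : τ p ≠ 0 := by rwa [Ne, map_eq_zero_iff _ τ.injective]
      refine ⟨⟨p, 0, τ s / τ p, p⁻¹, by rw [mul_inv_cancel₀ hp0]; ring⟩, hp, ?_, ?_, ?_⟩
      · simp only [map_div₀, h.apply_apply]
        field_simp
      · field_simp
      · simp only [map_div₀, h.apply_apply]
        have : algebraMap F K (y (.inl 0)) ≠ 0 := by simpa using hy1
        field_simp
        apply mul_left_cancel₀ this
        rw [← hp] at hN ⊢
        linear_combination (-p * τ p) * hN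
  set g : SL2Gal F K := SemidirectProduct.inl A with hg
  have hgy : (f g).1 *ᵥ Pi.single (.inl 0) 1 = y := by
    refine (h.mulVec_eq_iff hf g herm_inl_zero (herm_apply θ y)).2 ?_
    rw [hyc, ← hs]
    simp [hg, ha, hb, hc, hd]
  have hg' : f g ∈ f.range := ⟨g, rfl⟩
  have key : (f g)⁻¹ * x ∈ f.range := by
    refine h.mem_range_of_fix_one hf hr (mul_mem (inv_mem (hr hg')) hx) ?_
    rw [Submonoid.coe_mul, ← mulVec_mulVec, ← hy, inv_mulVec_eq hgy]
  rwa [Subgroup.mul_mem_cancel_left _ (inv_mem hg')] at key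

end IsArtinSchreier

/-! ### Conclusion. -/

theorem nonempty_isometrySubgroup_mulEquiv {F K : Type*} [Field F] [Field K] [Algebra F K]
    [CharP F 2] [Finite F] (hK : Module.finrank F K = 2)
    {Q : QuadraticForm F (Fin 2 ⊕ Fin 2 → F)} (hQ : IsMinusForm Q) :
    Nonempty (isometrySubgroup Q ≃* SL2Gal F K) := by
  obtain ⟨δ, g, hδ, hg⟩ := hQ.exists_isometry
  obtain ⟨θ, τ, h⟩ := exists_isArtinSchreier K hK hδ
  obtain ⟨f, hf⟩ := h.exists_hom_isometry
  have hinj := h.isometry_injective hf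
  -- The isometry group of Q is the conjugate by g of that of the standard form.
  refine MonoidHom.nonempty_mulEquiv (f := (MulAut.conj g).toMonoidHom.comp f)
    ((MulAut.conj g).injective.comp hinj) ?_
  rw [MonoidHom.range_comp, h.range_eq_isometrySubgroup hf]
  have hginv : ∀ v, stdForm δ (g⁻¹.1 *ᵥ v) = Q v := fun v => by
    rw [← hg, mulVec_mulVec, ← Submonoid.coe_mul, mul_inv_cancel]; simp
  ext x
  constructor
  · rintro ⟨y, hy, rfl⟩ v
    change Q ((g * y * g⁻¹).1 *ᵥ v) = Q v
    rw [Submonoid.coe_mul, Submonoid.coe_mul, ← mulVec_mulVec, ← mulVec_mulVec, hg, hy, hginv]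
  · intro hx
    refine ⟨g⁻¹ * x * g, fun v => ?_, ?_⟩
    · rw [Submonoid.coe_mul, Submonoid.coe_mul, ← mulVec_mulVec, ← mulVec_mulVec, hginv, hx, hg]
    · change g * (g⁻¹ * x * g) * g⁻¹ = x
      group

theorem mainTheorem4 (F K : Type*) [Field F] [Finite F] [Field K] [Algebra F K]
    (q e : ℕ) (he : 1 < e) (hq : q = 2 ^ e) (hF : Nat.card F = q)
    (hK : Module.finrank F K = 2) :
    (∃ φ : (Fin 2 ⊕ Fin 2 → F) ≃ₗ[F] (Fin 1 ⊕ Fin 1 → K), IsTraceIsometry φ) ∧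
    (∃ Q : QuadraticForm F (Fin 2 ⊕ Fin 2 → F), IsMinusForm Q) ∧
    (∀ φ : (Fin 2 ⊕ Fin 2 → F) ≃ₗ[F] (Fin 1 ⊕ Fin 1 → K), IsTraceIsometry φ →
      ¬ IsStrongGelfandSubgroup (semilinearSp φ) ∧
      totalCharacter (semilinearSp φ) 1 = (q : ℂ) ^ 4 + (q : ℂ) ^ 3 + (q : ℂ) ∧
      ∀ Q : QuadraticForm F (Fin 2 ⊕ Fin 2 → F), IsMinusForm Q →
        Nonempty (semilinearSp φ ≃* isometrySubgroup Q)) ∧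
    (∀ Q : QuadraticForm F (Fin 2 ⊕ Fin 2 → F), IsMinusForm Q →
      ¬ IsStrongGelfandSubgroup (isometrySubgroup Q)) ∧
    (∃ m : ℕ, IsGreatest (irrDegrees (Sp 2 F)) m ∧
      q ^ 4 + q ^ 3 + q < m ∧
      (2 < e → m = (q + 1) ^ 2 * (q ^ 2 + 1))) := by
  have hF2 : CharP F 2 := by
    have := Fintype.ofFinite F
    have : Fact (Nat.Prime 2) := ⟨Nat.prime_two⟩
    exact charP_of_card_eq_prime_pow (f := e) (by rw [← Nat.card_eq_fintype_card, hF, hq])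
  obtain ⟨δ, hδ⟩ := exists_sq_add_self_add_ne_zero (F := F)
  obtain ⟨θ, τ, h⟩ := exists_isArtinSchreier K hK hδ
  obtain ⟨m, hm, hlt, hm'⟩ := Sp4.exists_isGreatest_irrDegrees (F := F) he (hF.trans hq)
  -- Only the isomorphism type of the subgroup matters, so both families are excluded at once.
  have hnot : ∀ H : Subgroup (Sp 2 F), Nonempty (H ≃* SL2Gal F K) →
      ¬ IsStrongGelfandSubgroup H := fun H ⟨i⟩ hH =>
    absurd (hH.degree_le hm.1 (SL2Gal.totalCharacter_one h i)) (not_le.2 hlt)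
  subst hF
  refine ⟨exists_isTraceIsometry hK, ⟨_, isMinusForm_stdForm hδ⟩, fun φ hφ => ?_, fun Q hQ =>
    hnot _ (nonempty_isometrySubgroup_mulEquiv hK hQ), m, hm, hlt, hm'⟩
  obtain ⟨i⟩ := nonempty_semilinearSp_mulEquiv hφ
  refine ⟨hnot _ ⟨i⟩, ?_, fun Q hQ => ?_⟩
  · rw [SL2Gal.totalCharacter_one h i]
    push_cast
    rfl
  · obtain ⟨j⟩ := nonempty_isometrySubgroup_mulEquiv (K := K) hK hQ
    exact ⟨i.trans j.symm⟩

end
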